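/- **Setting.** Let $\Lambda\subset\mathbb R^3$ be a smooth Legendrian knot for the contact form $\lambda=dz-y\,dx$ whose Lagrangian projection $\pi_{xy}(\Lambda)\subset\mathbb C$ is in general position (its only self-intersections are transverse double points). Let $J$ be the almost complex structure on $\mathbb R\times\mathbb R^3$ with coordinates $(r,x,y,z)$ given by $$J\partial_x=\partial_y+y\partial_r,\quad J\partial_y=-\partial_x-y\partial_z,\quad J\partial_z=-\partial_r,\quad J\partial_r=\partial_z .$$ A *holomorphic annulus (disk) on $\pi_{xy}(\Lambda)$* is a nonconstant holomorphic map $u$ to $\mathbb C$ from a closed annulus $\{1\le|z|\le\rho\}$, $\rho>1$ arbitrary (from the closed disk), with finitely many boundary punctures, smooth up to the boundary away from the punctures, whose boundary arcs map to $\pi_{xy}(\Lambda)$ and lift continuously to $\Lambda$, and which at every puncture converges to a self-intersection of $\pi_{xy}(\Lambda)$, where it has a positive or a negative corner. The corner is *positive* if, following the boundary in its positive direction, the arc arriving at the puncture lies on the undercrossing and the arc leaving it on the overcrossing; it is *negative* if the arriving arc is on the overcrossing and the leaving arc on the undercrossing. A corner is convex if the image near it covers one quadrant. Let $\mathcal M^\pi_2$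 be the set of holomorphic annuli on $\pi_{xy}(\Lambda)$ with exactly one positive corner (and arbitrarily many negative corners), up to holomorphic reparameterization; the boundary component with the positive corner is called *outer*, the other one *inner*. A function on $\mathcal M^\pi_2$ is smooth if it is smooth along every smooth finite-dimensional family of annuli (modulus, punctures, and map away from the punctures smooth in the parameter, with all parameter derivatives of the map locally bounded near the punctures in a boundary chart centred at the puncture). Let $\mathcal M^\pi_{2,0}$ be the part of annuli with no branch points and only convex corners, and $\mathcal M^\pi_{2,1}$ the part of annuli with either exactly one branch point, which is a simple boundary branch point, and only convex corners, or no branch points and exactly one non-convex corner, near which the map is injective (it covers three quadrants). A *lift* of $u_0\in\mathcal M_2^\pi$ is a smooth $J$-holomorphic map from the same punctured annulus to $\mathbb R\times\mathbb R^3$ with boundary on $\mathbb R\times\Lambda$ and $xy$-projection $u_0$, positively asymptotic to a Reeb chord at the positive corner and negatively asymptotic to Reeb chords at the negative corners. An *index zero disk* is a holomorphic disk on $\pi_{xy}(\Lambda)$ with no branch points and only convex corners. The compactification $\overline{\mathcal M}{}^\pi_{2,1}$ is $\mathcal M^\pi_{2,1}$ together with the following points, with the topology of Gromov convergence of annuli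 in $\mathcal M^\pi_{2,1}$. * *Non-split boundary points*: index zero disks with two distinguished corners, one positive and one negative, over the same self-intersection $\Gamma$ of $\pi_{xy}(\Lambda)$, and exactly one further positive corner. The two distinguished corners divide the boundary of the disk into two arcs; the one containing the further positive corner is the outer boundary component of the degenerate annulus, and it passes near $\Gamma$ through a single one of the two branches of $\Lambda$. * *Split boundary points*: an annulus $u_0\in\mathcal M^\pi_{2,0}$ (the *annular part*) together with an index zero disk attached at one of its corners to a corner of $u_0$ of the opposite sign over the same self-intersection, such that the resulting building has exactly one positive corner besides the attached ones. **Proposition.** There exists a smooth function (section) $\Omega:\mathcal M^\pi_2\to\mathbb R$ such that $u_0\in\mathcal M^\pi_2$ has a lift if and only if $\Omega(u_0)=0$. Furthermore, $\Omega|_{\mathcal M^\pi_{2,1}}$ extends to a continuous map $\Omega:\overline{\mathcal M}{}^\pi_{2,1}\to\mathbb R\cup\{+\infty,-\infty\}$ such that * if $u$ is a non-split boundary point over the self-intersection $\Gamma$, then $\Omega(u)=+\infty$ if the outer boundary component passes through the undercrossing branch at $\Gamma$, and $\Omega(u)=-\infty$ if it passes through the overcrossing branch; * if $u$ is a split boundary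 point, then $\Omega(u)=\Omega(u_0)$, where $u_0\in\mathcal M^\pi_{2,0}$ is the annular part of $u$. -/

import Mathlib

open Filter Topology
open scoped ContDiff

noncomputable section

namespace LegAnnuli

/-! ### Legendrian knots in `(ℝ³, dz - y dx)` -/

/-- An oriented, smoothly parameterized Legendrian knot: a 1-periodic smooth immersion
`ℝ → ℝ³`, injective modulo the period, on which the contact form `dz - y dx` vanishes. -/
structure LegendrianKnot where
  x : ℝ → ℝ
  y : ℝ → ℝ
  z : ℝ → ℝ
  smooth_x : ContDiff ℝ ∞ x
  smooth_y : ContDiff ℝ ∞ y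
  smooth_z : ContDiff ℝ ∞ z
  periodic_x : Function.Periodic x 1
  periodic_y : Function.Periodic y 1
  periodic_z : Function.Periodic z 1
  immersed : ∀ s, ¬ (deriv x s = 0 ∧ deriv y s = 0 ∧ deriv z s = 0)
  embedded : ∀ s t, x s = x t → y s = y t → z s = z t → ∃ n : ℤ, t = s + n
  legendrian : ∀ s, deriv z s = y s * deriv x s

namespace LegendrianKnot

/-- The point `(Re p, Im p, ζ)` of `ℝ³` lies on the knot. The `xy`-plane is `ℂ`. -/
def Mem (Λ : LegendrianKnot) (p : ℂ) (ζ : ℝ) : Prop :=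
  ∃ s, Λ.x s = p.re ∧ Λ.y s = p.im ∧ Λ.z s = ζ

/-- The Lagrangian projection `π_xy(Λ)` is in general position: its only self-intersections are
transverse double points. -/
def GeneralPosition (Λ : LegendrianKnot) : Prop :=
  (∀ s t, Λ.x s = Λ.x t → Λ.y s = Λ.y t → (¬ ∃ n : ℤ, t = s + n) →
    deriv Λ.x s * deriv Λ.y t - deriv Λ.y s * deriv Λ.x t ≠ 0) ∧
  (∀ p ζ₁ ζ₂ ζ₃, Λ.Mem p ζ₁ → Λ.Mem p ζ₂ → Λ.Mem p ζ₃ → ζ₁ = ζ₂ ∨ ζ₁ = ζ₃ ∨ ζ₂ = ζ₃)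

end LegendrianKnot

/-! ### Domains -/

/-- A closed planar domain with its boundary and, at every boundary point `t`, a holomorphic
boundary chart `ζ ↦ chart t ζ` from a neighbourhood of `0` in the closed upper half-plane, with
`chart t 0 = t`. For real `ζ` the chart runs along the boundary in the positive direction (the
domain lies on the left). -/
structure BdDomain where
  carrier : Set ℂ
  bdry : Set ℂ
  chart : ℂ → ℂ → ℂ

/-- The annulus `1 ≤ ‖z‖ ≤ r`. -/
def annulus (r : ℝ) : BdDomain where
  carrier := {z | 1 ≤ ‖z‖ ∧ ‖z‖ ≤ r}
  bdry := {z | ‖z‖ = 1 ∨ ‖z‖ = r}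
  chart t ζ := if ‖t‖ = r then t * Complex.exp (Complex.I * ζ)
    else t * Complex.exp (-(Complex.I * ζ))

/-- The strip `0 ≤ Im z ≤ 1`: the closed disk with two boundary points (`Re z = ± ∞`) removed. -/
def strip : BdDomain where
  carrier := {z | 0 ≤ z.im ∧ z.im ≤ 1}
  bdry := {z | z.im = 0 ∨ z.im = 1}
  chart t ζ := if t.im = 0 then t + ζ else t - ζ

/-- The closed upper half-plane: the closed disk with one boundary point (`∞`) removed. -/
def halfPlane : BdDomain where
  carrier := {z | 0 ≤ z.im}
  bdry := {z | z.im = 0}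
  chart t ζ := t + ζ

/-! ### Holomorphic maps with corners and boundary on the projection of the knot -/

/-- A nonconstant holomorphic map on `D` with finitely many boundary punctures removed, smooth up
to the boundary, with boundary on `π_xy(Λ)`. The function `h` is the `z`-coordinate of the
continuous lift of the boundary to `Λ`. -/
structure HolCurve (Λ : LegendrianKnot) (D : BdDomain) where
  P : Finset ℂ
  u : ℂ → ℂ
  h : ℂ → ℝ
  punctures_mem : ∀ t ∈ P, t ∈ D.bdry
  holomorphic : ContDiffOn ℂ ∞ u (D.carrier \ (P : Set ℂ))
  lift_continuous : ContinuousOn h (D.bdry \ (P : Set ℂ))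
  lift_mem : ∀ z ∈ D.bdry \ (P : Set ℂ), Λ.Mem (u z) (h z)
  nonconstant : ¬ ∃ c, ∀ z ∈ D.carrier \ (P : Set ℂ), u z = c

namespace HolCurve

variable {Λ : LegendrianKnot} {D : BdDomain}

/-- The punctured domain. -/
def dom (C : HolCurve Λ D) : Set ℂ := D.carrier \ (C.P : Set ℂ)

/-- At the puncture `t` the map tends to `Γ`, the boundary arc arriving at `t` lies on the branch
of the knot through `(Γ, a)` and the boundary arc leaving `t` on the branch through `(Γ, b)`. -/
def HasCorner (C : HolCurve Λ D) (t Γ : ℂ) (a b : ℝ) : Prop :=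
  Λ.Mem Γ a ∧ Λ.Mem Γ b ∧ Tendsto C.u (𝓝[C.dom] t) (𝓝 Γ) ∧
  Tendsto (fun x : ℝ => C.h (D.chart t x)) (𝓝[<] 0) (𝓝 a) ∧
  Tendsto (fun x : ℝ => C.h (D.chart t x)) (𝓝[>] 0) (𝓝 b)

/-- Positive corner: in strip coordinates `[R, ∞) × [0, 1]` at the puncture, the side `{0}`
(the arriving arc) is on the undercrossing and the side `{1}` (the leaving arc) on the
overcrossing. -/
def IsPosCorner (C : HolCurve Λ D) (t : ℂ) : Prop := ∃ Γ a b, C.HasCorner t Γ a b ∧ a < b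

/-- Negative corner: arriving arc on the overcrossing, leaving arc on the undercrossing. -/
def IsNegCorner (C : HolCurve Λ D) (t : ℂ) : Prop := ∃ Γ a b, C.HasCorner t Γ a b ∧ b < a

/-- Along the filter `l` (the end of the punctured domain at a corner over `Γ`), the image lies in
a cone with vertex `Γ` of opening angle less than `π`. -/
def ConvexAlong (C : HolCurve Λ D) (l : Filter ℂ) (Γ : ℂ) : Prop :=
  ∃ (c : ℂ) (ε : ℝ), 0 < ε ∧ ∀ᶠ z in l, ε * ‖C.u z - Γ‖ ≤ (c * (C.u z - Γ)).re

/-- The corner at the puncture `t` is convex (it covers one quadrant). -/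
def IsConvexCorner (C : HolCurve Λ D) (t : ℂ) : Prop :=
  ∃ Γ, Tendsto C.u (𝓝[C.dom] t) (𝓝 Γ) ∧ C.ConvexAlong (𝓝[C.dom] t) Γ

/-- The corner at `t` is not convex, but the map is injective near `t` (it covers three
quadrants). -/
def IsSimpleNonconvexCorner (C : HolCurve Λ D) (t : ℂ) : Prop :=
  ¬ C.IsConvexCorner t ∧ ∃ s ∈ 𝓝[C.dom] t, Set.InjOn C.u s

/-- No interior or boundary branch points. -/
def Unbranched (C : HolCurve Λ D) : Prop := ∀ z ∈ C.dom, derivWithin C.u C.dom z ≠ 0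

/-- Unbranched, and all corners at the punctures in `P` are convex. -/
def IsRigid (C : HolCurve Λ D) : Prop := C.Unbranched ∧ ∀ t ∈ C.P, C.IsConvexCorner t

/-- Precisely one branch point, which is a simple boundary branch point, and convex corners. -/
def HasOneBranchPoint (C : HolCurve Λ D) : Prop :=
  (∀ t ∈ C.P, C.IsConvexCorner t) ∧
  ∃ z₀ ∈ D.bdry \ (C.P : Set ℂ), derivWithin C.u C.dom z₀ = 0 ∧
    iteratedDerivWithin 2 C.u C.dom z₀ ≠ 0 ∧ ∀ z ∈ C.dom, derivWithin C.u C.dom z = 0 → z = z₀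

/-- Unbranched, with precisely one non-convex corner. -/
def HasOneNonconvexCorner (C : HolCurve Λ D) : Prop :=
  C.Unbranched ∧ ∃ t₀ ∈ C.P, C.IsSimpleNonconvexCorner t₀ ∧
    ∀ t ∈ C.P, t ≠ t₀ → C.IsConvexCorner t

end HolCurve

/-! ### The moduli space of annuli with one positive corner -/

/-- A holomorphic annulus with corners, boundary on `π_xy(Λ)` and exactly one positive corner `pos`.
The outer boundary component, the one containing the positive corner, is taken to be `‖z‖ = r`;
by the inversion `z ↦ r / z` every annulus has a representative of this form. -/
structure HolAnnulus (Λ : LegendrianKnot) where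
  r : ℝ
  one_lt_r : 1 < r
  curve : HolCurve Λ (annulus r)
  pos : ℂ
  pos_mem : pos ∈ curve.P
  norm_pos : ‖pos‖ = r
  isPos : curve.IsPosCorner pos
  isNeg : ∀ t ∈ curve.P, t ≠ pos → curve.IsNegCorner t

namespace HolAnnulus

variable {Λ : LegendrianKnot}

/-- Holomorphic reparameterization: the biholomorphic maps between annuli preserving the outer
boundary are the rotations. -/
def Equivalent (A B : HolAnnulus Λ) : Prop :=
  A.r = B.r ∧ ∃ c : ℂ, ‖c‖ = 1 ∧ B.pos = c * A.pos ∧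
    (B.curve.P : Set ℂ) = (fun z => c * z) '' (A.curve.P : Set ℂ) ∧
    ∀ z ∈ A.curve.dom, B.curve.u (c * z) = A.curve.u z

/-- The annulus belongs to the 0-dimensional part of the moduli space. -/
def IsDimZero (A : HolAnnulus Λ) : Prop := A.curve.IsRigid

/-- The annulus belongs to the 1-dimensional part of the moduli space. -/
def IsDimOne (A : HolAnnulus Λ) : Prop :=
  A.curve.HasOneBranchPoint ∨ A.curve.HasOneNonconvexCorner

end HolAnnulus

/-- The moduli space of holomorphic annuli with one positive corner. -/
def Moduli (Λ : LegendrianKnot) : Type := Quot (HolAnnulus.Equivalent (Λ := Λ))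

/-- The class of an annulus in the moduli space. -/
def Moduli.mk {Λ : LegendrianKnot} (A : HolAnnulus Λ) : Moduli Λ := Quot.mk _ A

/-- A smooth family of annuli over `ℝⁿ`: the modulus, the punctures and the map (away from the
punctures, up to the boundary) depend smoothly on the parameter, and in the boundary chart
centred at a puncture all parameter derivatives of the map stay locally bounded. -/
def IsSmoothFamily {Λ : LegendrianKnot} {n : ℕ}
    (F : EuclideanSpace ℝ (Fin n) → HolAnnulus Λ) : Prop :=
  ContDiff ℝ ∞ (fun p => (F p).r) ∧
  ContDiffOn ℝ ∞ (fun q : EuclideanSpace ℝ (Fin n) × ℂ => (F q.1).curve.u q.2)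
    {q | q.2 ∈ (F q.1).curve.dom} ∧
  ∃ (m : ℕ) (t : Fin m → EuclideanSpace ℝ (Fin n) → ℂ),
    (∀ j, ContDiff ℝ ∞ (t j)) ∧
    (∀ p, Function.Injective (fun j => t j p)) ∧
    (∀ p, ((F p).curve.P : Set ℂ) = Set.range (fun j => t j p)) ∧
    (∃ j, ∀ p, (F p).pos = t j p) ∧
    ∀ (j : Fin m) (p₀ : EuclideanSpace ℝ (Fin n)) (k : ℕ), ∃ δ > 0, ∃ C : ℝ,
      ∀ p ∈ Metric.ball p₀ δ, ∀ ζ : ℂ, 0 ≤ ζ.im → ζ ≠ 0 → ‖ζ‖ < δ →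
        ‖iteratedFDeriv ℝ k
          (fun q => (F q).curve.u ((annulus (F q).r).chart (t j q) ζ)) p‖ ≤ C

/-- A function on the moduli space is smooth if it is smooth along every smooth family. -/
def Moduli.IsSmooth {Λ : LegendrianKnot} (Ω : Moduli Λ → ℝ) : Prop :=
  ∀ (n : ℕ) (F : EuclideanSpace ℝ (Fin n) → HolAnnulus Λ), IsSmoothFamily F →
    ContDiff ℝ ∞ (fun p => Ω (Moduli.mk (F p)))

/-! ### `J`-holomorphic lifts to the symplectization -/

/-- Named coordinates `(r, x, y, z)` on the symplectization `ℝ × ℝ³`. -/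
structure R4Coord where
  r : ℝ
  x : ℝ
  y : ℝ
  z : ℝ

/-- The symplectization `ℝ × ℝ³` as a normed space, with coordinates ordered as `(r, x, y, z)`. -/
abbrev R4 : Type := ℝ × ℝ × ℝ × ℝ

/-- The coordinates of a point or a vector. -/
def coords (p : R4) : R4Coord := ⟨p.1, p.2.1, p.2.2.1, p.2.2.2⟩

/-- The projection to the `xy`-plane. -/
def projXY (p : R4) : ℂ := ⟨(coords p).x, (coords p).y⟩

/-- The almost complex structure `J ∂x = ∂y + y ∂r`, `J ∂y = -∂x - y ∂z`, `J ∂z = -∂r`,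
`J ∂r = ∂z` at the point `p`, applied to the vector `v`. -/
def almostJ (p v : R4) : R4 :=
  ((coords p).y * (coords v).x - (coords v).z,
    -(coords v).y,
    (coords v).x,
    (coords v).r - (coords p).y * (coords v).y)

/-- Holomorphic strip coordinates `(s, τ) ∈ [R, ∞) × [0, 1]` near the boundary point `t`. -/
def stripEnd (D : BdDomain) (t : ℂ) (s τ : ℝ) : ℂ :=
  D.chart t (-Complex.exp (-(Real.pi * (s + τ * Complex.I))))

/-- `U` is positively asymptotic at `t` to the Reeb chord from `(Γ, a)` to `(Γ, b)`. -/
def PosAsymptotic (Λ : LegendrianKnot) (D : BdDomain) (U : ℂ → R4) (t : ℂ) : Prop :=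
  ∃ (Γ : ℂ) (a b : ℝ), Λ.Mem Γ a ∧ Λ.Mem Γ b ∧ a < b ∧
    TendstoUniformlyOn (fun s τ => projXY (U (stripEnd D t s τ))) (fun _ => Γ)
      atTop (Set.Icc 0 1) ∧
    TendstoUniformlyOn (fun s τ => (coords (U (stripEnd D t s τ))).z)
      (fun τ => a + (b - a) * τ) atTop (Set.Icc 0 1) ∧
    ∀ M : ℝ, ∀ᶠ s in atTop, ∀ τ ∈ Set.Icc (0 : ℝ) 1, M ≤ (coords (U (stripEnd D t s τ))).r

/-- `U` is negatively asymptotic at `t` to the Reeb chord from `(Γ, a)` to `(Γ, b)`. -/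
def NegAsymptotic (Λ : LegendrianKnot) (D : BdDomain) (U : ℂ → R4) (t : ℂ) : Prop :=
  ∃ (Γ : ℂ) (a b : ℝ), Λ.Mem Γ a ∧ Λ.Mem Γ b ∧ a < b ∧
    TendstoUniformlyOn (fun s τ => projXY (U (stripEnd D t s τ))) (fun _ => Γ)
      atTop (Set.Icc 0 1) ∧
    TendstoUniformlyOn (fun s τ => (coords (U (stripEnd D t s τ))).z)
      (fun τ => a + (b - a) * (1 - τ)) atTop (Set.Icc 0 1) ∧
    ∀ M : ℝ, ∀ᶠ s in atTop, ∀ τ ∈ Set.Icc (0 : ℝ) 1, (coords (U (stripEnd D t s τ))).r ≤ M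

/-- `U` is a `J`-holomorphic annulus with boundary on `ℝ × Λ`, asymptotic to Reeb chords at the
punctures, whose projection to the `xy`-plane is the annulus `A`. -/
def HolAnnulus.IsLift {Λ : LegendrianKnot} (A : HolAnnulus Λ) (U : ℂ → R4) : Prop :=
  ContDiffOn ℝ ∞ U A.curve.dom ∧
  (∀ z ∈ A.curve.dom, ∀ v : ℂ, fderivWithin ℝ U A.curve.dom z (Complex.I * v) =
    almostJ (U z) (fderivWithin ℝ U A.curve.dom z v)) ∧
  (∀ z ∈ (annulus A.r).bdry \ (A.curve.P : Set ℂ), Λ.Mem (projXY (U z)) (coords (U z)).z) ∧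
  PosAsymptotic Λ (annulus A.r) U A.pos ∧
  (∀ t ∈ A.curve.P, t ≠ A.pos → NegAsymptotic Λ (annulus A.r) U t) ∧
  ∀ z ∈ A.curve.dom, projXY (U z) = A.curve.u z

/-! ### Boundary points of the compactified 1-dimensional part -/

/-- A non-split degenerate annulus: an index zero disk (unbranched, with convex corners) with two
distinguished corners over the same self-intersection `Γ`, at the two ends of the strip. The edge
`Im z = 0` carries the positive corner `pos` of the degenerate annulus and becomes its outer
boundary component; all other corners are negative. Both ends of the edge `Im z = 0` are on the
branch through `(Γ, outerZ)` and both ends of the edge `Im z = 1` on the branch through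
`(Γ, innerZ)`, hence one distinguished corner is positive and the other negative. -/
structure NonSplit (Λ : LegendrianKnot) where
  curve : HolCurve Λ strip
  pos : ℂ
  Γ : ℂ
  outerZ : ℝ
  innerZ : ℝ
  pos_mem : pos ∈ curve.P
  pos_im : pos.im = 0
  isPos : curve.IsPosCorner pos
  isNeg : ∀ t ∈ curve.P, t ≠ pos → curve.IsNegCorner t
  mem_outer : Λ.Mem Γ outerZ
  mem_inner : Λ.Mem Γ innerZ
  ne : outerZ ≠ innerZ
  tendsto_left : Tendsto curve.u (comap Complex.re atBot ⊓ 𝓟 curve.dom) (𝓝 Γ)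
  tendsto_right : Tendsto curve.u (comap Complex.re atTop ⊓ 𝓟 curve.dom) (𝓝 Γ)
  outer_left : Tendsto (fun x : ℝ => curve.h x) atBot (𝓝 outerZ)
  outer_right : Tendsto (fun x : ℝ => curve.h x) atTop (𝓝 outerZ)
  inner_left : Tendsto (fun x : ℝ => curve.h (x + Complex.I)) atBot (𝓝 innerZ)
  inner_right : Tendsto (fun x : ℝ => curve.h (x + Complex.I)) atTop (𝓝 innerZ)
  rigid : curve.IsRigid
  convex_left : curve.ConvexAlong (comap Complex.re atBot ⊓ 𝓟 curve.dom) Γ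
  convex_right : curve.ConvexAlong (comap Complex.re atTop ⊓ 𝓟 curve.dom) Γ

/-- Reparameterization of non-split degenerate annuli: the automorphisms of the strip preserving
its ends and edges are the real translations. -/
def NonSplit.Equivalent {Λ : LegendrianKnot} (d e : NonSplit Λ) : Prop :=
  ∃ c : ℝ, e.pos = d.pos + c ∧
    (e.curve.P : Set ℂ) = (fun z => z + (c : ℂ)) '' (d.curve.P : Set ℂ) ∧
    ∀ z ∈ d.curve.dom, e.curve.u (z + c) = d.curve.u z

/-- A split degenerate annulus: an annulus in the 0-dimensional part together with an index zero
disk, whose corner at `∞` is attached to the annulus at its corner `node`. The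
boundary strands at the two corners match, hence the two corners have opposite signs. The
resulting building has exactly one positive corner. -/
structure Split (Λ : LegendrianKnot) where
  ann : HolAnnulus Λ
  ann_dim : ann.IsDimZero
  node : ℂ
  node_mem : node ∈ ann.curve.P
  disk : HolCurve Λ halfPlane
  Γ : ℂ
  arriving : ℝ
  leaving : ℝ
  corner : ann.curve.HasCorner node Γ arriving leaving
  tendsto_end : Tendsto disk.u (Bornology.cobounded ℂ ⊓ 𝓟 disk.dom) (𝓝 Γ)
  end_left : Tendsto (fun x : ℝ => disk.h x) atBot (𝓝 arriving)
  end_right : Tendsto (fun x : ℝ => disk.h x) atTop (𝓝 leaving)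
  rigid : disk.IsRigid
  convex_end : disk.ConvexAlong (Bornology.cobounded ℂ ⊓ 𝓟 disk.dom) Γ
  signs : (node ≠ ann.pos ∧ ∀ t ∈ disk.P, disk.IsNegCorner t) ∨
    (node = ann.pos ∧ ∃ q ∈ disk.P, disk.IsPosCorner q ∧
      ∀ t ∈ disk.P, t ≠ q → disk.IsNegCorner t)

/-- Reparameterization of split degenerate annuli: rotations of the annulus and automorphisms
`z ↦ αz + β` of the half-plane. -/
def Split.Equivalent {Λ : LegendrianKnot} (d e : Split Λ) : Prop :=
  (d.ann.r = e.ann.r ∧ ∃ c : ℂ, ‖c‖ = 1 ∧ e.node = c * d.node ∧ e.ann.pos = c * d.ann.pos ∧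
    (e.ann.curve.P : Set ℂ) = (fun z => c * z) '' (d.ann.curve.P : Set ℂ) ∧
    ∀ z ∈ d.ann.curve.dom, e.ann.curve.u (c * z) = d.ann.curve.u z) ∧
  ∃ α β : ℝ, 0 < α ∧
    (e.disk.P : Set ℂ) = (fun z : ℂ => α * z + β) '' (d.disk.P : Set ℂ) ∧
    ∀ z ∈ d.disk.dom, e.disk.u (α * z + β) = d.disk.u z

/-! ### Gromov convergence -/

/-- The maps `f n` on `S n` converge to `g` on `T`, locally uniformly with all derivatives (in the
form of continuous convergence, which makes sense for varying domains). -/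
def SmoothConv (f : ℕ → ℂ → ℂ) (S : ℕ → Set ℂ) (g : ℂ → ℂ) (T : Set ℂ) : Prop :=
  ∀ (k : ℕ) (z : ℕ → ℂ) (w : ℂ), (∀ n, z n ∈ S n) → Tendsto z atTop (𝓝 w) → w ∈ T →
    Tendsto (fun n => iteratedDerivWithin k (f n) (S n) (z n)) atTop
      (𝓝 (iteratedDerivWithin k g T w))

/-- The maps `f n` on `S n` converge uniformly to `g` on `T` near the corner `t` of `g`. -/
def CornerConv (f : ℕ → ℂ → ℂ) (S : ℕ → Set ℂ) (g : ℂ → ℂ) (T : Set ℂ) (t : ℂ) : Prop :=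
  ∀ Γ : ℂ, Tendsto g (𝓝[T] t) (𝓝 Γ) → ∀ z : ℕ → ℂ, (∀ n, z n ∈ S n) → Tendsto z atTop (𝓝 t) →
    Tendsto (fun n => f n (z n)) atTop (𝓝 Γ)

/-- `t` is a limit of points of the sets `Q n`. -/
def PointConv (Q : ℕ → Set ℂ) (t : ℂ) : Prop :=
  ∃ s : ℕ → ℂ, (∀ᶠ n in atTop, s n ∈ Q n) ∧ Tendsto s atTop (𝓝 t)

section Convergence

variable {Λ : LegendrianKnot}

/-- Convergence of annuli to an annulus, after rotations `c n` of the domains. -/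
def ConvToAnnulus (A : ℕ → HolAnnulus Λ) (B : HolAnnulus Λ) : Prop :=
  ∃ c : ℕ → ℂ, (∀ n, ‖c n‖ = 1) ∧
    Tendsto (fun n => (A n).r) atTop (𝓝 B.r) ∧
    SmoothConv (fun n z => (A n).curve.u (c n * z)) (fun n => {z | c n * z ∈ (A n).curve.dom})
      B.curve.u B.curve.dom ∧
    (∀ t ∈ B.curve.P,
      CornerConv (fun n z => (A n).curve.u (c n * z)) (fun n => {z | c n * z ∈ (A n).curve.dom})
        B.curve.u B.curve.dom t) ∧
    (∀ᶠ n in atTop, (A n).curve.P.card = B.curve.P.card) ∧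
    (∀ t ∈ B.curve.P, PointConv (fun n => {z | c n * z ∈ (A n).curve.P}) t) ∧
    PointConv (fun n => {z | c n * z = (A n).pos}) B.pos

/-- The holomorphic map `ζ ↦ chart b (δ ζ)` to the annulus, rescaling near the boundary point
`b`. -/
def rescale (r : ℝ) (b : ℂ) (δ : ℝ) (ζ : ℂ) : ℂ := (annulus r).chart b (δ * ζ)

/-- Convergence of annuli to a non-split degenerate annulus. With `δ = log r` and `b` on the outer
boundary, `rescale r b δ` is the universal covering of the annulus by the strip, of period
`2π / δ`. The moduli tend to zero, the lifted maps converge on compact subsets of the strip, and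
they converge uniformly to `Γ` on the neck, i.e. the rest of the period. -/
def ConvToNonSplit (A : ℕ → HolAnnulus Λ) (d : NonSplit Λ) : Prop :=
  ∃ b : ℕ → ℂ, (∀ n, ‖b n‖ = (A n).r) ∧
    Tendsto (fun n => (A n).r) atTop (𝓝 1) ∧
    let ψ : ℕ → ℂ → ℂ := fun n => rescale (A n).r (b n) (Real.log (A n).r)
    let f : ℕ → ℂ → ℂ := fun n ζ => (A n).curve.u (ψ n ζ)
    let S : ℕ → Set ℂ := fun n => {ζ | ψ n ζ ∈ (A n).curve.dom}
    SmoothConv f S d.curve.u d.curve.dom ∧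
    (∀ t ∈ d.curve.P, CornerConv f S d.curve.u d.curve.dom t) ∧
    (∀ᶠ n in atTop, (A n).curve.P.card = d.curve.P.card) ∧
    (∀ t ∈ d.curve.P, PointConv (fun n => {ζ | ψ n ζ ∈ (A n).curve.P}) t) ∧
    PointConv (fun n => {ζ | ψ n ζ = (A n).pos}) d.pos ∧
    ∀ ζ : ℕ → ℂ, (∀ n, ζ n ∈ S n) → Tendsto (fun n => |(ζ n).re|) atTop atTop →
      (∀ n, |(ζ n).re| ≤ Real.pi / Real.log (A n).r) →
      Tendsto (fun n => f n (ζ n)) atTop (𝓝 d.Γ)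

/-- Convergence of annuli to a split degenerate annulus: after rotations `c n`, convergence to the
annular part away from the node; after rescaling by `δ n → 0` at boundary points `b n` tending to
the node, convergence to the disk; and uniform convergence to `Γ` on the neck between. -/
def ConvToSplit (A : ℕ → HolAnnulus Λ) (d : Split Λ) : Prop :=
  ∃ (c b : ℕ → ℂ) (δ : ℕ → ℝ), (∀ n, ‖c n‖ = 1) ∧ (∀ n, b n ∈ (annulus (A n).r).bdry) ∧
    (∀ n, 0 < δ n) ∧ Tendsto b atTop (𝓝 d.node) ∧ Tendsto δ atTop (𝓝 0) ∧
    Tendsto (fun n => (A n).r) atTop (𝓝 d.ann.r) ∧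
    let f : ℕ → ℂ → ℂ := fun n z => (A n).curve.u (c n * z)
    let S : ℕ → Set ℂ := fun n => {z | c n * z ∈ (A n).curve.dom}
    let ψ : ℕ → ℂ → ℂ := fun n => rescale (A n).r (b n) (δ n)
    let f' : ℕ → ℂ → ℂ := fun n ζ => f n (ψ n ζ)
    let S' : ℕ → Set ℂ := fun n => {ζ | ψ n ζ ∈ S n}
    SmoothConv f S d.ann.curve.u d.ann.curve.dom ∧
    (∀ t ∈ d.ann.curve.P, t ≠ d.node →
      CornerConv f S d.ann.curve.u d.ann.curve.dom t ∧
      PointConv (fun n => {z | c n * z ∈ (A n).curve.P}) t) ∧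
    SmoothConv f' S' d.disk.u d.disk.dom ∧
    (∀ t ∈ d.disk.P, CornerConv f' S' d.disk.u d.disk.dom t ∧
      PointConv (fun n => {ζ | c n * ψ n ζ ∈ (A n).curve.P}) t) ∧
    (∀ᶠ n in atTop, (A n).curve.P.card + 1 = d.ann.curve.P.card + d.disk.P.card) ∧
    (d.node ≠ d.ann.pos → PointConv (fun n => {z | c n * z = (A n).pos}) d.ann.pos) ∧
    (∀ q ∈ d.disk.P, d.disk.IsPosCorner q →
      PointConv (fun n => {ζ | c n * ψ n ζ = (A n).pos}) q) ∧
    ∀ ζ : ℕ → ℂ, (∀ n, 0 ≤ (ζ n).im ∧ ζ n ∈ S' n) → Tendsto (fun n => ‖ζ n‖) atTop atTop →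
      Tendsto (fun n => (δ n : ℂ) * ζ n) atTop (𝓝 0) →
      Tendsto (fun n => f' n (ζ n)) atTop (𝓝 d.Γ)

end Convergence

/-! ### The compactified 1-dimensional part -/

/-- Representatives of points of the compactified 1-dimensional part of the moduli space. -/
inductive PreBar (Λ : LegendrianKnot) : Type
  | interior (A : HolAnnulus Λ) (hA : A.IsDimOne) : PreBar Λ
  | nonSplit (d : NonSplit Λ) : PreBar Λ
  | split (d : Split Λ) : PreBar Λ

/-- Equivalence of representatives. -/
def PreBar.Equivalent {Λ : LegendrianKnot} : PreBar Λ → PreBar Λ → Prop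
  | .interior A _, .interior B _ => A.Equivalent B
  | .nonSplit d, .nonSplit e => d.Equivalent e
  | .split d, .split e => d.Equivalent e
  | _, _ => False

/-- Gromov convergence of annuli to a possibly degenerate annulus. -/
def GromovConv {Λ : LegendrianKnot} (A : ℕ → HolAnnulus Λ) : PreBar Λ → Prop
  | .interior B _ => ConvToAnnulus A B
  | .nonSplit d => ConvToNonSplit A d
  | .split d => ConvToSplit A d

/-- The compactified 1-dimensional part of the moduli space. -/
def ModuliBar (Λ : LegendrianKnot) : Type := Quot (PreBar.Equivalent (Λ := Λ))

/-- The class of a representative. -/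
def ModuliBar.mk {Λ : LegendrianKnot} (y : PreBar Λ) : ModuliBar Λ := Quot.mk _ y

/-- The Gromov topology: a set is open if it eventually contains every sequence of annuli in the
1-dimensional part Gromov converging to one of its points. -/
instance ModuliBar.gromovTopology (Λ : LegendrianKnot) : TopologicalSpace (ModuliBar Λ) where
  IsOpen V := ∀ (A : ℕ → HolAnnulus Λ) (hA : ∀ n, (A n).IsDimOne) (y : PreBar Λ),
    GromovConv A y → ModuliBar.mk y ∈ V →
      ∀ᶠ n in atTop, ModuliBar.mk (.interior (A n) (hA n)) ∈ V
  isOpen_univ := fun _ _ _ _ _ => Eventually.of_forall fun _ => trivial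
  isOpen_inter := fun _ _ hV hW A hA y hy hyV =>
    (hV A hA y hy hyV.1).and (hW A hA y hy hyV.2)
  isOpen_sUnion := fun 𝒱 h𝒱 A hA y hy hyV => by
    obtain ⟨V, hV, hyV'⟩ := hyV
    exact (h𝒱 V hV A hA y hy hyV').mono fun n hn => ⟨V, hV, hn⟩

end LegAnnuli

end

/-! In coordinates, `J`-holomorphicity of a lift `(r, x, y, z)` of `u₀ = x + iy` says exactly that
`z + i(y² / 2 - r)` is holomorphic. So `z` is a harmonic function whose boundary values are the
heights `h` of the lifted boundary, and `r` comes from its harmonic conjugate. On an annulus the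
only obstruction to a single-valued conjugate is the flux of `z` through the core circle. Circle
means of a harmonic function are affine in `log ρ`, so up to sign and normalization the flux is
`(total 1 - total r) / log r`, where `total R` integrates `h` over the circle of radius `R` against
the angle. This number is `Ω` (`HolAnnulus.flux`). It depends only on the class of the annulus
because in general position a nonconstant path in the projection has only one lift
(`LegendrianKnot.lift_unique`), and boundary arcs are nonconstant by boundary uniqueness.

Necessity (`flux_eq_zero_of_isLift`): by Cauchy's theorem circle integrals of the holomorphic
function do not depend on the radius, and boundedness of `z` at the punctures allows passage to both
boundary circles.

Sufficiency (`exists_isLift`): if the means agree, the Dirichlet problem is solved by the real part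
of a holomorphic function, built from the Herglotz integrals of the two boundary circles and a
series of reflections correcting their values on the opposite circle (`exists_annulus_extension`).
The solution is smooth up to the boundary where the data are smooth (`hergExt_smooth_at`). At a
puncture the data jump from `l` to `m`; the model is an angle function, with conjugate `(m - l) / π
* log ‖ζ‖`, which is the behaviour at a Reeb chord. As `u` is only assumed continuous at a corner,
the deviation from the model must be controlled without derivative bounds. Boundary chords of `u`
are almost parallel to a tangent of the knot, and Cauchy's theorem for the square of a difference
quotient turns this into a scale invariant bound (`integral_slope_sq_le`). The resulting Dini
condition (`HolCurve.diniCorner`) makes the error in the conjugate sublogarithmic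
(`cornerAsymp_herg`).

Continuity: under Gromov convergence the boundary maps, hence the heights, converge at almost every
angle, and heights are bounded, so dominated convergence applies. A disk splitting off shrinks to a
boundary point and leaves the flux of the annular part. In a non-split degeneration `log r` tends to
`0` from above, while at every angle but one the circle ends up on the neck, so the numerator tends
to `2π * (innerZ - outerZ)` (`edge_total_tendsto`); its sign decides between the two infinities.

Smoothness: cut-off functions moving with the punctures split the total height of a family into
integrals which can be differentiated under the integral sign (`CircleFamily.contDiff_total`). Near
a corner, the derivative bounds assumed for `u` pass to the height because on each branch the height
is a smooth function of the projection. -/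

open Filter Topology MeasureTheory
open scoped ContDiff

/-! ### Local geometry of the knot and its projection -/

namespace LegAnnuli.LegendrianKnot

variable (Λ : LegendrianKnot)

/-- The Lagrangian projection of the point with parameter `s`. -/
noncomputable def proj (s : ℝ) : ℂ := Λ.x s + Λ.y s * Complex.I

/-- The derivative of the Lagrangian projection. -/
noncomputable def tangent (s : ℝ) : ℂ := deriv Λ.x s + deriv Λ.y s * Complex.I

lemma mem_iff {p : ℂ} {ζ : ℝ} : Λ.Mem p ζ ↔ ∃ s, Λ.proj s = p ∧ Λ.z s = ζ := by
  refine exists_congr fun s => ?_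
  rw [Complex.ext_iff]
  simp [proj, and_assoc]

lemma mem_self (s : ℝ) : Λ.Mem (Λ.proj s) (Λ.z s) := Λ.mem_iff.2 ⟨s, rfl, rfl⟩

lemma contDiff_proj : ContDiff ℝ ∞ Λ.proj := by
  unfold proj
  exact (Complex.ofRealCLM.contDiff.comp Λ.smooth_x).add
    ((Complex.ofRealCLM.contDiff.comp Λ.smooth_y).mul contDiff_const)

lemma hasDerivAt_proj (s : ℝ) : HasDerivAt Λ.proj (Λ.tangent s) s := by
  have hx := ((Λ.smooth_x.differentiable (by simp)) s).hasDerivAt.ofReal_comp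
  have hy := ((Λ.smooth_y.differentiable (by simp)) s).hasDerivAt.ofReal_comp
  exact hx.add (hy.mul_const _)

lemma tangent_ne_zero (s : ℝ) : Λ.tangent s ≠ 0 := by
  intro h
  have h1 : deriv Λ.x s = 0 := by simpa [tangent] using congrArg Complex.re h
  have h2 : deriv Λ.y s = 0 := by simpa [tangent] using congrArg Complex.im h
  exact Λ.immersed s ⟨h1, h2, by rw [Λ.legendrian, h1, mul_zero]⟩

lemma continuous_z : Continuous Λ.z := Λ.smooth_z.continuous

lemma continuous_proj : Continuous Λ.proj := Λ.contDiff_proj.continuous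

lemma proj_add_int (s : ℝ) (n : ℤ) : Λ.proj (s + n) = Λ.proj s := by
  have hx := Λ.periodic_x.int_mul n s
  have hy := Λ.periodic_y.int_mul n s
  simp only [mul_one] at hx hy
  simp [proj, hx, hy]

lemma z_add_int (s : ℝ) (n : ℤ) : Λ.z (s + n) = Λ.z s := by
  simpa using Λ.periodic_z.int_mul n s

/-- By periodicity all points are reached from one closed interval around `s₀`, on which compactness
arguments can be run. -/
lemma exists_param_near {p : ℂ} {ζ : ℝ} (h : Λ.Mem p ζ) (s₀ : ℝ) :
    ∃ s, |s - s₀| ≤ 1 / 2 ∧ Λ.proj s = p ∧ Λ.z s = ζ := by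
  obtain ⟨s, h1, h2⟩ := Λ.mem_iff.1 h
  refine ⟨s + (-round (s - s₀) : ℤ), ?_, by rw [proj_add_int, h1], by rw [z_add_int, h2]⟩
  have := abs_sub_round (s - s₀)
  have e : s + ((-round (s - s₀) : ℤ) : ℝ) - s₀ = s - s₀ - round (s - s₀) := by push_cast; ring
  rwa [e]

/-- The set of pairs `(p, ζ)` on the knot. -/
def graph : Set (ℂ × ℝ) := {q | Λ.Mem q.1 q.2}

lemma graph_eq_image (s₀ : ℝ) :
    Λ.graph = (fun s => (Λ.proj s, Λ.z s)) '' Metric.closedBall s₀ (1 / 2) := by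
  ext ⟨p, ζ⟩
  constructor
  · intro h
    obtain ⟨s, hs, h1, h2⟩ := Λ.exists_param_near h s₀
    exact ⟨s, by simpa [Real.dist_eq] using hs, by simp [h1, h2]⟩
  · rintro ⟨s, -, h⟩
    rw [← h]
    exact Λ.mem_self s

lemma isCompact_graph : IsCompact Λ.graph := by
  rw [Λ.graph_eq_image 0]
  exact (isCompact_closedBall _ _).image (Λ.continuous_proj.prodMk Λ.continuous_z)

/-- The constant dominates the boundary heights of all curves at once, and so is the majorant in the
dominated convergence arguments for total heights. -/
lemma exists_bound : ∃ Z : ℝ, 0 ≤ Z ∧ ∀ p ζ, Λ.Mem p ζ → |ζ| ≤ Z ∧ ‖p‖ ≤ Z := by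
  obtain ⟨Z, hZ⟩ := Λ.isCompact_graph.isBounded.exists_norm_le
  have key : ∀ p ζ, Λ.Mem p ζ → |ζ| ≤ Z ∧ ‖p‖ ≤ Z := fun p ζ h => by
    have := hZ (p, ζ) h
    rw [Prod.norm_mk, max_le_iff] at this
    exact ⟨this.2, this.1⟩
  exact ⟨Z, (abs_nonneg _).trans (key _ _ (Λ.mem_self 0)).1, key⟩

/-- A pair close to the point with parameter `s₀` has a parameter close to `s₀`. -/
lemma exists_param_of_near (s₀ : ℝ) {ε : ℝ} (hε : 0 < ε) :
    ∃ δ > 0, ∀ p ζ, Λ.Mem p ζ → ‖p - Λ.proj s₀‖ < δ → |ζ - Λ.z s₀| < δ →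
      ∃ s, |s - s₀| < ε ∧ Λ.proj s = p ∧ Λ.z s = ζ := by
  -- The points with parameter in the window but at distance at least `ε` from `s₀` form a compact
  -- set, which misses the point at `s₀` by embeddedness; a ball around that point avoids it.
  set K : Set (ℂ × ℝ) := (fun s => (Λ.proj s, Λ.z s)) ''
    (Metric.closedBall s₀ (1 / 2) \ Metric.ball s₀ ε) with hK
  have hKc : IsClosed K :=
    (((isCompact_closedBall _ _).diff Metric.isOpen_ball).image
      (Λ.continuous_proj.prodMk Λ.continuous_z)).isClosed
  have hn : (Λ.proj s₀, Λ.z s₀) ∈ Kᶜ := by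
    rintro ⟨s, ⟨hs1, hs2⟩, hs⟩
    simp only [Prod.mk.injEq, Complex.ext_iff] at hs
    obtain ⟨⟨h1, h2⟩, h3⟩ := hs
    obtain ⟨n, hn⟩ := Λ.embedded s s₀ (by simpa [proj] using h1) (by simpa [proj] using h2) h3
    have hn0 : n = 0 := by
      rw [Metric.mem_closedBall, Real.dist_eq, hn] at hs1
      have : |(n : ℝ)| < 1 := by
        have e : s - (s + n) = -(n : ℝ) := by ring
        rw [e, abs_neg] at hs1
        linarith
      have h4 : |n| < 1 := by exact_mod_cast this
      exact Int.abs_lt_one_iff.1 h4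
    apply hs2
    rw [hn, hn0]
    simpa using hε
  obtain ⟨δ, hδ, hball⟩ := Metric.isOpen_iff.1 hKc.isOpen_compl _ hn
  refine ⟨δ, hδ, fun p ζ h h1 h2 => ?_⟩
  obtain ⟨s, hs, hp, hz⟩ := Λ.exists_param_near h s₀
  refine ⟨s, ?_, hp, hz⟩
  by_contra hlt
  have : (p, ζ) ∈ Kᶜ := hball (by
    rw [Metric.mem_ball, Prod.dist_eq, max_lt_iff]
    exact ⟨by rw [dist_eq_norm]; exact h1, by rw [Real.dist_eq]; exact h2⟩)
  exact this ⟨s, ⟨by simpa [Real.dist_eq] using hs, by simpa [Real.dist_eq] using hlt⟩,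
    by simp [hp, hz]⟩

/-- Near a point of the knot, chords of the projection are almost tangent, and the `z`-coordinate
is a Lipschitz function of the projection. -/
lemma chord (s₀ : ℝ) : ∃ C : ℝ, 0 ≤ C ∧ ∀ ε > 0, ∃ δ > 0, ∀ p ζ p' ζ', Λ.Mem p ζ → Λ.Mem p' ζ' →
    ‖p - Λ.proj s₀‖ < δ → |ζ - Λ.z s₀| < δ → ‖p' - Λ.proj s₀‖ < δ → |ζ' - Λ.z s₀| < δ →
    |ζ - ζ'| ≤ C * ‖p - p'‖ ∧ ∃ c : ℝ, ‖(p - p') - c * Λ.tangent s₀‖ ≤ ε * ‖p - p'‖ := by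
  set T := Λ.tangent s₀ with hTdef
  have hT : 0 < ‖T‖ := norm_pos_iff.2 (Λ.tangent_ne_zero s₀)
  have hsd : HasStrictDerivAt Λ.proj T s₀ :=
    (Λ.contDiff_proj.contDiffAt).hasStrictDerivAt' (Λ.hasDerivAt_proj s₀) (by simp)
  obtain ⟨L, hL⟩ : ∃ L : ℝ, ∀ᶠ q : ℝ × ℝ in 𝓝 (s₀, s₀),
      |Λ.z q.1 - Λ.z q.2| ≤ L * |q.1 - q.2| := by
    have h := (Λ.smooth_z.contDiffAt (x := s₀)).hasStrictDerivAt (by simp)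
    obtain ⟨L, hL⟩ := h.hasStrictFDerivAt.isBigO_sub.bound
    exact ⟨L, hL⟩
  refine ⟨|L| * (2 / ‖T‖), by positivity, fun ε hε => ?_⟩
  -- The bound `1 / 2` absorbs the linearization error and gives `|s - s'| * ‖T‖ ≤ 2 * ‖d‖`; the
  -- bound `ε / 2` then cancels this factor `2`.
  set e := min (1 / 2) (ε / 2) with he
  have he0 : 0 < e := by positivity
  have hs := hsd.hasStrictFDerivAt.isLittleO.def (c := e * ‖T‖) (by positivity)
  obtain ⟨η, hη, hball⟩ := Metric.eventually_nhds_iff.1 (hs.and hL)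
  obtain ⟨δ, hδ, hpar⟩ := Λ.exists_param_of_near s₀ hη
  refine ⟨δ, hδ, fun p ζ p' ζ' h h' h1 h2 h3 h4 => ?_⟩
  obtain ⟨s, hs, rfl, rfl⟩ := hpar p ζ h h1 h2
  obtain ⟨s', hs', rfl, rfl⟩ := hpar p' ζ' h' h3 h4
  obtain ⟨hb1, hb2⟩ := hball (y := (s, s')) (by
    rw [Prod.dist_eq, max_lt_iff]
    exact ⟨by simpa [Real.dist_eq] using hs, by simpa [Real.dist_eq] using hs'⟩)
  simp only [ContinuousLinearMap.toSpanSingleton_apply, Complex.real_smul, Real.norm_eq_abs] at hb1 hb2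
  set d := Λ.proj s - Λ.proj s' with hd
  have hcT : ‖((s - s' : ℝ) : ℂ) * T‖ = |s - s'| * ‖T‖ := by
    rw [norm_mul, Complex.norm_real, Real.norm_eq_abs]
  have hlow : |s - s'| * ‖T‖ ≤ 2 * ‖d‖ := by
    have h5 : ‖((s - s' : ℝ) : ℂ) * T‖ ≤ ‖d‖ + ‖d - ((s - s' : ℝ) : ℂ) * T‖ := by
      have := norm_sub_le d (d - ((s - s' : ℝ) : ℂ) * T)
      simpa using this
    have h6 : e * ‖T‖ * |s - s'| ≤ 1 / 2 * ‖T‖ * |s - s'| := by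
      gcongr; exact min_le_left _ _
    rw [hcT] at h5
    linarith
  constructor
  · have h7 : |s - s'| ≤ 2 / ‖T‖ * ‖d‖ := by
      rw [div_mul_eq_mul_div, le_div_iff₀ hT]
      exact hlow
    calc |Λ.z s - Λ.z s'| ≤ L * |s - s'| := hb2
      _ ≤ |L| * |s - s'| := by gcongr; exact le_abs_self L
      _ ≤ |L| * (2 / ‖T‖ * ‖d‖) := by gcongr
      _ = _ := by ring
  · refine ⟨s - s', hb1.trans ?_⟩
    have h8 : e ≤ ε / 2 := min_le_right _ _
    calc e * ‖T‖ * |s - s'| = e * (|s - s'| * ‖T‖) := by ring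
      _ ≤ e * (2 * ‖d‖) := by gcongr
      _ ≤ ε / 2 * (2 * ‖d‖) := by gcongr
      _ = _ := by ring

/-- Points of the knot over the same point of the plane are separated. -/
lemma exists_separation :
    ∃ η > 0, ∀ p ζ ζ', Λ.Mem p ζ → Λ.Mem p ζ' → ζ = ζ' ∨ η ≤ |ζ - ζ'| := by
  by_contra hcon
  push Not at hcon
  have hcon' : ∀ n : ℕ, ∃ p ζ ζ', Λ.Mem p ζ ∧ Λ.Mem p ζ' ∧ ζ ≠ ζ' ∧
      |ζ - ζ'| < 1 / ((n : ℝ) + 1) := fun n => hcon _ (by positivity)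
  choose p ζ ζ' h h' hne hlt using hcon'
  obtain ⟨⟨p₀, ζ₀⟩, h₀, φ, hφ, hlim⟩ := Λ.isCompact_graph.tendsto_subseq (x := fun n => (p n, ζ n)) h
  obtain ⟨s₀, rfl, rfl⟩ := Λ.mem_iff.1 h₀
  obtain ⟨C, hC, hch⟩ := Λ.chord s₀
  obtain ⟨δ, hδ, hch⟩ := hch 1 one_pos
  have hp : Tendsto (fun n => p (φ n)) atTop (𝓝 (Λ.proj s₀)) :=
    (continuous_fst.tendsto _).comp hlim
  have hz : Tendsto (fun n => ζ (φ n)) atTop (𝓝 (Λ.z s₀)) :=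
    (continuous_snd.tendsto _).comp hlim
  have hd : Tendsto (fun n => ζ (φ n) - ζ' (φ n)) atTop (𝓝 0) :=
    squeeze_zero_norm (fun n => (hlt (φ n)).le)
      (tendsto_one_div_add_atTop_nhds_zero_nat.comp hφ.tendsto_atTop)
  have hz' : Tendsto (fun n => ζ' (φ n)) atTop (𝓝 (Λ.z s₀)) := by simpa using hz.sub hd
  obtain ⟨n, hn1, hn2, hn3⟩ := ((Metric.tendsto_nhds.1 hp δ hδ).and
    ((Metric.tendsto_nhds.1 hz δ hδ).and (Metric.tendsto_nhds.1 hz' δ hδ))).exists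
  rw [dist_eq_norm] at hn1 hn2 hn3
  -- Both heights lie over one point of the plane, so the Lipschitz estimate has right-hand side
  -- zero and forces them to agree.
  have := (hch _ _ _ _ (h (φ n)) (h' (φ n)) hn1 hn2 hn1 hn3).1
  rw [sub_self, norm_zero, mul_zero] at this
  exact hne (φ n) (sub_eq_zero.1 (abs_nonpos_iff.1 this))

/-- If two points of the plane are close, then points of the knot above them are either close or
separated. -/
lemma exists_gap : ∃ η > 0, ∀ ε > 0, ∃ δ > 0, ∀ p p' ζ ζ', Λ.Mem p ζ → Λ.Mem p' ζ' →
    ‖p - p'‖ < δ → |ζ - ζ'| < ε ∨ η < |ζ - ζ'| := by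
  obtain ⟨η, hη, hsep⟩ := Λ.exists_separation
  refine ⟨η / 2, by positivity, fun ε hε => ?_⟩
  by_contra hcon
  push Not at hcon
  have hcon' : ∀ n : ℕ, ∃ p p' ζ ζ', Λ.Mem p ζ ∧ Λ.Mem p' ζ' ∧ ‖p - p'‖ < 1 / ((n : ℝ) + 1) ∧
      ε ≤ |ζ - ζ'| ∧ |ζ - ζ'| ≤ η / 2 := fun n => hcon _ (by positivity)
  choose p p' ζ ζ' h h' hlt h1 h2 using hcon'
  obtain ⟨⟨⟨p₀, ζ₀⟩, ⟨p₁, ζ₁⟩⟩, ⟨h₀, h₁⟩, φ, hφ, hlim⟩ :=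
    (Λ.isCompact_graph.prod Λ.isCompact_graph).tendsto_subseq
      (x := fun n => ((p n, ζ n), (p' n, ζ' n))) (fun n => ⟨h n, h' n⟩)
  have e1 : Tendsto (fun n => p (φ n)) atTop (𝓝 p₀) :=
    ((continuous_fst.comp continuous_fst).tendsto _).comp hlim
  have e2 : Tendsto (fun n => ζ (φ n)) atTop (𝓝 ζ₀) :=
    ((continuous_snd.comp continuous_fst).tendsto _).comp hlim
  have e3 : Tendsto (fun n => p' (φ n)) atTop (𝓝 p₁) :=
    ((continuous_fst.comp continuous_snd).tendsto _).comp hlim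
  have e4 : Tendsto (fun n => ζ' (φ n)) atTop (𝓝 ζ₁) :=
    ((continuous_snd.comp continuous_snd).tendsto _).comp hlim
  have hd : Tendsto (fun n => p (φ n) - p' (φ n)) atTop (𝓝 0) :=
    squeeze_zero_norm (fun n => (hlt (φ n)).le)
      (tendsto_one_div_add_atTop_nhds_zero_nat.comp hφ.tendsto_atTop)
  have hpp : p₀ = p₁ := sub_eq_zero.1 (tendsto_nhds_unique (e1.sub e3) hd)
  subst hpp
  -- In the limit both heights lie over the same point, at positive distance at most half the
  -- separation constant.
  have l1 : ε ≤ |ζ₀ - ζ₁| := ge_of_tendsto' (e2.sub e4).abs fun n => h1 (φ n)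
  have l2 : |ζ₀ - ζ₁| ≤ η / 2 := le_of_tendsto' (e2.sub e4).abs fun n => h2 (φ n)
  rcases hsep p₀ ζ₀ ζ₁ h₀ h₁ with h3 | h3
  · rw [h3, sub_self, abs_zero] at l1; linarith
  · linarith

/-- A point of the plane is simple if there is at most one point of the knot above it. -/
def Simple (p : ℂ) : Prop := ∀ ζ ζ', Λ.Mem p ζ → Λ.Mem p ζ' → ζ = ζ'

variable {Λ}

/-- Up to sign the imaginary part of `S * star T` is the determinant of the two tangents; this is
transversality in complex notation. -/
lemma independent_tangents (hΛ : Λ.GeneralPosition) {s t : ℝ} (hp : Λ.proj s = Λ.proj t)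
    (hz : Λ.z s ≠ Λ.z t) : (Λ.tangent s * star (Λ.tangent t)).im ≠ 0 := by
  have h1 : Λ.x s = Λ.x t := by simpa [proj] using congrArg Complex.re hp
  have h2 : Λ.y s = Λ.y t := by simpa [proj] using congrArg Complex.im hp
  have := hΛ.1 s t h1 h2 (by
    rintro ⟨n, rfl⟩
    exact hz (Λ.z_add_int s n).symm)
  intro h
  apply this
  simp [tangent] at h
  linarith

/-- If double points accumulated at `Γ`, separation of heights would put them on two different
branches through `Γ`. The chord from `Γ` to such a point would then be almost parallel to both
branch tangents, against transversality. -/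
lemma isolated_of_not_simple (hΛ : Λ.GeneralPosition) (Γ : ℂ) :
    ∃ δ > 0, ∀ p, ‖p - Γ‖ < δ → p ≠ Γ → Λ.Simple p := by
  by_contra hcon
  push Not at hcon
  have hcon' : ∀ n : ℕ, ∃ p ζ ζ', ‖p - Γ‖ < 1 / ((n : ℝ) + 1) ∧ p ≠ Γ ∧ Λ.Mem p ζ ∧ Λ.Mem p ζ' ∧
      ζ ≠ ζ' := fun n => by
    obtain ⟨p, h1, h2, h3⟩ := hcon (1 / ((n : ℝ) + 1)) (by positivity)
    unfold Simple at h3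
    push Not at h3
    obtain ⟨ζ, ζ', h4, h5, h6⟩ := h3
    exact ⟨p, ζ, ζ', h1, h2, h4, h5, h6⟩
  choose p ζ ζ' hlt hne h h' hz using hcon'
  obtain ⟨η, hη, hsep⟩ := Λ.exists_separation
  obtain ⟨⟨⟨p₀, ζ₀⟩, ⟨p₁, ζ₁⟩⟩, ⟨h₀, h₁⟩, φ, hφ, hlim⟩ :=
    (Λ.isCompact_graph.prod Λ.isCompact_graph).tendsto_subseq
      (x := fun n => ((p n, ζ n), (p n, ζ' n))) (fun n => ⟨h n, h' n⟩)
  have e1 : Tendsto (fun n => p (φ n)) atTop (𝓝 p₀) :=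
    ((continuous_fst.comp continuous_fst).tendsto _).comp hlim
  have e2 : Tendsto (fun n => ζ (φ n)) atTop (𝓝 ζ₀) :=
    ((continuous_snd.comp continuous_fst).tendsto _).comp hlim
  have e3 : Tendsto (fun n => p (φ n)) atTop (𝓝 p₁) :=
    ((continuous_fst.comp continuous_snd).tendsto _).comp hlim
  have e4 : Tendsto (fun n => ζ' (φ n)) atTop (𝓝 ζ₁) :=
    ((continuous_snd.comp continuous_snd).tendsto _).comp hlim
  have hd : Tendsto (fun n => p (φ n) - Γ) atTop (𝓝 0) :=
    squeeze_zero_norm (fun n => (hlt (φ n)).le)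
      (tendsto_one_div_add_atTop_nhds_zero_nat.comp hφ.tendsto_atTop)
  obtain rfl : p₀ = Γ := sub_eq_zero.1 (tendsto_nhds_unique (e1.sub_const Γ) hd)
  obtain rfl : p₁ = p₀ := tendsto_nhds_unique e3 e1
  have hζ : ζ₀ ≠ ζ₁ := by
    intro h3
    have l1 : η ≤ |ζ₀ - ζ₁| := ge_of_tendsto' (e2.sub e4).abs fun n =>
      (hsep _ _ _ (h (φ n)) (h' (φ n))).resolve_left (hz (φ n))
    rw [h3, sub_self, abs_zero] at l1
    linarith
  obtain ⟨s, hs, rfl⟩ := Λ.mem_iff.1 h₀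
  obtain ⟨t, ht, rfl⟩ := Λ.mem_iff.1 h₁
  have hdet := independent_tangents hΛ (hs.trans ht.symm) hζ
  set S := Λ.tangent s
  set T := Λ.tangent t
  obtain ⟨ε, hε, hεlt⟩ : ∃ ε > 0, ε * ‖S‖ * ‖T‖ + (ε * ‖T‖) * ‖S‖ + ε * ‖S‖ * (ε * ‖T‖) <
      |(S * star T).im| := by
    have : Tendsto (fun ε : ℝ => ε * ‖S‖ * ‖T‖ + (ε * ‖T‖) * ‖S‖ + ε * ‖S‖ * (ε * ‖T‖)) (𝓝[>] 0)
        (𝓝 0) := by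
      have : ContinuousAt
        (fun ε : ℝ => ε * ‖S‖ * ‖T‖ + (ε * ‖T‖) * ‖S‖ + ε * ‖S‖ * (ε * ‖T‖)) 0 := by fun_prop
      have h0 := this.tendsto
      simp only [zero_mul, add_zero] at h0
      exact h0.mono_left nhdsWithin_le_nhds
    exact ((eventually_mem_nhdsWithin).and
      (this.eventually (gt_mem_nhds (abs_pos.2 hdet)))).exists
  obtain ⟨C₁, -, c1⟩ := Λ.chord s
  obtain ⟨C₂, -, c2⟩ := Λ.chord t
  obtain ⟨ε', hε', hε1, hε2, hε3⟩ : ∃ ε' : ℝ, 0 < ε' ∧ ε' ≤ 1 / 2 ∧ 2 * ε' ≤ ε ∧ 2 * ε' ≤ ε :=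
    ⟨min (1 / 2) (ε / 2), by positivity, min_le_left _ _,
      by linarith [min_le_right (1 / 2) (ε / 2)], by linarith [min_le_right (1 / 2) (ε / 2)]⟩
  obtain ⟨δ₁, hδ₁, c1⟩ := c1 ε' hε'
  obtain ⟨δ₂, hδ₂, c2⟩ := c2 ε' hε'
  obtain ⟨n, hn1, hn2, hn3, hn4⟩ := ((Metric.tendsto_nhds.1 e1 δ₁ hδ₁).and
    ((Metric.tendsto_nhds.1 e2 δ₁ hδ₁).and ((Metric.tendsto_nhds.1 e1 δ₂ hδ₂).and
      (Metric.tendsto_nhds.1 e4 δ₂ hδ₂)))).exists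
  rw [dist_eq_norm] at hn1 hn2 hn3 hn4
  obtain ⟨-, a, ha⟩ := c1 _ _ _ _ (h (φ n)) h₀ (by rwa [hs]) hn2 (by simpa [hs] using hδ₁)
    (by simpa using hδ₁)
  obtain ⟨-, b, hb⟩ := c2 _ _ _ _ (h' (φ n)) h₁ (by rwa [ht]) hn4 (by simpa [ht] using hδ₂)
    (by simpa using hδ₂)
  set d := p (φ n) - p₁ with hddef
  have hd0 : 0 < ‖d‖ := norm_pos_iff.2 (sub_ne_zero.2 (hne _))
  -- the chord `d` would be almost parallel to both tangents
  have im1 : |(d * star S).im| ≤ ε' * ‖d‖ * ‖S‖ := by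
    have : (d * star S).im = ((d - a * S) * star S).im := by
      simp; ring
    rw [this]
    refine (Complex.abs_im_le_norm _).trans ?_
    rw [norm_mul, norm_star]
    gcongr
  have im2 : |(d * star T).im| ≤ ε' * ‖d‖ * ‖T‖ := by
    have : (d * star T).im = ((d - b * T) * star T).im := by
      simp; ring
    rw [this]
    refine (Complex.abs_im_le_norm _).trans ?_
    rw [norm_mul, norm_star]
    gcongr
  have re1 : |(d * star S).re| ≤ ‖d‖ * ‖S‖ := by
    refine (Complex.abs_re_le_norm _).trans ?_
    rw [norm_mul, norm_star]
  have re2 : |(d * star T).re| ≤ ‖d‖ * ‖T‖ := by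
    refine (Complex.abs_re_le_norm _).trans ?_
    rw [norm_mul, norm_star]
  -- The imaginary part of `star (d * star S) * (d * star T)`, whose value is `‖d‖ ^ 2 * (S * star
  -- T)`. Each product on the right contains one of the small imaginary parts.
  have key : ‖d‖ ^ 2 * (S * star T).im =
      (d * star S).re * (d * star T).im - (d * star S).im * (d * star T).re := by
    rw [← Complex.normSq_eq_norm_sq, Complex.normSq_apply]
    simp
    ring
  have hk : ‖d‖ ^ 2 * |(S * star T).im| ≤
      (‖d‖ * ‖S‖) * (ε' * ‖d‖ * ‖T‖) + (ε' * ‖d‖ * ‖S‖) * (‖d‖ * ‖T‖) := by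
    have e : ‖d‖ ^ 2 * |(S * star T).im| = |‖d‖ ^ 2 * (S * star T).im| := by
      rw [abs_mul, abs_of_nonneg (sq_nonneg ‖d‖)]
    rw [e, key]
    refine (abs_sub _ _).trans ?_
    rw [abs_mul, abs_mul]
    gcongr
  have hk2 : ‖d‖ ^ 2 * |(S * star T).im| ≤ ‖d‖ ^ 2 * (ε * ‖S‖ * ‖T‖) := by
    refine hk.trans ?_
    have : (‖d‖ * ‖S‖) * (ε' * ‖d‖ * ‖T‖) + (ε' * ‖d‖ * ‖S‖) * (‖d‖ * ‖T‖) =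
      ‖d‖ ^ 2 * (2 * ε' * ‖S‖ * ‖T‖) := by ring
    rw [this]
    gcongr
  have hk3 := le_of_mul_le_mul_left hk2 (by positivity)
  have : 0 ≤ (ε * ‖T‖) * ‖S‖ + ε * ‖S‖ * (ε * ‖T‖) := by positivity
  linarith

/-- Near a point of the knot, the `z`-coordinate is a smooth function of the projection. -/
lemma exists_local_graph (Λ : LegendrianKnot) {p₀ : ℂ} {ζ₀ : ℝ} (h₀ : Λ.Mem p₀ ζ₀) :
    ∃ Φ : ℂ → ℝ, ∃ δ > 0, ContDiffOn ℝ ∞ Φ (Metric.ball p₀ δ) ∧ Φ p₀ = ζ₀ ∧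
      ∀ p ζ, Λ.Mem p ζ → ‖p - p₀‖ < δ → |ζ - ζ₀| < δ → ζ = Φ p := by
  obtain ⟨s₀, rfl, rfl⟩ := Λ.mem_iff.1 h₀
  set T := Λ.tangent s₀ with hT
  have hT0 : T ≠ 0 := Λ.tangent_ne_zero s₀
  -- the tangential coordinate
  let ℓ : ℂ →L[ℝ] ℝ := Complex.reCLM.comp (ContinuousLinearMap.mul ℝ ℂ (star T))
  have hℓ : ∀ w, ℓ w = (star T * w).re := fun w => rfl
  set g : ℝ → ℝ := fun s => ℓ (Λ.proj s) with hg
  have hgs : ContDiff ℝ ∞ g := ℓ.contDiff.comp Λ.contDiff_proj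
  have hgd : HasDerivAt g (Complex.normSq T) s₀ := by
    have := ℓ.hasFDerivAt.comp_hasDerivAt s₀ (Λ.hasDerivAt_proj s₀)
    have e : ℓ (Λ.tangent s₀) = Complex.normSq T := by
      rw [hℓ, ← hT, Complex.normSq_apply]
      simp
    rwa [e] at this
  have hn : Complex.normSq T ≠ 0 := by simpa using hT0
  have hgF := hgd.hasFDerivAt_equiv hn
  set e := (hgs.contDiffAt (x := s₀)).toOpenPartialHomeomorph g hgF (by simp) with hedef
  have hcoe : ∀ s, e s = g s := fun s => rfl
  have hsrc : s₀ ∈ e.source := (hgs.contDiffAt (x := s₀)).mem_toOpenPartialHomeomorph_source hgF (by simp)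
  have hinv : ContDiffAt ℝ ∞ e.symm (g s₀) :=
    (hgs.contDiffAt (x := s₀)).to_localInverse hgF (by simp)
  set Φ : ℂ → ℝ := fun p => Λ.z (e.symm (ℓ p)) with hΦ
  have hΦ0 : Φ (Λ.proj s₀) = Λ.z s₀ := by
    show Λ.z (e.symm (e s₀)) = _
    rw [e.left_inv hsrc]
  have hcont : ContinuousAt e.symm (g s₀) := hinv.continuousAt
  have htgt : ∀ᶠ a in 𝓝 (g s₀), a ∈ e.target ∧ deriv g (e.symm a) ≠ 0 := by
    have h1 : ∀ᶠ s in 𝓝 s₀, deriv g s ≠ 0 :=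
      ((hgs.continuous_deriv (by simp)).continuousAt (x := s₀)).eventually_ne (by rwa [hgd.deriv])
    have h2 : Tendsto e.symm (𝓝 (g s₀)) (𝓝 s₀) := by
      have := hcont.tendsto
      rwa [show e.symm (g s₀) = s₀ from e.left_inv hsrc] at this
    exact Filter.Eventually.and (e.open_target.mem_nhds (e.map_source hsrc)) (h2.eventually h1)
  have hnear : ∀ᶠ p in 𝓝 (Λ.proj s₀), ℓ p ∈ e.target ∧ deriv g (e.symm (ℓ p)) ≠ 0 :=
    (ℓ.continuous.continuousAt (x := Λ.proj s₀)).eventually htgt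
  obtain ⟨δ₁, hδ₁, hball⟩ := Metric.eventually_nhds_iff.1 hnear
  obtain ⟨δ₂, hδ₂, hsrc'⟩ := Metric.isOpen_iff.1 e.open_source _ hsrc
  obtain ⟨δ₃, hδ₃, hpar⟩ := Λ.exists_param_of_near s₀ hδ₂
  refine ⟨Φ, min δ₁ δ₃, by positivity, fun p hp => ?_, hΦ0, fun p ζ h h1 h2 => ?_⟩
  · obtain ⟨hb1, hb2⟩ := hball (lt_of_lt_of_le (Metric.mem_ball.1 hp) (min_le_left _ _))
    have hs : ContDiffAt ℝ ∞ e.symm (ℓ p) :=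
      e.contDiffAt_symm_deriv hb2 hb1
        ((hgs.differentiable (by simp)) _).hasDerivAt hgs.contDiffAt
    exact (Λ.smooth_z.contDiffAt.comp p (hs.comp p ℓ.contDiff.contDiffAt)).contDiffWithinAt
  · obtain ⟨s, hs, rfl, rfl⟩ := hpar p ζ h (h1.trans_le (min_le_right _ _))
      (h2.trans_le (min_le_right _ _))
    show _ = Λ.z (e.symm (e s))
    rw [e.left_inv (hsrc' (by simpa [Real.dist_eq] using hs))]

end LegAnnuli.LegendrianKnot

/-! ### Uniqueness and stability of lifts of plane paths -/

namespace LegAnnuli.LegendrianKnot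

variable (Λ : LegendrianKnot)

/-- Upper semicontinuity of the fibres of the projection, by compactness of the knot. -/
lemma exists_mem_near (p : ℂ) {ε : ℝ} (hε : 0 < ε) :
    ∃ δ > 0, ∀ p' ζ', Λ.Mem p' ζ' → ‖p' - p‖ < δ → ∃ ζ, Λ.Mem p ζ ∧ |ζ' - ζ| < ε := by
  by_contra hcon
  push Not at hcon
  have hcon' : ∀ n : ℕ, ∃ p' ζ', Λ.Mem p' ζ' ∧ ‖p' - p‖ < 1 / ((n : ℝ) + 1) ∧
      ∀ ζ, Λ.Mem p ζ → ε ≤ |ζ' - ζ| := fun n => hcon _ (by positivity)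
  choose p' ζ' h h1 h2 using hcon'
  obtain ⟨⟨p₀, ζ₀⟩, h₀, φ, hφ, hlim⟩ :=
    Λ.isCompact_graph.tendsto_subseq (x := fun n => (p' n, ζ' n)) h
  have e1 : Tendsto (fun n => p' (φ n)) atTop (𝓝 p₀) := (continuous_fst.tendsto _).comp hlim
  have e2 : Tendsto (fun n => ζ' (φ n)) atTop (𝓝 ζ₀) := (continuous_snd.tendsto _).comp hlim
  have hd : Tendsto (fun n => p' (φ n) - p) atTop (𝓝 0) :=
    squeeze_zero_norm (fun n => (h1 (φ n)).le)
      (tendsto_one_div_add_atTop_nhds_zero_nat.comp hφ.tendsto_atTop)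
  obtain rfl : p₀ = p := sub_eq_zero.1 (tendsto_nhds_unique (e1.sub_const p) hd)
  have := ge_of_tendsto' (e2.sub_const ζ₀).abs fun n => h2 (φ n) ζ₀ h₀
  rw [sub_self, abs_zero] at this
  linarith

/-- Lifts of close paths which are not too far from each other at one point are close. -/
lemma exists_lift_close : ∃ η > 0, ∀ ε > 0, ∃ δ > 0, ∀ (I : Set ℝ), IsPreconnected I →
    ∀ (v v' : ℝ → ℂ) (h h' : ℝ → ℝ), ContinuousOn h I → ContinuousOn h' I →
    (∀ x ∈ I, Λ.Mem (v x) (h x)) → (∀ x ∈ I, Λ.Mem (v' x) (h' x)) →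
    (∀ x ∈ I, ‖v x - v' x‖ < δ) → ∀ x₁ ∈ I, |h x₁ - h' x₁| ≤ η →
    ∀ x ∈ I, |h x - h' x| < ε := by
  obtain ⟨η, hη, hgap⟩ := Λ.exists_gap
  refine ⟨η, hη, fun ε hε => ?_⟩
  obtain ⟨δ, hδ, hgap⟩ := hgap (min ε η) (by positivity)
  refine ⟨δ, hδ, fun I hI v v' h h' hc hc' hm hm' hv x₁ hx₁ h1 x hx => ?_⟩
  by_contra hlt
  push Not at hlt
  have g := fun y hy => hgap _ _ _ _ (hm y hy) (hm' y hy) (hv y hy)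
  have g1 : |h x₁ - h' x₁| < min ε η := (g x₁ hx₁).resolve_right (not_lt.2 h1)
  -- If the lifts drifted apart, their distance would somewhere equal `min ε η`, a value lying in
  -- the forbidden gap.
  obtain ⟨y, hy, hye⟩ := hI.intermediate_value hx₁ hx (hc.sub hc').abs
    ⟨g1.le, (min_le_left _ _).trans hlt⟩
  change |h y - h' y| = _ at hye
  rcases g y hy with h2 | h2
  · rw [hye] at h2; exact lt_irrefl _ h2
  · rw [hye] at h2; exact absurd (min_le_right ε η) (not_le.2 h2)

variable {Λ}

/-- For two lifts of the same path the closeness required by `exists_lift_close` holds for every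
`ε`. -/
lemma lift_eq {I : Set ℝ} (hI : IsPreconnected I) {v : ℝ → ℂ} {h h' : ℝ → ℝ}
    (hc : ContinuousOn h I) (hc' : ContinuousOn h' I) (hm : ∀ x ∈ I, Λ.Mem (v x) (h x))
    (hm' : ∀ x ∈ I, Λ.Mem (v x) (h' x)) {x₁ : ℝ} (hx₁ : x₁ ∈ I) (h1 : h x₁ = h' x₁) :
    ∀ x ∈ I, h x = h' x := by
  intro x hx
  obtain ⟨η, hη, H⟩ := Λ.exists_lift_close
  refine sub_eq_zero.1 (abs_nonpos_iff.1 (le_of_forall_pos_lt_add fun ε hε => ?_))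
  obtain ⟨δ, hδ, H⟩ := H ε hε
  rw [zero_add]
  exact H I hI v v h h' hc hc' hm hm' (fun y _ => by simpa using hδ) x₁ hx₁ (by simp [h1, hη.le])
    x hx

/-- Non-simple points form a discrete set, and a continuous map from a preconnected set to a
discrete set is constant. Over a simple point a lift has no choice. -/
lemma exists_simple (hΛ : Λ.GeneralPosition) {I : Set ℝ} (hI : IsPreconnected I) {v : ℝ → ℂ}
    (hv : ContinuousOn v I) (hne : ¬ ∃ c, ∀ x ∈ I, v x = c) : ∃ x ∈ I, Λ.Simple (v x) := by
  by_contra hcon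
  push Not at hcon
  have hdisc : DiscreteTopology {p : ℂ | ¬ Λ.Simple p} := by
    rw [discreteTopology_subtype_iff']
    intro Γ hΓ
    obtain ⟨δ, hδ, H⟩ := isolated_of_not_simple hΛ Γ
    refine ⟨Metric.ball Γ δ, Metric.isOpen_ball, ?_⟩
    ext p
    constructor
    · rintro ⟨h1, h2⟩
      by_contra h3
      exact h2 (H p (by simpa [dist_eq_norm] using h1) h3)
    · rintro rfl
      exact ⟨Metric.mem_ball_self hδ, hΓ⟩
  apply hne
  rcases I.eq_empty_or_nonempty with rfl | ⟨x₀, hx₀⟩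
  · exact ⟨0, by simp⟩
  · exact ⟨v x₀, fun x hx => hI.constant_of_mapsTo (T := {p : ℂ | ¬ Λ.Simple p}) ⟨hdisc⟩ hv
      (fun y hy => hcon y hy) hx hx₀⟩

/-- Nonconstancy is essential, since a path resting at a double point has two lifts. Otherwise the
lifts agree over a simple point, and agreement propagates. -/
lemma lift_unique (hΛ : Λ.GeneralPosition) {I : Set ℝ} (hI : IsPreconnected I) {v : ℝ → ℂ}
    {h h' : ℝ → ℝ} (hv : ContinuousOn v I) (hne : ¬ ∃ c, ∀ x ∈ I, v x = c)
    (hc : ContinuousOn h I) (hc' : ContinuousOn h' I) (hm : ∀ x ∈ I, Λ.Mem (v x) (h x))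
    (hm' : ∀ x ∈ I, Λ.Mem (v x) (h' x)) : ∀ x ∈ I, h x = h' x := by
  obtain ⟨x₁, hx₁, hs⟩ := exists_simple hΛ hI hv hne
  exact lift_eq hI hc hc' hm hm' hx₁ (hs _ _ (hm x₁ hx₁) (hm' x₁ hx₁))

/-- Lifts of uniformly convergent paths converge. -/
lemma lift_tendsto (hΛ : Λ.GeneralPosition) {ι : Type*} {l : Filter ι} {I : Set ℝ}
    (hI : IsPreconnected I) {v : ℝ → ℂ} {h : ℝ → ℝ} {w : ι → ℝ → ℂ} {k : ι → ℝ → ℝ}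
    (hv : ContinuousOn v I) (hne : ¬ ∃ c, ∀ x ∈ I, v x = c)
    (hc : ContinuousOn h I) (hm : ∀ x ∈ I, Λ.Mem (v x) (h x))
    (hk : ∀ᶠ n in l, ContinuousOn (k n) I ∧ ∀ x ∈ I, Λ.Mem (w n x) (k n x))
    (hw : ∀ δ > 0, ∀ᶠ n in l, ∀ x ∈ I, ‖w n x - v x‖ < δ) :
    ∀ ε > 0, ∀ᶠ n in l, ∀ x ∈ I, |k n x - h x| < ε := by
  intro ε hε
  obtain ⟨η, hη, H⟩ := Λ.exists_lift_close
  obtain ⟨δ, hδ, H⟩ := H ε hε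
  -- At a parameter with simple image all nearby heights are close to the single one above it; this
  -- starts the propagation along `I`.
  obtain ⟨x₁, hx₁, hs⟩ := exists_simple hΛ hI hv hne
  obtain ⟨δ', hδ', H'⟩ := Λ.exists_mem_near (v x₁) hη
  filter_upwards [hk, hw δ hδ, hw δ' hδ'] with n h1 h2 h3
  refine H I hI (w n) v (k n) h h1.1 hc h1.2 hm h2 x₁ hx₁ ?_
  obtain ⟨ζ, hζ, hlt⟩ := H' _ _ (h1.2 x₁ hx₁) (h3 x₁ hx₁)
  rw [hs _ _ (hm x₁ hx₁) hζ]
  exact hlt.le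

end LegAnnuli.LegendrianKnot

/-! ### Boundary uniqueness for holomorphic functions -/

namespace LegAnnuli

/-- A two-constants argument. The factor `exp (N * φ)` has modulus at most one on the arc of the
half-disk and does no harm on the diameter, where `f` vanishes, but it grows exponentially in `N` at
the point in question. The maximum principle for the product then squeezes the value of `f` there to
zero. -/
lemma eq_zero_of_eq_zero_on_diameter {f : ℂ → ℂ} {ε η : ℝ} (hη : 0 < η) (hηε : 4 * η < ε)
    (hc : ContinuousOn f {z | ‖z‖ ≤ ε ∧ 0 ≤ z.im})
    (hd : DifferentiableOn ℂ f {z | ‖z‖ < ε ∧ 0 < z.im})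
    (h0 : ∀ x : ℝ, |x| ≤ ε → f x = 0) : f (η * Complex.I) = 0 := by
  have hε : 0 < ε := by linarith
  set U : Set ℂ := {z | ‖z‖ < ε ∧ 0 < z.im} with hU
  have hUo : IsOpen U := (isOpen_lt continuous_norm continuous_const).inter
    (isOpen_lt continuous_const Complex.continuous_im)
  set K : Set ℂ := {z | ‖z‖ ≤ ε ∧ 0 ≤ z.im} with hK
  have hKc : IsClosed K := (isClosed_le continuous_norm continuous_const).inter
    (isClosed_le continuous_const Complex.continuous_im)
  have hUK : closure U ⊆ K := closure_minimal (fun z hz => ⟨hz.1.le, hz.2.le⟩) hKc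
  have hUb : Bornology.IsBounded U :=
    Metric.isBounded_ball.subset (fun z hz => by simpa using hz.1 : U ⊆ Metric.ball 0 ε)
  obtain ⟨M, hM⟩ : ∃ M, ∀ z ∈ K, ‖f z‖ ≤ M := by
    have : IsCompact K := Metric.isCompact_of_isClosed_isBounded hKc
      (Metric.isBounded_closedBall.subset (fun z hz => by simpa using hz.1 : K ⊆ Metric.closedBall 0 ε))
    exact this.exists_bound_of_continuousOn hc
  have hM0 : 0 ≤ M := (norm_nonneg _).trans (hM 0 ⟨by simpa using hε.le, by simp⟩)
  have hden : ∀ z ∈ K, z + η * Complex.I ≠ 0 := fun z hz h => by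
    have := congrArg Complex.im h
    simp at this
    linarith [hz.2]
  -- The pole lies below the half-disk. On the arc the first term has norm at most `1 / (ε - η)`, so
  -- the real part of `φ` is nonpositive there; at `η * I` the value is `1 / (2 * η) - 1 / (ε - η)`,
  -- positive because `4 * η < ε`.
  set φ : ℂ → ℂ := fun z => Complex.I / (z + η * Complex.I) - ((1 / (ε - η) : ℝ) : ℂ) with hφ
  have hφc : DiffContOnCl ℂ φ U := by
    refine ⟨?_, ?_⟩
    · intro z hz
      have := hden z (hUK (subset_closure hz))
      have : DifferentiableAt ℂ φ z := by
        rw [hφ]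
        fun_prop (disch := assumption)
      exact this.differentiableWithinAt
    · intro z hz
      have := hden z (hUK hz)
      have : ContinuousAt φ z := by
        rw [hφ]
        fun_prop (disch := assumption)
      exact this.continuousWithinAt
  have key : ∀ N : ℕ, ‖f (η * Complex.I)‖ ≤ M * Real.exp (-(N * (1 / (2 * η) - 1 / (ε - η)))) := by
    intro N
    set g : ℂ → ℂ := fun z => f z * Complex.exp (N * φ z) with hg
    have hgc : DiffContOnCl ℂ g U := by
      refine ⟨?_, ?_⟩
      · exact hd.mul ((hφc.differentiableOn.const_mul _).cexp)
      · exact (hc.mono hUK).mul ((hφc.continuousOn.const_smul (N : ℂ)).cexp)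
    have hfr : ∀ z ∈ frontier U, ‖g z‖ ≤ M := by
      intro z hz
      have hzK := hUK (frontier_subset_closure hz)
      have hzU : z ∉ U := by
        rw [hUo.frontier_eq] at hz
        exact hz.2
      rcases hzK.2.eq_or_lt with him | him
      · have hzr : z = (z.re : ℂ) := by apply Complex.ext <;> simp [← him]
        have : f z = 0 := by
          rw [hzr]
          exact h0 _ ((Complex.abs_re_le_norm z).trans hzK.1)
        simp [hg, this, hM0]
      · have hzn : ‖z‖ = ε := by
          by_contra hne
          exact hzU ⟨lt_of_le_of_ne hzK.1 hne, him⟩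
        have hre : (N * φ z).re ≤ 0 := by
          have e1 : (N * φ z).re = N * (φ z).re := by simp
          rw [e1]
          refine mul_nonpos_of_nonneg_of_nonpos (Nat.cast_nonneg N) ?_
          have h1 : (Complex.I / (z + η * Complex.I)).re ≤ 1 / (ε - η) := by
            refine (Complex.re_le_norm _).trans ?_
            rw [norm_div, Complex.norm_I]
            refine one_div_le_one_div_of_le (by linarith) ?_
            have := norm_sub_norm_le z (-(η * Complex.I))
            rw [norm_neg, norm_mul, Complex.norm_I, Complex.norm_real, Real.norm_eq_abs,
              abs_of_pos hη, mul_one, sub_neg_eq_add, hzn] at this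
            exact this
          simp only [hφ, Complex.sub_re, Complex.ofReal_re]
          linarith
        rw [hg]
        simp only [norm_mul, Complex.norm_exp]
        calc ‖f z‖ * Real.exp (N * φ z).re ≤ M * 1 := by
              gcongr
              · exact hM z hzK
              · exact Real.exp_le_one_iff.2 hre
          _ = M := mul_one M
    have hmem : (η * Complex.I : ℂ) ∈ U := by
      refine ⟨?_, by simpa using hη⟩
      rw [norm_mul, Complex.norm_I, Complex.norm_real, Real.norm_eq_abs, abs_of_pos hη]
      linarith
    have := Complex.norm_le_of_forall_mem_frontier_norm_le hUb hgc hfr (subset_closure hmem)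
    rw [hg] at this
    simp only [norm_mul, Complex.norm_exp] at this
    have e2 : (N * φ (η * Complex.I)).re = N * (1 / (2 * η) - 1 / (ε - η)) := by
      have : φ (η * Complex.I) = ((1 / (2 * η) - 1 / (ε - η) : ℝ) : ℂ) := by
        rw [hφ]
        have : (η : ℂ) ≠ 0 := by exact_mod_cast hη.ne'
        push_cast
        congr 1
        have hI := Complex.I_ne_zero
        field_simp
        ring
      rw [this]
      simp only [Complex.mul_re, Complex.natCast_re, Complex.natCast_im, Complex.ofReal_re,
        zero_mul, sub_zero]
    rw [e2] at this
    rw [Real.exp_neg, ← div_eq_mul_inv, le_div_iff₀ (Real.exp_pos _)]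
    exact this
  have hpos : 0 < 1 / (2 * η) - 1 / (ε - η) := by
    rw [sub_pos]
    exact one_div_lt_one_div_of_lt (by positivity) (by linarith)
  have hlim : Tendsto (fun N : ℕ => M * Real.exp (-(N * (1 / (2 * η) - 1 / (ε - η))))) atTop
      (𝓝 (M * 0)) := by
    refine Tendsto.const_mul M (Real.tendsto_exp_neg_atTop_nhds_zero.comp ?_)
    exact tendsto_natCast_atTop_atTop.atTop_mul_const hpos
  rw [mul_zero] at hlim
  exact norm_le_zero_iff.1 (ge_of_tendsto' hlim key)

/-- Boundary uniqueness: a holomorphic function on a strip which is constant on a boundary interval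
is constant. -/
lemma eq_const_of_eq_const_on_interval {f : ℂ → ℂ} {L a b : ℝ} {c : ℂ} (hL : 0 < L) (hab : a < b)
    (hd : DifferentiableOn ℂ f {z | 0 < z.im ∧ z.im < L})
    (hc : ContinuousOn f ({z | 0 < z.im ∧ z.im < L} ∪ {z | z.im = 0 ∧ a < z.re ∧ z.re < b}))
    (h0 : ∀ x : ℝ, a < x → x < b → f x = c) : ∀ z : ℂ, 0 < z.im → z.im < L → f z = c := by
  set S : Set ℂ := {z | 0 < z.im ∧ z.im < L} with hS
  have hSo : IsOpen S := (isOpen_lt continuous_const Complex.continuous_im).inter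
    (isOpen_lt Complex.continuous_im continuous_const)
  have hSc : IsPreconnected S := by
    have : Convex ℝ S := (convex_halfSpace_im_gt 0).inter (convex_halfSpace_im_lt L)
    exact this.isPreconnected
  set x₀ := (a + b) / 2 with hx₀
  -- With this radius, a closed half-disk centred at a real point within `ρ` of the midpoint stays
  -- over `(a, b)` and below height `L`.
  obtain ⟨ρ, hρ, hρ1, hρ2⟩ : ∃ ρ > 0, ρ ≤ (b - a) / 8 ∧ ρ ≤ L / 2 :=
    ⟨min ((b - a) / 8) (L / 2), lt_min (by linarith) (by linarith), min_le_left _ _,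
      min_le_right _ _⟩
  have key : ∀ z : ℂ, |z.re - x₀| < ρ → 0 < z.im → 4 * z.im < ρ → f z = c := by
    intro z h1 h2 h3
    rw [abs_lt] at h1
    have := eq_zero_of_eq_zero_on_diameter (f := fun w => f (w + z.re) - c) h2 h3 ?_ ?_ ?_
    · have e : (z.im * Complex.I + z.re : ℂ) = z := by apply Complex.ext <;> simp
      rw [e] at this
      exact sub_eq_zero.1 this
    · refine ContinuousOn.sub (hc.comp (by fun_prop) ?_) continuousOn_const
      rintro w ⟨hw1, hw2⟩
      have hw3 := abs_le.1 ((Complex.abs_re_le_norm w).trans hw1)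
      have hw4 := abs_le.1 ((Complex.abs_im_le_norm w).trans hw1)
      rcases hw2.eq_or_lt with h | h
      · right
        simp only [Set.mem_ofPred_eq, Complex.add_im, Complex.ofReal_im, add_zero, Complex.add_re,
          Complex.ofReal_re]
        refine ⟨h.symm, by linarith, by linarith⟩
      · left
        simp only [hS, Set.mem_ofPred_eq, Complex.add_im, Complex.ofReal_im, add_zero]
        exact ⟨h, by linarith⟩
    · refine DifferentiableOn.sub (hd.comp (by fun_prop) ?_) (differentiableOn_const _)
      rintro w ⟨hw1, hw2⟩
      have hw4 := abs_le.1 ((Complex.abs_im_le_norm w).trans hw1.le)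
      simp only [hS, Set.mem_ofPred_eq, Complex.add_im, Complex.ofReal_im, add_zero]
      exact ⟨hw2, by linarith⟩
    · intro x hx
      rw [abs_le] at hx
      rw [sub_eq_zero, ← Complex.ofReal_add]
      exact h0 _ (by linarith) (by linarith)
  have han : AnalyticOnNhd ℂ f S := hd.analyticOnNhd hSo
  have hz₀ : (x₀ + (ρ / 8 : ℝ) * Complex.I : ℂ) ∈ S := by
    simp only [hS, Set.mem_ofPred_eq, Complex.add_im, Complex.ofReal_im, Complex.mul_im,
      Complex.I_im, Complex.ofReal_re, Complex.I_re]
    constructor <;> linarith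
  have hev : f =ᶠ[𝓝 (x₀ + (ρ / 8 : ℝ) * Complex.I : ℂ)] fun _ => c := by
    have e1 : ∀ᶠ z : ℂ in 𝓝 (x₀ + (ρ / 8 : ℝ) * Complex.I : ℂ), |z.re - x₀| < ρ :=
      (by fun_prop : Continuous fun z : ℂ => |z.re - x₀|).continuousAt.eventually_lt
        continuousAt_const (by simpa using hρ)
    have e2 : ∀ᶠ z : ℂ in 𝓝 (x₀ + (ρ / 8 : ℝ) * Complex.I : ℂ), 0 < z.im :=
      continuousAt_const.eventually_lt Complex.continuous_im.continuousAt (by simp; linarith)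
    have e3 : ∀ᶠ z : ℂ in 𝓝 (x₀ + (ρ / 8 : ℝ) * Complex.I : ℂ), 4 * z.im < ρ :=
      (by fun_prop : Continuous fun z : ℂ => 4 * z.im).continuousAt.eventually_lt
        continuousAt_const (by simp; linarith)
    filter_upwards [e1, e2, e3] with z h1 h2 h3 using key z h1 h2 h3
  intro z h1 h2
  exact han.eqOn_of_preconnected_of_eventuallyEq analyticOnNhd_const hSc hz₀ hev ⟨h1, h2⟩

end LegAnnuli

/-! ### Boundary circles, total heights and the flux -/

namespace LegAnnuli

/-- The point of the circle of radius `R` with argument `θ`. -/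
noncomputable def cpt (R θ : ℝ) : ℂ := R * Complex.exp (θ * Complex.I)

lemma norm_cpt {R : ℝ} (hR : 0 ≤ R) (θ : ℝ) : ‖cpt R θ‖ = R := by
  rw [cpt, norm_mul, Complex.norm_exp_ofReal_mul_I, Complex.norm_real, Real.norm_eq_abs,
    abs_of_nonneg hR, mul_one]

lemma continuous_cpt (R : ℝ) : Continuous (cpt R) := by
  unfold cpt; fun_prop

lemma contDiff_cpt : ContDiff ℝ ∞ fun q : ℝ × ℝ => cpt q.1 q.2 := by
  unfold cpt
  exact (Complex.ofRealCLM.contDiff.comp contDiff_fst).mul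
    (((Complex.ofRealCLM.contDiff.comp contDiff_snd).mul contDiff_const).cexp)

lemma cpt_periodic (R : ℝ) : Function.Periodic (cpt R) (2 * Real.pi) := by
  intro θ
  unfold cpt
  push_cast
  rw [add_mul, Complex.exp_add, Complex.exp_two_pi_mul_I, mul_one]

lemma cpt_add (R θ α : ℝ) : cpt R (θ + α) = Complex.exp (α * Complex.I) * cpt R θ := by
  unfold cpt
  push_cast
  rw [add_mul, Complex.exp_add]
  ring

lemma exists_cpt {z : ℂ} {R : ℝ} (hz : ‖z‖ = R) : ∃ θ, cpt R θ = z :=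
  ⟨z.arg, by rw [cpt, ← hz, Complex.norm_mul_exp_arg_mul_I]⟩

lemma cpt_eq_iff {R : ℝ} (hR : 0 < R) {θ φ : ℝ} :
    cpt R θ = cpt R φ ↔ ∃ n : ℤ, θ = φ + n * (2 * Real.pi) := by
  have hR' : (R : ℂ) ≠ 0 := by exact_mod_cast hR.ne'
  rw [cpt, cpt, mul_right_inj' hR', Complex.exp_eq_exp_iff_exists_int]
  refine exists_congr fun n => ?_
  have : (φ * Complex.I + n * (2 * Real.pi * Complex.I) : ℂ) =
      ((φ + n * (2 * Real.pi) : ℝ) : ℂ) * Complex.I := by push_cast; ring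
  rw [this, mul_left_inj' Complex.I_ne_zero]
  exact_mod_cast Iff.rfl

namespace HolCurve

variable {Λ : LegendrianKnot} {D : BdDomain}

lemma continuousOn (C : HolCurve Λ D) : ContinuousOn C.u C.dom := C.holomorphic.continuousOn

/-- Boundary uniqueness for holomorphic curves, for a boundary arc which is the lower edge of a
strip parameterizing the interior of the domain. -/
lemma not_const_of_param (C : HolCurve Λ D) {g : ℂ → ℂ} (hg : Differentiable ℂ g) {L a b : ℝ}
    (hL : 0 < L) (hab : a < b)
    (hS : ∀ ζ : ℂ, 0 < ζ.im → ζ.im < L → C.dom ∈ 𝓝 (g ζ))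
    (hb : ∀ x : ℝ, a < x → x < b → g x ∈ C.dom)
    (hsurj : ∀ z ∈ C.dom, z ∈ closure (g '' {ζ | 0 < ζ.im ∧ ζ.im < L})) :
    ¬ ∃ c, ∀ x ∈ Set.Ioo a b, C.u (g x) = c := by
  rintro ⟨c, hc⟩
  have key := eq_const_of_eq_const_on_interval (f := fun ζ => C.u (g ζ)) (c := c) hL hab
    ?_ ?_ (fun x h1 h2 => hc x ⟨h1, h2⟩)
  · refine C.nonconstant ⟨c, fun z hz => ?_⟩
    have hsub : g '' {ζ | 0 < ζ.im ∧ ζ.im < L} ⊆ C.dom := by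
      rintro _ ⟨ζ, hζ, rfl⟩
      exact mem_of_mem_nhds (hS ζ hζ.1 hζ.2)
    have h1 : C.u z ∈ closure (C.u '' (g '' {ζ | 0 < ζ.im ∧ ζ.im < L})) :=
      ((C.continuousOn z hz).mono hsub).mem_closure_image (hsurj z hz)
    have h2 : C.u '' (g '' {ζ | 0 < ζ.im ∧ ζ.im < L}) ⊆ {c} := by
      rintro _ ⟨_, ⟨ζ, hζ, rfl⟩, rfl⟩
      exact key ζ hζ.1 hζ.2
    simpa using closure_mono h2 h1
  · intro ζ hζ
    have h1 : DifferentiableAt ℂ C.u (g ζ) :=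
      ((C.holomorphic.differentiableOn (by simp)) _ (mem_of_mem_nhds (hS ζ hζ.1 hζ.2))).differentiableAt
        (hS ζ hζ.1 hζ.2)
    exact (h1.comp ζ (hg ζ)).differentiableWithinAt
  · refine C.continuousOn.comp hg.continuous.continuousOn ?_
    rintro ζ (hζ | ⟨h0, h1, h2⟩)
    · exact mem_of_mem_nhds (hS ζ hζ.1 hζ.2)
    · have : ζ = (ζ.re : ℂ) := by apply Complex.ext <;> simp [h0]
      rw [this]
      exact hb _ h1 h2

section annulus

variable {r : ℝ} (C : HolCurve Λ (annulus r))

/-- The arguments of the boundary points at radius `R` which are not punctures. -/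
def arcs (R : ℝ) : Set ℝ := {θ | cpt R θ ∉ C.P}

lemma isOpen_arcs (R : ℝ) : IsOpen (C.arcs R) :=
  (C.P.finite_toSet.isClosed.preimage (continuous_cpt R)).isOpen_compl

lemma arcs_compl_countable {R : ℝ} (hR : 0 < R) : (C.arcs R)ᶜ.Countable := by
  have : (C.arcs R)ᶜ = ⋃ t ∈ (C.P : Set ℂ), {θ | cpt R θ = t} := by
    ext θ; simp [arcs]
  rw [this]
  refine C.P.countable_toSet.biUnion fun t _ => ?_
  rcases Set.eq_empty_or_nonempty {θ | cpt R θ = t} with h | ⟨φ, hφ⟩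
  · rw [h]; exact Set.countable_empty
  · refine (Set.countable_range fun n : ℤ => φ + n * (2 * Real.pi)).mono ?_
    intro θ hθ
    obtain ⟨n, hn⟩ := (cpt_eq_iff hR).1 ((hθ : cpt R θ = t).trans (hφ : cpt R φ = t).symm)
    exact ⟨n, hn.symm⟩

variable {C}

lemma bdry_iff {z : ℂ} : z ∈ (annulus r).bdry ↔ ‖z‖ = 1 ∨ ‖z‖ = r := Iff.rfl

lemma mem_dom_iff {z : ℂ} : z ∈ C.dom ↔ (1 ≤ ‖z‖ ∧ ‖z‖ ≤ r) ∧ z ∉ C.P := Iff.rfl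

lemma interior_mem_nhds {z : ℂ} (h1 : 1 < ‖z‖) (h2 : ‖z‖ < r) : C.dom ∈ 𝓝 z := by
  have : {z : ℂ | 1 < ‖z‖ ∧ ‖z‖ < r} ∈ 𝓝 z :=
    ((isOpen_lt continuous_const continuous_norm).inter
      (isOpen_lt continuous_norm continuous_const)).mem_nhds ⟨h1, h2⟩
  filter_upwards [this] with w hw
  refine mem_dom_iff.2 ⟨⟨hw.1.le, hw.2.le⟩, fun hP => ?_⟩
  rcases C.punctures_mem w hP with h | h
  · exact hw.1.ne' h
  · exact hw.2.ne h

lemma cpt_mem_bdry (hr : 1 < r) {R : ℝ} (hR : R = 1 ∨ R = r) (θ : ℝ) :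
    cpt R θ ∈ (annulus r).bdry := by
  have : 0 ≤ R := by rcases hR with h | h <;> linarith
  rw [bdry_iff, norm_cpt this]
  exact hR

lemma bdry_subset (hr : 1 < r) : (annulus r).bdry ⊆ (annulus r).carrier := by
  rintro z (h | h)
  · exact ⟨h.ge, by rw [h]; exact hr.le⟩
  · exact ⟨by rw [h]; exact hr.le, h.le⟩

lemma cpt_mem_dom (hr : 1 < r) {R : ℝ} (hR : R = 1 ∨ R = r) {θ : ℝ} (hθ : θ ∈ C.arcs R) :
    cpt R θ ∈ C.dom := ⟨bdry_subset hr (cpt_mem_bdry hr hR θ), hθ⟩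

lemma continuousOn_trace (hr : 1 < r) {R : ℝ} (hR : R = 1 ∨ R = r) :
    ContinuousOn (fun θ => C.u (cpt R θ)) (C.arcs R) :=
  C.continuousOn.comp (continuous_cpt R).continuousOn fun _ hθ => cpt_mem_dom hr hR hθ

lemma continuousOn_height (hr : 1 < r) {R : ℝ} (hR : R = 1 ∨ R = r) :
    ContinuousOn (fun θ => C.h (cpt R θ)) (C.arcs R) :=
  C.lift_continuous.comp (continuous_cpt R).continuousOn
    fun θ hθ => ⟨cpt_mem_bdry hr hR θ, hθ⟩

lemma mem_height (hr : 1 < r) {R : ℝ} (hR : R = 1 ∨ R = r) {θ : ℝ} (hθ : θ ∈ C.arcs R) :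
    Λ.Mem (C.u (cpt R θ)) (C.h (cpt R θ)) :=
  C.lift_mem _ ⟨cpt_mem_bdry hr hR θ, hθ⟩

lemma mem_closure_interior (hr : 1 < r) {z : ℂ} (h1 : 1 ≤ ‖z‖) (h2 : ‖z‖ ≤ r) :
    z ∈ closure {w : ℂ | 1 < ‖w‖ ∧ ‖w‖ < r} := by
  have hz : ‖z‖ ≠ 0 := by linarith
  -- Sliding radially towards the circle of radius `(1 + r) / 2` moves a point of the closed annulus
  -- into the open one.
  set k : ℝ := ((1 + r) / 2) / ‖z‖ with hk
  have hk0 : 0 < k := by positivity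
  have hlim : Tendsto (fun s : ℝ => (((1 - s) + s * k : ℝ) : ℂ) * z) (𝓝[>] 0) (𝓝 z) := by
    have : Continuous fun s : ℝ => (((1 - s) + s * k : ℝ) : ℂ) * z := by fun_prop
    have h := this.tendsto 0
    simp only [sub_zero, zero_mul, add_zero, Complex.ofReal_one, one_mul] at h
    exact h.mono_left nhdsWithin_le_nhds
  refine mem_closure_of_tendsto hlim ?_
  filter_upwards [self_mem_nhdsWithin,
    mem_nhdsWithin_of_mem_nhds (Iio_mem_nhds (zero_lt_one' ℝ))] with s hs hs1
  have hs : 0 < s := hs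
  have hs1 : s < 1 := hs1
  have hn : ‖(((1 - s) + s * k : ℝ) : ℂ) * z‖ = (1 - s) * ‖z‖ + s * ((1 + r) / 2) := by
    rw [norm_mul, Complex.norm_real, Real.norm_eq_abs, abs_of_pos (by nlinarith), hk]
    field_simp
  constructor
  · rw [hn]; nlinarith
  · rw [hn]; nlinarith

/-- The exponential maps the strip of height `log r` onto the open annulus and its lower edge onto
the boundary circle, so that boundary uniqueness on the strip applies: a constant arc would make the
whole curve constant. -/
lemma not_const_arc (hr : 1 < r) {R : ℝ} (hR : R = 1 ∨ R = r) {a b : ℝ} (hab : a < b)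
    (hs : Set.Ioo a b ⊆ C.arcs R) : ¬ ∃ c, ∀ x ∈ Set.Ioo a b, C.u (cpt R x) = c := by
  have hL : 0 < Real.log r := Real.log_pos hr
  have hr0 : 0 < r := by linarith
  have hnorm : ∀ (R σ : ℝ) (ζ : ℂ), 0 ≤ R → ‖(R : ℂ) * Complex.exp (σ * ζ * Complex.I)‖ =
      R * Real.exp (-(σ * ζ.im)) := by
    intro R σ ζ hR
    rw [norm_mul, Complex.norm_real, Real.norm_eq_abs, abs_of_nonneg hR, Complex.norm_exp]
    simp
  have hsurj : ∀ (R σ : ℝ), (R = 1 ∧ σ = -1 ∨ R = r ∧ σ = 1) → ∀ z ∈ C.dom,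
      z ∈ closure ((fun ζ : ℂ => (R : ℂ) * Complex.exp (σ * ζ * Complex.I)) ''
        {ζ | 0 < ζ.im ∧ ζ.im < Real.log r}) := by
    intro R σ hRσ z hz
    refine closure_mono ?_ (mem_closure_interior hr hz.1.1 hz.1.2)
    intro w hw
    have hw0 : 0 < ‖w‖ := lt_trans one_pos hw.1
    have hwne : w ≠ 0 := norm_pos_iff.1 hw0
    have hR0 : 0 < R := by rcases hRσ with h | h <;> rw [h.1] <;> linarith
    have hRc : (R : ℂ) ≠ 0 := by exact_mod_cast hR0.ne'
    have hσ2 : (σ : ℂ) * σ = 1 := by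
      rcases hRσ with h | h <;> rw [h.2] <;> simp
    have hlog : Real.log ‖w‖ < Real.log r := Real.log_lt_log hw0 hw.2
    have hlog0 : 0 < Real.log ‖w‖ := Real.log_pos hw.1
    refine ⟨-(σ * Complex.I * Complex.log (w / R)), ?_, ?_⟩
    · have : (-(σ * Complex.I * Complex.log (w / R))).im = -(σ * Real.log (‖w‖ / R)) := by
        simp [Complex.log_re, abs_of_pos hR0]
      simp only [Set.mem_ofPred_eq, this]
      rw [Real.log_div hw0.ne' hR0.ne']
      rcases hRσ with h | h
      · rw [h.1, h.2, Real.log_one]; constructor <;> linarith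
      · rw [h.1, h.2]; constructor <;> linarith
    · simp only
      have : (σ : ℂ) * -(σ * Complex.I * Complex.log (w / R)) * Complex.I = Complex.log (w / R) := by
        linear_combination (-(Complex.I * Complex.I) * Complex.log (w / R)) * hσ2
          - Complex.log (w / R) * Complex.I_mul_I
      rw [this, Complex.exp_log (div_ne_zero hwne hRc)]
      field_simp
  rintro ⟨c, hc⟩
  rcases hR with rfl | rfl
  · refine C.not_const_of_param (g := fun ζ => ((1 : ℝ) : ℂ) * Complex.exp (((-1 : ℝ) : ℂ) * ζ * Complex.I))
      (by fun_prop) hL (neg_lt_neg hab) ?_ ?_ (hsurj 1 (-1) (Or.inl ⟨rfl, rfl⟩)) ⟨c, ?_⟩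
    · intro ζ h1 h2
      refine interior_mem_nhds ?_ ?_
      · rw [hnorm _ _ _ zero_le_one]; simpa using h1
      · rw [hnorm _ _ _ zero_le_one]
        simpa using (Real.exp_lt_exp.2 h2).trans_eq (Real.exp_log hr0)
    · intro x h1 h2
      have := cpt_mem_dom hr (Or.inl rfl) (hs (show -x ∈ Set.Ioo a b from ⟨by linarith, by linarith⟩))
      simpa [cpt] using this
    · rintro x ⟨h1, h2⟩
      have := hc (-x) ⟨by linarith, by linarith⟩
      simpa [cpt] using this
  · refine C.not_const_of_param (g := fun ζ => (R : ℂ) * Complex.exp (((1 : ℝ) : ℂ) * ζ * Complex.I))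
      (by fun_prop) hL hab ?_ ?_ (hsurj R 1 (Or.inr ⟨rfl, rfl⟩)) ⟨c, ?_⟩
    · intro ζ h1 h2
      refine interior_mem_nhds ?_ ?_
      · rw [hnorm _ _ _ hr0.le, Real.exp_neg, one_mul, ← div_eq_mul_inv, lt_div_iff₀ (Real.exp_pos _),
          one_mul]
        exact (Real.exp_lt_exp.2 h2).trans_eq (Real.exp_log hr0)
      · rw [hnorm _ _ _ hr0.le]
        have : Real.exp (-(1 * ζ.im)) < 1 := by simpa using h1
        nlinarith
    · intro x h1 h2
      have := cpt_mem_dom hr (Or.inr rfl) (hs ⟨h1, h2⟩)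
      simpa [cpt] using this
    · rintro x ⟨h1, h2⟩
      have := hc x ⟨h1, h2⟩
      simpa [cpt] using this

variable (C) in
/-- The total height of the boundary circle of radius `R`. -/
noncomputable def total (R : ℝ) : ℝ := ∫ θ in (0 : ℝ)..2 * Real.pi, C.h (cpt R θ)

/-- At punctures the function `h` is unconstrained. Measurability comes from continuity on the arcs,
whose complement is countable. -/
lemma aestronglyMeasurable_height (hr : 1 < r) {R : ℝ} (hR : R = 1 ∨ R = r) :
    AEStronglyMeasurable (fun θ => C.h (cpt R θ)) volume := by
  have h0 : 0 < R := by rcases hR with h | h <;> linarith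
  have h1 := (continuousOn_height (C := C) hr hR).aestronglyMeasurable (μ := volume)
    (C.isOpen_arcs R).measurableSet
  have h2 : volume.restrict (C.arcs R) = volume := by
    rw [Measure.restrict_eq_self_of_ae_mem]
    rw [ae_iff]
    exact (C.arcs_compl_countable h0).measure_zero _
  rwa [h2] at h1

lemma ae_mem_arcs {R : ℝ} (h0 : 0 < R) : ∀ᵐ θ, θ ∈ C.arcs R := by
  rw [ae_iff]
  exact (C.arcs_compl_countable h0).measure_zero _

lemma height_bound (hr : 1 < r) {R : ℝ} (hR : R = 1 ∨ R = r) {Z : ℝ}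
    (hZ : ∀ p ζ, Λ.Mem p ζ → |ζ| ≤ Z ∧ ‖p‖ ≤ Z) : ∀ᵐ θ, ‖C.h (cpt R θ)‖ ≤ Z := by
  filter_upwards [ae_mem_arcs (C := C) (R := R) (by rcases hR with h | h <;> linarith)] with θ hθ
  exact (hZ _ _ (mem_height hr hR hθ)).1

lemma intervalIntegrable_height (hr : 1 < r) {R : ℝ} (hR : R = 1 ∨ R = r) (a b : ℝ) :
    IntervalIntegrable (fun θ => C.h (cpt R θ)) volume a b := by
  obtain ⟨Z, -, hZ⟩ := Λ.exists_bound
  refine (intervalIntegrable_const (c := Z)).mono_fun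
    (aestronglyMeasurable_height hr hR).restrict (ae_restrict_of_ae ?_)
  filter_upwards [height_bound (C := C) hr hR hZ] with θ hθ
  exact hθ.trans (le_abs_self _)

lemma total_eq (R a : ℝ) : C.total R = ∫ θ in a..a + 2 * Real.pi, C.h (cpt R θ) := by
  have : Function.Periodic (fun θ => C.h (cpt R θ)) (2 * Real.pi) := fun θ => by
    simp only [cpt_periodic R θ]
  rw [total, ← this.intervalIntegral_add_eq 0 a, zero_add]

/-- The boundary lift is determined by the curve. -/
lemma lift_unique_rotate (hΛ : Λ.GeneralPosition) (hr : 1 < r) {C' : HolCurve Λ (annulus r)}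
    {α R : ℝ} (hR : R = 1 ∨ R = r)
    (hP : (C'.P : Set ℂ) = (fun z => Complex.exp (α * Complex.I) * z) '' (C.P : Set ℂ))
    (hu : ∀ z ∈ C.dom, C'.u (Complex.exp (α * Complex.I) * z) = C.u z) :
    ∀ θ ∈ C.arcs R, C'.h (cpt R (θ + α)) = C.h (cpt R θ) := by
  have harcs : ∀ θ, θ ∈ C.arcs R → θ + α ∈ C'.arcs R := by
    intro θ hθ hmem
    have hmem : cpt R (θ + α) ∈ (C'.P : Set ℂ) := hmem
    rw [hP, cpt_add] at hmem
    obtain ⟨z, hz, hz2⟩ := hmem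
    have := mul_left_cancel₀ (Complex.exp_ne_zero _) hz2
    rw [this] at hz
    exact hθ hz
  intro θ hθ
  obtain ⟨ε, hε, hball⟩ := Metric.isOpen_iff.1 (C.isOpen_arcs R) θ hθ
  rw [Real.ball_eq_Ioo] at hball
  refine LegendrianKnot.lift_unique hΛ (I := Set.Ioo (θ - ε) (θ + ε)) isPreconnected_Ioo
    (v := fun x => C.u (cpt R x)) (h := fun x => C'.h (cpt R (x + α)))
    ((continuousOn_trace hr hR).mono hball) (not_const_arc hr hR (by linarith) hball)
    ((continuousOn_height (C := C') hr hR).comp (by fun_prop) fun x hx => harcs x (hball hx))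
    ((continuousOn_height hr hR).mono hball) (fun x hx => ?_)
    (fun x hx => mem_height hr hR (hball hx)) θ ⟨by linarith, by linarith⟩
  have := mem_height (C := C') hr hR (harcs x (hball hx))
  rwa [cpt_add, hu _ (cpt_mem_dom hr hR (hball hx)), ← cpt_add] at this

lemma total_rotate (hΛ : Λ.GeneralPosition) (hr : 1 < r) {C' : HolCurve Λ (annulus r)}
    {α R : ℝ} (hR : R = 1 ∨ R = r)
    (hP : (C'.P : Set ℂ) = (fun z => Complex.exp (α * Complex.I) * z) '' (C.P : Set ℂ))
    (hu : ∀ z ∈ C.dom, C'.u (Complex.exp (α * Complex.I) * z) = C.u z) :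
    C'.total R = C.total R := by
  have h0 : 0 < R := by rcases hR with h | h <;> linarith
  rw [C'.total_eq R (0 + α), show 0 + α + 2 * Real.pi = 2 * Real.pi + α by ring,
    ← intervalIntegral.integral_comp_add_right (fun θ => C'.h (cpt R θ)) α, total]
  refine intervalIntegral.integral_congr_ae ?_
  filter_upwards [ae_mem_arcs (C := C) h0] with θ hθ _
  exact lift_unique_rotate hΛ hr hR hP hu θ hθ

end annulus

end HolCurve

namespace HolAnnulus

variable {Λ : LegendrianKnot}

/-- The flux (up to sign and normalization) of the harmonic extension of the boundary heights. -/
noncomputable def flux (A : HolAnnulus Λ) : ℝ :=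
  (A.curve.total 1 - A.curve.total A.r) / Real.log A.r

/-- Equivalence of annuli does not mention the heights. They agree because the boundary lift is
determined by the map. -/
lemma flux_congr (hΛ : Λ.GeneralPosition) {A B : HolAnnulus Λ} (h : A.Equivalent B) :
    A.flux = B.flux := by
  obtain ⟨r, hr, C, p, hp, hpn, hpp, hpneg⟩ := A
  obtain ⟨r', hr', C', p', hp', hpn', hpp', hpneg'⟩ := B
  obtain ⟨h1, c, hc, -, hP, hu⟩ := h
  simp only at h1 hP hu
  subst h1
  have hce : Complex.exp (c.arg * Complex.I) = c := by
    have := Complex.norm_mul_exp_arg_mul_I c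
    rwa [hc, Complex.ofReal_one, one_mul] at this
  rw [← hce] at hP hu
  simp only [flux]
  rw [HolCurve.total_rotate hΛ hr (Or.inl rfl) hP hu, HolCurve.total_rotate hΛ hr (Or.inr rfl) hP hu]

end HolAnnulus

end LegAnnuli

/-! ### Convergence of total heights -/

namespace LegAnnuli

/-- Continuous convergence on a compact set is uniform. -/
lemma uniform_of_continuous_conv {K : Set ℝ} (hK : IsCompact K) {v : ℝ → ℂ} {w : ℕ → ℝ → ℂ}
    (hv : ContinuousOn v K)
    (H : ∀ x : ℕ → ℝ, (∀ n, x n ∈ K) → ∀ y ∈ K, Tendsto x atTop (𝓝 y) →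
      Tendsto (fun n => w n (x n)) atTop (𝓝 (v y))) :
    ∀ δ > 0, ∀ᶠ n in atTop, ∀ x ∈ K, ‖w n x - v x‖ < δ := by
  intro δ hδ
  by_contra hcon
  rw [not_eventually] at hcon
  obtain ⟨φ, hφ, hφ2⟩ := extraction_of_frequently_atTop hcon
  push Not at hφ2
  choose x hxK hx using hφ2
  obtain ⟨y, hy, ψ, hψ, hlim⟩ := hK.tendsto_subseq hxK
  classical
  have hinj : Function.Injective (φ ∘ ψ) := (hφ.comp hψ).injective
  -- The hypothesis concerns full sequences in `K`, so the subsequence of bad points is completed by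
  -- its limit `y`.
  let x' : ℕ → ℝ := fun n => if h : ∃ k, φ (ψ k) = n then x (ψ h.choose) else y
  have hx' : ∀ k, x' (φ (ψ k)) = x (ψ k) := by
    intro k
    have h : ∃ k', φ (ψ k') = φ (ψ k) := ⟨k, rfl⟩
    simp only [x', h, dif_pos]
    rw [hinj h.choose_spec]
  have hx'K : ∀ n, x' n ∈ K := by
    intro n
    simp only [x']
    split_ifs with h
    · exact hxK _
    · exact hy
  have hx'lim : Tendsto x' atTop (𝓝 y) := by
    rw [Metric.tendsto_atTop]
    intro ε hε
    obtain ⟨N, hN⟩ := Metric.tendsto_atTop.1 hlim ε hε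
    refine ⟨φ (ψ N), fun n hn => ?_⟩
    simp only [x']
    split_ifs with h
    · refine hN _ ?_
      have := h.choose_spec
      exact (hφ.comp hψ).le_iff_le.1 (by simpa [this] using hn)
    · simpa using hε
  have h1 := ((H x' hx'K y hy hx'lim).comp (hφ.comp hψ).tendsto_atTop)
  have h2 : Tendsto (fun k => v (x (ψ k))) atTop (𝓝 (v y)) :=
    (hv y hy).tendsto.comp (tendsto_nhdsWithin_iff.2 ⟨hlim, Eventually.of_forall fun k => hxK _⟩)
  have h3 := (h1.sub h2).norm
  rw [sub_self, norm_zero] at h3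
  refine absurd (ge_of_tendsto' h3 (b := δ) fun k => ?_) (not_le.2 hδ)
  simp only [Function.comp]
  rw [hx']
  exact hx _

/-- Derivative order zero of `SmoothConv`. That definition requires membership for all `n`; eventual
membership suffices after replacing finitely many terms by arbitrary points of the sets. -/
lemma SmoothConv.tendsto {f : ℕ → ℂ → ℂ} {S : ℕ → Set ℂ} {g : ℂ → ℂ} {T : Set ℂ}
    (h : SmoothConv f S g T) (hS : ∀ n, (S n).Nonempty) {z : ℕ → ℂ} {w : ℂ}
    (hz : ∀ᶠ n in atTop, z n ∈ S n) (hlim : Tendsto z atTop (𝓝 w)) (hw : w ∈ T) :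
    Tendsto (fun n => f n (z n)) atTop (𝓝 (g w)) := by
  classical
  let z' : ℕ → ℂ := fun n => if z n ∈ S n then z n else (hS n).some
  have he : z' =ᶠ[atTop] z := by
    filter_upwards [hz] with n hn
    simp [z', hn]
  have := h 0 z' w (fun n => by
    simp only [z']
    split_ifs with h
    · exact h
    · exact (hS n).some_mem) (hlim.congr' he.symm) hw
  simp only [iteratedDerivWithin_zero] at this
  refine this.congr' ?_
  filter_upwards [he] with n hn
  rw [hn]

/-- Pigeonhole: as many eventually distinct members as the cardinality exhaust the set. In the limit
theorems it shows that no puncture escapes the prescribed limits. -/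
lemma eventually_eq_of_card {ι : Type*} [Fintype ι] {Q : ℕ → Finset ℂ} {s : ι → ℕ → ℂ}
    (hs : ∀ i, ∀ᶠ n in atTop, s i n ∈ Q n)
    (hd : ∀ i j, i ≠ j → ∀ᶠ n in atTop, s i n ≠ s j n)
    (hcard : ∀ᶠ n in atTop, (Q n).card = Fintype.card ι) :
    ∀ᶠ n in atTop, ∀ q ∈ Q n, ∃ i, q = s i n := by
  classical
  have hd' : ∀ᶠ n in atTop, ∀ i j, i ≠ j → s i n ≠ s j n := by
    rw [eventually_all]; intro i
    rw [eventually_all]; intro j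
    by_cases h : i = j
    · simp [h]
    · filter_upwards [hd i j h] with n hn _ using hn
  filter_upwards [eventually_all.2 hs, hd', hcard] with n h1 h2 h3 q hq
  have hinj : Function.Injective fun i => s i n := fun i j hij => by
    by_contra h
    exact h2 i j h hij
  have himg : Finset.univ.image (fun i => s i n) = Q n := by
    refine Finset.eq_of_subset_of_card_le ?_ ?_
    · intro x hx
      obtain ⟨i, -, rfl⟩ := Finset.mem_image.1 hx
      exact h1 i
    · rw [Finset.card_image_of_injective _ hinj, h3, Finset.card_univ]
  rw [← himg] at hq
  obtain ⟨i, -, hi⟩ := Finset.mem_image.1 hq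
  exact ⟨i, hi.symm⟩

lemma exists_unit_arg {c : ℂ} (hc : ‖c‖ = 1) : ∃ α : ℝ, Complex.exp (α * Complex.I) = c := by
  refine ⟨c.arg, ?_⟩
  have := Complex.norm_mul_exp_arg_mul_I c
  rwa [hc, Complex.ofReal_one, one_mul] at this

namespace HolCurve

variable {Λ : LegendrianKnot}

lemma dom_nonempty {r : ℝ} (hr : 1 < r) (C : HolCurve Λ (annulus r)) : C.dom.Nonempty := by
  have h : ‖(((1 + r) / 2 : ℝ) : ℂ)‖ = (1 + r) / 2 := by
    rw [Complex.norm_real, Real.norm_eq_abs, abs_of_pos (by linarith)]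
  exact ⟨(((1 + r) / 2 : ℝ) : ℂ), mem_of_mem_nhds
    (interior_mem_nhds (by rw [h]; linarith) (by rw [h]; linarith))⟩

lemma total_rotation {r : ℝ} {C : HolCurve Λ (annulus r)} (R α : ℝ) :
    C.total R = ∫ θ in (0 : ℝ)..2 * Real.pi, C.h (Complex.exp (α * Complex.I) * cpt R θ) := by
  rw [C.total_eq R (0 + α), show 0 + α + 2 * Real.pi = 2 * Real.pi + α by ring,
    ← intervalIntegral.integral_comp_add_right (fun θ => C.h (cpt R θ)) α]
  simp only [cpt_add]

/-- Convergence of the total heights of the boundary circles. -/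
lemma total_tendsto (hΛ : Λ.GeneralPosition) {r : ℕ → ℝ} {ρ : ℝ} (hr : ∀ n, 1 < r n) (hρ : 1 < ρ)
    {C : ∀ n, HolCurve Λ (annulus (r n))} {B : HolCurve Λ (annulus ρ)} {c : ℕ → ℂ}
    (hc : ∀ n, ‖c n‖ = 1) {R : ℕ → ℝ} {R₀ : ℝ} (hR : ∀ n, R n = 1 ∨ R n = r n)
    (hR₀ : R₀ = 1 ∨ R₀ = ρ) (hlim : Tendsto R atTop (𝓝 R₀))
    (hconv : SmoothConv (fun n z => (C n).u (c n * z)) (fun n => {z | c n * z ∈ (C n).dom})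
      B.u B.dom)
    (hP : ∀ ε > 0, ∀ᶠ n in atTop, ∀ z, c n * z ∈ (C n).P → ∃ t ∈ B.P, ‖z - t‖ < ε) :
    Tendsto (fun n => (C n).total (R n)) atTop (𝓝 (B.total R₀)) := by
  choose α hα using fun n => exists_unit_arg (hc n)
  have hR0 : 0 < R₀ := by rcases hR₀ with h | h <;> linarith
  have hc0 : ∀ n, c n ≠ 0 := fun n h => by simpa [h] using hc n
  have htot : ∀ n, (C n).total (R n) =
      ∫ θ in (0 : ℝ)..2 * Real.pi, (C n).h (c n * cpt (R n) θ) := fun n => by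
    rw [total_rotation (R n) (α n), hα n]
  have hrot : ∀ n θ, c n * cpt (R n) θ = cpt (R n) (θ + α n) := fun n θ => by
    rw [cpt_add, hα]
  have hS : ∀ n, {z | c n * z ∈ (C n).dom}.Nonempty := fun n => by
    obtain ⟨z, hz⟩ := dom_nonempty (hr n) (C n)
    refine ⟨(c n)⁻¹ * z, ?_⟩
    simpa [mul_inv_cancel_left₀ (hc0 n)] using hz
  have hdist : ∀ n θ, ‖cpt (R n) θ - cpt R₀ θ‖ = |R n - R₀| := fun n θ => by
    rw [cpt, cpt, ← sub_mul, norm_mul, Complex.norm_exp_ofReal_mul_I, mul_one,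
      ← Complex.ofReal_sub, Complex.norm_real, Real.norm_eq_abs]
  -- compact intervals without punctures stay away from the punctures
  have hgood : ∀ K : Set ℝ, IsCompact K → K ⊆ B.arcs R₀ →
      ∀ᶠ n in atTop, ∀ θ ∈ K, θ + α n ∈ (C n).arcs (R n) := by
    intro K hK hKs
    have hKc : IsCompact (cpt R₀ '' K) := hK.image (continuous_cpt R₀)
    obtain ⟨ε, hε, hdisj⟩ : ∃ ε > 0, ∀ θ ∈ K, ∀ t ∈ B.P, ε ≤ ‖cpt R₀ θ - t‖ := by
      have hd : Disjoint (cpt R₀ '' K) (B.P : Set ℂ) := by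
        rw [Set.disjoint_left]
        rintro _ ⟨θ, hθ, rfl⟩ h
        exact hKs hθ h
      obtain ⟨ε, hε, h⟩ := Metric.exists_pos_forall_lt_edist hKc B.P.finite_toSet.isClosed hd
      refine ⟨ε, hε, fun θ hθ t ht => ?_⟩
      have := h _ ⟨θ, hθ, rfl⟩ t ht
      rw [edist_nndist] at this
      have h2 : ε < nndist (cpt R₀ θ) t := by exact_mod_cast this
      rw [← dist_eq_norm, ← coe_nndist]
      exact_mod_cast h2.le
    have hl : ∀ᶠ n in atTop, |R n - R₀| < ε / 2 := by
      simpa [Real.dist_eq] using Metric.tendsto_nhds.1 hlim (ε / 2) (by positivity)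
    filter_upwards [hP (ε / 2) (by positivity), hl] with n h1 h2 θ hθ hmem
    rw [← hrot] at hmem
    obtain ⟨t, ht, hlt⟩ := h1 _ hmem
    have h3 := hdisj θ hθ t ht
    have h4 : ‖cpt R₀ θ - t‖ ≤ ‖cpt (R n) θ - t‖ + ‖cpt (R n) θ - cpt R₀ θ‖ := by
      have := norm_sub_le (cpt (R n) θ - t) (cpt (R n) θ - cpt R₀ θ)
      simpa using this
    rw [hdist] at h4
    linarith
  -- pointwise convergence
  have hpt : ∀ θ ∈ B.arcs R₀, Tendsto (fun n => (C n).h (c n * cpt (R n) θ)) atTop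
      (𝓝 (B.h (cpt R₀ θ))) := by
    intro θ hθ
    obtain ⟨ε, hε, hball⟩ := Metric.nhds_basis_closedBall.mem_iff.1 ((B.isOpen_arcs R₀).mem_nhds hθ)
    rw [Real.closedBall_eq_Icc] at hball
    set K := Set.Icc (θ - ε) (θ + ε) with hK
    have hv := (continuousOn_trace (C := B) hρ hR₀).mono hball
    have hg := hgood K isCompact_Icc hball
    have hunif := uniform_of_continuous_conv (K := K) isCompact_Icc
      (w := fun n θ => (C n).u (c n * cpt (R n) θ)) hv (by
        intro x hx y hy hxy
        refine hconv.tendsto hS (z := fun n => cpt (R n) (x n)) ?_ ?_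
          (cpt_mem_dom hρ hR₀ (hball hy))
        · filter_upwards [hg] with n hn
          show c n * cpt (R n) (x n) ∈ (C n).dom
          rw [hrot]
          exact cpt_mem_dom (hr n) (hR n) (hn _ (hx n))
        · exact (contDiff_cpt.continuous.tendsto (R₀, y)).comp (hlim.prodMk_nhds hxy))
    have hnc : ¬ ∃ a, ∀ x ∈ K, B.u (cpt R₀ x) = a := by
      rintro ⟨a, ha⟩
      exact not_const_arc hρ hR₀ (show θ - ε < θ + ε by linarith)
        (Set.Ioo_subset_Icc_self.trans hball) ⟨a, fun x hx => ha x (Set.Ioo_subset_Icc_self hx)⟩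
    have := LegendrianKnot.lift_tendsto hΛ (l := atTop) (I := K) isPreconnected_Icc hv hnc
      ((continuousOn_height hρ hR₀).mono hball) (fun x hx => mem_height hρ hR₀ (hball hx))
      (w := fun n θ => (C n).u (c n * cpt (R n) θ)) (k := fun n θ => (C n).h (c n * cpt (R n) θ))
      (by
        filter_upwards [hg] with n hn
        simp only [hrot]
        exact ⟨(continuousOn_height (hr n) (hR n)).comp (by fun_prop) hn,
          fun x hx => mem_height (hr n) (hR n) (hn x hx)⟩) hunif
    rw [Metric.tendsto_nhds]
    intro e he
    filter_upwards [this e he] with n hn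
    exact hn θ ⟨by linarith, by linarith⟩
  obtain ⟨Z, -, hZ⟩ := Λ.exists_bound
  simp only [htot]
  rw [total]
  -- Pointwise convergence fails at most at the countably many puncture angles of the limit, and all
  -- heights are bounded by `Z`.
  refine intervalIntegral.tendsto_integral_filter_of_dominated_convergence (fun _ => Z) ?_ ?_
    intervalIntegrable_const ?_
  · refine Eventually.of_forall fun n => ?_
    simp only [hrot]
    have := aestronglyMeasurable_height (C := C n) (hr n) (hR n)
    exact (this.comp_measurePreserving (measurePreserving_add_right volume (α n))).restrict
  · refine Eventually.of_forall fun n => ?_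
    have := height_bound (C := C n) (hr n) (hR n) hZ
    have h2 := (measurePreserving_add_right volume (α n)).quasiMeasurePreserving.ae this
    filter_upwards [h2] with θ hθ _
    rw [hrot]
    exact hθ
  · filter_upwards [ae_mem_arcs (C := B) hR0] with θ hθ _
    exact hpt θ hθ

end HolCurve

end LegAnnuli

/-! ### Continuity of the flux at annuli and at split boundary points -/

namespace LegAnnuli

lemma tendsto_unique_ne {x y : ℕ → ℂ} {a b : ℂ} (hx : Tendsto x atTop (𝓝 a))
    (hy : Tendsto y atTop (𝓝 b)) (hab : a ≠ b) : ∀ᶠ n in atTop, x n ≠ y n := by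
  filter_upwards [(hx.sub hy).eventually_ne (sub_ne_zero.2 hab)] with n hn h
  exact hn (sub_eq_zero.2 h)

lemma annulus_chart (r : ℝ) (t : ℂ) : ∃ σ : ℝ, (σ = 1 ∨ σ = -1) ∧
    ∀ ζ, (annulus r).chart t ζ = t * Complex.exp (σ * Complex.I * ζ) := by
  by_cases h : ‖t‖ = r
  · exact ⟨1, Or.inl rfl, fun ζ => by simp [annulus, h]⟩
  · exact ⟨-1, Or.inr rfl, fun ζ => by simp [annulus, h]⟩

/-- The chart is an exponential with period `2π`. This keeps punctures distinct after rescaling by a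
factor tending to zero. -/
lemma annulus_chart_injective {r : ℝ} {t ζ ζ' : ℂ} (ht : t ≠ 0) (hζ : ‖ζ - ζ'‖ < 2 * Real.pi)
    (h : (annulus r).chart t ζ = (annulus r).chart t ζ') : ζ = ζ' := by
  obtain ⟨σ, hσ, hch⟩ := annulus_chart r t
  rw [hch, hch, mul_right_inj' ht, Complex.exp_eq_exp_iff_exists_int] at h
  obtain ⟨n, hn⟩ := h
  have e : ζ - ζ' = (σ * n * (2 * Real.pi) : ℝ) := by
    apply mul_left_cancel₀ Complex.I_ne_zero
    rcases hσ with rfl | rfl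
    · push_cast at hn ⊢
      linear_combination hn
    · push_cast at hn ⊢
      linear_combination -hn
  have hn0 : n = 0 := by
    rw [e, Complex.norm_real, Real.norm_eq_abs, abs_mul, abs_mul, abs_of_pos Real.two_pi_pos] at hζ
    have hσ1 : |σ| = 1 := by rcases hσ with rfl | rfl <;> simp
    rw [hσ1, one_mul, mul_lt_iff_lt_one_left Real.two_pi_pos] at hζ
    exact Int.abs_lt_one_iff.1 (by exact_mod_cast hζ)
  rw [hn0] at e
  simpa [sub_eq_zero] using e

lemma annulus_chart_tendsto {r : ℕ → ℝ} {b ζ : ℕ → ℂ} {b₀ : ℂ} (hb : Tendsto b atTop (𝓝 b₀))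
    (hζ : Tendsto ζ atTop (𝓝 0)) :
    Tendsto (fun n => (annulus (r n)).chart (b n) (ζ n)) atTop (𝓝 b₀) := by
  have h1 : Tendsto (fun n => b n * Complex.exp (Complex.I * ζ n)) atTop (𝓝 b₀) := by
    have : Tendsto (fun n => b n * Complex.exp (Complex.I * ζ n)) atTop
        (𝓝 (b₀ * Complex.exp (Complex.I * 0))) :=
      hb.mul ((Complex.continuous_exp.tendsto _).comp (hζ.const_mul _))
    simpa using this
  have h2 : Tendsto (fun n => b n * Complex.exp (-(Complex.I * ζ n))) atTop (𝓝 b₀) := by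
    have : Tendsto (fun n => b n * Complex.exp (-(Complex.I * ζ n))) atTop
        (𝓝 (b₀ * Complex.exp (-(Complex.I * 0)))) :=
      hb.mul ((Complex.continuous_exp.tendsto _).comp (hζ.const_mul _).neg)
    simpa using this
  rw [Metric.tendsto_nhds] at *
  intro ε hε
  filter_upwards [h1 ε hε, h2 ε hε] with n hn1 hn2
  simp only [annulus]
  split_ifs
  · exact hn1
  · exact hn2

variable {Λ : LegendrianKnot}

namespace HolAnnulus

lemma flux_tendsto {A : ℕ → HolAnnulus Λ} {B : HolAnnulus Λ}
    (hr : Tendsto (fun n => (A n).r) atTop (𝓝 B.r))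
    (h1 : Tendsto (fun n => (A n).curve.total 1) atTop (𝓝 (B.curve.total 1)))
    (h2 : Tendsto (fun n => (A n).curve.total (A n).r) atTop (𝓝 (B.curve.total B.r))) :
    Tendsto (fun n => (A n).flux) atTop (𝓝 B.flux) :=
  (h1.sub h2).div (hr.log (by linarith [B.one_lt_r])) (Real.log_pos B.one_lt_r).ne'

/-- The common core of annular and split limits: it is enough that the maps converge off the limit
punctures and that all punctures accumulate there. -/
lemma flux_tendsto_of_conv (hΛ : Λ.GeneralPosition) {A : ℕ → HolAnnulus Λ} {B : HolAnnulus Λ}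
    {c : ℕ → ℂ} (hc : ∀ n, ‖c n‖ = 1) (hr : Tendsto (fun n => (A n).r) atTop (𝓝 B.r))
    (hconv : SmoothConv (fun n z => (A n).curve.u (c n * z))
      (fun n => {z | c n * z ∈ (A n).curve.dom}) B.curve.u B.curve.dom)
    (hP : ∀ ε > 0, ∀ᶠ n in atTop, ∀ z, c n * z ∈ (A n).curve.P → ∃ t ∈ B.curve.P, ‖z - t‖ < ε) :
    Tendsto (fun n => (A n).flux) atTop (𝓝 B.flux) :=
  flux_tendsto hr
    (HolCurve.total_tendsto hΛ (fun n => (A n).one_lt_r) B.one_lt_r hc (R := fun _ => 1)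
      (fun _ => Or.inl rfl) (Or.inl rfl) tendsto_const_nhds hconv hP)
    (HolCurve.total_tendsto hΛ (fun n => (A n).one_lt_r) B.one_lt_r hc (R := fun n => (A n).r)
      (fun _ => Or.inr rfl) (Or.inr rfl) hr hconv hP)

lemma flux_tendsto_annulus (hΛ : Λ.GeneralPosition) {A : ℕ → HolAnnulus Λ} {B : HolAnnulus Λ}
    (h : ConvToAnnulus A B) : Tendsto (fun n => (A n).flux) atTop (𝓝 B.flux) := by
  obtain ⟨c, hc, hr, hconv, -, hcard, hpt, -⟩ := h
  have hc0 : ∀ n, c n ≠ 0 := fun n h => by simpa [h] using hc n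
  refine flux_tendsto_of_conv hΛ hc hr hconv fun ε hε => ?_
  choose s hs hlim using fun t : B.curve.P => hpt t t.2
  have hall := eventually_eq_of_card (Q := fun n => (A n).curve.P) (s := fun t n => c n * s t n)
    (fun t => hs t) (fun t t' hne => by
      filter_upwards [tendsto_unique_ne (hlim t) (hlim t') (fun h => hne (Subtype.ext h))]
        with n hn h
      exact hn (mul_left_cancel₀ (hc0 n) h)) (by simpa using hcard)
  filter_upwards [hall, eventually_all.2 fun t => Metric.tendsto_nhds.1 (hlim t) ε hε]
    with n h1 h2 z hz
  obtain ⟨t, ht⟩ := h1 _ hz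
  rw [mul_left_cancel₀ (hc0 n) ht]
  exact ⟨t, t.2, by rw [← dist_eq_norm]; exact h2 t⟩

/-- Seen from the annular part, the disk lives over boundary points shrinking to the node: its
punctures are rescaled by `δ n` and therefore tend to the node. So all punctures accumulate at
punctures of the annular part, and its flux is the limit. -/
lemma flux_tendsto_split (hΛ : Λ.GeneralPosition) {A : ℕ → HolAnnulus Λ} {d : Split Λ}
    (h : ConvToSplit A d) : Tendsto (fun n => (A n).flux) atTop (𝓝 d.ann.flux) := by
  obtain ⟨c, b, δ, hc, hb, hδ, hbl, hδl, hr, hconv, hann, -, hdisk, hcard, -, -, -⟩ := h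
  have hc0 : ∀ n, c n ≠ 0 := fun n h => by simpa [h] using hc n
  have hb0 : ∀ n, b n ≠ 0 := fun n h => by
    have := hb n
    rw [h] at this
    rcases this with h | h <;> simp at h
    linarith [(A n).one_lt_r]
  refine flux_tendsto_of_conv hΛ hc hr hconv fun ε hε => ?_
  choose s hs hlim using fun t : (d.ann.curve.P.erase d.node : Finset ℂ) =>
    (hann t (Finset.mem_of_mem_erase t.2) (Finset.ne_of_mem_erase t.2)).2
  choose s' hs' hlim' using fun q : d.disk.P => (hdisk q q.2).2
  set ψ : ℕ → ℂ → ℂ := fun n => rescale (A n).r (b n) (δ n) with hψ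
  have hδs : ∀ q : d.disk.P, Tendsto (fun n => (δ n : ℂ) * s' q n) atTop (𝓝 0) := fun q => by
    have h1 : Tendsto (fun n => (δ n : ℂ)) atTop (𝓝 ((0 : ℝ) : ℂ)) :=
      (Complex.continuous_ofReal.tendsto _).comp hδl
    simpa using h1.mul (hlim' q)
  have hψl : ∀ q : d.disk.P, Tendsto (fun n => ψ n (s' q n)) atTop (𝓝 d.node) := fun q =>
    annulus_chart_tendsto hbl (hδs q)
  -- Candidates for all punctures of the approximating annuli: those surviving on the annular part,
  -- and those of the disk carried over by the rescaling `ψ n`.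
  set S : (d.ann.curve.P.erase d.node : Finset ℂ) ⊕ d.disk.P → ℕ → ℂ :=
    Sum.elim s (fun q n => ψ n (s' q n)) with hS
  have hne : ∀ i j, i ≠ j → ∀ᶠ n in atTop, S i n ≠ S j n := by
    rintro (t | q) (t' | q') hij
    · exact tendsto_unique_ne (hlim t) (hlim t') fun h => hij (by rw [Subtype.ext h])
    · exact tendsto_unique_ne (hlim t) (hψl q') (Finset.ne_of_mem_erase t.2)
    · exact tendsto_unique_ne (hψl q) (hlim t') (Finset.ne_of_mem_erase t'.2).symm
    · have h1 : ∀ᶠ n in atTop, ‖(δ n : ℂ) * s' q n - δ n * s' q' n‖ < 2 * Real.pi := by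
        have := ((hδs q).sub (hδs q')).norm
        rw [sub_zero, norm_zero] at this
        exact this.eventually (gt_mem_nhds (by positivity))
      filter_upwards [h1, tendsto_unique_ne (hlim' q) (hlim' q')
        fun h => hij (by rw [Subtype.ext h])] with n h1 h2 h3
      have h4 := annulus_chart_injective (hb0 n) h1 h3
      exact h2 (mul_left_cancel₀ (by exact_mod_cast (hδ n).ne') h4)
  have hall := eventually_eq_of_card (Q := fun n => (A n).curve.P) (s := fun i n => c n * S i n)
    (by rintro (t | q)
        · exact hs t
        · exact hs' q)
    (fun i j hij => by
      filter_upwards [hne i j hij] with n hn h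
      exact hn (mul_left_cancel₀ (hc0 n) h))
    (by
      filter_upwards [hcard] with n hn
      -- The node is a puncture of the annular part but not of the glued annulus; this is the `+ 1`
      -- in the count.
      rw [Fintype.card_sum, Fintype.card_coe, Fintype.card_coe, Finset.card_erase_of_mem d.node_mem]
      have := Finset.card_pos.2 ⟨_, d.node_mem⟩
      omega)
  have e1 : ∀ᶠ n in atTop, ∀ t, dist (s t n) t < ε :=
    eventually_all.2 fun t => Metric.tendsto_nhds.1 (hlim t) ε hε
  have e2 : ∀ᶠ n in atTop, ∀ q, dist (ψ n (s' q n)) d.node < ε :=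
    eventually_all.2 fun q => Metric.tendsto_nhds.1 (hψl q) ε hε
  filter_upwards [hall, e1, e2] with n h1 h2 h3 z hz
  obtain ⟨i, hi⟩ := h1 _ hz
  rw [mul_left_cancel₀ (hc0 n) hi]
  rcases i with t | q
  · exact ⟨t, Finset.mem_of_mem_erase t.2, by rw [← dist_eq_norm]; exact h2 t⟩
  · exact ⟨d.node, d.node_mem, by rw [← dist_eq_norm]; exact h3 q⟩

end HolAnnulus

/-- The point with real part `x` on the edge at height `σ`. -/
noncomputable def spt (σ x : ℝ) : ℂ := x + σ * Complex.I

lemma continuous_spt (σ : ℝ) : Continuous (spt σ) := by unfold spt; fun_prop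

@[simp] lemma spt_re (σ x : ℝ) : (spt σ x).re = x := by simp [spt]

@[simp] lemma spt_im (σ x : ℝ) : (spt σ x).im = σ := by simp [spt]

namespace HolCurve

lemma spt_mem_dom {C : HolCurve Λ strip} {σ x : ℝ} (hσ : σ = 0 ∨ σ = 1) (h : spt σ x ∉ C.P) :
    spt σ x ∈ C.dom := by
  refine ⟨?_, h⟩
  show 0 ≤ (spt σ x).im ∧ (spt σ x).im ≤ 1
  rw [spt_im]
  rcases hσ with rfl | rfl <;> norm_num

lemma spt_mem_bdry {σ x : ℝ} (hσ : σ = 0 ∨ σ = 1) : spt σ x ∈ strip.bdry := by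
  show (spt σ x).im = 0 ∨ (spt σ x).im = 1
  rwa [spt_im]

lemma strip_not_const (C : HolCurve Λ strip) {σ a b : ℝ} (hσ : σ = 0 ∨ σ = 1) (hab : a < b)
    (hs : ∀ x ∈ Set.Ioo a b, spt σ x ∉ C.P) : ¬ ∃ c, ∀ x ∈ Set.Ioo a b, C.u (spt σ x) = c := by
  have hnhds : ∀ ζ : ℂ, 0 < ζ.im → ζ.im < 1 → C.dom ∈ 𝓝 ζ := by
    intro ζ h1 h2
    have : {z : ℂ | 0 < z.im ∧ z.im < 1} ∈ 𝓝 ζ :=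
      ((isOpen_lt continuous_const Complex.continuous_im).inter
        (isOpen_lt Complex.continuous_im continuous_const)).mem_nhds ⟨h1, h2⟩
    filter_upwards [this] with w hw
    refine ⟨⟨hw.1.le, hw.2.le⟩, fun hP => ?_⟩
    rcases C.punctures_mem w hP with h | h
    · exact hw.1.ne' h
    · exact hw.2.ne h
  have hcl : ∀ z ∈ C.dom, z ∈ closure {ζ : ℂ | 0 < ζ.im ∧ ζ.im < 1} := by
    intro z hz
    have hlim : Tendsto (fun s : ℝ => z + (s * (1 / 2 - z.im) : ℝ) * Complex.I) (𝓝[>] 0) (𝓝 z) := by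
      have : Continuous fun s : ℝ => z + (s * (1 / 2 - z.im) : ℝ) * Complex.I := by fun_prop
      have h := this.tendsto 0
      simp only [zero_mul, add_zero, Complex.ofReal_zero] at h
      exact h.mono_left nhdsWithin_le_nhds
    refine mem_closure_of_tendsto hlim ?_
    filter_upwards [self_mem_nhdsWithin,
      mem_nhdsWithin_of_mem_nhds (Iio_mem_nhds (zero_lt_one' ℝ))] with s hs hs1
    have hs : 0 < s := hs
    have hs1 : s < 1 := hs1
    have h1 : 0 ≤ z.im := hz.1.1
    have h2 : z.im ≤ 1 := hz.1.2
    have e : (z + (s * (1 / 2 - z.im) : ℝ) * Complex.I).im = z.im + s * (1 / 2 - z.im) := by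
      simp
    show 0 < Complex.im _ ∧ Complex.im _ < 1
    rw [e]
    constructor <;> nlinarith
  rintro ⟨c, hc⟩
  rcases hσ with rfl | rfl
  · refine C.not_const_of_param (g := fun ζ => ζ) differentiable_id one_pos hab hnhds ?_ ?_
      ⟨c, ?_⟩
    · intro x h1 h2
      simpa [spt] using spt_mem_dom (Or.inl rfl) (hs x ⟨h1, h2⟩)
    · simpa using hcl
    · intro x hx
      simpa [spt] using hc x hx
  -- The half turn of the strip about its centre line exchanges the edges and keeps the domain above
  -- the parameter line.
  · refine C.not_const_of_param (g := fun ζ => Complex.I - ζ) (by fun_prop) one_pos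
      (neg_lt_neg hab) ?_ ?_ ?_ ⟨c, ?_⟩
    · intro ζ h1 h2
      refine hnhds _ ?_ ?_ <;> simp <;> linarith
    · intro x h1 h2
      have := spt_mem_dom (Or.inr rfl) (hs (-x) ⟨by linarith, by linarith⟩)
      have e : spt 1 (-x) = Complex.I - x := by simp [spt]; ring
      rwa [e] at this
    · intro z hz
      refine closure_mono ?_ (hcl z hz)
      rintro w ⟨h1, h2⟩
      refine ⟨Complex.I - w, ⟨?_, ?_⟩, by simp⟩ <;> simp <;> linarith
    · rintro x ⟨h1, h2⟩
      have := hc (-x) ⟨by linarith, by linarith⟩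
      have e : spt 1 (-x) = Complex.I - x := by simp [spt]; ring
      rwa [e] at this

end HolCurve

end LegAnnuli

/-! ### Non-split degenerations and the extended flux -/

namespace LegAnnuli

variable {Λ : LegendrianKnot}

/-- If sequences in the sets `S n` which escape to the ends of the strip are mapped to sequences
converging to `Γ`, then the convergence is uniform. -/
lemma uniform_on_neck {f : ℕ → ℂ → ℂ} {S : ℕ → Set ℂ} {T : ℕ → ℝ} {Γ : ℂ} {e : ℕ → ℂ}
    (he : ∀ n, e n ∈ S n ∧ |(e n).re| ≤ T n) (hel : Tendsto (fun n => |(e n).re|) atTop atTop)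
    (H : ∀ ζ : ℕ → ℂ, (∀ n, ζ n ∈ S n) → Tendsto (fun n => |(ζ n).re|) atTop atTop →
      (∀ n, |(ζ n).re| ≤ T n) → Tendsto (fun n => f n (ζ n)) atTop (𝓝 Γ)) {ε : ℝ} (hε : 0 < ε) :
    ∃ X : ℝ, ∀ᶠ n in atTop, ∀ ζ ∈ S n, X ≤ |ζ.re| → |ζ.re| ≤ T n → ‖f n ζ - Γ‖ < ε := by
  classical
  by_contra hcon
  push Not at hcon
  obtain ⟨φ, hφ, hφ2⟩ := extraction_forall_of_frequently (fun k : ℕ => hcon (k : ℝ))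
  choose x hxS hx1 hx2 hx3 using hφ2
  -- The bad points along the subsequence `φ` are filled up by the given sequence `e`, which also
  -- escapes to the ends, since the hypothesis needs a full sequence.
  let ζ : ℕ → ℂ := fun n => if h : ∃ k, φ k = n then x h.choose else e n
  have hζ : ∀ k, ζ (φ k) = x k := fun k => by
    have h : ∃ k', φ k' = φ k := ⟨k, rfl⟩
    simp only [ζ, h, dif_pos]
    rw [hφ.injective h.choose_spec]
  have hcases : ∀ n, (∃ k, φ k = n ∧ ζ n = x k) ∨ ζ n = e n := fun n => by
    by_cases h : ∃ k, φ k = n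
    · obtain ⟨k, rfl⟩ := h
      exact Or.inl ⟨k, rfl, hζ k⟩
    · exact Or.inr (by simp only [ζ, h, dif_neg, not_false_eq_true])
  have hlim := H ζ (fun n => by
      rcases hcases n with ⟨k, rfl, h⟩ | h
      · rw [h]; exact hxS k
      · rw [h]; exact (he n).1)
    (by
      rw [tendsto_atTop] at hel ⊢
      intro M
      obtain ⟨K, hK⟩ := exists_nat_ge M
      filter_upwards [hel M, eventually_ge_atTop (φ K)] with n h1 h2
      rcases hcases n with ⟨k, rfl, h⟩ | h
      · rw [h]
        have : K ≤ k := hφ.le_iff_le.1 h2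
        have : (K : ℝ) ≤ k := by exact_mod_cast this
        linarith [hx1 k]
      · rwa [h])
    (fun n => by
      rcases hcases n with ⟨k, rfl, h⟩ | h
      · rw [h]; exact hx2 k
      · rw [h]; exact (he n).2)
  have h1 := ((hlim.comp hφ.tendsto_atTop).sub_const Γ).norm
  rw [sub_self, norm_zero] at h1
  refine absurd (ge_of_tendsto' h1 (b := ε) fun k => ?_) (not_le.2 hε)
  simp only [Function.comp]
  rw [hζ]
  exact hx3 k

/-- In the covering by the strip, the edge at height `σ` becomes the circle of radius `r ^ (1 - σ)`,
and translation along it becomes rotation at speed `log r`. -/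
lemma rescale_spt {r : ℝ} (hr : 1 < r) (β σ x : ℝ) :
    rescale r (cpt r β) (Real.log r) (spt σ x) =
      cpt (r * Real.exp (-(σ * Real.log r))) (β + Real.log r * x) := by
  have hn : ‖cpt r β‖ = r := norm_cpt (by linarith) β
  simp only [rescale, annulus]
  rw [if_pos hn]
  simp only [cpt, spt]
  push_cast
  rw [mul_assoc, mul_assoc, ← Complex.exp_add, ← Complex.exp_add]
  congr 2
  linear_combination (σ : ℂ) * (Real.log r : ℝ) * Complex.I_mul_I

/-- The inner or outer radius. -/
lemma edge_radius {r σ : ℝ} (hr : 1 < r) (hσ : σ = 0 ∨ σ = 1) :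
    r * Real.exp (-(σ * Real.log r)) = 1 ∨ r * Real.exp (-(σ * Real.log r)) = r := by
  rcases hσ with rfl | rfl
  · right; simp
  · left
    rw [one_mul, Real.exp_neg, Real.exp_log (by linarith), mul_inv_cancel₀ (by linarith)]

namespace HolAnnulus

/-- In the limit of a non-split degeneration, the heights of a boundary circle concentrate at the
height of the neck. -/
lemma edge_total_tendsto (hΛ : Λ.GeneralPosition) {A : ℕ → HolAnnulus Λ} {d : NonSplit Λ}
    (h : ConvToNonSplit A d) {σ Z : ℝ} (hσ : σ = 0 ∨ σ = 1) (hZ : Λ.Mem d.Γ Z)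
    (hbot : Tendsto (fun x => d.curve.h (spt σ x)) atBot (𝓝 Z))
    (htop : Tendsto (fun x => d.curve.h (spt σ x)) atTop (𝓝 Z)) :
    Tendsto (fun n => (A n).curve.total ((A n).r * Real.exp (-(σ * Real.log (A n).r)))) atTop
      (𝓝 (2 * Real.pi * Z)) := by
  obtain ⟨b, hb, hr1, hconv, -, hcard, hpt, -, hneck⟩ := h
  have hr : ∀ n, 1 < (A n).r := fun n => (A n).one_lt_r
  choose β hβ using fun n => exists_cpt (hb n)
  set δ : ℕ → ℝ := fun n => Real.log (A n).r with hδ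
  have hδ0 : ∀ n, 0 < δ n := fun n => Real.log_pos (hr n)
  have hδl : Tendsto δ atTop (𝓝 0) := by
    have := hr1.log one_ne_zero
    rwa [Real.log_one] at this
  set R : ℕ → ℝ := fun n => (A n).r * Real.exp (-(σ * δ n)) with hRdef
  have hR : ∀ n, R n = 1 ∨ R n = (A n).r := fun n => edge_radius (hr n) hσ
  have hR0 : ∀ n, 0 < R n := fun n => by rcases hR n with h | h <;> linarith [hr n]
  set ψ : ℕ → ℂ → ℂ := fun n => rescale (A n).r (b n) (δ n) with hψ
  have hψe : ∀ n x, ψ n (spt σ x) = cpt (R n) (β n + δ n * x) := fun n x => by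
    simp only [hψ, ← hβ n]
    exact rescale_spt (hr n) _ _ _
  have hbne : ∀ n, b n ≠ 0 := fun n h => by
    have := hb n
    rw [h, norm_zero] at this
    linarith [hr n]
  have hψexp : ∀ n ζ, ψ n ζ = b n * Complex.exp (Complex.I * (δ n * ζ)) := fun n ζ => by
    simp [hψ, rescale, annulus, hb n]
  set S : ℕ → Set ℂ := fun n => {ζ | ψ n ζ ∈ (A n).curve.dom} with hS
  -- the neck has a filler sequence
  have hfill : ∀ n, ((Real.pi / δ n : ℝ) + (1 / 2 : ℝ) * Complex.I : ℂ) ∈ S n := fun n => by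
    have hnorm : ‖ψ n ((Real.pi / δ n : ℝ) + (1 / 2 : ℝ) * Complex.I : ℂ)‖ =
        (A n).r * Real.exp (-(1 / 2 * δ n)) := by
      rw [hψexp, norm_mul, hb, Complex.norm_exp]
      congr 2
      simp
      ring
    have he : (A n).r = Real.exp (δ n) := (Real.exp_log (by linarith [hr n])).symm
    rw [he, ← Real.exp_add] at hnorm
    show ψ n _ ∈ (A n).curve.dom
    refine mem_of_mem_nhds (HolCurve.interior_mem_nhds ?_ ?_)
    · rw [hnorm]
      exact Real.one_lt_exp_iff.2 (by linarith [hδ0 n])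
    · rw [hnorm, he]
      exact Real.exp_lt_exp.2 (by linarith [hδ0 n])
  have hfre : ∀ n, ((Real.pi / δ n : ℝ) + (1 / 2 : ℝ) * Complex.I : ℂ).re = Real.pi / δ n :=
    fun n => by simp
  have hTl : Tendsto (fun n => Real.pi / δ n) atTop atTop := by
    have : Tendsto δ atTop (𝓝[>] 0) := tendsto_nhdsWithin_iff.2 ⟨hδl, Eventually.of_forall hδ0⟩
    exact (this.inv_tendsto_nhdsGT_zero).const_mul_atTop Real.pi_pos
  have hT0 : ∀ n, 0 < Real.pi / δ n := fun n => div_pos Real.pi_pos (hδ0 n)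
  have hneck' : ∀ ε > 0, ∃ X : ℝ, ∀ᶠ n in atTop, ∀ ζ ∈ S n, X ≤ |ζ.re| → |ζ.re| ≤ Real.pi / δ n →
      ‖(A n).curve.u (ψ n ζ) - d.Γ‖ < ε := fun ε hε =>
    uniform_on_neck (f := fun n ζ => (A n).curve.u (ψ n ζ))
      (e := fun n => ((Real.pi / δ n : ℝ) + (1 / 2 : ℝ) * Complex.I : ℂ))
      (fun n => ⟨hfill n, by rw [hfre, abs_of_pos (hT0 n)]⟩)
      (by simp only [hfre, abs_of_pos (hT0 _)]; exact hTl)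
      (fun ζ h1 h2 h3 => hneck ζ h1 h2 h3) hε
  -- the punctures
  choose s hs hlim using fun t : d.curve.P => hpt t t.2
  have hinj : ∀ n ζ ζ', ‖(δ n : ℂ) * ζ - δ n * ζ'‖ < 2 * Real.pi → ψ n ζ = ψ n ζ' → ζ = ζ' := by
    intro n ζ ζ' h1 h2
    have h4 := annulus_chart_injective (hbne n) h1 h2
    exact mul_left_cancel₀ (by exact_mod_cast (hδ0 n).ne') h4
  have hδs : ∀ q : d.curve.P, Tendsto (fun n => (δ n : ℂ) * s q n) atTop (𝓝 0) := fun q => by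
    have h1 : Tendsto (fun n => (δ n : ℂ)) atTop (𝓝 ((0 : ℝ) : ℂ)) :=
      (Complex.continuous_ofReal.tendsto _).comp hδl
    simpa using h1.mul (hlim q)
  have hall := eventually_eq_of_card (Q := fun n => (A n).curve.P) (s := fun q n => ψ n (s q n))
    (fun q => hs q) (fun q q' hij => by
      have h1 : ∀ᶠ n in atTop, ‖(δ n : ℂ) * s q n - δ n * s q' n‖ < 2 * Real.pi := by
        have := ((hδs q).sub (hδs q')).norm
        rw [sub_zero, norm_zero] at this
        exact this.eventually (gt_mem_nhds (by positivity))
      filter_upwards [h1, tendsto_unique_ne (hlim q) (hlim q')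
        fun h => hij (by rw [Subtype.ext h])] with n h1 h2 h3
      exact h2 (hinj n _ _ h1 h3)) (by simpa using hcard)
  obtain ⟨M, hM0, hM⟩ : ∃ M > 0, ∀ t ∈ d.curve.P, |t.re| < M := by
    obtain ⟨M, hM⟩ := d.curve.P.finite_toSet.isBounded.exists_norm_le
    exact ⟨|M| + 1, by positivity, fun t ht => by
      have := (Complex.abs_re_le_norm t).trans (hM t ht)
      linarith [le_abs_self M]⟩
  -- By the count of punctures, all of them lie, within one period, near those of the limit disk,
  -- whose real parts are smaller than `M` in absolute value.
  have hpunc : ∀ᶠ n in atTop, ∀ x, M ≤ |x| → |δ n * x| < Real.pi →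
      ψ n (spt σ x) ∉ (A n).curve.P := by
    have e1 : ∀ᶠ n in atTop, ∀ q, |(s q n).re| < M := eventually_all.2 fun q =>
      (((Complex.continuous_re.tendsto _).comp (hlim q)).abs).eventually (gt_mem_nhds (hM q q.2))
    have e2 : ∀ᶠ n in atTop, δ n * M < Real.pi := by
      have := hδl.mul_const M
      rw [zero_mul] at this
      exact this.eventually (gt_mem_nhds Real.pi_pos)
    filter_upwards [hall, e1, e2] with n h1 h2 h3 x hx1 hx2 hmem
    obtain ⟨q, hq⟩ := h1 _ hmem
    rw [hψexp, hψexp, mul_right_inj' (hbne n), Complex.exp_eq_exp_iff_exists_int] at hq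
    obtain ⟨k, hk⟩ := hq
    have hk2 := congrArg Complex.im hk
    simp at hk2
    have h4 : |δ n * (s q n).re| < Real.pi := by
      rw [abs_mul, abs_of_pos (hδ0 n)]
      exact (mul_le_mul_of_nonneg_left (h2 q).le (hδ0 n).le).trans_lt h3
    -- Both real parts, multiplied by `δ n`, lie in `(-π, π)`, so there is no ambiguity in the
    -- covering.
    have hk0 : k = 0 := by
      have h5 : |(k : ℝ) * (2 * Real.pi)| < 2 * Real.pi := by
        have : (k : ℝ) * (2 * Real.pi) = δ n * x - δ n * (s q n).re := by linarith
        rw [this]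
        exact (abs_sub _ _).trans_lt (by linarith)
      rw [abs_mul, abs_of_pos Real.two_pi_pos, mul_lt_iff_lt_one_left Real.two_pi_pos] at h5
      exact Int.abs_lt_one_iff.1 (by exact_mod_cast h5)
    rw [hk0] at hk2
    have h6 : x = (s q n).re := mul_left_cancel₀ (hδ0 n).ne' (by simpa using hk2)
    rw [h6] at hx1
    linarith [h2 q]
  have hdarcs : ∀ x, M ≤ |x| → spt σ x ∉ d.curve.P := fun x hx hmem => by
    have := hM _ hmem
    rw [spt_re] at this
    linarith
  have hSne : ∀ n, (S n).Nonempty := fun n => ⟨_, hfill n⟩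
  have hheight : ∀ n I, (∀ x ∈ I, ψ n (spt σ x) ∉ (A n).curve.P) →
      ContinuousOn (fun x => (A n).curve.h (ψ n (spt σ x))) I ∧
      ∀ x ∈ I, Λ.Mem ((A n).curve.u (ψ n (spt σ x))) ((A n).curve.h (ψ n (spt σ x))) := by
    intro n I hI
    simp only [hψe] at hI ⊢
    exact ⟨(HolCurve.continuousOn_height (hr n) (hR n)).comp (by fun_prop) hI,
      fun x hx => HolCurve.mem_height (hr n) (hR n) (hI x hx)⟩
  -- pointwise convergence on the neck
  have hpoint : ∀ sg : ℝ, (sg = 1 ∨ sg = -1) → ∀ φ, 0 < φ → φ < Real.pi →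
      Tendsto (fun x => d.curve.h (spt σ (sg * x))) atTop (𝓝 Z) →
      Tendsto (fun n => (A n).curve.h (cpt (R n) (β n + sg * φ))) atTop (𝓝 Z) := by
    intro sg hsg φ hφ0 hφπ hlimZ
    have hsg1 : |sg| = 1 := by rcases hsg with rfl | rfl <;> simp
    rw [Metric.tendsto_nhds]
    intro ε hε
    obtain ⟨η, hη, H⟩ := Λ.exists_lift_close
    obtain ⟨δ₀, hδ₀, H⟩ := H ε hε
    obtain ⟨X₁, hX₁⟩ := hneck' δ₀ hδ₀
    -- Beyond `X` the neck estimate holds and punctures are absent, and at `X` the height of the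
    -- limit disk is already within `η / 2` of `Z`.
    obtain ⟨X, hX1, hX2, hX3⟩ := (((eventually_ge_atTop X₁).and
      ((eventually_ge_atTop (M + 2)).and (Metric.tendsto_nhds.1 hlimZ (η / 2) (by positivity)))).exists)
    -- A fixed window around `±X`. Here heights converge to those of the limit disk, which selects
    -- the branch through `(Γ, Z)`. An interval is used rather than a point because lifts are only
    -- controlled over nonconstant paths.
    set K : Set ℝ := Set.Icc (sg * X - 1) (sg * X + 1) with hK
    have hKM : ∀ x ∈ K, M ≤ |x| ∧ |x| ≤ X + 1 := by
      rintro x ⟨h1, h2⟩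
      rcases hsg with rfl | rfl
      · rw [abs_of_pos (by linarith)]; constructor <;> linarith
      · rw [abs_of_neg (by linarith)]; constructor <;> linarith
    have hev1 : ∀ᶠ n in atTop, δ n * (X + 1) < Real.pi := by
      have := hδl.mul_const (X + 1)
      rw [zero_mul] at this
      exact this.eventually (gt_mem_nhds Real.pi_pos)
    have hKgood : ∀ᶠ n in atTop, ∀ x ∈ K, ψ n (spt σ x) ∉ (A n).curve.P := by
      filter_upwards [hpunc, hev1] with n h1 h2 x hx
      refine h1 x (hKM x hx).1 ?_
      rw [abs_mul, abs_of_pos (hδ0 n)]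
      exact (mul_le_mul_of_nonneg_left (hKM x hx).2 (hδ0 n).le).trans_lt h2
    have hKd : ∀ x ∈ K, spt σ x ∉ d.curve.P := fun x hx => hdarcs x (hKM x hx).1
    have hdom : ∀ n x, ψ n (spt σ x) ∉ (A n).curve.P → spt σ x ∈ S n := fun n x hx => by
      show ψ n (spt σ x) ∈ (A n).curve.dom
      rw [hψe] at hx ⊢
      exact HolCurve.cpt_mem_dom (hr n) (hR n) hx
    have hvc : ContinuousOn (fun x => d.curve.u (spt σ x)) K :=
      d.curve.continuousOn.comp (continuous_spt σ).continuousOn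
        fun x hx => HolCurve.spt_mem_dom hσ (hKd x hx)
    have hunif := uniform_of_continuous_conv (K := K) isCompact_Icc
      (w := fun n x => (A n).curve.u (ψ n (spt σ x))) hvc (by
        intro x hx y hy hxy
        refine SmoothConv.tendsto (f := fun n ζ => (A n).curve.u (ψ n ζ)) hconv hSne
          (z := fun n => spt σ (x n)) ?_ (((continuous_spt σ).tendsto y).comp hxy)
          (HolCurve.spt_mem_dom hσ (hKd y hy))
        filter_upwards [hKgood] with n hn
        exact hdom n _ (hn _ (hx n)))
    have hnc : ¬ ∃ a, ∀ x ∈ K, d.curve.u (spt σ x) = a := by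
      rintro ⟨a, ha⟩
      exact d.curve.strip_not_const hσ (show sg * X - 1 < sg * X + 1 by linarith)
        (fun x hx => hKd x (Set.Ioo_subset_Icc_self hx))
        ⟨a, fun x hx => ha x (Set.Ioo_subset_Icc_self hx)⟩
    have hloc := LegendrianKnot.lift_tendsto hΛ (l := atTop) (I := K) isPreconnected_Icc hvc hnc
      (h := fun x => d.curve.h (spt σ x))
      (d.curve.lift_continuous.comp (continuous_spt σ).continuousOn
        fun x hx => ⟨HolCurve.spt_mem_bdry hσ, hKd x hx⟩)
      (fun x hx => d.curve.lift_mem _ ⟨HolCurve.spt_mem_bdry hσ, hKd x hx⟩)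
      (w := fun n x => (A n).curve.u (ψ n (spt σ x)))
      (k := fun n x => (A n).curve.h (ψ n (spt σ x)))
      (by
        filter_upwards [hKgood] with n hn
        exact hheight n K hn) hunif
    have hev2 : ∀ᶠ n in atTop, δ n * X < φ := by
      have := hδl.mul_const X
      rw [zero_mul] at this
      exact this.eventually (gt_mem_nhds hφ0)
    filter_upwards [hloc (η / 2) (by positivity), hX₁, hpunc, hev2] with n h1 h2 h3 h4
    have hXφ : X ≤ φ / δ n := by
      rw [le_div_iff₀ (hδ0 n)]; linarith
    -- From `X` on to the prescribed angle the image stays near `Γ`, so the height cannot leave its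
    -- branch. The comparison path is the constant `Γ` with constant lift `Z`.
    set I : Set ℝ := Set.Icc X (φ / δ n) with hI
    have habs : ∀ x ∈ I, |sg * x| = x := fun x hx => by
      rw [abs_mul, hsg1, one_mul, abs_of_nonneg (by linarith [hx.1])]
    have hIle : ∀ x ∈ I, δ n * x ≤ φ := fun x hx => by
      have := hx.2
      rw [le_div_iff₀ (hδ0 n)] at this
      linarith
    have hIgood : ∀ x ∈ I, ψ n (spt σ (sg * x)) ∉ (A n).curve.P := fun x hx => by
      refine h3 _ (by rw [habs x hx]; linarith [hx.1]) ?_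
      rw [abs_mul, habs x hx, abs_of_pos (hδ0 n)]
      exact (hIle x hx).trans_lt hφπ
    have hh := hheight n ((fun x => sg * x) '' I) (by
      rintro _ ⟨x, hx, rfl⟩
      exact hIgood x hx)
    have hfin := H I isPreconnected_Icc (fun x => (A n).curve.u (ψ n (spt σ (sg * x))))
      (fun _ => d.Γ) (fun x => (A n).curve.h (ψ n (spt σ (sg * x)))) (fun _ => Z)
      (hh.1.comp (by fun_prop) (Set.mapsTo_image _ _)) continuousOn_const
      (fun x hx => hh.2 _ (Set.mem_image_of_mem _ hx)) (fun _ _ => hZ)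
      (fun x hx => by
        refine h2 _ (hdom n _ (hIgood x hx)) ?_ ?_
        · rw [spt_re, habs x hx]; linarith [hx.1]
        · rw [spt_re, habs x hx, le_div_iff₀ (hδ0 n)]
          have := hIle x hx
          linarith)
      X ⟨le_rfl, hXφ⟩ (by
        have h5 := h1 (sg * X) ⟨by linarith, by linarith⟩
        have h6 := hX3
        rw [Real.dist_eq] at h6
        have := abs_sub_le ((A n).curve.h (ψ n (spt σ (sg * X)))) (d.curve.h (spt σ (sg * X))) Z
        linarith) (φ / δ n) ⟨hXφ, le_rfl⟩
    have e : δ n * (sg * (φ / δ n)) = sg * φ := by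
      have := (hδ0 n).ne'
      field_simp
    simp only [hψe, e] at hfin
    rwa [Real.dist_eq]
  -- dominated convergence
  have htot : ∀ n, (A n).curve.total (R n) =
      ∫ θ in (-Real.pi)..Real.pi, (A n).curve.h (cpt (R n) (θ + β n)) := fun n => by
    rw [intervalIntegral.integral_comp_add_right (fun θ => (A n).curve.h (cpt (R n) θ)),
      HolCurve.total_eq (R n) (-Real.pi + β n)]
    congr 1
    ring
  have hconst : 2 * Real.pi * Z = ∫ θ in (-Real.pi)..Real.pi, Z := by
    rw [intervalIntegral.integral_const, smul_eq_mul]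
    ring
  show Tendsto (fun n => (A n).curve.total (R n)) atTop _
  simp only [htot]
  rw [hconst]
  obtain ⟨B, -, hB⟩ := Λ.exists_bound
  refine intervalIntegral.tendsto_integral_filter_of_dominated_convergence (fun _ => B) ?_ ?_
    intervalIntegrable_const ?_
  · refine Eventually.of_forall fun n => ?_
    have := HolCurve.aestronglyMeasurable_height (C := (A n).curve) (hr n) (hR n)
    exact (this.comp_measurePreserving (measurePreserving_add_right volume (β n))).restrict
  · refine Eventually.of_forall fun n => ?_
    have := HolCurve.height_bound (C := (A n).curve) (hr n) (hR n) hB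
    have h2 := (measurePreserving_add_right volume (β n)).quasiMeasurePreserving.ae this
    filter_upwards [h2] with θ hθ _
    exact hθ
  · have hne : ∀ᵐ θ : ℝ, θ ∉ ({0, Real.pi} : Set ℝ) :=
      (Set.toFinite ({0, Real.pi} : Set ℝ)).countable.ae_notMem volume
    filter_upwards [hne] with θ hθ hmem
    rw [Set.uIoc_of_le (by linarith [Real.pi_pos])] at hmem
    simp only [Set.mem_insert_iff, Set.mem_singleton_iff, not_or] at hθ
    rcases lt_or_gt_of_ne hθ.1 with h0 | h0
    · have := hpoint (-1) (Or.inr rfl) (-θ) (by linarith) (by linarith [hmem.1]) (by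
        have := hbot.comp tendsto_neg_atTop_atBot
        simpa [Function.comp_def] using this)
      simpa [add_comm] using this
    · have := hpoint 1 (Or.inl rfl) θ h0 (lt_of_le_of_ne hmem.2 hθ.2) (by simpa using htop)
      simpa [add_comm] using this

/-- The numerator of the flux tends to `2π * (innerZ - outerZ)`, which is nonzero, and `1 / log r`
tends to infinity. -/
lemma flux_tendsto_nonSplit (hΛ : Λ.GeneralPosition) {A : ℕ → HolAnnulus Λ} {d : NonSplit Λ}
    (h : ConvToNonSplit A d) :
    (d.outerZ < d.innerZ → Tendsto (fun n => (A n).flux) atTop atTop) ∧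
    (d.innerZ < d.outerZ → Tendsto (fun n => (A n).flux) atTop atBot) := by
  have h0 := edge_total_tendsto hΛ h (Or.inl rfl) d.mem_outer
    (by simpa [spt] using d.outer_left) (by simpa [spt] using d.outer_right)
  have h1 := edge_total_tendsto hΛ h (Or.inr rfl) d.mem_inner
    (by simpa [spt] using d.inner_left) (by simpa [spt] using d.inner_right)
  have e0 : ∀ n, (A n).r * Real.exp (-(0 * Real.log (A n).r)) = (A n).r := fun n => by simp
  have e1 : ∀ n, (A n).r * Real.exp (-(1 * Real.log (A n).r)) = 1 := fun n => by
    have := (A n).one_lt_r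
    rw [one_mul, Real.exp_neg, Real.exp_log (by linarith), mul_inv_cancel₀ (by linarith)]
  simp only [e0] at h0
  simp only [e1] at h1
  obtain ⟨b, -, hr1, -⟩ := h
  have hδl : Tendsto (fun n => (Real.log (A n).r)⁻¹) atTop atTop := by
    have h2 := hr1.log one_ne_zero
    rw [Real.log_one] at h2
    have h3 : Tendsto (fun n => Real.log (A n).r) atTop (𝓝[>] 0) :=
      tendsto_nhdsWithin_iff.2 ⟨h2, Eventually.of_forall fun n => Real.log_pos (A n).one_lt_r⟩
    exact h3.inv_tendsto_nhdsGT_zero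
  have hd := h1.sub h0
  rw [← mul_sub] at hd
  constructor
  · intro hlt
    exact hd.pos_mul_atTop (mul_pos Real.two_pi_pos (sub_pos.2 hlt)) hδl
  · intro hlt
    exact hd.neg_mul_atTop (mul_neg_of_pos_of_neg Real.two_pi_pos (sub_neg.2 hlt)) hδl

end HolAnnulus

namespace NonSplit

/-- Beyond all punctures, the two heights lift the same nonconstant half-line up to translation, so
they coincide there and have the same limit. -/
lemma Equivalent.height (hΛ : Λ.GeneralPosition) {d e : NonSplit Λ} (h : d.Equivalent e)
    {σ Z Z' : ℝ} (hσ : σ = 0 ∨ σ = 1)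
    (hd : Tendsto (fun x => d.curve.h (spt σ x)) atTop (𝓝 Z))
    (he : Tendsto (fun x => e.curve.h (spt σ x)) atTop (𝓝 Z')) : Z = Z' := by
  obtain ⟨c, -, hP, hu⟩ := h
  obtain ⟨M, hM⟩ : ∃ M, ∀ t ∈ d.curve.P, t.re < M := by
    obtain ⟨M, hM⟩ := d.curve.P.finite_toSet.isBounded.exists_norm_le
    exact ⟨M + 1, fun t ht => by
      have := (Complex.re_le_norm t).trans (hM t ht)
      linarith⟩
  have hI : ∀ x ∈ Set.Ioi M, spt σ x ∉ d.curve.P := fun x hx hmem => by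
    have := hM _ hmem
    rw [spt_re] at this
    exact lt_irrefl _ (this.trans hx)
  have hadd : ∀ x, spt σ (x + c) = spt σ x + c := fun x => by simp [spt]; ring
  have hI' : ∀ x ∈ Set.Ioi M, spt σ (x + c) ∉ e.curve.P := fun x hx hmem => by
    have hmem : spt σ (x + c) ∈ (e.curve.P : Set ℂ) := hmem
    rw [hP, hadd] at hmem
    obtain ⟨z, hz, hz2⟩ := hmem
    rw [add_right_cancel hz2] at hz
    exact hI x hx hz
  have key := LegendrianKnot.lift_unique hΛ (I := Set.Ioi M) isPreconnected_Ioi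
    (v := fun x => d.curve.u (spt σ x)) (h := fun x => d.curve.h (spt σ x))
    (h' := fun x => e.curve.h (spt σ (x + c)))
    (d.curve.continuousOn.comp (continuous_spt σ).continuousOn
      fun x hx => HolCurve.spt_mem_dom hσ (hI x hx))
    (by
      rintro ⟨a, ha⟩
      exact d.curve.strip_not_const hσ (show M < M + 1 by linarith) (fun x hx => hI x hx.1)
        ⟨a, fun x hx => ha x hx.1⟩)
    (d.curve.lift_continuous.comp (continuous_spt σ).continuousOn
      fun x hx => ⟨HolCurve.spt_mem_bdry hσ, hI x hx⟩)
    (e.curve.lift_continuous.comp ((continuous_spt σ).comp (continuous_add_const c)).continuousOn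
      fun x hx => ⟨HolCurve.spt_mem_bdry hσ, hI' x hx⟩)
    (fun x hx => d.curve.lift_mem _ ⟨HolCurve.spt_mem_bdry hσ, hI x hx⟩)
    (fun x hx => by
      have := e.curve.lift_mem _ ⟨HolCurve.spt_mem_bdry hσ, hI' x hx⟩
      have h2 := hu _ (HolCurve.spt_mem_dom hσ (hI x hx))
      rw [← hadd] at h2
      rwa [h2] at this)
  refine tendsto_nhds_unique hd ((he.comp (tendsto_atTop_add_const_right _ c tendsto_id)).congr' ?_)
  filter_upwards [eventually_gt_atTop M] with x hx
  exact (key x hx).symm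

end NonSplit

/-- The flux descends to the moduli space. -/
noncomputable def fluxModuli (hΛ : Λ.GeneralPosition) : Moduli Λ → ℝ :=
  Quot.lift HolAnnulus.flux fun _ _ h => HolAnnulus.flux_congr hΛ h

open Classical in
/-- The extended flux of representatives. -/
noncomputable def fluxPre : PreBar Λ → EReal
  | .interior A _ => (A.flux : EReal)
  | .nonSplit d => if d.outerZ < d.innerZ then ⊤ else ⊥
  | .split d => (d.ann.flux : EReal)

/-- For non-split points the value refers to the heights of the branches, which equivalence does not
mention; they are recovered from the map by uniqueness of lifts. -/
lemma fluxPre_congr (hΛ : Λ.GeneralPosition) (x y : PreBar Λ) (h : x.Equivalent y) :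
    fluxPre x = fluxPre y := by
  rcases x with ⟨A, hA⟩ | d | d <;> rcases y with ⟨B, hB⟩ | e | e <;>
    simp only [PreBar.Equivalent] at h
  · simp only [fluxPre, HolAnnulus.flux_congr hΛ h]
  · have h0 := NonSplit.Equivalent.height hΛ h (Or.inl rfl)
      (by simpa [spt] using d.outer_right) (by simpa [spt] using e.outer_right)
    have h1 := NonSplit.Equivalent.height hΛ h (Or.inr rfl)
      (by simpa [spt] using d.inner_right) (by simpa [spt] using e.inner_right)
    simp only [fluxPre, h0, h1]
  · obtain ⟨⟨h1, c, h2, -, h3⟩, -⟩ := h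
    simp only [fluxPre, HolAnnulus.flux_congr hΛ ⟨h1, c, h2, h3⟩]

/-- The extension of the flux to the compactification. -/
noncomputable def fluxBar (hΛ : Λ.GeneralPosition) : ModuliBar Λ → EReal :=
  Quot.lift fluxPre (fluxPre_congr hΛ)

lemma flux_tendsto_gromov (hΛ : Λ.GeneralPosition) {A : ℕ → HolAnnulus Λ} {y : PreBar Λ}
    (h : GromovConv A y) :
    Tendsto (fun n => ((A n).flux : EReal)) atTop (𝓝 (fluxPre y)) := by
  rcases y with ⟨B, hB⟩ | d | d
  · exact (continuous_coe_real_ereal.tendsto _).comp (HolAnnulus.flux_tendsto_annulus hΛ h)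
  · obtain ⟨h1, h2⟩ := HolAnnulus.flux_tendsto_nonSplit hΛ h
    rcases lt_or_gt_of_ne d.ne with hlt | hlt
    · simp only [fluxPre, hlt, if_true]
      exact EReal.tendsto_coe_nhds_top_iff.2 (h1 hlt)
    · simp only [fluxPre, not_lt.2 hlt.le, if_false]
      exact EReal.tendsto_coe_nhds_bot_iff.2 (h2 hlt)
  · exact (continuous_coe_real_ereal.tendsto _).comp (HolAnnulus.flux_tendsto_split hΛ h)

/-- Open sets are defined by sequences of one-dimensional annuli, so convergence of the flux along
such sequences is all that continuity demands. -/
lemma continuous_fluxBar (hΛ : Λ.GeneralPosition) : Continuous (fluxBar hΛ) := by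
  refine continuous_def.2 fun V hV => ?_
  intro A hA y hy hyV
  exact (flux_tendsto_gromov hΛ hy).eventually (hV.mem_nhds hyV)

end LegAnnuli

/-! ### Annuli with a lift have vanishing flux -/

namespace LegAnnuli

/-- The boundary chart of the annulus covers a neighbourhood of its centre. -/
lemma exists_chart_eq {r : ℝ} (hr : 1 < r) {t : ℂ} (ht : t ∈ (annulus r).bdry) {ε : ℝ} (hε : 0 < ε) :
    ∀ᶠ z in 𝓝 t, z ∈ (annulus r).carrier → z ≠ t →
      ∃ ζ : ℂ, 0 ≤ ζ.im ∧ ζ ≠ 0 ∧ ‖ζ‖ < ε ∧ (annulus r).chart t ζ = z := by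
  have ht0 : t ≠ 0 := by
    rintro rfl
    rcases ht with h | h <;> simp at h
    linarith
  have hlim : Tendsto (fun z : ℂ => Complex.log (z / t)) (𝓝 t) (𝓝 0) := by
    have h1 : ContinuousAt (fun z : ℂ => Complex.log (z / t)) t := by
      refine ContinuousAt.clog (by fun_prop) ?_
      rw [div_self ht0]
      exact Complex.one_mem_slitPlane
    have := h1.tendsto
    rwa [div_self ht0, Complex.log_one] at this
  filter_upwards [Metric.tendsto_nhds.1 hlim ε hε, isOpen_ne.mem_nhds ht0] with z hz hz0 hzc hzt
  have hz0 : z ≠ 0 := hz0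
  rw [dist_zero_right] at hz
  have hexp : Complex.exp (Complex.log (z / t)) = z / t := Complex.exp_log (div_ne_zero hz0 ht0)
  have hlog0 : Complex.log (z / t) ≠ 0 := fun h => by
    rw [h, Complex.exp_zero] at hexp
    exact hzt ((div_eq_one_iff_eq ht0).1 hexp.symm)
  have hre : (Complex.log (z / t)).re = Real.log ‖z‖ - Real.log ‖t‖ := by
    rw [Complex.log_re, norm_div, Real.log_div (norm_ne_zero_iff.2 hz0) (norm_ne_zero_iff.2 ht0)]
  by_cases h : ‖t‖ = r
  · refine ⟨-(Complex.I * Complex.log (z / t)), ?_, ?_, ?_, ?_⟩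
    · have : (-(Complex.I * Complex.log (z / t))).im = -(Complex.log (z / t)).re := by simp
      rw [this, hre, h]
      have := Real.log_le_log (norm_pos_iff.2 hz0) hzc.2
      linarith
    · simpa using hlog0
    · simpa using hz
    · simp only [annulus]
      rw [if_pos h]
      have : Complex.I * -(Complex.I * Complex.log (z / t)) = Complex.log (z / t) := by
        linear_combination -Complex.log (z / t) * Complex.I_mul_I
      rw [this, hexp]
      field_simp
  · have h1 : ‖t‖ = 1 := (ht : ‖t‖ = 1 ∨ ‖t‖ = r).resolve_right h
    refine ⟨Complex.I * Complex.log (z / t), ?_, ?_, ?_, ?_⟩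
    · have : (Complex.I * Complex.log (z / t)).im = (Complex.log (z / t)).re := by simp
      rw [this, hre, h1, Real.log_one, sub_zero]
      exact Real.log_nonneg hzc.1
    · simpa using hlog0
    · simpa using hz
    · simp only [annulus]
      rw [if_neg h]
      have : -(Complex.I * (Complex.I * Complex.log (z / t))) = Complex.log (z / t) := by
        linear_combination -Complex.log (z / t) * Complex.I_mul_I
      rw [this, hexp]
      field_simp

/-- The inverse of the strip coordinates, with `τ = 1 - arg ζ / π`: a strip end covers a full
punctured half-disk, so uniform statements on it concern a whole neighbourhood of the puncture. -/
lemma exists_strip_eq {ζ : ℂ} (h : 0 ≤ ζ.im) (h0 : ζ ≠ 0) : ∃ τ ∈ Set.Icc (0 : ℝ) 1,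
    -Complex.exp (-(Real.pi * ((-Real.log ‖ζ‖ / Real.pi : ℝ) + τ * Complex.I))) = ζ := by
  have hpi : (Real.pi : ℂ) ≠ 0 := by exact_mod_cast Real.pi_ne_zero
  have ha := Complex.arg_nonneg_iff.2 h
  refine ⟨1 - ζ.arg / Real.pi, ⟨?_, ?_⟩, ?_⟩
  · rw [sub_nonneg, div_le_one Real.pi_pos]
    exact Complex.arg_le_pi ζ
  · have := div_nonneg ha Real.pi_pos.le
    linarith
  · have e : -(Real.pi * ((-Real.log ‖ζ‖ / Real.pi : ℝ) + (1 - ζ.arg / Real.pi : ℝ) * Complex.I)) =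
        Complex.log ζ - Real.pi * Complex.I := by
      rw [Complex.log]
      push_cast
      field_simp
      ring
    rw [e, Complex.exp_sub, Complex.exp_pi_mul_I, Complex.exp_log h0]
    ring

variable {Λ : LegendrianKnot}

namespace HolCurve

/-- A function on the punctured annulus which is locally bounded near every point of the closed
annulus is bounded. -/
lemma exists_bound_of_locally {r : ℝ} {C : HolCurve Λ (annulus r)} {g : ℂ → ℝ}
    (hg : ContinuousOn g C.dom)
    (hP : ∀ t ∈ C.P, ∃ B, ∀ᶠ z in 𝓝 t, z ∈ C.dom → |g z| ≤ B) :
    ∃ B, ∀ z ∈ C.dom, |g z| ≤ B := by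
  have hK : IsCompact (annulus r).carrier := by
    refine Metric.isCompact_of_isClosed_isBounded ?_
      (Metric.isBounded_closedBall.subset (fun z hz => by simpa using hz.2 :
        (annulus r).carrier ⊆ Metric.closedBall 0 r))
    exact (isClosed_le continuous_const continuous_norm).inter
      (isClosed_le continuous_norm continuous_const)
  have := hK.induction_on (p := fun s => ∃ B, ∀ z ∈ s, z ∈ C.dom → |g z| ≤ B) ⟨0, by simp⟩
    (fun s t hst ⟨B, hB⟩ => ⟨B, fun z hz => hB z (hst hz)⟩)
    (fun s t ⟨B, hB⟩ ⟨B', hB'⟩ => ⟨max B B', fun z hz hd => by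
      rcases hz with hz | hz
      · exact (hB z hz hd).trans (le_max_left _ _)
      · exact (hB' z hz hd).trans (le_max_right _ _)⟩)
    (fun x hx => by
      by_cases hxP : x ∈ C.P
      · obtain ⟨B, hB⟩ := hP x hxP
        exact ⟨_, mem_nhdsWithin_of_mem_nhds hB, B, fun z hz hd => hz hd⟩
      · have h1 := (hg x ⟨hx, hxP⟩).abs
        have h2 : ∀ᶠ z in 𝓝[C.dom] x, |g z| < |g x| + 1 := h1.eventually (gt_mem_nhds (by linarith))
        rw [eventually_nhdsWithin_iff] at h2
        exact ⟨_, mem_nhdsWithin_of_mem_nhds h2, |g x| + 1, fun z hz hd => (hz hd).le⟩)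
  obtain ⟨B, hB⟩ := this
  exact ⟨B, fun z hz => hB z hz.1 hz⟩

/-- Means over circles converge to means over the boundary circles. -/
lemma integral_tendsto_boundary {r : ℝ} (hr : 1 < r) {C : HolCurve Λ (annulus r)} {g : ℂ → ℝ}
    (hg : ContinuousOn g C.dom) {B : ℝ} (hB : ∀ z ∈ C.dom, |g z| ≤ B) {R : ℝ}
    (hR : R = 1 ∨ R = r) :
    Tendsto (fun ρ => ∫ θ in (0 : ℝ)..2 * Real.pi, g (cpt ρ θ)) (𝓝[Set.Ioo 1 r] R)
      (𝓝 (∫ θ in (0 : ℝ)..2 * Real.pi, g (cpt R θ))) := by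
  have h0 : 0 < R := by rcases hR with h | h <;> linarith
  have hdom : ∀ ρ ∈ Set.Ioo 1 r, ∀ θ, cpt ρ θ ∈ C.dom := fun ρ hρ θ => by
    have hn : ‖cpt ρ θ‖ = ρ := norm_cpt (by linarith [hρ.1]) θ
    exact mem_of_mem_nhds (interior_mem_nhds (by rw [hn]; exact hρ.1) (by rw [hn]; exact hρ.2))
  refine intervalIntegral.tendsto_integral_filter_of_dominated_convergence (fun _ => B) ?_ ?_
    intervalIntegrable_const ?_
  · filter_upwards [self_mem_nhdsWithin] with ρ hρ
    have : Continuous fun θ => g (cpt ρ θ) :=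
      hg.comp_continuous (continuous_cpt ρ) (hdom ρ hρ)
    exact this.aestronglyMeasurable
  · filter_upwards [self_mem_nhdsWithin] with ρ hρ
    exact Eventually.of_forall fun θ _ => hB _ (hdom ρ hρ θ)
  · filter_upwards [ae_mem_arcs (C := C) h0] with θ hθ _
    refine (hg _ (cpt_mem_dom hr hR hθ)).tendsto.comp (tendsto_nhdsWithin_iff.2 ⟨?_, ?_⟩)
    · have : Continuous fun ρ => cpt ρ θ := by unfold cpt; fun_prop
      exact (this.tendsto R).mono_left nhdsWithin_le_nhds
    · filter_upwards [self_mem_nhdsWithin] with ρ hρ using hdom ρ hρ θ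

end HolCurve

/-- Cauchy's theorem for `F z / z`, whose circle integral is `I` times the angular integral of `F`.
-/
lemma integral_circle_eq {F : ℂ → ℂ} {r : ℝ}
    (hF : ∀ z : ℂ, 1 < ‖z‖ → ‖z‖ < r → DifferentiableAt ℂ F z) {ρ ρ' : ℝ} (h1 : 1 < ρ)
    (h2 : ρ ≤ ρ') (h3 : ρ' < r) :
    ∫ θ in (0 : ℝ)..2 * Real.pi, F (cpt ρ θ) = ∫ θ in (0 : ℝ)..2 * Real.pi, F (cpt ρ' θ) := by
  have key := Complex.circleIntegral_sub_center_inv_smul_eq_of_differentiable_on_annulus_off_countable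
    (c := 0) (r := ρ) (R := ρ') (f := F) (s := ∅) (by linarith) h2 Set.countable_empty
    (fun z hz => (hF z (by
      have := hz.2
      simp at this
      linarith) (by
      have := hz.1
      simp at this
      linarith)).continuousAt.continuousWithinAt)
    (fun z hz => hF z (by
      have := hz.1.2
      simp at this
      linarith) (by
      have := hz.1.1
      simp at this
      linarith))
  have e : ∀ ρ : ℝ, 0 < ρ → (∮ z in C(0, ρ), (z - 0)⁻¹ • F z) =
      Complex.I * ∫ θ in (0 : ℝ)..2 * Real.pi, F (cpt ρ θ) := by
    intro ρ hρ
    rw [circleIntegral, ← intervalIntegral.integral_const_mul]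
    refine intervalIntegral.integral_congr fun θ _ => ?_
    have hc : circleMap 0 ρ θ = cpt ρ θ := by simp [circleMap, cpt]
    have hne : cpt ρ θ ≠ 0 := by
      rw [← norm_pos_iff, norm_cpt hρ.le]; exact hρ
    simp only [deriv_circleMap, hc, sub_zero, smul_eq_mul]
    field_simp
  rw [e ρ (by linarith), e ρ' (by linarith)] at key
  exact (mul_left_cancel₀ Complex.I_ne_zero key).symm

namespace HolAnnulus

/-- If an annulus has a lift, then its flux vanishes. -/
lemma flux_eq_zero_of_isLift (hΛ : Λ.GeneralPosition) {A : HolAnnulus Λ} {U : ℂ → R4}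
    (hU : A.IsLift U) : A.flux = 0 := by
  obtain ⟨hs, hJ, hm, hpos, hneg, hproj⟩ := hU
  have hr := A.one_lt_r
  set C := A.curve with hC
  set g : ℂ → ℝ := fun z => (coords (U z)).z with hg
  have hgc : ContinuousOn g C.dom := by
    have := hs.continuousOn
    exact (continuous_snd.comp (continuous_snd.comp continuous_snd)).comp_continuousOn this
  -- boundedness
  have hlocal : ∀ t ∈ C.P, ∀ f : ℝ → ℝ, (∀ τ ∈ Set.Icc (0 : ℝ) 1, ∃ D, ∀ τ ∈ Set.Icc (0 : ℝ) 1, |f τ| ≤ D) →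
      TendstoUniformlyOn (fun s τ => (coords (U (stripEnd (annulus A.r) t s τ))).z) f
        atTop (Set.Icc 0 1) → ∃ B, ∀ᶠ z in 𝓝 t, z ∈ C.dom → |g z| ≤ B := by
    intro t ht f hf hlim
    obtain ⟨D, hD⟩ := hf 0 (by simp)
    rw [Metric.tendstoUniformlyOn_iff] at hlim
    obtain ⟨S, hS⟩ := eventually_atTop.1 (hlim 1 one_pos)
    refine ⟨D + 1, ?_⟩
    filter_upwards [exists_chart_eq hr (C.punctures_mem t ht) (Real.exp_pos (-(Real.pi * S)))]
      with z hz hzd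
    obtain ⟨ζ, h1, h2, h3, rfl⟩ := hz hzd.1 (fun h => hzd.2 (by rw [h]; exact ht))
    obtain ⟨τ, hτ, he⟩ := exists_strip_eq h1 h2
    have hS' : S ≤ -Real.log ‖ζ‖ / Real.pi := by
      rw [le_div_iff₀ Real.pi_pos]
      have := Real.log_lt_log (norm_pos_iff.2 h2) h3
      rw [Real.log_exp] at this
      linarith
    have := hS _ hS' τ hτ
    rw [stripEnd, he, Real.dist_eq] at this
    have h4 := hD τ hτ
    rw [abs_le] at h4 ⊢
    rw [abs_lt] at this
    simp only [hg]
    constructor <;> linarith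
  have hlin : ∀ a b : ℝ, ∀ τ ∈ Set.Icc (0 : ℝ) 1, |a + b * τ| ≤ |a| + |b| := by
    intro a b τ hτ
    refine (abs_add_le _ _).trans ?_
    rw [abs_mul, abs_of_nonneg hτ.1]
    have := mul_le_of_le_one_right (abs_nonneg b) hτ.2
    linarith
  obtain ⟨B, hB⟩ := HolCurve.exists_bound_of_locally hgc (fun t ht => by
    by_cases htp : t = A.pos
    · obtain ⟨Γ, a, b, -, -, -, -, h, -⟩ := hpos
      rw [← htp] at h
      exact hlocal t ht _ (fun _ _ => ⟨|a| + |b - a|, hlin a (b - a)⟩) h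
    · obtain ⟨Γ, a, b, -, -, -, -, h, -⟩ := hneg t ht htp
      refine hlocal t ht _ (fun _ _ => ⟨|b| + |-(b - a)|, fun τ hτ => ?_⟩) h
      have := hlin b (-(b - a)) τ hτ
      convert this using 2
      ring)
  -- the boundary values are the heights
  have htotal : ∀ R, (R = 1 ∨ R = A.r) →
      C.total R = ∫ θ in (0 : ℝ)..2 * Real.pi, g (cpt R θ) := by
    intro R hR
    have h0 : 0 < R := by rcases hR with h | h <;> linarith
    refine intervalIntegral.integral_congr_ae ?_
    filter_upwards [HolCurve.ae_mem_arcs (C := C) h0] with θ hθ _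
    obtain ⟨ε, hε, hball⟩ := Metric.isOpen_iff.1 (C.isOpen_arcs R) θ hθ
    rw [Real.ball_eq_Ioo] at hball
    refine LegendrianKnot.lift_unique hΛ (I := Set.Ioo (θ - ε) (θ + ε)) isPreconnected_Ioo
      (v := fun x => C.u (cpt R x)) (h := fun x => C.h (cpt R x)) (h' := fun x => g (cpt R x))
      ((HolCurve.continuousOn_trace hr hR).mono hball)
      (HolCurve.not_const_arc hr hR (by linarith) hball)
      ((HolCurve.continuousOn_height hr hR).mono hball)
      (hgc.comp (continuous_cpt R).continuousOn
        fun x hx => HolCurve.cpt_mem_dom hr hR (hball hx))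
      (fun x hx => HolCurve.mem_height hr hR (hball hx)) (fun x hx => ?_)
      θ ⟨by linarith, by linarith⟩
    have := hm _ ⟨HolCurve.cpt_mem_bdry hr hR x, hball hx⟩
    rwa [hproj _ (HolCurve.cpt_mem_dom hr hR (hball hx))] at this
  -- the holomorphic function with real part `z`
  set F : ℂ → ℂ := fun z => ((U z).2.2.2 : ℂ) +
    Complex.I * (1 / 2 * ((U z).2.2.1 : ℂ) ^ 2 - ((U z).1 : ℂ)) with hF
  have hFd : ∀ z : ℂ, 1 < ‖z‖ → ‖z‖ < A.r → DifferentiableAt ℂ F z := by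
    intro z h1 h2
    have hn : C.dom ∈ 𝓝 z := HolCurve.interior_mem_nhds h1 h2
    have hzd : z ∈ C.dom := mem_of_mem_nhds hn
    have hUd : HasFDerivAt U (fderivWithin ℝ U C.dom z) z :=
      ((hs.differentiableOn (by simp)) z hzd).hasFDerivWithinAt.hasFDerivAt hn
    set D := fderivWithin ℝ U C.dom z with hD
    have d1 : HasFDerivAt (fun w => ((U w).1 : ℂ)) _ z :=
      Complex.ofRealCLM.hasFDerivAt.comp z hUd.fst
    have d2 : HasFDerivAt (fun w => ((U w).2.2.1 : ℂ)) _ z :=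
      Complex.ofRealCLM.hasFDerivAt.comp z hUd.snd.snd.fst
    have d3 : HasFDerivAt (fun w => ((U w).2.2.2 : ℂ)) _ z :=
      Complex.ofRealCLM.hasFDerivAt.comp z hUd.snd.snd.snd
    have d4 := d3.add ((((d2.pow 2).const_mul (1 / 2 : ℂ)).sub d1).const_mul Complex.I)
    have hFF : HasFDerivAt F _ z := d4
    rw [differentiableAt_complex_iff_differentiableAt_real]
    refine ⟨hFF.differentiableAt, ?_⟩
    rw [hFF.fderiv]
    -- The Cauchy–Riemann equation for `F` only has to be tested on the vector `1`. The term `y ^ 2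
    -- / 2` compensates for the `y`-dependence of `almostJ`.
    have hJ1 := hJ z hzd 1
    rw [mul_one] at hJ1
    rw [← hD] at hJ1
    simp [hJ1, almostJ, coords]
    ring_nf
    simp
    ring
  have hre : ∀ ρ ∈ Set.Ioo 1 A.r, ∫ θ in (0 : ℝ)..2 * Real.pi, g (cpt ρ θ) =
      (∫ θ in (0 : ℝ)..2 * Real.pi, F (cpt ρ θ)).re := by
    intro ρ hρ
    have hcont : Continuous fun θ => F (cpt ρ θ) := by
      rw [continuous_iff_continuousAt]
      intro θ
      have hn : ‖cpt ρ θ‖ = ρ := norm_cpt (by linarith [hρ.1]) θ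
      exact (hFd _ (by rw [hn]; exact hρ.1) (by rw [hn]; exact hρ.2)).continuousAt.comp
        (continuous_cpt ρ).continuousAt
    have := Complex.reCLM.intervalIntegral_comp_comm (hcont.intervalIntegrable (μ := volume) 0 (2 * Real.pi))
    simp only [Complex.reCLM_apply] at this
    rw [← this]
    refine intervalIntegral.integral_congr fun θ _ => ?_
    simp [hF, hg, coords, ← Complex.ofReal_pow]
  set ρ₀ : ℝ := (1 + A.r) / 2 with hρ₀
  have hρ₀mem : ρ₀ ∈ Set.Ioo 1 A.r := ⟨by linarith, by linarith⟩
  have hconst : ∀ ρ ∈ Set.Ioo 1 A.r, ∫ θ in (0 : ℝ)..2 * Real.pi, g (cpt ρ θ) =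
      ∫ θ in (0 : ℝ)..2 * Real.pi, g (cpt ρ₀ θ) := by
    intro ρ hρ
    rw [hre ρ hρ, hre ρ₀ hρ₀mem]
    rcases le_total ρ ρ₀ with h | h
    · rw [integral_circle_eq hFd hρ.1 h hρ₀mem.2]
    · rw [integral_circle_eq hFd hρ₀mem.1 h hρ.2]
  have hfinal : ∀ R, (R = 1 ∨ R = A.r) →
      C.total R = ∫ θ in (0 : ℝ)..2 * Real.pi, g (cpt ρ₀ θ) := by
    intro R hR
    have hne : (𝓝[Set.Ioo 1 A.r] R).NeBot := by
      rw [← mem_closure_iff_nhdsWithin_neBot, closure_Ioo hr.ne]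
      rcases hR with rfl | rfl
      · exact ⟨le_rfl, hr.le⟩
      · exact ⟨hr.le, le_rfl⟩
    rw [htotal R hR]
    -- The circle integrals are constant in the open annulus and converge to the boundary integral,
    -- so both totals equal the integral over the middle circle.
    refine tendsto_nhds_unique (HolCurve.integral_tendsto_boundary hr hgc hB hR) ?_
    refine tendsto_const_nhds.congr' ?_
    filter_upwards [self_mem_nhdsWithin] with ρ hρ
    exact (hconst ρ hρ).symm
  rw [flux, ← hC, hfinal 1 (Or.inl rfl), hfinal A.r (Or.inr rfl), sub_self, zero_div]

end HolAnnulus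

end LegAnnuli

/-! ### The Herglotz integral on the unit disk -/

namespace LegAnnuli

/-- The point of the unit circle with argument `θ`. -/
noncomputable def ept (θ : ℝ) : ℂ := Complex.exp (θ * Complex.I)

lemma norm_ept (θ : ℝ) : ‖ept θ‖ = 1 := Complex.norm_exp_ofReal_mul_I θ

lemma ept_zero : ept 0 = 1 := by simp [ept]

lemma ept_ne_zero (θ : ℝ) : ept θ ≠ 0 := Complex.exp_ne_zero _

lemma contDiff_ept : ContDiff ℝ ∞ ept := by
  unfold ept
  exact (Complex.ofRealCLM.contDiff.mul contDiff_const).cexp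

lemma continuous_ept : Continuous ept := contDiff_ept.continuous

lemma ept_add (θ φ : ℝ) : ept (θ + φ) = ept θ * ept φ := by
  unfold ept; push_cast; rw [add_mul, Complex.exp_add]

lemma ept_periodic : Function.Periodic ept (2 * Real.pi) := by
  intro θ
  unfold ept
  push_cast
  rw [add_mul, Complex.exp_add, Complex.exp_two_pi_mul_I, mul_one]

lemma ept_eq_cpt (θ : ℝ) : ept θ = cpt 1 θ := by simp [ept, cpt]

lemma hasDerivAt_ept (θ : ℝ) : HasDerivAt ept (ept θ * Complex.I) θ := by
  have h : HasDerivAt (fun θ : ℝ => (θ : ℂ) * Complex.I) (1 * Complex.I) θ :=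
    (hasDerivAt_id θ).ofReal_comp.mul_const Complex.I
  have h2 := h.cexp
  rw [one_mul] at h2
  exact h2

/-- The Herglotz kernel. -/
noncomputable def kern (θ : ℝ) (v : ℂ) : ℂ := (ept θ + v) / (ept θ - v)

/-- The holomorphic function on the unit disk whose real part is the Poisson integral of `a`. -/
noncomputable def herg (a : ℝ → ℝ) (v : ℂ) : ℂ :=
  (2 * Real.pi : ℂ)⁻¹ * ∫ θ in (-Real.pi)..Real.pi, (a θ : ℂ) * kern θ v

/-- Bounded measurable periodic boundary data. -/
structure BdData (a : ℝ → ℝ) : Prop where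
  periodic : Function.Periodic a (2 * Real.pi)
  meas : AEStronglyMeasurable a volume
  bound : ∃ B, ∀ θ, |a θ| ≤ B

lemma ept_sub_ne {v : ℂ} (hv : ‖v‖ < 1) (θ : ℝ) : ept θ - v ≠ 0 := by
  intro h
  rw [sub_eq_zero] at h
  rw [← h, norm_ept] at hv
  exact lt_irrefl _ hv

lemma continuous_kern {v : ℂ} (hv : ‖v‖ < 1) : Continuous fun θ => kern θ v := by
  unfold kern
  exact (continuous_ept.add continuous_const).div (continuous_ept.sub continuous_const)
    (ept_sub_ne hv)

lemma measurable_kern (v : ℂ) : Measurable fun θ => kern θ v := by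
  unfold kern
  exact (continuous_ept.measurable.add_const v).div (continuous_ept.measurable.sub_const v)

namespace BdData

variable {a b : ℝ → ℝ}

lemma intervalIntegrable (ha : BdData a) (x y : ℝ) : IntervalIntegrable a volume x y := by
  obtain ⟨B, hB⟩ := ha.bound
  refine (intervalIntegrable_const (c := B)).mono_fun ha.meas.restrict
    (Eventually.of_forall fun θ => (hB θ).trans (le_abs_self _))

lemma intervalIntegrable_mul (ha : BdData a) {f : ℝ → ℂ} (hf : Continuous f) (x y : ℝ) :
    IntervalIntegrable (fun θ => (a θ : ℂ) * f θ) volume x y :=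
  IntervalIntegrable.mul_continuousOn (f := fun θ => (a θ : ℂ))
    ⟨(ha.intervalIntegrable x y).1.ofReal, (ha.intervalIntegrable x y).2.ofReal⟩ hf.continuousOn

lemma of_contDiff (hp : Function.Periodic a (2 * Real.pi)) (hc : Continuous a) : BdData a := by
  refine ⟨hp, hc.aestronglyMeasurable, ?_⟩
  obtain ⟨B, hB⟩ := (isCompact_Icc (a := (0 : ℝ)) (b := 2 * Real.pi)).exists_bound_of_continuousOn
    hc.continuousOn
  refine ⟨B, fun θ => ?_⟩
  obtain ⟨y, hy, hxy⟩ := hp.exists_mem_Ico₀ Real.two_pi_pos θ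
  rw [hxy]
  exact hB y ⟨hy.1, hy.2.le⟩

/-- Bounded data remain bounded data after multiplication by a continuous function on the circle. -/
lemma smul (ha : BdData a) {χ : ℂ → ℝ} (hχ : Continuous χ) : BdData fun θ => χ (ept θ) * a θ := by
  have h1 : BdData fun θ => χ (ept θ) :=
    of_contDiff (fun θ => by simp only [ept_periodic θ]) (hχ.comp continuous_ept)
  obtain ⟨A, hA⟩ := ha.bound
  obtain ⟨B, hB⟩ := h1.bound
  refine ⟨fun θ => by simp only [ha.periodic θ, ept_periodic θ], h1.meas.mul ha.meas, B * A,
    fun θ => ?_⟩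
  rw [abs_mul]
  exact mul_le_mul (hB θ) (hA θ) (abs_nonneg _) ((abs_nonneg _).trans (hB θ))

end BdData

lemma herg_add {a b : ℝ → ℝ} (ha : BdData a) (hb : BdData b) {v : ℂ} (hv : ‖v‖ < 1) :
    herg (fun θ => a θ + b θ) v = herg a v + herg b v := by
  unfold herg
  rw [← mul_add, ← intervalIntegral.integral_add (ha.intervalIntegrable_mul (continuous_kern hv) _ _)
    (hb.intervalIntegrable_mul (continuous_kern hv) _ _)]
  congr 1
  refine intervalIntegral.integral_congr fun θ _ => ?_
  push_cast
  ring

lemma hasDerivAt_kern {θ : ℝ} {v : ℂ} (h : ept θ - v ≠ 0) :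
    HasDerivAt (kern θ) (2 * ept θ / (ept θ - v) ^ 2) v := by
  have h1 : HasDerivAt (fun w => ept θ + w) 1 v := (hasDerivAt_id v).const_add _
  have h2 : HasDerivAt (fun w => ept θ - w) (-1) v := (hasDerivAt_id v).const_sub _
  refine (h1.div h2 h).congr_deriv ?_
  ring

/-- The kernel depends on `v / ept θ` alone, so its angular derivative is `-I * v` times its
derivative in `v`. This is what makes integration by parts possible. -/
lemma hasDerivAt_kern_arg {θ : ℝ} {v : ℂ} (h : ept θ - v ≠ 0) :
    HasDerivAt (fun θ => kern θ v) (-Complex.I * v * (2 * ept θ / (ept θ - v) ^ 2)) θ := by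
  have h1 : HasDerivAt (fun θ => ept θ + v) (ept θ * Complex.I) θ := (hasDerivAt_ept θ).add_const _
  have h2 : HasDerivAt (fun θ => ept θ - v) (ept θ * Complex.I) θ := (hasDerivAt_ept θ).sub_const _
  refine (h1.div h2 h).congr_deriv ?_
  ring

/-- The Herglotz integral is holomorphic away from the support of the boundary data. -/
lemma hasDerivAt_herg {a : ℝ → ℝ} (ha : BdData a) {v₀ : ℂ} {c : ℝ} (hc : 0 < c)
    (h : ∀ θ, a θ ≠ 0 → ∀ v ∈ Metric.ball v₀ c, c ≤ ‖ept θ - v‖) :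
    HasDerivAt (herg a) ((2 * Real.pi : ℂ)⁻¹ *
      ∫ θ in (-Real.pi)..Real.pi, (a θ : ℂ) * (2 * ept θ / (ept θ - v₀) ^ 2)) v₀ := by
  obtain ⟨B, hB⟩ := ha.bound
  have hB0 : 0 ≤ B := (abs_nonneg _).trans (hB 0)
  have hcast : AEStronglyMeasurable (fun θ => (a θ : ℂ)) volume :=
    Complex.continuous_ofReal.comp_aestronglyMeasurable ha.meas
  have hmeas : ∀ v, AEStronglyMeasurable (fun θ => (a θ : ℂ) * kern θ v) volume := fun v =>
    hcast.mul (measurable_kern v).aestronglyMeasurable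
  have hmeas' : AEStronglyMeasurable
      (fun θ => (a θ : ℂ) * (2 * ept θ / (ept θ - v₀) ^ 2)) volume := by
    refine hcast.mul (Measurable.aestronglyMeasurable ?_)
    exact (continuous_ept.measurable.const_mul 2).div ((continuous_ept.measurable.sub_const v₀).pow_const 2)
  have hv₀ : v₀ ∈ Metric.ball v₀ c := Metric.mem_ball_self hc
  refine HasDerivAt.const_mul _ (intervalIntegral.hasDerivAt_integral_of_dominated_loc_of_deriv_le
    (F := fun v θ => (a θ : ℂ) * kern θ v)
    (F' := fun v θ => (a θ : ℂ) * (2 * ept θ / (ept θ - v) ^ 2))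
    (bound := fun _ => B * (2 / c ^ 2)) (Metric.ball_mem_nhds v₀ hc)
    (Eventually.of_forall fun v => (hmeas v).restrict) ?_ hmeas'.restrict ?_
    intervalIntegrable_const ?_).2
  · refine (intervalIntegrable_const (c := B * ((1 + ‖v₀‖) / c))).mono_fun (hmeas v₀).restrict
      (Eventually.of_forall fun θ => ?_)
    simp only
    by_cases h0 : a θ = 0
    · simp only [h0, Complex.ofReal_zero, zero_mul, norm_zero]
      exact norm_nonneg _
    · refine le_trans ?_ (le_abs_self _)
      rw [norm_mul, Complex.norm_real, kern, norm_div]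
      refine mul_le_mul (hB θ) ?_ (by positivity) hB0
      refine div_le_div₀ (by positivity) ?_ hc (h θ h0 v₀ hv₀)
      refine (norm_add_le _ _).trans ?_
      rw [norm_ept]
  · refine Eventually.of_forall fun θ _ v hv => ?_
    by_cases h0 : a θ = 0
    · simp only [h0, Complex.ofReal_zero, zero_mul, norm_zero]
      positivity
    · rw [norm_mul, Complex.norm_real, norm_div, norm_mul, norm_ept, norm_pow]
      refine mul_le_mul (hB θ) ?_ (by positivity) hB0
      have := h θ h0 v hv
      simp only [Complex.norm_ofNat, mul_one]
      gcongr
  · refine Eventually.of_forall fun θ _ v hv => ?_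
    by_cases h0 : a θ = 0
    · simpa [h0] using hasDerivAt_const v (0 : ℂ)
    · refine (hasDerivAt_kern ?_).const_mul _
      rw [← norm_pos_iff]
      exact hc.trans_le (h θ h0 v hv)

lemma hasDerivAt_herg_of_mem {a : ℝ → ℝ} (ha : BdData a) {v₀ : ℂ} (hv : ‖v₀‖ < 1) :
    HasDerivAt (herg a) ((2 * Real.pi : ℂ)⁻¹ *
      ∫ θ in (-Real.pi)..Real.pi, (a θ : ℂ) * (2 * ept θ / (ept θ - v₀) ^ 2)) v₀ := by
  refine hasDerivAt_herg ha (c := (1 - ‖v₀‖) / 2) (by linarith) fun θ _ v hv' => ?_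
  rw [Metric.mem_ball, dist_eq_norm] at hv'
  have h1 : ‖v‖ ≤ ‖v - v₀‖ + ‖v₀‖ := by simpa using norm_add_le (v - v₀) v₀
  have h2 := norm_sub_norm_le (ept θ) v
  rw [norm_ept] at h2
  linarith

lemma differentiableOn_herg {a : ℝ → ℝ} (ha : BdData a) :
    DifferentiableOn ℂ (herg a) (Metric.ball 0 1) := fun v hv =>
  (hasDerivAt_herg_of_mem ha (by simpa using hv)).differentiableAt.differentiableWithinAt

/-- Differentiation of the Herglotz integral of smooth data. -/
lemma hasDerivAt_herg_smooth {a : ℝ → ℝ} (hp : Function.Periodic a (2 * Real.pi))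
    (hs : ContDiff ℝ ∞ a) {v : ℂ} (hv : ‖v‖ < 1) (hv0 : v ≠ 0) :
    HasDerivAt (herg a) (-Complex.I * v⁻¹ * herg (deriv a) v) v := by
  have ha : BdData a := .of_contDiff hp hs.continuous
  convert hasDerivAt_herg_of_mem ha hv using 1
  have hcd : Continuous (deriv a) := hs.continuous_deriv (by simp)
  have hc2 : Continuous fun θ => 2 * ept θ / (ept θ - v) ^ 2 :=
    (continuous_const.mul continuous_ept).div ((continuous_ept.sub continuous_const).pow 2)
      fun θ => pow_ne_zero 2 (ept_sub_ne hv θ)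
  -- Integration by parts moves the derivative from the kernel to the data; the boundary terms
  -- cancel by periodicity.
  have key := intervalIntegral.integral_deriv_mul_eq_sub (a := -Real.pi) (b := Real.pi)
    (u := fun θ => (a θ : ℂ)) (v := fun θ => kern θ v) (u' := fun θ => ((deriv a θ : ℝ) : ℂ))
    (v' := fun θ => -Complex.I * v * (2 * ept θ / (ept θ - v) ^ 2))
    (fun θ _ => ((hs.differentiable (by simp)) θ).hasDerivAt.ofReal_comp)
    (fun θ _ => hasDerivAt_kern_arg (ept_sub_ne hv θ))
    ((Complex.continuous_ofReal.comp hcd).intervalIntegrable _ _)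
    ((continuous_const.mul hc2).intervalIntegrable _ _)
  have hb : (a Real.pi : ℂ) * kern Real.pi v - (a (-Real.pi) : ℂ) * kern (-Real.pi) v = 0 := by
    have e1 : a Real.pi = a (-Real.pi) := by rw [← hp (-Real.pi)]; congr 1; ring
    have e2 : ept Real.pi = ept (-Real.pi) := by rw [← ept_periodic (-Real.pi)]; congr 1; ring
    rw [kern, kern, e1, e2, sub_self]
  have i1 : IntervalIntegrable (fun θ => ((deriv a θ : ℝ) : ℂ) * kern θ v) volume (-Real.pi)
      Real.pi :=
    ((Complex.continuous_ofReal.comp hcd).mul (continuous_kern hv)).intervalIntegrable _ _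
  have i2 : IntervalIntegrable
      (fun θ => (a θ : ℂ) * (-Complex.I * v * (2 * ept θ / (ept θ - v) ^ 2))) volume (-Real.pi)
      Real.pi :=
    ((Complex.continuous_ofReal.comp hs.continuous).mul
      (continuous_const.mul hc2)).intervalIntegrable _ _
  rw [hb, intervalIntegral.integral_add i1 i2] at key
  have e3 : ∫ θ in (-Real.pi)..Real.pi, (a θ : ℂ) * (-Complex.I * v * (2 * ept θ / (ept θ - v) ^ 2)) =
      -Complex.I * v * ∫ θ in (-Real.pi)..Real.pi, (a θ : ℂ) * (2 * ept θ / (ept θ - v) ^ 2) := by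
    rw [← intervalIntegral.integral_const_mul]
    refine intervalIntegral.integral_congr fun θ _ => ?_
    ring
  rw [e3] at key
  unfold herg
  rw [eq_neg_of_add_eq_zero_left key]
  have hI := Complex.I_mul_I
  generalize (∫ θ in (-Real.pi)..Real.pi, (a θ : ℂ) * (2 * ept θ / (ept θ - v) ^ 2)) = K
  field_simp
  linear_combination (-K) * hI

/-! ### Boundary values of smooth data -/

/-- Jordan's inequality for the sine of `θ / 2`. -/
lemma abs_le_norm_ept_sub_one {θ : ℝ} (h : |θ| ≤ Real.pi) : |θ| ≤ Real.pi / 2 * ‖ept θ - 1‖ := by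
  have h1 : ‖ept θ - 1‖ = 2 * |Real.sin (θ / 2)| := by
    rw [ept, mul_comm, Complex.norm_exp_I_mul_ofReal_sub_one, Real.norm_eq_abs, abs_mul, abs_two]
  have h2 := Real.mul_abs_le_abs_sin (x := θ / 2) (by
    rw [abs_div, abs_two]; linarith)
  rw [h1]
  rw [abs_div, abs_two] at h2
  have := mul_le_mul_of_nonneg_left h2 Real.pi_pos.le
  have e : Real.pi * (2 / Real.pi * (|θ| / 2)) = |θ| := by
    have := Real.pi_ne_zero
    field_simp
  linarith

/-- The distance to a boundary point is comparable to the distance to the nearest one. -/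
lemma norm_ept_sub_le {θ φ ρ : ℝ} (h0 : 0 ≤ ρ) (h1 : ρ ≤ 1) :
    ‖ept θ - ept φ‖ ≤ 2 * ‖ept θ - ρ * ept φ‖ := by
  have e1 : ‖(ρ : ℂ) * ept φ - ept φ‖ = 1 - ρ := by
    have : (ρ : ℂ) * ept φ - ept φ = ((ρ - 1 : ℝ) : ℂ) * ept φ := by push_cast; ring
    rw [this, norm_mul, norm_ept, mul_one, Complex.norm_real, Real.norm_eq_abs,
      abs_of_nonpos (by linarith)]
    ring
  have e2 : 1 - ρ ≤ ‖ept θ - ρ * ept φ‖ := by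
    have := norm_sub_norm_le (ept θ) (ρ * ept φ)
    rwa [norm_ept, norm_mul, norm_ept, mul_one, Complex.norm_real, Real.norm_eq_abs,
      abs_of_nonneg h0] at this
  have e3 : ‖ept θ - ept φ‖ ≤ ‖ept θ - ρ * ept φ‖ + ‖(ρ : ℂ) * ept φ - ept φ‖ := by
    have := norm_add_le (ept θ - ρ * ept φ) (ρ * ept φ - ept φ)
    simpa using this
  linarith

/-- An explicit primitive of the Herglotz kernel. -/
lemma hasDerivAt_primitive {v : ℂ} (hv : ‖v‖ < 1) (θ : ℝ) : HasDerivAt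
    (fun θ : ℝ => (θ : ℂ) - 2 * Complex.I * Complex.log (1 - v * ept (-θ))) (kern θ v) θ := by
  have hre : 0 < (1 - v * ept (-θ)).re := by
    have : (v * ept (-θ)).re ≤ ‖v‖ := by
      refine (Complex.re_le_norm _).trans ?_
      rw [norm_mul, norm_ept, mul_one]
    rw [Complex.sub_re, Complex.one_re]
    linarith
  have hm : ept θ * ept (-θ) = 1 := by rw [← ept_add, add_neg_cancel, ept_zero]
  have h1 : HasDerivAt (fun θ : ℝ => ept (-θ)) (-(ept (-θ) * Complex.I)) θ := by
    have := (hasDerivAt_ept (-θ)).scomp θ (hasDerivAt_neg θ)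
    simpa [Function.comp_def] using this
  have h2 : HasDerivAt (fun θ : ℝ => 1 - v * ept (-θ)) (-(v * -(ept (-θ) * Complex.I))) θ :=
    (h1.const_mul v).const_sub 1
  have h3 := h2.clog_real (Or.inl hre)
  have h4 : HasDerivAt
      (fun θ : ℝ => (θ : ℂ) - 2 * Complex.I * Complex.log (1 - v * ept (-θ))) _ θ :=
    (hasDerivAt_id θ).ofReal_comp.sub (h3.const_mul (2 * Complex.I))
  refine h4.congr_deriv ?_
  have hn1 := ept_sub_ne hv θ
  have hn2 : 1 - v * ept (-θ) ≠ 0 := fun h => by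
    rw [h] at hre
    exact lt_irrefl _ hre
  have e : 1 - v * ept (-θ) = (ept θ - v) * ept (-θ) := by rw [sub_mul, hm]
  unfold kern
  rw [e, Complex.ofReal_one]
  have hn3 := ept_ne_zero (-θ)
  field_simp
  linear_combination (-2 * v) * Complex.I_sq

/-- The Poisson kernel has integral one. -/
lemma integral_kern {v : ℂ} (hv : ‖v‖ < 1) :
    ∫ θ in (-Real.pi)..Real.pi, kern θ v = 2 * Real.pi := by
  rw [intervalIntegral.integral_eq_sub_of_hasDerivAt (fun θ _ => hasDerivAt_primitive hv θ)
    ((continuous_kern hv).intervalIntegrable _ _)]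
  have e2 : ept (-Real.pi) = ept (- -Real.pi) := by
    rw [neg_neg, ← ept_periodic (-Real.pi)]; congr 1; ring
  rw [e2]
  push_cast
  ring

/-- Rotation invariance of the kernel reduces the study of an arbitrary boundary point to that of
the point `1`. -/
lemma herg_rotate {a : ℝ → ℝ} (ha : BdData a) (φ : ℝ) (v : ℂ) :
    herg a (v * ept φ) = herg (fun θ => a (φ + θ)) v := by
  unfold herg
  congr 1
  have hper : Function.Periodic (fun θ => (a θ : ℂ) * kern θ (v * ept φ)) (2 * Real.pi) := fun θ => by
    simp only [ha.periodic θ, kern, ept_periodic θ]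
  have h1 := hper.intervalIntegral_add_eq (-Real.pi) (-Real.pi + φ)
  rw [show -Real.pi + 2 * Real.pi = Real.pi by ring,
    show -Real.pi + φ + 2 * Real.pi = Real.pi + φ by ring] at h1
  rw [h1, ← intervalIntegral.integral_comp_add_right (fun θ => (a θ : ℂ) * kern θ (v * ept φ)) φ]
  refine intervalIntegral.integral_congr fun θ _ => ?_
  simp only [kern]
  rw [add_comm θ φ, ept_add, mul_comm (ept φ), ← add_mul, ← sub_mul,
    mul_div_mul_right _ _ (ept_ne_zero φ)]

/-- For two points of the unit circle, numerator and denominator are orthogonal. For equal points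
the division by zero gives the value `0`, so no exception is needed. -/
lemma kern_re_eq_zero (θ φ : ℝ) : (kern θ (ept φ)).re = 0 := by
  rw [kern, Complex.div_re]
  have h1 : Complex.normSq (ept θ) = 1 := by rw [Complex.normSq_eq_norm_sq, norm_ept, one_pow]
  have h2 : Complex.normSq (ept φ) = 1 := by rw [Complex.normSq_eq_norm_sq, norm_ept, one_pow]
  rw [Complex.normSq_apply] at h1 h2
  simp only [Complex.add_re, Complex.sub_re, Complex.add_im, Complex.sub_im]
  rw [← add_div]
  have : ((ept θ).re + (ept φ).re) * ((ept θ).re - (ept φ).re) +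
    ((ept θ).im + (ept φ).im) * ((ept θ).im - (ept φ).im) = 0 := by linarith
  rw [this, zero_div]

/-- The Herglotz integral in polar coordinates, regularized so that it makes sense on the closed
disk. -/
noncomputable def hergPolar (a : ℝ → ℝ) (q : ℝ × ℝ) : ℂ :=
  a q.2 + (2 * Real.pi : ℂ)⁻¹ *
    ∫ θ in (-Real.pi)..Real.pi, ((a (q.2 + θ) - a q.2 : ℝ) : ℂ) * kern θ q.1

lemma herg_eq_hergPolar {a : ℝ → ℝ} (ha : BdData a) {ρ φ : ℝ} (h0 : 0 ≤ ρ) (h1 : ρ < 1) :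
    herg a (ρ * ept φ) = hergPolar a (ρ, φ) := by
  have hv : ‖(ρ : ℂ)‖ < 1 := by rwa [Complex.norm_real, Real.norm_eq_abs, abs_of_nonneg h0]
  have ha' : BdData fun θ => a (φ + θ) := by
    obtain ⟨B, hB⟩ := ha.bound
    exact ⟨fun θ => by simp only [← add_assoc, ha.periodic (φ + θ)],
      ha.meas.comp_measurePreserving (measurePreserving_add_left volume φ), B, fun θ => hB _⟩
  rw [herg_rotate ha, hergPolar, herg]
  have hpi : (2 * Real.pi : ℂ) ≠ 0 := by exact_mod_cast Real.two_pi_pos.ne'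
  have e : ∫ θ in (-Real.pi)..Real.pi, ((a (φ + θ) - a φ : ℝ) : ℂ) * kern θ ρ =
      (∫ θ in (-Real.pi)..Real.pi, (a (φ + θ) : ℂ) * kern θ ρ) - a φ * (2 * Real.pi) := by
    rw [← integral_kern hv, ← intervalIntegral.integral_const_mul, ← intervalIntegral.integral_sub
      (ha'.intervalIntegrable_mul (continuous_kern hv) _ _)
      (((continuous_kern hv).const_mul _).intervalIntegrable _ _)]
    refine intervalIntegral.integral_congr fun θ _ => ?_
    push_cast
    ring
  rw [e]
  field_simp
  ring

/-- The singularity of the kernel is of order `1 / |θ|`, uniformly up to the boundary value `ρ = 1`.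
A Lipschitz factor therefore makes the product bounded. -/
lemma norm_kern_le {θ ρ : ℝ} (h0 : 0 ≤ ρ) (h1 : ρ ≤ 1) (hθ : |θ| ≤ Real.pi) :
    |θ| * ‖kern θ ρ‖ ≤ 2 * Real.pi := by
  have e1 : ‖ept θ + ρ‖ ≤ 2 := by
    refine (norm_add_le _ _).trans ?_
    rw [norm_ept, Complex.norm_real, Real.norm_eq_abs, abs_of_nonneg h0]
    linarith
  have e2 : ‖ept θ - 1‖ ≤ 2 * ‖ept θ - ρ‖ := by
    simpa [ept_zero] using norm_ept_sub_le (θ := θ) (φ := 0) h0 h1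
  have e3 : |θ| ≤ Real.pi * ‖ept θ - ρ‖ := by
    have := abs_le_norm_ept_sub_one hθ
    have := mul_le_mul_of_nonneg_left e2 (show 0 ≤ Real.pi / 2 by positivity)
    linarith
  rw [kern, norm_div]
  rcases eq_or_ne ‖ept θ - ρ‖ 0 with h | h
  · rw [h, div_zero, mul_zero]; positivity
  · rw [← mul_div_assoc, div_le_iff₀ (lt_of_le_of_ne (norm_nonneg _) h.symm)]
    calc |θ| * ‖ept θ + ρ‖ ≤ (Real.pi * ‖ept θ - ρ‖) * 2 := by gcongr
      _ = _ := by ring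

/-- After subtracting `a φ`, the Lipschitz condition dominates the integrand by a constant up to the
boundary, which fails for the Herglotz integral itself. -/
lemma hergPolar_tendsto {a : ℝ → ℝ} {L : ℝ} (hc : Continuous a)
    (hL : ∀ θ φ, |a θ - a φ| ≤ L * |θ - φ|) (φ₀ : ℝ) :
    Tendsto (hergPolar a) (𝓝[Set.Icc 0 1 ×ˢ Set.univ] (1, φ₀)) (𝓝 (hergPolar a (1, φ₀))) := by
  have hL0 : 0 ≤ L := by
    have := (abs_nonneg _).trans (hL 1 0)
    simpa using this
  unfold hergPolar
  refine Tendsto.add ?_ (Tendsto.const_mul _ ?_)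
  · exact ((Complex.continuous_ofReal.comp (hc.comp continuous_snd)).tendsto _).mono_left
      nhdsWithin_le_nhds
  refine intervalIntegral.tendsto_integral_filter_of_dominated_convergence
    (fun _ => L * (2 * Real.pi)) ?_ ?_ intervalIntegrable_const ?_
  · refine Eventually.of_forall fun q => AEStronglyMeasurable.mul ?_
      (measurable_kern _).aestronglyMeasurable
    exact (by fun_prop : Continuous fun θ => ((a (q.2 + θ) - a q.2 : ℝ) : ℂ)).aestronglyMeasurable
  · filter_upwards [self_mem_nhdsWithin] with q hq
    refine Eventually.of_forall fun θ hθ => ?_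
    rw [Set.uIoc_of_le (by linarith [Real.pi_pos])] at hθ
    have hθ' : |θ| ≤ Real.pi := abs_le.2 ⟨hθ.1.le, hθ.2⟩
    rw [norm_mul, Complex.norm_real, Real.norm_eq_abs]
    have h1 := hL (q.2 + θ) q.2
    rw [add_sub_cancel_left] at h1
    calc |a (q.2 + θ) - a q.2| * ‖kern θ q.1‖ ≤ (L * |θ|) * ‖kern θ q.1‖ := by gcongr
      _ = L * (|θ| * ‖kern θ q.1‖) := by ring
      _ ≤ _ := by
        exact mul_le_mul_of_nonneg_left (norm_kern_le hq.1.1 hq.1.2 hθ') hL0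
  · have hne : ∀ᵐ θ : ℝ, θ ∉ ({0} : Set ℝ) := (Set.countable_singleton 0).ae_notMem volume
    filter_upwards [hne] with θ hθ hmem
    rw [Set.uIoc_of_le (by linarith [Real.pi_pos])] at hmem
    have hnz : ept θ - ((1 : ℝ) : ℂ) ≠ 0 := fun h => by
      have h1 := abs_le_norm_ept_sub_one (abs_le.2 ⟨hmem.1.le, hmem.2⟩)
      rw [Complex.ofReal_one] at h
      rw [h, norm_zero, mul_zero] at h1
      exact hθ (abs_nonpos_iff.1 h1)
    have : ContinuousAt (fun q : ℝ × ℝ => ((a (q.2 + θ) - a q.2 : ℝ) : ℂ) * kern θ q.1) (1, φ₀) := by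
      refine ContinuousAt.mul (by fun_prop) ?_
      unfold kern
      exact ContinuousAt.div (by fun_prop) (by fun_prop) hnz
    exact this.tendsto.mono_left nhdsWithin_le_nhds

/-- On the circle the kernel is purely imaginary, so only the subtracted value survives in the real
part. -/
lemma hergPolar_re (a : ℝ → ℝ) (φ : ℝ) {L : ℝ} (hc : Continuous a)
    (hL : ∀ θ φ, |a θ - a φ| ≤ L * |θ - φ|) : (hergPolar a (1, φ)).re = a φ := by
  have hL0 : 0 ≤ L := by
    have := (abs_nonneg _).trans (hL 1 0)
    simpa using this
  have hint : IntervalIntegrable (fun θ => ((a (φ + θ) - a φ : ℝ) : ℂ) * kern θ (1 : ℝ)) volume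
      (-Real.pi) Real.pi := by
    rw [intervalIntegrable_iff]
    refine Measure.integrableOn_of_bounded (M := L * (2 * Real.pi)) (by simp)
      (AEStronglyMeasurable.mul ?_ (measurable_kern _).aestronglyMeasurable) ?_
    · exact (by fun_prop : Continuous fun θ => ((a (φ + θ) - a φ : ℝ) : ℂ)).aestronglyMeasurable
    · refine (ae_restrict_iff' measurableSet_uIoc).2 (Eventually.of_forall fun θ hθ => ?_)
      rw [Set.uIoc_of_le (by linarith [Real.pi_pos])] at hθ
      have hθ' : |θ| ≤ Real.pi := abs_le.2 ⟨hθ.1.le, hθ.2⟩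
      rw [norm_mul, Complex.norm_real, Real.norm_eq_abs]
      have h1 := hL (φ + θ) φ
      rw [add_sub_cancel_left] at h1
      calc |a (φ + θ) - a φ| * ‖kern θ (1 : ℝ)‖ ≤ (L * |θ|) * ‖kern θ (1 : ℝ)‖ := by gcongr
        _ = L * (|θ| * ‖kern θ (1 : ℝ)‖) := by ring
        _ ≤ _ := by
          exact mul_le_mul_of_nonneg_left (norm_kern_le zero_le_one le_rfl hθ') hL0
  have hre : (∫ θ in (-Real.pi)..Real.pi, ((a (φ + θ) - a φ : ℝ) : ℂ) * kern θ (1 : ℝ)).re = 0 := by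
    have := Complex.reCLM.intervalIntegral_comp_comm hint
    simp only [Complex.reCLM_apply] at this
    rw [← this]
    have h0 : ∀ θ, (((a (φ + θ) - a φ : ℝ) : ℂ) * kern θ (1 : ℝ)).re = 0 := fun θ => by
      have := kern_re_eq_zero θ 0
      rw [ept_zero] at this
      rw [Complex.re_ofReal_mul, Complex.ofReal_one, this, mul_zero]
    simp only [h0, intervalIntegral.integral_zero]
  unfold hergPolar
  have e : (2 * Real.pi : ℂ)⁻¹ = (((2 * Real.pi)⁻¹ : ℝ) : ℂ) := by push_cast; rfl
  rw [Complex.add_re, e, Complex.re_ofReal_mul]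
  simp only
  rw [hre, mul_zero, add_zero, Complex.ofReal_re]

end LegAnnuli

/-! ### Boundary regularity of the Herglotz integral -/

namespace LegAnnuli

/-- The Herglotz integral, extended to the closed disk by its limits. -/
noncomputable def hergExt (a : ℝ → ℝ) : ℂ → ℂ := extendFrom (Metric.ball 0 1) (herg a)

lemma hergExt_eq {a : ℝ → ℝ} (ha : BdData a) {v : ℂ} (hv : ‖v‖ < 1) : hergExt a v = herg a v :=
  extendFrom_extends (differentiableOn_herg ha).continuousOn v (by simpa using hv)

lemma closure_unitBall : closure (Metric.ball (0 : ℂ) 1) = Metric.closedBall 0 1 :=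
  closure_ball 0 one_ne_zero

lemma hergExt_eq_of_tendsto {a : ℝ → ℝ} {v c : ℂ} (hv : ‖v‖ ≤ 1)
    (h : Tendsto (herg a) (𝓝[Metric.ball 0 1] v) (𝓝 c)) : hergExt a v = c :=
  extendFrom_eq (by rw [closure_unitBall]; simpa using hv) h

lemma exists_lipschitz {a : ℝ → ℝ} (hp : Function.Periodic a (2 * Real.pi)) (hs : ContDiff ℝ ∞ a) :
    ∃ L, ∀ θ φ, |a θ - a φ| ≤ L * |θ - φ| := by
  have hper : Function.Periodic (deriv a) (2 * Real.pi) := fun θ => by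
    rw [← deriv_comp_add_const]
    congr 1
    funext x
    exact hp x
  obtain ⟨L, hL⟩ := (BdData.of_contDiff hper (hs.continuous_deriv (by simp))).bound
  refine ⟨L, fun θ φ => ?_⟩
  have := convex_univ.norm_image_sub_le_of_norm_deriv_le (f := a) (C := L)
    (fun x _ => (hs.differentiable (by simp)) x) (fun x _ => hL x) (Set.mem_univ φ) (Set.mem_univ θ)
  simpa [Real.norm_eq_abs] using this

/-- Transfer from polar coordinates; the argument is taken relative to `ept φ`, which keeps it away
from the branch cut. -/
lemma herg_tendsto {a : ℝ → ℝ} (hp : Function.Periodic a (2 * Real.pi)) (hs : ContDiff ℝ ∞ a)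
    (φ : ℝ) : Tendsto (herg a) (𝓝[Metric.ball 0 1] (ept φ)) (𝓝 (hergPolar a (1, φ))) := by
  have ha : BdData a := .of_contDiff hp hs.continuous
  obtain ⟨L, hL⟩ := exists_lipschitz hp hs
  have h1 : ContinuousAt (fun v : ℂ => (‖v‖, φ + (v / ept φ).arg)) (ept φ) := by
    refine ContinuousAt.prodMk continuous_norm.continuousAt (continuousAt_const.add ?_)
    refine ContinuousAt.comp (g := Complex.arg) (Complex.continuousAt_arg ?_)
      (continuousAt_id.div_const _)
    simp [div_self (ept_ne_zero φ)]
  have h2 : Tendsto (fun v : ℂ => (‖v‖, φ + (v / ept φ).arg)) (𝓝[Metric.ball 0 1] (ept φ))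
      (𝓝[Set.Icc 0 1 ×ˢ Set.univ] (1, φ)) := by
    refine tendsto_nhdsWithin_iff.2 ⟨?_, ?_⟩
    · have := h1.tendsto
      simp only [norm_ept, div_self (ept_ne_zero φ), Complex.arg_one, add_zero] at this
      exact this.mono_left nhdsWithin_le_nhds
    · filter_upwards [self_mem_nhdsWithin] with v hv
      exact ⟨⟨norm_nonneg _, by simpa using (mem_ball_zero_iff.1 hv).le⟩, trivial⟩
  refine ((hergPolar_tendsto hs.continuous hL φ).comp h2).congr' ?_
  filter_upwards [self_mem_nhdsWithin] with v hv
  have hv' : ‖v‖ < 1 := by simpa using hv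
  have e : v = ‖v‖ * ept (φ + (v / ept φ).arg) := by
    have h3 : (‖v‖ : ℂ) * ept (v / ept φ).arg = v / ept φ := by
      have h3 := Complex.norm_mul_exp_arg_mul_I (v / ept φ)
      rwa [norm_div, norm_ept, div_one] at h3
    rw [ept_add, mul_left_comm, h3, mul_div_cancel₀ _ (ept_ne_zero φ)]
  simp only [Function.comp_apply]
  rw [← herg_eq_hergPolar ha (norm_nonneg v) hv', ← e]

lemma hergExt_tendsto {a : ℝ → ℝ} (hp : Function.Periodic a (2 * Real.pi)) (hs : ContDiff ℝ ∞ a)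
    {v : ℂ} (hv : ‖v‖ ≤ 1) : Tendsto (herg a) (𝓝[Metric.ball 0 1] v) (𝓝 (hergExt a v)) := by
  refine tendsto_extendFrom ?_
  rcases hv.lt_or_eq with h | h
  · have hb : v ∈ Metric.ball (0 : ℂ) 1 := by simpa using h
    exact ⟨_, (differentiableOn_herg (.of_contDiff hp hs.continuous)).continuousOn v hb⟩
  · obtain ⟨φ, rfl⟩ := exists_cpt h
    rw [← ept_eq_cpt]
    exact ⟨_, herg_tendsto hp hs φ⟩

lemma hergExt_re {a : ℝ → ℝ} (hp : Function.Periodic a (2 * Real.pi)) (hs : ContDiff ℝ ∞ a)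
    (φ : ℝ) : (hergExt a (ept φ)).re = a φ := by
  rw [hergExt_eq_of_tendsto (norm_ept φ).le (herg_tendsto hp hs φ)]
  obtain ⟨L, hL⟩ := exists_lipschitz hp hs
  exact hergPolar_re a φ hs.continuous hL

lemma continuousOn_hergExt {a : ℝ → ℝ} (hp : Function.Periodic a (2 * Real.pi))
    (hs : ContDiff ℝ ∞ a) : ContinuousOn (hergExt a) (Metric.closedBall 0 1) :=
  continuousOn_extendFrom closure_unitBall.ge fun _ hv =>
    ⟨_, hergExt_tendsto hp hs (by simpa using hv)⟩

/-- In the open disk the derivative is the Herglotz integral of `deriv a` up to an explicit factor,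
which extends continuously to the circle. On a convex domain a continuous extension of the
derivative is the derivative of the extension. -/
lemma hasDerivWithinAt_hergExt {a : ℝ → ℝ} (hp : Function.Periodic a (2 * Real.pi))
    (hs : ContDiff ℝ ∞ a) {v : ℂ} (hv : ‖v‖ ≤ 1) (hv0 : v ≠ 0) :
    HasDerivWithinAt (hergExt a) (-Complex.I * v⁻¹ * hergExt (deriv a) v) (Metric.closedBall 0 1)
      v := by
  have ha : BdData a := .of_contDiff hp hs.continuous
  have hp' : Function.Periodic (deriv a) (2 * Real.pi) := fun θ => by
    rw [← deriv_comp_add_const]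
    congr 1
    funext x
    exact hp x
  have hs' : ContDiff ℝ ∞ (deriv a) := (contDiff_infty_iff_deriv.1 hs).2
  have hd : ∀ w ∈ Metric.ball (0 : ℂ) 1, w ≠ 0 →
      HasDerivAt (hergExt a) (-Complex.I * w⁻¹ * herg (deriv a) w) w := fun w hw hw0 => by
    refine (hasDerivAt_herg_smooth hp hs (by simpa using hw) hw0).congr_of_eventuallyEq ?_
    filter_upwards [Metric.isOpen_ball.mem_nhds hw] with x hx
    exact hergExt_eq ha (by simpa using hx)
  have hdiff : DifferentiableOn ℂ (hergExt a) (Metric.ball 0 1) :=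
    (differentiableOn_herg ha).congr fun x hx => hergExt_eq ha (by simpa using hx)
  have key : HasFDerivWithinAt (hergExt a)
      ((ContinuousLinearMap.toSpanSingleton ℂ (-Complex.I * v⁻¹ * hergExt (deriv a) v)).restrictScalars ℝ)
      (closure (Metric.ball (0 : ℂ) 1)) v := by
    refine hasFDerivWithinAt_closure_of_tendsto_fderiv (hdiff.restrictScalars ℝ)
      (convex_ball 0 1) Metric.isOpen_ball (fun y hy => ?_) ?_
    · rw [closure_unitBall] at hy
      exact (continuousOn_hergExt hp hs y hy).mono Metric.ball_subset_closedBall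
    · have h1 : Tendsto (fun w => -Complex.I * w⁻¹ * herg (deriv a) w) (𝓝[Metric.ball 0 1] v)
          (𝓝 (-Complex.I * v⁻¹ * hergExt (deriv a) v)) :=
        (tendsto_const_nhds.mul ((tendsto_inv₀ hv0).mono_left nhdsWithin_le_nhds)).mul
          (hergExt_tendsto hp' hs' hv)
      have h2 : Continuous fun c : ℂ => (ContinuousLinearMap.toSpanSingleton ℂ c).restrictScalars ℝ := by
        refine (ContinuousLinearMap.restrictScalarsL ℂ ℂ ℂ ℝ ℝ).continuous.comp ?_
        exact (ContinuousLinearMap.toSpanSingletonCLE (𝕜 := ℂ) (E := ℂ)).continuous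
      refine ((h2.tendsto _).comp h1).congr' ?_
      filter_upwards [self_mem_nhdsWithin,
        nhdsWithin_le_nhds (isOpen_ne.mem_nhds hv0)] with w hw hw0
      exact ((hd w hw hw0).hasFDerivAt.restrictScalars ℝ).fderiv.symm
  rw [closure_unitBall] at key
  exact hasDerivWithinAt_iff_hasFDerivWithinAt.2 (HasFDerivWithinAt.of_restrictScalars ℝ key rfl)

/-- Differentiation reproduces the same operator applied to `deriv a`, which allows induction on the
order. The centre is excluded only because of the factor `v⁻¹` in this formula. -/
lemma contDiffOn_hergExt {a : ℝ → ℝ} (hp : Function.Periodic a (2 * Real.pi))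
    (hs : ContDiff ℝ ∞ a) : ContDiffOn ℂ ∞ (hergExt a) (Metric.closedBall 0 1 \ {0}) := by
  have hu : UniqueDiffOn ℂ (Metric.closedBall (0 : ℂ) 1 \ {0}) := by
    refine UniqueDiffOn.mono_field (𝕜 := ℝ) ?_
    refine UniqueDiffOn.inter (uniqueDiffOn_convex (convex_closedBall 0 1) ?_) isOpen_compl_singleton
    exact ⟨0, by rw [interior_closedBall _ one_ne_zero]; simp⟩
  rw [contDiffOn_infty]
  intro n
  induction n generalizing a with
  | zero =>
    exact contDiffOn_zero.2 ((continuousOn_hergExt hp hs).mono Set.sdiff_subset)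
  | succ n ih =>
    have hp' : Function.Periodic (deriv a) (2 * Real.pi) := fun θ => by
      rw [← deriv_comp_add_const]
      congr 1
      funext x
      exact hp x
    have hd : ∀ v ∈ Metric.closedBall (0 : ℂ) 1 \ {0}, HasDerivWithinAt (hergExt a)
        (-Complex.I * v⁻¹ * hergExt (deriv a) v) (Metric.closedBall 0 1 \ {0}) v := fun v hv =>
      (hasDerivWithinAt_hergExt hp hs (by simpa using hv.1) hv.2).mono Set.sdiff_subset
    rw [show ((n + 1 : ℕ) : WithTop ℕ∞) = n + 1 by push_cast; rfl,
      contDiffOn_succ_iff_derivWithin hu]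
    refine ⟨fun v hv => (hd v hv).differentiableWithinAt, by simp, ?_⟩
    refine ContDiffOn.congr (f := fun v => -Complex.I * v⁻¹ * hergExt (deriv a) v) ?_
      fun v hv => (hd v hv).derivWithin (hu v hv)
    exact (contDiffOn_const.mul (contDiffOn_id.inv fun v hv => hv.2)).mul
      (ih hp' (contDiff_infty_iff_deriv.1 hs).2)

/-- Shifting an argument by a multiple of the period into a given half-open interval. -/
lemma exists_near_arg (θ φ : ℝ) : ∃ n : ℤ, |θ + n * (2 * Real.pi) - φ| ≤ Real.pi := by
  obtain ⟨n, hn, -⟩ := existsUnique_add_zsmul_mem_Ioc Real.two_pi_pos θ (φ - Real.pi)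
  refine ⟨n, ?_⟩
  simp only [zsmul_eq_mul] at hn
  rw [abs_le]
  constructor <;> linarith [hn.1, hn.2]

/-- The Herglotz integral of data which vanish near a boundary point. -/
lemma herg_of_vanishing {a : ℝ → ℝ} (ha : BdData a) {θ₀ c : ℝ} (hc : 0 < c)
    (h : ∀ θ, ‖ept θ - ept θ₀‖ < c → a θ = 0) :
    DifferentiableOn ℂ (herg a) (Metric.ball (ept θ₀) (c / 2)) ∧
      ∀ φ, ‖ept φ - ept θ₀‖ < c / 2 → (herg a (ept φ)).re = 0 := by
  refine ⟨fun v hv => ?_, fun φ hφ => ?_⟩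
  · rw [mem_ball_iff_norm] at hv
    set d := (c / 2 - ‖v - ept θ₀‖) / 2 with hd
    refine (hasDerivAt_herg ha (c := d) (by linarith) fun θ hθ w hw => ?_).differentiableAt.differentiableWithinAt
    rw [mem_ball_iff_norm] at hw
    have h1 : c ≤ ‖ept θ - ept θ₀‖ := not_lt.1 fun h' => hθ (h θ h')
    have h2 : ‖ept θ - ept θ₀‖ ≤ ‖ept θ - w‖ + ‖w - ept θ₀‖ := norm_sub_le_norm_sub_add_norm_sub _ _ _
    have h3 : ‖w - ept θ₀‖ ≤ ‖w - v‖ + ‖v - ept θ₀‖ := norm_sub_le_norm_sub_add_norm_sub _ _ _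
    have := norm_nonneg (v - ept θ₀)
    linarith
  · have hint : IntervalIntegrable (fun θ => (a θ : ℂ) * kern θ (ept φ)) volume (-Real.pi) Real.pi := by
      obtain ⟨B, hB⟩ := ha.bound
      have hB0 : 0 ≤ B := (abs_nonneg _).trans (hB 0)
      refine (intervalIntegrable_const (c := B * (2 / (c / 2)))).mono_fun
        ((Complex.continuous_ofReal.comp_aestronglyMeasurable ha.meas).mul
          (measurable_kern _).aestronglyMeasurable).restrict
        (Eventually.of_forall fun θ => ?_)
      simp only
      by_cases h0 : a θ = 0
      · simp only [h0, Complex.ofReal_zero, zero_mul, norm_zero]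
        exact norm_nonneg _
      · refine le_trans ?_ (le_abs_self _)
        rw [norm_mul, Complex.norm_real, kern, norm_div]
        refine mul_le_mul (hB θ) ?_ (by positivity) hB0
        refine div_le_div₀ (by norm_num) ?_ (by positivity) ?_
        · refine (norm_add_le _ _).trans ?_
          rw [norm_ept, norm_ept]
          norm_num
        · have h1 : c ≤ ‖ept θ - ept θ₀‖ := not_lt.1 fun h' => h0 (h θ h')
          have h2 : ‖ept θ - ept θ₀‖ ≤ ‖ept θ - ept φ‖ + ‖ept φ - ept θ₀‖ :=
            norm_sub_le_norm_sub_add_norm_sub _ _ _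
          linarith
    have h1 := Complex.reCLM.intervalIntegral_comp_comm hint
    simp only [Complex.reCLM_apply, Complex.re_ofReal_mul, kern_re_eq_zero, mul_zero,
      intervalIntegral.integral_zero] at h1
    have e : (2 * Real.pi : ℂ)⁻¹ = (((2 * Real.pi)⁻¹ : ℝ) : ℂ) := by push_cast; rfl
    rw [herg, e, Complex.re_ofReal_mul, ← h1, mul_zero]

/-- Boundary regularity of the Herglotz integral near a point where the data are smooth. -/
lemma hergExt_smooth_at {a : ℝ → ℝ} (ha : BdData a) {θ₀ η : ℝ} (hη : 0 < η)
    (hs : ContDiffOn ℝ ∞ a (Metric.ball θ₀ η)) :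
    ∃ N ∈ 𝓝 (ept θ₀), ContDiffOn ℂ ∞ (hergExt a) (N ∩ Metric.closedBall 0 1) ∧
      ∀ θ, ept θ ∈ N → (hergExt a (ept θ)).re = a θ := by
  -- Arguments at distance at least `η` have chord at least `2 * η / π`; half of it leaves room for
  -- strict inequalities, so the cut-off lives where the data are smooth.
  set R : ℝ := 2 / Real.pi * η / 2 with hR
  have hR0 : 0 < R := by
    have := Real.pi_pos
    positivity
  let χ : ContDiffBump (ept θ₀) := ⟨R / 2, R, by linarith, by linarith⟩
  -- The data are split into `b`, smooth on the whole circle, and `d`, vanishing near the point. The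
  -- integral of `d` is holomorphic across the circle there and has vanishing real part on it.
  set b : ℝ → ℝ := fun θ => χ (ept θ) * a θ with hb
  set d : ℝ → ℝ := fun θ => (1 - χ (ept θ)) * a θ with hd
  have hbd : BdData b := ha.smul χ.continuous
  have hdd : BdData d := ha.smul (χ := fun v => 1 - χ v) (continuous_const.sub χ.continuous)
  have hsum : a = fun θ => b θ + d θ := by funext θ; simp only [hb, hd]; ring
  have hbs : ContDiff ℝ ∞ b := by
    rw [contDiff_iff_contDiffAt]
    intro θ
    obtain ⟨n, hn⟩ := exists_near_arg θ θ₀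
    set θ' := θ + n * (2 * Real.pi) with hθ'
    have hχ : ContDiff ℝ ∞ fun θ => χ (ept θ) := χ.contDiff.comp contDiff_ept
    have he : ept θ' = ept θ := by
      rw [hθ']; exact_mod_cast ept_periodic.int_mul n θ
    by_cases hlt : |θ' - θ₀| < η
    · have h1 : ContDiffAt ℝ ∞ a θ' := hs.contDiffAt (Metric.isOpen_ball.mem_nhds (by
        rwa [mem_ball_iff_norm, Real.norm_eq_abs]))
      have h2 : ContDiffAt ℝ ∞ a θ := by
        have h3 : (fun x => a (x + n * (2 * Real.pi))) = a := by
          funext x; exact_mod_cast ha.periodic.int_mul n x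
        rw [← h3]
        exact ContDiffAt.comp θ h1 (contDiffAt_id.add contDiffAt_const)
      exact hχ.contDiffAt.mul h2
    · have h1 : ∀ᶠ x in 𝓝 θ, b x = 0 := by
        have h2 : R < ‖ept θ - ept θ₀‖ := by
          refine (half_lt_self (by have := Real.pi_pos; positivity)).trans_le ?_
          have h3 := abs_le_norm_ept_sub_one hn
          have h4 : ‖ept (θ' - θ₀) - 1‖ = ‖ept θ - ept θ₀‖ := by
            rw [← he, ← mul_one ‖ept (θ' - θ₀) - 1‖, ← norm_ept θ₀, ← norm_mul, sub_mul, ← ept_add]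
            simp
          rw [h4] at h3
          have h5 := Real.pi_pos
          have h6 : η ≤ Real.pi / 2 * ‖ept θ - ept θ₀‖ := (not_lt.1 hlt).trans h3
          calc 2 / Real.pi * η ≤ 2 / Real.pi * (Real.pi / 2 * ‖ept θ - ept θ₀‖) := by gcongr
            _ = _ := by field_simp
        have : ∀ᶠ x in 𝓝 θ, R < ‖ept x - ept θ₀‖ :=
          ((continuous_ept.sub continuous_const).norm.tendsto θ).eventually_const_lt h2
        filter_upwards [this] with x hx
        simp only [hb]
        rw [χ.zero_of_le_dist (by rw [dist_eq_norm]; exact hx.le), zero_mul]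
      exact (contDiffAt_const (c := (0 : ℝ))).congr_of_eventuallyEq h1
  obtain ⟨hd1, hd2⟩ := herg_of_vanishing hdd (θ₀ := θ₀) (c := R / 2) (by linarith) fun θ hθ => by
    simp only [hd]
    rw [χ.one_of_mem_closedBall (by rw [mem_closedBall_iff_norm]; exact hθ.le), sub_self, zero_mul]
  set N := Metric.ball (ept θ₀) (min (R / 2 / 2) 1) with hN
  have hNs : N ⊆ Metric.ball (ept θ₀) (R / 2 / 2) := Metric.ball_subset_ball (min_le_left _ _)
  have hN0 : ∀ v ∈ N, v ≠ 0 := by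
    rintro v hv rfl
    rw [hN, mem_ball_iff_norm, zero_sub, norm_neg, norm_ept] at hv
    exact absurd (hv.trans_le (min_le_right _ _)) (lt_irrefl _)
  have heq : ∀ v ∈ N ∩ Metric.closedBall 0 1, hergExt a v = hergExt b v + herg d v := by
    rintro v ⟨hv, hv1⟩
    rw [mem_closedBall_zero_iff] at hv1
    refine hergExt_eq_of_tendsto hv1 ?_
    have h1 := (hergExt_tendsto hbd.periodic hbs hv1).add
      ((hd1.differentiableAt (Metric.isOpen_ball.mem_nhds (hNs hv))).continuousAt.tendsto.mono_left
        (nhdsWithin_le_nhds (s := Metric.ball 0 1)))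
    refine h1.congr' ?_
    filter_upwards [self_mem_nhdsWithin] with w hw
    conv_rhs => rw [hsum]
    exact (herg_add hbd hdd (by simpa using hw)).symm
  refine ⟨N, Metric.ball_mem_nhds _ (lt_min (by positivity) one_pos), ?_, fun θ hθ => ?_⟩
  · refine ContDiffOn.congr ?_ heq
    refine ((contDiffOn_hergExt hbd.periodic hbs).mono fun v hv => ⟨hv.2, hN0 v hv.1⟩).add ?_
    exact ((hd1.contDiffOn Metric.isOpen_ball).mono hNs).mono Set.inter_subset_left
  · rw [heq _ ⟨hθ, by simp [norm_ept]⟩, Complex.add_re, hergExt_re hbd.periodic hbs,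
      hd2 θ (by have := hNs hθ; rwa [mem_ball_iff_norm] at this), add_zero]
    have h1 := congrFun hsum θ
    have h2 : d θ = 0 := by
      have h3 := hNs hθ
      rw [mem_ball_iff_norm] at h3
      simp only [hd]
      rw [χ.one_of_mem_closedBall (by rw [mem_closedBall_iff_norm]; exact h3.le.trans (half_le_self (by positivity))), sub_self,
        zero_mul]
    rw [h1]
    rw [h2, add_zero]

end LegAnnuli

namespace LegAnnuli

/-! ### The Herglotz integral near a jump of the boundary data -/

lemma BdData.translate {a : ℝ → ℝ} (ha : BdData a) (φ : ℝ) : BdData fun θ => a (φ + θ) := by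
  obtain ⟨B, hB⟩ := ha.bound
  exact ⟨fun θ => by simp only [← add_assoc, ha.periodic (φ + θ)],
    ha.meas.comp_measurePreserving (measurePreserving_add_left volume φ), B, fun θ => hB _⟩

lemma herg_congr_ae {a b : ℝ → ℝ} (h : ∀ᵐ θ, a θ = b θ) (v : ℂ) : herg a v = herg b v := by
  unfold herg
  congr 1
  refine intervalIntegral.integral_congr_ae ?_
  filter_upwards [h] with θ hθ _
  rw [hθ]

lemma norm_two_pi_inv : ‖(2 * Real.pi : ℂ)⁻¹‖ = (2 * Real.pi)⁻¹ := by
  have e : (2 * Real.pi : ℂ)⁻¹ = (((2 * Real.pi)⁻¹ : ℝ) : ℂ) := by push_cast; rfl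
  rw [e, Complex.norm_real, Real.norm_eq_abs, abs_of_pos (inv_pos.2 Real.two_pi_pos)]

/-- The source of logarithmic growth: the singularity `1 / |θ|` truncated at scale `d`. -/
lemma integral_inv_max {d : ℝ} (hd : 0 < d) (hdp : d ≤ Real.pi) :
    ∫ θ in (-Real.pi)..Real.pi, (max |θ| d)⁻¹ = 2 * (1 + Real.log (Real.pi / d)) := by
  have hpi := Real.pi_pos
  have hc : Continuous fun θ : ℝ => (max |θ| d)⁻¹ :=
    (continuous_abs.max continuous_const).inv₀ fun θ => (hd.trans_le (le_max_right _ _)).ne'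
  have hii : ∀ x y, IntervalIntegrable (fun θ : ℝ => (max |θ| d)⁻¹) volume x y := fun x y =>
    hc.intervalIntegrable _ _
  have h1 : ∫ θ in (0 : ℝ)..Real.pi, (max |θ| d)⁻¹ = 1 + Real.log (Real.pi / d) := by
    rw [← intervalIntegral.integral_add_adjacent_intervals (hii 0 d) (hii d Real.pi)]
    congr 1
    · rw [intervalIntegral.integral_congr (g := fun _ => d⁻¹)]
      · rw [intervalIntegral.integral_const, smul_eq_mul, sub_zero, mul_inv_cancel₀ hd.ne']
      · intro θ hθ
        rw [Set.uIcc_of_le hd.le] at hθ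
        simp only
        rw [abs_of_nonneg hθ.1, max_eq_right hθ.2]
    · rw [← integral_inv_of_pos hd hpi]
      refine intervalIntegral.integral_congr fun θ hθ => ?_
      rw [Set.uIcc_of_le hdp] at hθ
      rw [abs_of_nonneg (hd.le.trans hθ.1), max_eq_left hθ.1]
  have h2 : ∫ θ in (-Real.pi)..0, (max |θ| d)⁻¹ = 1 + Real.log (Real.pi / d) := by
    rw [← h1]
    have := intervalIntegral.integral_comp_neg (a := 0) (b := Real.pi)
      (fun θ : ℝ => (max |θ| d)⁻¹)
    simpa using this.symm
  rw [← intervalIntegral.integral_add_adjacent_intervals (hii _ 0) (hii 0 _), h1, h2]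
  ring

lemma norm_kern_le' {θ ρ : ℝ} (h0 : 0 ≤ ρ) (h1 : ρ < 1) (hθ : |θ| ≤ Real.pi) :
    ‖kern θ ρ‖ ≤ 2 * Real.pi * (max |θ| (1 - ρ))⁻¹ := by
  have hm : 0 < max |θ| (1 - ρ) := lt_max_of_lt_right (by linarith)
  rw [← div_eq_mul_inv, le_div_iff₀ hm, mul_comm]
  rcases le_total |θ| (1 - ρ) with h | h
  · rw [max_eq_right h, kern, norm_div]
    have e1 : ‖ept θ + ρ‖ ≤ 2 := by
      refine (norm_add_le _ _).trans ?_
      rw [norm_ept, Complex.norm_real, Real.norm_eq_abs, abs_of_nonneg h0]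
      linarith
    have e2 : 1 - ρ ≤ ‖ept θ - ρ‖ := by
      have := norm_sub_norm_le (ept θ) ρ
      rwa [norm_ept, Complex.norm_real, Real.norm_eq_abs, abs_of_nonneg h0] at this
    have e3 : 0 < ‖ept θ - ρ‖ := by linarith
    rw [← mul_div_assoc, div_le_iff₀ e3]
    have := Real.pi_gt_three
    nlinarith [norm_nonneg (ept θ + ρ)]
  · rw [max_eq_left h]
    exact norm_kern_le h0 h1.le hθ

lemma kern_re {θ ρ : ℝ} : (kern θ ρ).re = (1 - ρ ^ 2) / ‖ept θ - ρ‖ ^ 2 := by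
  have h1 : Complex.normSq (ept θ) = 1 := by rw [Complex.normSq_eq_norm_sq, norm_ept, one_pow]
  rw [Complex.normSq_apply] at h1
  rw [kern, Complex.div_re, ← Complex.normSq_eq_norm_sq, ← add_div]
  congr 1
  simp only [Complex.add_re, Complex.sub_re, Complex.add_im, Complex.sub_im, Complex.ofReal_re,
    Complex.ofReal_im]
  linarith

/-- One-sided limits at `0` together with a Dini type bound near `0`. -/
structure DiniCorner (a : ℝ → ℝ) (l r : ℝ) : Prop where
  left : Tendsto a (𝓝[<] 0) (𝓝 l)
  right : Tendsto a (𝓝[>] 0) (𝓝 r)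
  dini : ∃ C, ∀ᶠ φ in 𝓝[≠] 0,
    IntervalIntegrable (fun θ => |a (φ + θ) - a φ| / |θ|) volume (-(|φ| / 2)) (|φ| / 2) ∧
    ∫ θ in (-(|φ| / 2))..(|φ| / 2), |a (φ + θ) - a φ| / |θ| ≤ C

/-- The real part of the Herglotz integral tends to zero where the data do. -/
lemma herg_re_small {g : ℝ → ℝ} (hg : BdData g) (h0 : Tendsto g (𝓝 0) (𝓝 0)) {ε : ℝ} (hε : 0 < ε) :
    ∃ δ > 0, ∀ ρ φ : ℝ, 0 ≤ ρ → ρ < 1 → 1 - ρ < δ → |φ| < δ → |(herg g (ρ * ept φ)).re| ≤ ε := by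
  obtain ⟨B, hB⟩ := hg.bound
  have hB0 : 0 ≤ B := (abs_nonneg _).trans (hB 0)
  obtain ⟨δ₁, hδ₁, h1⟩ := Metric.tendsto_nhds_nhds.1 h0 (ε / 2) (by linarith)
  have hpi := Real.pi_pos
  -- Away from the point the distance in the Poisson kernel is at least `δ₁ / (2π)`, so the far part
  -- of the integrand is at most `K * (1 - ρ)`.
  set K : ℝ := B * (2 * (2 * Real.pi / δ₁) ^ 2) with hK
  have hK0 : 0 ≤ K := by positivity
  refine ⟨min (δ₁ / 2) (ε / 2 / (K + 1)), lt_min (by linarith) (by positivity),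
    fun ρ φ hρ0 hρ1 hρ hφ => ?_⟩
  have hρ2 : 1 - ρ < ε / 2 / (K + 1) := hρ.trans_le (min_le_right _ _)
  have hφ2 : |φ| < δ₁ / 2 := hφ.trans_le (min_le_left _ _)
  have hv : ‖(ρ : ℂ)‖ < 1 := by rwa [Complex.norm_real, Real.norm_eq_abs, abs_of_nonneg hρ0]
  have hck := continuous_kern hv
  have hckr : Continuous fun θ => (kern θ ρ).re := Complex.continuous_re.comp hck
  have hint := (hg.translate φ).intervalIntegrable_mul hck (-Real.pi) Real.pi
  have e1 := Complex.reCLM.intervalIntegral_comp_comm hint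
  simp only [Complex.reCLM_apply, Complex.re_ofReal_mul] at e1
  have e : (2 * Real.pi : ℂ)⁻¹ = (((2 * Real.pi)⁻¹ : ℝ) : ℂ) := by push_cast; rfl
  rw [herg_rotate hg, herg, e, Complex.re_ofReal_mul, ← e1, abs_mul,
    abs_of_pos (inv_pos.2 Real.two_pi_pos)]
  have hre : ∫ θ in (-Real.pi)..Real.pi, (kern θ ρ).re = 2 * Real.pi := by
    have := Complex.reCLM.intervalIntegral_comp_comm (hck.intervalIntegrable (μ := volume) (-Real.pi) Real.pi)
    simp only [Complex.reCLM_apply] at this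
    rw [this, integral_kern hv]
    simp
  -- Near the point the data are at most `ε / 2`, and the nonnegative Poisson kernel has total mass
  -- `2π`; far from it the kernel is `O(1 - ρ)`.
  have hbound : ‖∫ θ in (-Real.pi)..Real.pi, g (φ + θ) * (kern θ ρ).re‖ ≤
      ∫ θ in (-Real.pi)..Real.pi, (ε / 2 * (kern θ ρ).re + K * (1 - ρ)) := by
    refine intervalIntegral.norm_integral_le_of_norm_le (by linarith) ?_
      (((hckr.const_mul _).add continuous_const).intervalIntegrable _ _)
    refine Eventually.of_forall fun θ hθ => ?_
    have hP : 0 ≤ (kern θ ρ).re := by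
      rw [kern_re]
      have : ρ ^ 2 ≤ 1 := by nlinarith
      exact div_nonneg (by linarith) (by positivity)
    have hK1 : 0 ≤ K * (1 - ρ) := mul_nonneg hK0 (by linarith)
    rw [norm_mul, Real.norm_eq_abs, Real.norm_eq_abs, abs_of_nonneg hP]
    by_cases hs : |φ + θ| < δ₁
    · have := h1 (x := φ + θ) (by rwa [dist_zero_right])
      rw [dist_zero_right, Real.norm_eq_abs] at this
      nlinarith
    · have h2 : δ₁ / 2 ≤ |θ| := by
        have := abs_add_le φ θ
        linarith [not_lt.1 hs]
      have h3 : δ₁ / (2 * Real.pi) ≤ ‖ept θ - ρ‖ := by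
        have h4 := abs_le_norm_ept_sub_one (abs_le.2 ⟨hθ.1.le, hθ.2⟩)
        have h5 : ‖ept θ - 1‖ ≤ 2 * ‖ept θ - ρ‖ := by
          simpa [ept_zero] using norm_ept_sub_le (θ := θ) (φ := 0) hρ0 hρ1.le
        rw [div_le_iff₀ (by positivity)]
        nlinarith
      have h4 : (kern θ ρ).re ≤ 2 * (1 - ρ) * (2 * Real.pi / δ₁) ^ 2 := by
        rw [kern_re, div_eq_mul_inv]
        have h5 : (‖ept θ - ρ‖ ^ 2)⁻¹ ≤ (2 * Real.pi / δ₁) ^ 2 := by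
          rw [← inv_pow]
          have : ‖ept θ - ρ‖⁻¹ ≤ 2 * Real.pi / δ₁ := by
            rw [← inv_div]
            exact inv_anti₀ (by positivity) h3
          gcongr
        have h6 : 1 - ρ ^ 2 ≤ 2 * (1 - ρ) := by nlinarith
        exact mul_le_mul h6 h5 (by positivity) (by linarith)
      calc |g (φ + θ)| * (kern θ ρ).re ≤ B * (2 * (1 - ρ) * (2 * Real.pi / δ₁) ^ 2) :=
            mul_le_mul (hB _) h4 hP hB0
        _ = K * (1 - ρ) := by rw [hK]; ring
        _ ≤ _ := by nlinarith
  rw [intervalIntegral.integral_add ((hckr.const_mul _).intervalIntegrable _ _)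
    (continuous_const.intervalIntegrable _ _), intervalIntegral.integral_const_mul, hre,
    intervalIntegral.integral_const, smul_eq_mul, Real.norm_eq_abs] at hbound
  have hfin : K * (1 - ρ) ≤ ε / 2 := by
    have := mul_le_mul_of_nonneg_left hρ2.le (show 0 ≤ K + 1 by linarith)
    rw [mul_div_cancel₀ _ (by positivity)] at this
    nlinarith
  rw [inv_mul_le_iff₀ Real.two_pi_pos]
  nlinarith

/-- Here `k` is the size of the kernel up to a constant. Either the data are small at the point, or
the point is far away and `k` is bounded; only the first alternative meets the singularity. -/
lemma far_bound {g : ℝ → ℝ} {B ε δ₁ φ θ k : ℝ} (hB : ∀ θ, |g θ| ≤ B) (hε : 0 ≤ ε)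
    (hδ₁ : 0 < δ₁) (h1 : ∀ θ, |θ| < δ₁ → |g θ| ≤ ε) (hφ : |φ| < δ₁ / 2) (hk0 : 0 ≤ k)
    (hk : k ≤ |θ|⁻¹ ∨ |φ + θ| < δ₁) :
    |g (φ + θ)| * k ≤ ε * k + B * (2 / δ₁) := by
  have hB0 : 0 ≤ B := (abs_nonneg _).trans (hB 0)
  by_cases hs : |φ + θ| < δ₁
  · have := mul_le_mul_of_nonneg_right (h1 _ hs) hk0
    have : 0 ≤ B * (2 / δ₁) := by positivity
    linarith
  · have h2 : δ₁ / 2 ≤ |θ| := by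
      have := abs_add_le φ θ
      linarith [not_lt.1 hs]
    have h3 : k ≤ 2 / δ₁ := by
      refine (hk.resolve_right hs).trans ?_
      rw [← inv_div]
      exact inv_anti₀ (by positivity) h2
    have := mul_le_mul (hB (φ + θ)) h3 hk0 hB0
    have : 0 ≤ ε * k := by positivity
    linarith

lemma log_inv_le {d s K : ℝ} (hd : 0 < d) (hs : 0 < s) (hK : 0 < K) (h : s ≤ K * d) :
    Real.log (Real.pi / d) ≤ Real.log (Real.pi * K) - Real.log s := by
  have hpi := Real.pi_pos
  rw [← Real.log_div (by positivity) hs.ne']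
  refine Real.log_le_log (by positivity) ?_
  rw [div_le_div_iff₀ hd hs]
  nlinarith

/-- Sublogarithmic growth of the Herglotz integral where the data tend to zero and satisfy a Dini
type bound. -/
lemma herg_norm_small {g : ℝ → ℝ} (hg : BdData g) (h0 : Tendsto g (𝓝 0) (𝓝 0))
    (hd : DiniCorner g 0 0) {ε : ℝ} (hε : 0 < ε) :
    ∃ δ > 0, ∃ C, ∀ ρ φ : ℝ, 0 ≤ ρ → ρ < 1 → 1 - ρ < δ → |φ| < δ →
      ‖herg g (ρ * ept φ)‖ ≤ C - ε * Real.log (|φ| + (1 - ρ)) := by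
  obtain ⟨B, hB⟩ := hg.bound
  have hB0 : 0 ≤ B := (abs_nonneg _).trans (hB 0)
  have hpi := Real.pi_pos
  obtain ⟨δ₁, hδ₁, h1'⟩ := Metric.tendsto_nhds_nhds.1 h0 (ε / 4) (by linarith)
  have h1 : ∀ θ, |θ| < δ₁ → |g θ| ≤ ε / 4 := fun θ hθ => by
    have := h1' (x := θ) (by rwa [dist_zero_right])
    rw [dist_zero_right, Real.norm_eq_abs] at this
    exact this.le
  obtain ⟨C, hC⟩ := hd.dini
  rw [eventually_nhdsWithin_iff, Metric.eventually_nhds_iff] at hC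
  obtain ⟨δ₂, hδ₂, hC⟩ := hC
  refine ⟨min (min (δ₁ / 2) δ₂) 1, by positivity,
    |C| + B * (2 / δ₁) * (2 * Real.pi) + ε * (1 + Real.log (Real.pi * 4)) + ε, fun ρ φ hρ0 hρ1 hρ hφ => ?_⟩
  have hφ1 : |φ| < δ₁ / 2 := hφ.trans_le ((min_le_left _ _).trans (min_le_left _ _))
  have hφ2 : |φ| < δ₂ := hφ.trans_le ((min_le_left _ _).trans (min_le_right _ _))
  have hφ3 : |φ| < 1 := hφ.trans_le (min_le_right _ _)
  have hρ' : 1 - ρ < 1 := hρ.trans_le (min_le_right _ _)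
  have hy : 0 < 1 - ρ := by linarith
  have hs0 : 0 < |φ| + (1 - ρ) := by have := abs_nonneg φ; linarith
  have hpi3 := Real.pi_gt_three
  have hcm : ∀ d : ℝ, 0 < d → Continuous fun θ : ℝ => (max |θ| d)⁻¹ := fun d hd =>
    (continuous_abs.max continuous_const).inv₀ fun θ => (hd.trans_le (le_max_right _ _)).ne'
  -- Two regimes. If the point lies within a fixed angle of the radius to `1`, truncation of the
  -- kernel at scale `1 - ρ` is enough. Otherwise truncation must happen at scale `|φ|`, and the
  -- part `|θ| ≤ |φ| / 2` is handled by subtracting `g φ` and using the Dini bound.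
  rcases le_or_gt |φ| (1 - ρ) with hle | hlt
  · rw [herg_rotate hg, herg, norm_mul, norm_two_pi_inv, inv_mul_le_iff₀ Real.two_pi_pos]
    have hb : ‖∫ θ in (-Real.pi)..Real.pi, (g (φ + θ) : ℂ) * kern θ ρ‖ ≤
        ∫ θ in (-Real.pi)..Real.pi,
          2 * Real.pi * (ε / 4 * (max |θ| (1 - ρ))⁻¹ + B * (2 / δ₁)) := by
      refine intervalIntegral.norm_integral_le_of_norm_le (by linarith) ?_
        ((continuous_const.mul (((hcm _ hy).const_mul _).add continuous_const)).intervalIntegrable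
          _ _)
      refine Eventually.of_forall fun θ hθ => ?_
      rw [norm_mul, Complex.norm_real, Real.norm_eq_abs]
      have h2 := norm_kern_le' hρ0 hρ1 (abs_le.2 ⟨hθ.1.le, hθ.2⟩)
      have hmp : 0 < max |θ| (1 - ρ) := lt_max_of_lt_right hy
      have h3 := far_bound hB (by linarith : 0 ≤ ε / 4) hδ₁ h1 hφ1
        (k := (max |θ| (1 - ρ))⁻¹) (by positivity) (θ := θ) (by
          rcases eq_or_ne θ 0 with rfl | h
          · right; rw [add_zero]; linarith
          · left; exact inv_anti₀ (abs_pos.2 h) (le_max_left _ _))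
      calc |g (φ + θ)| * ‖kern θ ρ‖ ≤ |g (φ + θ)| * (2 * Real.pi * (max |θ| (1 - ρ))⁻¹) := by gcongr
        _ = 2 * Real.pi * (|g (φ + θ)| * (max |θ| (1 - ρ))⁻¹) := by ring
        _ ≤ _ := by gcongr
    rw [intervalIntegral.integral_const_mul, intervalIntegral.integral_add
      (((hcm _ hy).const_mul _).intervalIntegrable _ _) (continuous_const.intervalIntegrable _ _),
      intervalIntegral.integral_const_mul, integral_inv_max hy (by linarith),
      intervalIntegral.integral_const, smul_eq_mul] at hb
    refine hb.trans (mul_le_mul_of_nonneg_left ?_ Real.two_pi_pos.le)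
    have h4 := log_inv_le (K := 4) hy hs0 (by norm_num) (by linarith)
    have h5 : Real.log (|φ| + (1 - ρ)) ≤ 1 := by
      have := Real.log_le_sub_one_of_pos hs0
      linarith
    have h6 := abs_nonneg C
    have h7 : 0 ≤ Real.log (Real.pi * 4) := Real.log_nonneg (by linarith)
    nlinarith
  · have hφ0 : φ ≠ 0 := fun h => by rw [h, abs_zero] at hlt; linarith
    set d := |φ| / 2 with hdd
    have hd0 : 0 < d := by have := abs_pos.2 hφ0; positivity
    obtain ⟨hCi, hCb⟩ := hC (by rwa [dist_zero_right]) hφ0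
    set D : ℝ → ℝ := fun θ => |g (φ + θ) - g φ| / |θ| with hD
    have hIoc : IntegrableOn D (Set.Ioc (-d) d) := by
      rwa [intervalIntegrable_iff, Set.uIoc_of_le (by linarith)] at hCi
    have hind : Integrable ((Set.Ioc (-d) d).indicator D) volume :=
      hIoc.integrable_indicator measurableSet_Ioc
    have hindI : ∫ θ in (-Real.pi)..Real.pi, (Set.Ioc (-d) d).indicator D θ ≤ |C| := by
      rw [intervalIntegral.integral_of_le (by linarith), setIntegral_indicator measurableSet_Ioc,
        Set.inter_eq_self_of_subset_right (Set.Ioc_subset_Ioc (by linarith) (by linarith)),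
        ← intervalIntegral.integral_of_le (by linarith)]
      exact hCb.trans (le_abs_self C)
    rw [herg_eq_hergPolar hg hρ0 hρ1, hergPolar]
    have hb : ‖∫ θ in (-Real.pi)..Real.pi, ((g (φ + θ) - g φ : ℝ) : ℂ) * kern θ ρ‖ ≤
        ∫ θ in (-Real.pi)..Real.pi, 2 * Real.pi * ((Set.Ioc (-d) d).indicator D θ +
          (ε / 2 * (max |θ| d)⁻¹ + B * (2 / δ₁))) := by
      refine intervalIntegral.norm_integral_le_of_norm_le (by linarith) ?_
        ((hind.intervalIntegrable.add ((((hcm _ hd0).const_mul _).add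
          continuous_const).intervalIntegrable _ _)).const_mul _)
      have hne : ∀ᵐ θ : ℝ, θ ∉ ({0} : Set ℝ) := (Set.countable_singleton 0).ae_notMem volume
      filter_upwards [hne] with θ hθ0 hθ
      have hθ0' : 0 < |θ| := abs_pos.2 hθ0
      rw [norm_mul, Complex.norm_real, Real.norm_eq_abs]
      have h2 := norm_kern_le hρ0 hρ1.le (abs_le.2 ⟨hθ.1.le, hθ.2⟩)
      have h3 : ‖kern θ ρ‖ ≤ 2 * Real.pi * |θ|⁻¹ := by
        rw [← div_eq_mul_inv, le_div_iff₀ hθ0', mul_comm]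
        exact h2
      have hp : 0 ≤ ε / 2 * (max |θ| d)⁻¹ + B * (2 / δ₁) := by
        have : 0 < max |θ| d := lt_max_of_lt_right hd0
        positivity
      refine (mul_le_mul_of_nonneg_left h3 (abs_nonneg _)).trans ?_
      rw [mul_left_comm]
      refine mul_le_mul_of_nonneg_left ?_ Real.two_pi_pos.le
      by_cases hm : θ ∈ Set.Ioc (-d) d
      · rw [Set.indicator_of_mem hm, ← div_eq_mul_inv]
        simp only [hD]
        linarith
      · rw [Set.indicator_of_notMem hm, zero_add]
        have hdl : d ≤ |θ| := by
          by_contra! hlt'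
          rw [abs_lt] at hlt'
          exact hm ⟨hlt'.1, hlt'.2.le⟩
        rw [max_eq_left hdl]
        have h4 := far_bound hB (by linarith : 0 ≤ ε / 4) hδ₁ h1 hφ1
          (k := |θ|⁻¹) (by positivity) (θ := θ) (Or.inl le_rfl)
        have h5 := h1 φ (by linarith)
        have h6 := abs_sub (g (φ + θ)) (g φ)
        have h7 : 0 < |θ|⁻¹ := inv_pos.2 hθ0'
        nlinarith
    have hi2 : IntervalIntegrable (fun θ : ℝ => ε / 2 * (max |θ| d)⁻¹ + B * (2 / δ₁)) volume
        (-Real.pi) Real.pi :=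
      (((hcm _ hd0).const_mul _).add continuous_const).intervalIntegrable _ _
    rw [intervalIntegral.integral_const_mul, intervalIntegral.integral_add
      hind.intervalIntegrable hi2, intervalIntegral.integral_add
      (((hcm _ hd0).const_mul _).intervalIntegrable _ _) (continuous_const.intervalIntegrable _ _),
      intervalIntegral.integral_const_mul, integral_inv_max hd0 (by linarith),
      intervalIntegral.integral_const, smul_eq_mul] at hb
    have hg1 : ‖((g φ : ℝ) : ℂ)‖ ≤ ε / 4 := by
      rw [Complex.norm_real, Real.norm_eq_abs]
      exact h1 φ (by linarith)
    have h4 := log_inv_le (K := 4) hd0 hs0 (by norm_num) (by linarith)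
    have h7 : 0 ≤ Real.log (Real.pi * 4) := Real.log_nonneg (by linarith)
    refine (norm_add_le _ _).trans ?_
    rw [norm_mul, norm_two_pi_inv]
    have h8 : (2 * Real.pi)⁻¹ * ‖∫ θ in (-Real.pi)..Real.pi, ((g (φ + θ) - g φ : ℝ) : ℂ) * kern θ ρ‖ ≤
        |C| + (ε / 2 * (2 * (1 + Real.log (Real.pi / d))) + (Real.pi - -Real.pi) * (B * (2 / δ₁))) := by
      rw [inv_mul_le_iff₀ Real.two_pi_pos]
      refine hb.trans (mul_le_mul_of_nonneg_left ?_ Real.two_pi_pos.le)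
      linarith
    have h9 : ε * Real.log (Real.pi / d) ≤ ε * (Real.log (Real.pi * 4) - Real.log (|φ| + (1 - ρ))) := by
      gcongr
    simp only at h8 ⊢
    linarith

end LegAnnuli

/-! ### Asymptotics of the Herglotz integral at a jump -/

namespace LegAnnuli

/-- The function which is `r` on the upper and `l` on the lower half of the circle. -/
noncomputable def stepFun (l r θ : ℝ) : ℝ := if 0 < Real.sin θ then r else l

lemma bdData_stepFun (l r : ℝ) : BdData (stepFun l r) := by
  refine ⟨fun θ => by simp only [stepFun, Real.sin_periodic θ], ?_, |l| + |r|, fun θ => ?_⟩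
  · refine Measurable.aestronglyMeasurable ?_
    exact Measurable.ite (measurableSet_lt measurable_const Real.measurable_sin) measurable_const
      measurable_const
  · have := abs_nonneg l
    have := abs_nonneg r
    unfold stepFun
    split_ifs <;> linarith

lemma stepFun_of_pos {l r θ : ℝ} (h0 : 0 < θ) (h1 : θ < Real.pi) : stepFun l r θ = r :=
  if_pos (Real.sin_pos_of_pos_of_lt_pi h0 h1)

lemma stepFun_of_neg {l r θ : ℝ} (h0 : θ < 0) (h1 : -Real.pi < θ) : stepFun l r θ = l :=
  if_neg (Real.sin_neg_of_neg_of_neg_pi_lt h0 h1).le.not_gt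

/-- The explicit primitive of the kernel is evaluated on each half-circle. The term `log (1 + v)`
belongs to the jump at `-1` and is regular at `1`. -/
lemma herg_stepFun (l r : ℝ) {v : ℂ} (hv : ‖v‖ < 1) : herg (stepFun l r) v =
    l + (r - l) * (1 / 2 + Complex.I / Real.pi * (Complex.log (1 - v) - Complex.log (1 + v))) := by
  have hpi := Real.pi_pos
  have hii := fun x y => (bdData_stepFun l r).intervalIntegrable_mul (continuous_kern hv) x y
  have hki := fun x y => (continuous_kern hv).intervalIntegrable (μ := volume) x y
  have hne : ∀ᵐ θ : ℝ, θ ∉ ({0, Real.pi} : Set ℝ) :=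
    ((Set.countable_singleton _).insert _).ae_notMem volume
  have h1 : ∫ θ in (0 : ℝ)..Real.pi, (stepFun l r θ : ℂ) * kern θ v =
      r * ∫ θ in (0 : ℝ)..Real.pi, kern θ v := by
    rw [← intervalIntegral.integral_const_mul]
    refine intervalIntegral.integral_congr_ae ?_
    filter_upwards [hne] with θ hθ hm
    rw [Set.uIoc_of_le hpi.le] at hm
    rw [stepFun_of_pos hm.1 (lt_of_le_of_ne hm.2 fun h => hθ (by simp [h]))]
  have h2 : ∫ θ in (-Real.pi)..0, (stepFun l r θ : ℂ) * kern θ v =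
      l * ∫ θ in (-Real.pi)..0, kern θ v := by
    rw [← intervalIntegral.integral_const_mul]
    refine intervalIntegral.integral_congr_ae ?_
    filter_upwards [hne] with θ hθ hm
    rw [Set.uIoc_of_le (by linarith)] at hm
    rw [stepFun_of_neg (lt_of_le_of_ne hm.2 fun h => hθ (by simp [h])) hm.1]
  have h3 : ∫ θ in (0 : ℝ)..Real.pi, kern θ v =
      Real.pi + 2 * Complex.I * (Complex.log (1 - v) - Complex.log (1 + v)) := by
    rw [intervalIntegral.integral_eq_sub_of_hasDerivAt (fun θ _ => hasDerivAt_primitive hv θ)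
      (hki _ _)]
    have e : ept (-Real.pi) = -1 := by
      rw [ept]; push_cast; rw [neg_mul, Complex.exp_neg, Complex.exp_pi_mul_I]; norm_num
    rw [e, neg_zero, ept_zero, mul_one, mul_neg_one, sub_neg_eq_add, Complex.ofReal_zero]
    ring
  have h4 : ∫ θ in (-Real.pi)..0, kern θ v =
      2 * Real.pi - ∫ θ in (0 : ℝ)..Real.pi, kern θ v := by
    rw [← integral_kern hv]
    exact eq_sub_of_add_eq (intervalIntegral.integral_add_adjacent_intervals (hki _ 0) (hki 0 _))
  rw [herg, ← intervalIntegral.integral_add_adjacent_intervals (hii _ 0) (hii 0 _), h1, h2, h4, h3]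
  have : (Real.pi : ℂ) ≠ 0 := by exact_mod_cast hpi.ne'
  field_simp
  ring

/-- `1 - exp (I * ζ)` is asymptotic to `-I * ζ`, whose argument is `arg ζ - π / 2`; the remaining
logarithm tends to `log 2`. -/
lemma one_sub_cexp_log : Tendsto
    (fun ζ : ℂ => Complex.log (1 - Complex.exp (Complex.I * ζ)) -
      Complex.log (1 + Complex.exp (Complex.I * ζ)) -
      (Real.log ‖ζ‖ + (ζ.arg - Real.pi / 2 : ℝ) * Complex.I))
    (𝓝[{ζ | 0 < ζ.im}] 0) (𝓝 (-Real.log 2 : ℝ)) := by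
  set q : ℂ → ℂ := fun ζ => (1 - Complex.exp (Complex.I * ζ)) / (-Complex.I * ζ) with hq
  have hq1 : Tendsto q (𝓝[≠] 0) (𝓝 1) := by
    have h1 : HasDerivAt (fun ζ : ℂ => Complex.exp (Complex.I * ζ)) Complex.I 0 := by
      have := ((hasDerivAt_id (0 : ℂ)).const_mul Complex.I).cexp
      simpa using this
    have h2 := hasDerivAt_iff_tendsto_slope.1 h1
    have h3 := h2.div_const Complex.I
    rw [div_self Complex.I_ne_zero] at h3
    refine h3.congr' ?_
    filter_upwards [self_mem_nhdsWithin] with ζ hζ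
    have hζ' : ζ ≠ 0 := hζ
    rw [slope_def_field]
    simp only [hq, mul_zero, Complex.exp_zero, sub_zero]
    have := Complex.I_ne_zero
    field_simp
    ring
  have hq2 : Tendsto q (𝓝[{ζ | 0 < ζ.im}] 0) (𝓝 1) := hq1.mono_left (nhdsWithin_mono _ fun ζ hζ h => by
    have h' : (0 : ℝ) < ζ.im := hζ
    rw [show ζ = 0 from h] at h'
    exact lt_irrefl _ h')
  have hl1 : Tendsto (fun ζ => Complex.log (q ζ)) (𝓝[{ζ | 0 < ζ.im}] 0) (𝓝 0) := by
    have := hq2.clog (by simp)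
    rwa [Complex.log_one] at this
  have hl2 : Tendsto (fun ζ : ℂ => Complex.log (1 + Complex.exp (Complex.I * ζ)))
      (𝓝[{ζ | 0 < ζ.im}] 0) (𝓝 (Real.log 2 : ℝ)) := by
    have h1 : Tendsto (fun ζ : ℂ => 1 + Complex.exp (Complex.I * ζ)) (𝓝[{ζ | 0 < ζ.im}] 0) (𝓝 2) := by
      have : Continuous fun ζ : ℂ => 1 + Complex.exp (Complex.I * ζ) := by fun_prop
      have h2 := this.tendsto 0
      simp only [mul_zero, Complex.exp_zero] at h2
      norm_num at h2
      exact h2.mono_left nhdsWithin_le_nhds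
    have h3 := h1.clog (by simp [Complex.slitPlane])
    rwa [Complex.ofReal_log (by norm_num)]
  have hfin := hl1.sub hl2
  rw [zero_sub, ← Complex.ofReal_neg] at hfin
  refine hfin.congr' ?_
  have hre : ∀ᶠ ζ in 𝓝[{ζ : ℂ | 0 < ζ.im}] 0, 0 < (q ζ).re :=
    ((Complex.continuous_re.tendsto _).comp hq2).eventually_const_lt (by simp)
  filter_upwards [hre, self_mem_nhdsWithin] with ζ hζ him
  have him' : 0 < ζ.im := him
  have hζ0 : ζ ≠ 0 := by rintro rfl; simp at him'
  have hIζ : -Complex.I * ζ ≠ 0 := mul_ne_zero (neg_ne_zero.2 Complex.I_ne_zero) hζ0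
  have hq0 : q ζ ≠ 0 := by intro h; rw [h] at hζ; simp at hζ
  have e1 : 1 - Complex.exp (Complex.I * ζ) = (-Complex.I * ζ) * q ζ := by
    simp only [hq]; rw [mul_div_cancel₀ _ hIζ]
  have harg := Complex.arg_nonneg_iff.2 him'.le
  have harg' := Complex.arg_le_pi ζ
  have hpi := Real.pi_pos
  have e2 : (-Complex.I * ζ).arg = ζ.arg - Real.pi / 2 := by
    rw [Complex.arg_mul (neg_ne_zero.2 Complex.I_ne_zero) hζ0, Complex.arg_neg_I]
    · ring
    · rw [Complex.arg_neg_I]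
      constructor <;> linarith
  have e3 : (-Complex.I * ζ).re = ζ.im := by simp
  have h4 : |(-Complex.I * ζ).arg| < Real.pi / 2 :=
    Complex.abs_arg_lt_pi_div_two_iff.2 (Or.inl (by rw [e3]; exact him'))
  have h5 : |(q ζ).arg| < Real.pi / 2 := Complex.abs_arg_lt_pi_div_two_iff.2 (Or.inl hζ)
  rw [abs_lt] at h4 h5
  rw [e1, Complex.log_mul hIζ hq0 ⟨by linarith [h4.1, h5.1], by linarith [h4.2, h5.2]⟩]
  have e4 : Complex.log (-Complex.I * ζ) =
      Real.log ‖ζ‖ + (ζ.arg - Real.pi / 2 : ℝ) * Complex.I := by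
    rw [Complex.log, e2, norm_mul, norm_neg, Complex.norm_I, one_mul]
  rw [e4]
  ring

/-- Along `S`, near `0`, the function `f` behaves like the holomorphic function whose real part is
`r` on the positive and `l` on the negative real half-axis. -/
def CornerAsymp (S : Set ℂ) (f : ℂ → ℂ) (l r : ℝ) : Prop :=
  ∀ ε > 0, ∃ C : ℝ, ∀ᶠ ζ in 𝓝[S] 0,
    |(f ζ).re - (r - (r - l) * (ζ.arg / Real.pi))| ≤ ε ∧
    |(f ζ).im - (r - l) / Real.pi * Real.log ‖ζ‖| ≤ C - ε * Real.log ‖ζ‖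

lemma eventually_log_nonpos (S : Set ℂ) : ∀ᶠ ζ in 𝓝[S] (0 : ℂ), Real.log ‖ζ‖ ≤ 0 := by
  filter_upwards [nhdsWithin_le_nhds (Metric.ball_mem_nhds (0 : ℂ) one_pos)] with ζ hζ
  exact Real.log_nonpos (norm_nonneg _) (by simpa using (mem_ball_zero_iff.1 hζ).le)

lemma CornerAsymp.add {S : Set ℂ} {f g : ℂ → ℂ} {l r : ℝ} {c : ℂ} (hf : CornerAsymp S f l r)
    (hg : Tendsto g (𝓝[S] 0) (𝓝 c)) (hc : c.re = 0) : CornerAsymp S (fun ζ => f ζ + g ζ) l r := by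
  intro ε hε
  obtain ⟨C, hC⟩ := hf (ε / 2) (by linarith)
  have h1 : ∀ᶠ ζ in 𝓝[S] 0, |(g ζ).re| < ε / 2 := by
    have := ((Complex.continuous_re.tendsto _).comp hg).abs
    rw [hc, abs_zero] at this
    exact this.eventually_lt_const (by linarith)
  have h2 : ∀ᶠ ζ in 𝓝[S] 0, |(g ζ).im| < |c.im| + 1 :=
    ((Complex.continuous_im.tendsto _).comp hg).abs.eventually_lt_const (by linarith)
  refine ⟨C + |c.im| + 1, ?_⟩
  filter_upwards [hC, h1, h2, eventually_log_nonpos S] with ζ ⟨h3, h4⟩ h5 h6 h7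
  rw [Complex.add_re, Complex.add_im]
  rw [abs_le] at h3 h4
  rw [abs_lt] at h5 h6
  have : ε * Real.log ‖ζ‖ ≤ ε / 2 * Real.log ‖ζ‖ := by nlinarith
  exact ⟨abs_le.2 ⟨by linarith [h3.1, h5.1], by linarith [h3.2, h5.2]⟩,
    abs_le.2 ⟨by linarith [h4.1, h6.1], by linarith [h4.2, h6.2]⟩⟩

/-- Passage from the open to the closed half-plane by continuity. -/
lemma CornerAsymp.closure {f : ℂ → ℂ} {l r : ℝ} (hf : CornerAsymp {ζ | 0 < ζ.im} f l r)
    (hc : ∀ᶠ ζ in 𝓝[{ζ : ℂ | 0 ≤ ζ.im ∧ ζ ≠ 0}] 0,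
      Tendsto f (𝓝[{ζ | 0 < ζ.im}] ζ) (𝓝 (f ζ))) :
    CornerAsymp {ζ | 0 ≤ ζ.im ∧ ζ ≠ 0} f l r := by
  intro ε hε
  obtain ⟨C, hC⟩ := hf ε hε
  refine ⟨C, ?_⟩
  rw [eventually_nhdsWithin_iff, Metric.eventually_nhds_iff] at hC hc
  obtain ⟨δ, hδ, hC⟩ := hC
  obtain ⟨δ', hδ', hc⟩ := hc
  rw [eventually_nhdsWithin_iff]
  filter_upwards [Metric.ball_mem_nhds 0 hδ, Metric.ball_mem_nhds 0 hδ'] with ζ h1 h2 hζ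
  have hlim := hc h2 hζ
  have hev : ∀ᶠ ξ in 𝓝[{ζ | 0 < ζ.im}] ζ,
      |(f ξ).re - (r - (r - l) * (ξ.arg / Real.pi))| ≤ ε ∧
      |(f ξ).im - (r - l) / Real.pi * Real.log ‖ξ‖| ≤ C - ε * Real.log ‖ξ‖ := by
    filter_upwards [nhdsWithin_le_nhds (Metric.isOpen_ball.mem_nhds h1), self_mem_nhdsWithin] with ξ hξ hξ'
    exact hC hξ hξ'
  have harg : Tendsto Complex.arg (𝓝[{ζ | 0 < ζ.im}] ζ) (𝓝 ζ.arg) := by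
    have h3 : {ζ : ℂ | 0 < ζ.im} ⊆ {ζ | 0 ≤ ζ.im} := fun ζ (h : 0 < ζ.im) => h.le
    by_cases hs : ζ ∈ Complex.slitPlane
    · exact (Complex.continuousAt_arg hs).tendsto.mono_left nhdsWithin_le_nhds
    · rw [Complex.mem_slitPlane_iff_not_le_zero, not_not] at hs
      have h4 : ζ.re < 0 := lt_of_le_of_ne (Complex.le_def.1 hs).1 fun h => hζ.2 <|
        Complex.ext h (Complex.le_def.1 hs).2
      exact (Complex.continuousWithinAt_arg_of_re_neg_of_im_zero h4 (Complex.le_def.1 hs).2).tendsto.mono_left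
        (nhdsWithin_mono _ h3)
  have hlog : Tendsto (fun ξ : ℂ => Real.log ‖ξ‖) (𝓝[{ζ | 0 < ζ.im}] ζ) (𝓝 (Real.log ‖ζ‖)) :=
    ((continuous_norm.tendsto ζ).log (norm_ne_zero_iff.2 hζ.2)).mono_left nhdsWithin_le_nhds
  have hne : (𝓝[{ζ : ℂ | 0 < ζ.im}] ζ).NeBot := by
    rw [← mem_closure_iff_nhdsWithin_neBot, Complex.closure_setOfPred_lt_im]
    exact hζ.1
  have hre := (Complex.continuous_re.tendsto _).comp hlim
  have him := (Complex.continuous_im.tendsto _).comp hlim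
  exact ⟨le_of_tendsto ((hre.sub (tendsto_const_nhds.sub
      (tendsto_const_nhds.mul (harg.div_const _)))).abs) (hev.mono fun _ h => h.1),
    le_of_tendsto_of_tendsto (him.sub (tendsto_const_nhds.mul hlog)).abs
      (tendsto_const_nhds.sub (tendsto_const_nhds.mul hlog)) (hev.mono fun _ h => h.2)⟩

/-- Subtracting the step function removes the jump. The Dini integrals do not change, because the
interval of half-width `|φ| / 2` around `φ` lies on one side of `0`, where the step is constant. -/
lemma DiniCorner.remainder {a : ℝ → ℝ} {l r : ℝ} (ha : BdData a) (h : DiniCorner a l r) :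
    ∃ g : ℝ → ℝ, BdData g ∧ Tendsto g (𝓝 0) (𝓝 0) ∧ DiniCorner g 0 0 ∧
      ∀ᵐ θ, a θ = g θ + stepFun l r θ := by
  classical
  have hpi := Real.pi_pos
  -- Redefinition on a null set makes the remainder tend to `0` along the full neighbourhood filter,
  -- including the value at the jump itself.
  set g : ℝ → ℝ := fun θ => if ept θ = 1 then 0 else a θ - stepFun l r θ with hg
  have hae : ∀ᵐ θ, ept θ ≠ 1 := by
    have : (fun θ => ept θ) ⁻¹' {1} ⊆ Set.range fun n : ℤ => (n : ℝ) * (2 * Real.pi) := by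
      intro θ hθ
      have h1 : cpt 1 θ = cpt 1 0 := by rw [← ept_eq_cpt, ← ept_eq_cpt, ept_zero]; exact hθ
      obtain ⟨n, hn⟩ := (cpt_eq_iff one_pos).1 h1
      exact ⟨n, by simp [hn]⟩
    exact ((Set.countable_range _).mono this).ae_notMem volume
  have hne : ∀ θ, θ ≠ 0 → |θ| < Real.pi → ept θ ≠ 1 := fun θ h0 h1 h2 => by
    have := abs_le_norm_ept_sub_one h1.le
    rw [h2, sub_self, norm_zero, mul_zero] at this
    exact h0 (abs_nonpos_iff.1 this)
  have hr : ∀ θ, 0 < θ → θ < Real.pi → g θ = a θ - r := fun θ h0 h1 => by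
    simp only [hg]
    rw [if_neg (hne θ h0.ne' (by rwa [abs_of_pos h0])), stepFun_of_pos h0 h1]
  have hl : ∀ θ, θ < 0 → -Real.pi < θ → g θ = a θ - l := fun θ h0 h1 => by
    simp only [hg]
    rw [if_neg (hne θ h0.ne (by rw [abs_of_neg h0]; linarith)), stepFun_of_neg h0 h1]
  have haeg : ∀ᵐ θ, a θ = g θ + stepFun l r θ := by
    filter_upwards [hae] with θ hθ
    simp only [hg]
    rw [if_neg hθ]
    ring
  have hgl : Tendsto g (𝓝[<] 0) (𝓝 0) := by
    have h1 := h.left.sub_const l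
    rw [sub_self] at h1
    refine h1.congr' ?_
    filter_upwards [self_mem_nhdsWithin, nhdsWithin_le_nhds (Ioi_mem_nhds (show -Real.pi < 0 by linarith))] with θ h2 h3
    exact (hl θ h2 h3).symm
  have hgr : Tendsto g (𝓝[>] 0) (𝓝 0) := by
    have h1 := h.right.sub_const r
    rw [sub_self] at h1
    refine h1.congr' ?_
    filter_upwards [self_mem_nhdsWithin, nhdsWithin_le_nhds (Iio_mem_nhds hpi)] with θ h2 h3
    exact (hr θ h2 h3).symm
  have hg0 : g 0 = 0 := by simp [hg, ept_zero]
  refine ⟨g, ⟨fun θ => ?_, ?_, ?_⟩, ?_, ⟨hgl, hgr, ?_⟩, haeg⟩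
  · simp only [hg, ept_periodic θ, ha.periodic θ, (bdData_stepFun l r).periodic θ]
  · refine (ha.meas.sub (bdData_stepFun l r).meas).congr ?_
    filter_upwards [haeg] with θ hθ
    simp only [Pi.sub_apply, hθ, add_sub_cancel_right]
  · obtain ⟨A, hA⟩ := ha.bound
    obtain ⟨B, hB⟩ := (bdData_stepFun l r).bound
    refine ⟨A + B, fun θ => ?_⟩
    have h1 := hA θ
    have h2 := hB θ
    simp only [hg]
    split_ifs
    · rw [abs_zero]; linarith [abs_nonneg (a θ), abs_nonneg (stepFun l r θ)]
    · exact (abs_sub _ _).trans (by linarith)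
  · have hn : 𝓝 (0 : ℝ) = 𝓝[<] 0 ⊔ (pure 0 ⊔ 𝓝[>] 0) := by
      rw [← nhdsWithin_insert, Set.Ioi_insert, nhdsLT_sup_nhdsGE]
    have hp : Tendsto g (pure 0 ⊔ 𝓝[>] 0) (𝓝 0) := Tendsto.sup ?_ hgr
    · have := hgl.sup hp
      rwa [← hn] at this
    rw [tendsto_pure_left]
    intro s hs
    rw [hg0]
    exact mem_of_mem_nhds hs
  · obtain ⟨C, hC⟩ := h.dini
    refine ⟨C, ?_⟩
    filter_upwards [hC, self_mem_nhdsWithin,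
      nhdsWithin_le_nhds (Metric.ball_mem_nhds (0 : ℝ) (show 0 < Real.pi / 2 by positivity))]
      with φ ⟨h1, h2⟩ hφ0 hφ1
    have hφ0' : φ ≠ 0 := hφ0
    rw [mem_ball_zero_iff, Real.norm_eq_abs] at hφ1
    have heq : Set.EqOn (fun θ => |a (φ + θ) - a φ| / |θ|) (fun θ => |g (φ + θ) - g φ| / |θ|)
        (Set.uIcc (-(|φ| / 2)) (|φ| / 2)) := by
      intro θ hθ
      rw [Set.uIcc_of_le (by linarith [abs_nonneg φ])] at hθ
      simp only
      rcases hφ0'.lt_or_gt with hn | hp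
      · rw [abs_of_neg hn] at hφ1 hθ
        rw [hl φ hn (by linarith), hl (φ + θ) (by linarith [hθ.2]) (by linarith [hθ.1])]
        congr 2
        ring
      · rw [abs_of_pos hp] at hφ1 hθ
        rw [hr φ hp (by linarith), hr (φ + θ) (by linarith [hθ.1]) (by linarith [hθ.2])]
        congr 2
        ring
    exact ⟨h1.congr (heq.mono Set.uIoc_subset_uIcc), by rwa [← intervalIntegral.integral_congr heq]⟩

/-- Asymptotics of the Herglotz integral at a jump of the boundary data. -/
lemma cornerAsymp_herg {a : ℝ → ℝ} {l r : ℝ} (ha : BdData a) (h : DiniCorner a l r) :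
    CornerAsymp {ζ | 0 < ζ.im} (fun ζ => herg a (Complex.exp (Complex.I * ζ))) l r := by
  intro ε hε
  have hpi := Real.pi_pos
  obtain ⟨g, hg, hg0, hgd, hag⟩ := h.remainder ha
  obtain ⟨δ₁, hδ₁, h1⟩ := herg_re_small hg hg0 (half_pos hε)
  obtain ⟨δ₂, hδ₂, C, h2⟩ := herg_norm_small hg hg0 hgd hε
  have hL := one_sub_cexp_log
  set L : ℂ → ℂ := fun ζ : ℂ => Complex.log (1 - Complex.exp (Complex.I * ζ)) -
      Complex.log (1 + Complex.exp (Complex.I * ζ)) -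
      (Real.log ‖ζ‖ + (ζ.arg - Real.pi / 2 : ℝ) * Complex.I) with hLd
  have hLi : ∀ᶠ ζ in 𝓝[{ζ | 0 < ζ.im}] 0, |(r - l) / Real.pi * (L ζ).im| < ε / 2 := by
    have := (((Complex.continuous_im.tendsto _).comp hL).const_mul ((r - l) / Real.pi)).abs
    rw [Complex.ofReal_im, mul_zero, abs_zero] at this
    exact this.eventually_lt_const (by linarith)
  have hLr : ∀ᶠ ζ in 𝓝[{ζ | 0 < ζ.im}] 0,
      |(r - l) / Real.pi * (L ζ).re| < |(r - l) / Real.pi * (-Real.log 2)| + 1 := by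
    have := (((Complex.continuous_re.tendsto _).comp hL).const_mul ((r - l) / Real.pi)).abs
    rw [Complex.ofReal_re] at this
    exact this.eventually_lt_const (by linarith)
  refine ⟨C + |(r - l) / Real.pi * (-Real.log 2)| + 1 + ε * Real.log 2, ?_⟩
  filter_upwards [hLi, hLr, self_mem_nhdsWithin, nhdsWithin_le_nhds (Metric.ball_mem_nhds (0 : ℂ) hδ₁),
    nhdsWithin_le_nhds (Metric.ball_mem_nhds (0 : ℂ) hδ₂),
    nhdsWithin_le_nhds (Metric.ball_mem_nhds (0 : ℂ) (show (0 : ℝ) < 1 by norm_num))] with ζ hζi hζr him hb1 hb2 hb3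
  rw [mem_ball_zero_iff] at hb1 hb2 hb3
  have him' : 0 < ζ.im := him
  have hre_le := Complex.abs_re_le_norm ζ
  have him_le := Complex.abs_im_le_norm ζ
  rw [abs_of_pos him'] at him_le
  set ρ := Real.exp (-ζ.im) with hρ
  have hρ0 : 0 ≤ ρ := (Real.exp_pos _).le
  have hρ1 : ρ < 1 := (Real.exp_lt_exp.2 (by linarith)).trans_eq Real.exp_zero
  have hρ2 : 1 - ρ ≤ ζ.im := by have := Real.add_one_le_exp (-ζ.im); linarith
  -- Together with `hρ2` this makes `1 - ρ` comparable to `ζ.im`, and hence `|ζ.re| + (1 - ρ)`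
  -- comparable to `‖ζ‖`.
  have hρ3 : ζ.im / 2 ≤ 1 - ρ := by
    have h3 : ρ ≤ 1 / (1 + ζ.im) := by
      rw [hρ, Real.exp_neg, ← one_div]
      exact one_div_le_one_div_of_le (by linarith) (by have := Real.add_one_le_exp ζ.im; linarith)
    have h4 : 1 / (1 + ζ.im) ≤ 1 - ζ.im / 2 := by
      rw [div_le_iff₀ (by linarith)]
      nlinarith
    linarith
  have hv : Complex.exp (Complex.I * ζ) = ρ * ept ζ.re := by
    rw [hρ, ept, Complex.ofReal_exp, ← Complex.exp_add]
    congr 1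
    conv_lhs => rw [← Complex.re_add_im ζ]
    push_cast
    linear_combination (ζ.im : ℂ) * Complex.I_sq
  have hvn : ‖Complex.exp (Complex.I * ζ)‖ < 1 := by
    rw [hv, norm_mul, norm_ept, mul_one, Complex.norm_real, Real.norm_eq_abs, abs_of_nonneg hρ0]
    exact hρ1
  -- The remainder contributes the error terms, and the step contributes the explicit model up to
  -- the convergent quantity `L ζ`.
  have e1 : herg a (Complex.exp (Complex.I * ζ)) = herg g (ρ * ept ζ.re) +
      (l + (r - l) * (1 / 2 + Complex.I / Real.pi *
        (L ζ + (Real.log ‖ζ‖ + (ζ.arg - Real.pi / 2 : ℝ) * Complex.I)))) := by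
    rw [herg_congr_ae hag, herg_add hg (bdData_stepFun l r) hvn, herg_stepFun l r hvn, ← hv]
    simp only [hLd]
    ring
  have hpc : (Real.pi : ℂ) ≠ 0 := by exact_mod_cast hpi.ne'
  have e2 : (l + (r - l) * (1 / 2 + Complex.I / Real.pi *
        (L ζ + (Real.log ‖ζ‖ + (ζ.arg - Real.pi / 2 : ℝ) * Complex.I))) : ℂ) =
      ((r - (r - l) * (ζ.arg / Real.pi) - (r - l) / Real.pi * (L ζ).im : ℝ) : ℂ) +
      ((r - l) / Real.pi * Real.log ‖ζ‖ + (r - l) / Real.pi * (L ζ).re : ℝ) * Complex.I := by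
    conv_lhs => rw [← Complex.re_add_im (L ζ)]
    push_cast
    field_simp
    linear_combination ((r - l) * (2 * ((L ζ).im : ℂ) + (2 * ζ.arg - Real.pi))) * Complex.I_sq
  have h3 := h1 ρ ζ.re hρ0 hρ1 (by linarith) (by linarith)
  have h4 := h2 ρ ζ.re hρ0 hρ1 (by linarith) (by linarith)
  have h5 : -Real.log (|ζ.re| + (1 - ρ)) ≤ Real.log 2 - Real.log ‖ζ‖ := by
    have hn0 : 0 < ‖ζ‖ := by linarith
    have h6 : ‖ζ‖ / 2 ≤ |ζ.re| + (1 - ρ) := by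
      have := Complex.norm_le_abs_re_add_abs_im ζ
      rw [abs_of_pos him'] at this
      linarith [abs_nonneg ζ.re]
    have h7 := Real.log_le_log (by positivity) h6
    rw [Real.log_div hn0.ne' (by norm_num)] at h7
    linarith
  have h6 := (Complex.abs_im_le_norm (herg g (ρ * ept ζ.re))).trans h4
  have h7 := mul_le_mul_of_nonneg_left h5 hε.le
  rw [e1, e2, Complex.add_re, Complex.add_im, Complex.add_re, Complex.add_im, Complex.re_ofReal_mul,
    Complex.im_ofReal_mul, Complex.I_re, Complex.I_im, Complex.ofReal_re, Complex.ofReal_im]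
  rw [abs_lt] at hζi hζr
  rw [abs_le] at h3 h6 ⊢
  rw [abs_le]
  exact ⟨⟨by linarith [h3.1], by linarith [h3.2]⟩, ⟨by linarith [h6.1], by linarith [h6.2]⟩⟩

end LegAnnuli

namespace LegAnnuli

/-! ### The Dirichlet problem on the annulus -/

/-- The mean value of boundary data. -/
noncomputable def bdMean (a : ℝ → ℝ) : ℝ := (2 * Real.pi)⁻¹ * ∫ θ in (-Real.pi)..Real.pi, a θ

/-- `kern θ v - 1 = 2 * v / (ept θ - v)` vanishes at the centre. This linear decay makes the series
of reflections converge geometrically. -/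
lemma norm_herg_sub_mean {a : ℝ → ℝ} (ha : BdData a) {B : ℝ} (hB : ∀ θ, |a θ| ≤ B) {v : ℂ}
    (hv : ‖v‖ < 1) : ‖herg a v - bdMean a‖ ≤ B * (2 * ‖v‖ / (1 - ‖v‖)) := by
  have hB0 : 0 ≤ B := (abs_nonneg _).trans (hB 0)
  have hpi := Real.pi_pos
  have e : herg a v - bdMean a =
      (2 * Real.pi : ℂ)⁻¹ * ∫ θ in (-Real.pi)..Real.pi, (a θ : ℂ) * (kern θ v - 1) := by
    have h1 := ha.intervalIntegrable_mul (continuous_kern hv) (-Real.pi) Real.pi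
    have h2 := ha.intervalIntegrable_mul (continuous_const (y := (1 : ℂ))) (-Real.pi) Real.pi
    simp only [mul_sub]
    rw [intervalIntegral.integral_sub h1 h2, herg, bdMean]
    simp only [mul_one]
    rw [intervalIntegral.integral_ofReal]
    push_cast
    ring
  rw [e, norm_mul, norm_two_pi_inv, inv_mul_le_iff₀ Real.two_pi_pos]
  have h1 : ∀ θ ∈ Set.uIoc (-Real.pi) Real.pi,
      ‖(a θ : ℂ) * (kern θ v - 1)‖ ≤ B * (2 * ‖v‖ / (1 - ‖v‖)) := fun θ _ => by
    rw [norm_mul, Complex.norm_real, Real.norm_eq_abs]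
    refine mul_le_mul (hB θ) ?_ (norm_nonneg _) hB0
    have hne := ept_sub_ne hv θ
    have e2 : kern θ v - 1 = 2 * v / (ept θ - v) := by
      rw [kern]; field_simp; ring
    rw [e2, norm_div, norm_mul, Complex.norm_ofNat]
    have h3 := norm_sub_norm_le (ept θ) v
    rw [norm_ept] at h3
    exact div_le_div_of_nonneg_left (by positivity) (by linarith) h3
  refine (intervalIntegral.norm_integral_le_of_norm_le_const h1).trans ?_
  rw [sub_neg_eq_add, abs_of_pos (by linarith)]
  exact le_of_eq (by ring)

/-- The correction term making the Poisson integral of `a` on the outer circle vanish on the inner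
circle. -/
lemma exists_correction {r : ℝ} (hr : 1 < r) {a : ℝ → ℝ} (ha : BdData a) :
    ∃ S : ℂ → ℂ, ∃ s : ℝ, 1 < s ∧ s < r ∧
      (∀ w : ℂ, s⁻¹ < ‖w‖ → ‖w‖ < r * s → DifferentiableAt ℂ S w) ∧
      (∀ w : ℂ, ‖w‖ = r → (S w).re = 0) ∧
      ∀ w : ℂ, ‖w‖ = 1 → (herg a (w / r) - bdMean a + S w).re = 0 := by
  obtain ⟨B, hB⟩ := ha.bound
  have hB0 : 0 ≤ B := (abs_nonneg _).trans (hB 0)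
  have hr0 : 0 < r := by linarith
  have hrc : (r : ℂ) ≠ 0 := by exact_mod_cast hr0.ne'
  -- The reflected terms stay inside the unit disk for `s⁻¹ < ‖w‖ < r * s`, a neighbourhood of the
  -- closed annulus, so the correction is holomorphic across both circles.
  set s : ℝ := √r with hs
  have hss : s * s = r := Real.mul_self_sqrt hr0.le
  have hs1 : 1 < s := by rw [hs, Real.lt_sqrt (by norm_num)]; linarith
  have hs0 : 0 < s := by linarith
  have hsr : s < r := by nlinarith
  set q : ℝ := (r ^ 2)⁻¹ with hq
  have hq0 : 0 < q := by positivity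
  have hq1 : q < 1 := inv_lt_one_of_one_lt₀ (by nlinarith)
  set H : ℂ → ℂ := fun v => herg a v - bdMean a with hH
  have hHd : DifferentiableOn ℂ H (Metric.ball 0 1) := (differentiableOn_herg ha).sub_const _
  have hHd' : ∀ v : ℂ, ‖v‖ < 1 → DifferentiableAt ℂ H v := fun v hv =>
    hHd.differentiableAt (Metric.isOpen_ball.mem_nhds (by simpa using hv))
  have hsi : s⁻¹ < 1 := inv_lt_one_of_one_lt₀ hs1
  have hsi0 : 0 < s⁻¹ := by positivity
  have hHb : ∀ (k : ℕ) (v : ℂ), ‖v‖ ≤ q ^ k * s⁻¹ → ‖v‖ < 1 ∧ ‖H v‖ ≤ B * (2 / (1 - s⁻¹)) * q ^ k := by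
    intro k v hv
    have hqk : q ^ k ≤ 1 := pow_le_one₀ hq0.le hq1.le
    have hqk0 : 0 < q ^ k := by positivity
    have h1 : ‖v‖ ≤ s⁻¹ := hv.trans (by nlinarith)
    have h2 : ‖v‖ ≤ q ^ k := hv.trans (by nlinarith)
    refine ⟨by linarith, (norm_herg_sub_mean ha hB (by linarith)).trans ?_⟩
    rw [mul_assoc]
    refine mul_le_mul_of_nonneg_left ?_ hB0
    rw [div_mul_eq_mul_div]
    exact div_le_div₀ (by positivity) (by linarith) (by linarith) (by linarith)
  -- Successive reflections in the two circles; their composite scales by `q = r⁻²`. On the outer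
  -- circle both arguments coincide and the real part vanishes. On the inner circle the second
  -- argument is the first one of the previous term, so the real parts telescope.
  set T : ℕ → ℂ → ℂ := fun k w => H ((q : ℂ) ^ (k + 1) * (w / r)) -
    (starRingEnd ℂ) (H ((starRingEnd ℂ) ((q : ℂ) ^ k / (r * w)))) with hT
  have hqn : ‖(q : ℂ)‖ = q := by rw [Complex.norm_real, Real.norm_eq_abs, abs_of_pos hq0]
  have hrn : ‖(r : ℂ)‖ = r := by rw [Complex.norm_real, Real.norm_eq_abs, abs_of_pos hr0]
  have hn1 : ∀ (k : ℕ) (w : ℂ), ‖w‖ < r * s → ‖(q : ℂ) ^ (k + 1) * (w / r)‖ ≤ q ^ k * s⁻¹ := by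
    intro k w hw
    rw [norm_mul, norm_pow, hqn, norm_div, hrn, pow_succ, mul_assoc]
    refine mul_le_mul_of_nonneg_left ?_ (by positivity)
    have h1 : ‖w‖ / r ≤ s := by rw [div_le_iff₀ hr0]; linarith
    have h2 : q * s ≤ s⁻¹ := by
      rw [le_inv_comm₀ (by positivity) hs0, hq, ← hss]
      rw [mul_inv_rev, inv_inv]
      rw [inv_mul_eq_div, le_div_iff₀ hs0]
      nlinarith [pow_pos hs0 3]
    calc q * (‖w‖ / r) ≤ q * s := by gcongr
      _ ≤ _ := h2
  have hn2 : ∀ (k : ℕ) (w : ℂ), s⁻¹ < ‖w‖ →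
      ‖(starRingEnd ℂ) ((q : ℂ) ^ k / (r * w))‖ ≤ q ^ k * s⁻¹ := by
    intro k w hw
    rw [Complex.norm_conj, norm_div, norm_pow, hqn, norm_mul, hrn, div_eq_mul_inv]
    refine mul_le_mul_of_nonneg_left ?_ (by positivity)
    refine inv_anti₀ hs0 ?_
    have : r * s⁻¹ = s := by rw [← hss]; field_simp
    rw [← this]
    gcongr
  set A : Set ℂ := {w | s⁻¹ < ‖w‖ ∧ ‖w‖ < r * s} with hA
  have hAo : IsOpen A := (isOpen_lt continuous_const continuous_norm).inter
    (isOpen_lt continuous_norm continuous_const)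
  have hsum : Summable fun k : ℕ => 2 * (B * (2 / (1 - s⁻¹))) * q ^ k :=
    (summable_geometric_of_lt_one hq0.le hq1).mul_left _
  have hTb : ∀ (k : ℕ) (w : ℂ), w ∈ A → ‖T k w‖ ≤ 2 * (B * (2 / (1 - s⁻¹))) * q ^ k := by
    intro k w hw
    have h1 := (hHb k _ (hn1 k w hw.2)).2
    have h2 := (hHb k _ (hn2 k w hw.1)).2
    refine (norm_sub_le _ _).trans ?_
    rw [Complex.norm_conj]
    linarith
  have hTs : ∀ w ∈ A, Summable fun k => T k w := fun w hw =>
    Summable.of_norm_bounded hsum fun k => hTb k w hw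
  refine ⟨fun w => ∑' k, T k w, s, hs1, hsr, ?_, ?_, ?_⟩
  · intro w h1 h2
    refine (Complex.differentiableOn_tsum_of_summable_norm hsum (fun k => ?_) hAo hTb).differentiableAt
      (hAo.mem_nhds ⟨h1, h2⟩)
    intro w hw
    have hw0 : w ≠ 0 := norm_pos_iff.1 (hsi0.trans hw.1)
    refine DifferentiableAt.differentiableWithinAt (DifferentiableAt.sub ?_ ?_)
    · have h4 : DifferentiableAt ℂ (fun w : ℂ => (q : ℂ) ^ (k + 1) * (w / r)) w := by fun_prop
      exact DifferentiableAt.comp w (g := H) (hHd' _ (hHb k _ (hn1 k w hw.2)).1) h4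
    · have h3 : DifferentiableAt ℂ (fun v => (starRingEnd ℂ) (H ((starRingEnd ℂ) v)))
          ((q : ℂ) ^ k / (r * w)) := by
        have := (hHd' _ (hHb k _ (hn2 k w hw.1)).1).conj_conj
        simpa [Function.comp_def] using this
      exact DifferentiableAt.comp w (g := fun v => (starRingEnd ℂ) (H ((starRingEnd ℂ) v))) h3
        ((differentiableAt_const _).div (differentiableAt_id.const_mul _) (mul_ne_zero hrc hw0))
  · intro w hw
    have hwA : w ∈ A := ⟨by rw [hw]; linarith, by rw [hw]; nlinarith⟩
    rw [Complex.re_tsum (hTs w hwA)]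
    refine (tsum_congr fun k => ?_).trans tsum_zero
    have hw0 : w ≠ 0 := norm_pos_iff.1 (by rw [hw]; exact hr0)
    have e1 : (starRingEnd ℂ) ((q : ℂ) ^ k / (r * w)) = (q : ℂ) ^ (k + 1) * (w / r) := by
      have h3 : w * (starRingEnd ℂ) w = (r : ℂ) ^ 2 := by
        rw [Complex.mul_conj, Complex.normSq_eq_norm_sq, hw]; push_cast; rfl
      have hc0 : (starRingEnd ℂ) w ≠ 0 := (map_ne_zero _).2 hw0
      simp only [map_div₀, map_mul, map_pow, Complex.conj_ofReal]
      have hqc : (q : ℂ) = ((r : ℂ) ^ 2)⁻¹ := by rw [hq]; push_cast; rfl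
      rw [pow_succ, hqc, ← h3]
      field_simp
    simp only [hT]
    rw [e1, Complex.sub_re, Complex.conj_re, sub_self]
  · intro w hw
    have hwA : w ∈ A := ⟨by rw [hw]; exact hsi, by rw [hw]; nlinarith⟩
    have e1 : ∀ k : ℕ, (T k w).re = (H ((q : ℂ) ^ (k + 1) * (w / r))).re -
        (H ((q : ℂ) ^ k * (w / r))).re := fun k => by
      have hw0 : w ≠ 0 := norm_pos_iff.1 (by rw [hw]; exact one_pos)
      have h3 : w * (starRingEnd ℂ) w = 1 := by
        rw [Complex.mul_conj, Complex.normSq_eq_norm_sq, hw]; norm_num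
      have hc0 : (starRingEnd ℂ) w ≠ 0 := (map_ne_zero _).2 hw0
      have h4 : (starRingEnd ℂ) ((q : ℂ) ^ k / (r * w)) = (q : ℂ) ^ k * (w / r) := by
        simp only [map_div₀, map_mul, map_pow, Complex.conj_ofReal]
        field_simp
        linear_combination (-(q : ℂ) ^ k) * h3
      simp only [hT]
      rw [h4, Complex.sub_re, Complex.conj_re]
    have hs2 : HasSum (fun k => (T k w).re) (∑' k, T k w).re := Complex.hasSum_re (hTs w hwA).hasSum
    have h5 := hs2.tendsto_sum_nat
    simp only [e1, Finset.sum_range_sub (fun k => (H ((q : ℂ) ^ k * (w / r))).re)] at h5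
    have h6 : Tendsto (fun k : ℕ => (H ((q : ℂ) ^ k * (w / r))).re) atTop (𝓝 0) := by
      -- The geometric bound is available for the arguments with exponent `k + 1` only.
      rw [← tendsto_add_atTop_iff_nat 1]
      refine squeeze_zero_norm (fun k => ?_)
        (a := fun k : ℕ => B * (2 / (1 - s⁻¹)) * q ^ k) ?_
      · exact (Complex.abs_re_le_norm _).trans (hHb k _ (hn1 k w hwA.2)).2
      · have := (tendsto_pow_atTop_nhds_zero_of_lt_one hq0.le hq1).const_mul (B * (2 / (1 - s⁻¹)))
        rwa [mul_zero] at this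
    have h7 := tendsto_nhds_unique h5 (h6.sub_const _)
    simp only [pow_zero, one_mul] at h7
    show (H (w / r) + ∑' k, T k w).re = 0
    rw [Complex.add_re, h7]
    ring

lemma hergExt_rotate {a : ℝ → ℝ} (ha : BdData a) (φ : ℝ) (v : ℂ) :
    hergExt a (v * ept φ) = hergExt (fun θ => a (φ + θ)) v := by
  have hmap : 𝓝[Metric.ball 0 1] (v * ept φ) = map (fun w => w * ept φ) (𝓝[Metric.ball 0 1] v) := by
    have h1 := (Homeomorph.mulRight₀ (ept φ) (ept_ne_zero φ)).isEmbedding.map_nhdsWithin_eq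
      (Metric.ball 0 1) v
    have h2 : (Homeomorph.mulRight₀ (ept φ) (ept_ne_zero φ)) '' Metric.ball 0 1 = Metric.ball 0 1 := by
      ext w
      simp only [Set.mem_image, mem_ball_zero_iff]
      constructor
      · rintro ⟨x, hx, rfl⟩
        simpa [norm_ept] using hx
      · intro hw
        refine ⟨w * ept (-φ), by simpa [norm_ept] using hw, ?_⟩
        show w * ept (-φ) * ept φ = w
        rw [mul_assoc, ← ept_add, neg_add_cancel, ept_zero, mul_one]
    rw [h2] at h1
    exact h1.symm
  unfold hergExt extendFrom limUnder
  rw [hmap, Filter.map_map]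
  congr 1
  refine congrArg (fun f => map f _) ?_
  funext w
  exact herg_rotate ha φ w

/-- Solution of the Dirichlet problem with bounded boundary data of equal means on the annulus,
described in the boundary charts. -/
theorem exists_annulus_extension {r : ℝ} (hr : 1 < r) {h : ℂ → ℝ}
    (h1 : BdData fun θ => h (cpt 1 θ)) (hout : BdData fun θ => h (cpt r θ))
    (hmean : bdMean (fun θ => h (cpt 1 θ)) = bdMean fun θ => h (cpt r θ)) :
    ∃ F : ℂ → ℂ, (∀ w : ℂ, 1 < ‖w‖ → ‖w‖ < r → DifferentiableAt ℂ F w) ∧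
      ∀ t ∈ (annulus r).bdry, BdData (fun θ => h ((annulus r).chart t θ)) ∧
        ∃ R : ℂ → ℂ, ∃ δ > 0, DifferentiableOn ℂ R (Metric.ball 0 δ) ∧
          (∀ x : ℝ, |x| < δ → (R x).re = 0) ∧
          ∀ ζ : ℂ, 0 ≤ ζ.im → ‖ζ‖ < δ → F ((annulus r).chart t ζ) =
            hergExt (fun θ => h ((annulus r).chart t θ)) (Complex.exp (Complex.I * ζ)) + R ζ := by
  have hr0 : 0 < r := by linarith
  have hrc : (r : ℂ) ≠ 0 := by exact_mod_cast hr0.ne'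
  have hrn : ‖(r : ℂ)‖ = r := by rw [Complex.norm_real, Real.norm_eq_abs, abs_of_pos hr0]
  set a : ℝ → ℝ := fun θ => h (cpt r θ) with ha
  -- The inversion `w ↦ w⁻¹`, which carries the outside of the unit circle to the disk, reverses the
  -- angle.
  set b : ℝ → ℝ := fun θ => h (cpt 1 (-θ)) with hb
  have hbd : BdData b := by
    obtain ⟨B, hB⟩ := h1.bound
    refine ⟨fun θ => ?_, h1.meas.comp_measurePreserving (Measure.measurePreserving_neg volume), B,
      fun θ => hB (-θ)⟩
    have := h1.periodic (-(θ + 2 * Real.pi))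
    simp only [hb]
    rw [← this]
    congr 2
    ring
  have hbm : bdMean b = bdMean a := by
    rw [← hmean, bdMean, bdMean]
    congr 1
    have := intervalIntegral.integral_comp_neg (a := -Real.pi) (b := Real.pi) (fun θ => h (cpt 1 θ))
    rw [neg_neg] at this
    exact this
  obtain ⟨S, s, hs1, hsr, hSd, hSr, hS1⟩ := exists_correction hr hout
  obtain ⟨S', s', hs1', hsr', hSd', hSr', hS1'⟩ := exists_correction hr hbd
  have hsi : s⁻¹ < 1 := inv_lt_one_of_one_lt₀ hs1
  have hsi' : s'⁻¹ < 1 := inv_lt_one_of_one_lt₀ hs1'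
  have hdiv : ∀ w : ℂ, w ≠ 0 → ‖(r : ℂ) / w‖ = r / ‖w‖ := fun w _ => by rw [norm_div, hrn]
  have hSc : ∀ w : ℂ, s'⁻¹ < ‖w‖ → ‖w‖ < r * s' → DifferentiableAt ℂ (fun w => S' (r / w)) w := by
    intro w hw1 hw2
    have hs0 : 0 < s' := by linarith
    have hw0 : 0 < ‖w‖ := (by positivity : 0 < s'⁻¹).trans hw1
    have hw0' : w ≠ 0 := norm_pos_iff.1 hw0
    refine DifferentiableAt.comp w (g := S') (hSd' _ ?_ ?_)
      ((differentiableAt_const _).div differentiableAt_id hw0')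
    · show s'⁻¹ < ‖(r : ℂ) / w‖
      rw [hdiv w hw0', lt_div_iff₀ hw0, inv_mul_lt_iff₀ hs0]
      linarith
    · show ‖(r : ℂ) / w‖ < r * s'
      rw [hdiv w hw0', div_lt_iff₀ hw0]
      have : 1 < s' * ‖w‖ := by rwa [inv_lt_iff_one_lt_mul₀ hs0, mul_comm] at hw1
      nlinarith
  have hha : ∀ w : ℂ, ‖w‖ < r → DifferentiableAt ℂ (fun w : ℂ => herg a (w / r)) w := fun w hw => by
    refine DifferentiableAt.comp w (g := herg a)
      ((hasDerivAt_herg_of_mem hout ?_).differentiableAt) (differentiableAt_id.div_const _)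
    show ‖w / r‖ < 1
    rwa [norm_div, hrn, div_lt_one hr0]
  have hhb : ∀ w : ℂ, 1 < ‖w‖ → DifferentiableAt ℂ (fun w : ℂ => herg b w⁻¹) w := fun w hw => by
    have hw0 : w ≠ 0 := norm_pos_iff.1 (by linarith)
    refine DifferentiableAt.comp w (g := herg b)
      ((hasDerivAt_herg_of_mem hbd ?_).differentiableAt) (differentiableAt_id.inv hw0)
    show ‖w⁻¹‖ < 1
    rw [norm_inv]
    exact inv_lt_one_of_one_lt₀ hw
  -- Each Herglotz integral minus the mean, plus its correction, has vanishing real part on the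
  -- opposite circle. Since the means agree, one subtraction of the mean serves both circles.
  set F : ℂ → ℂ := fun w => hergExt a (w / r) + S w + hergExt b w⁻¹ + S' (r / w) - bdMean a with hF
  have hEa : ∀ w : ℂ, ‖w‖ < r → hergExt a (w / r) = herg a (w / r) := fun w hw => by
    refine hergExt_eq hout ?_
    rwa [norm_div, hrn, div_lt_one hr0]
  have hEb : ∀ w : ℂ, 1 < ‖w‖ → hergExt b w⁻¹ = herg b w⁻¹ := fun w hw => by
    refine hergExt_eq hbd ?_
    rw [norm_inv]
    exact inv_lt_one_of_one_lt₀ hw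
  refine ⟨F, ?_, ?_⟩
  · intro w hw1 hw2
    have hd : DifferentiableAt ℂ
        (fun w : ℂ => herg a (w / r) + S w + herg b w⁻¹ + S' (r / w) - bdMean a) w :=
      ((((hha w hw2).add (hSd w (by linarith) (by nlinarith))).add (hhb w hw1)).add
        (hSc w (by linarith) (by nlinarith))).sub_const _
    refine hd.congr_of_eventuallyEq ?_
    filter_upwards [(isOpen_lt continuous_const continuous_norm).mem_nhds hw1,
      (isOpen_lt continuous_norm continuous_const).mem_nhds hw2] with x hx1 hx2
    simp only [hF]
    rw [hEa x hx2, hEb x hx1]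
  · intro t ht
    have ht0 : t ≠ 0 := by
      rintro rfl
      rcases ht with h | h <;> rw [norm_zero] at h <;> linarith
    have hexpn : ∀ (c : ℝ) (ζ : ℂ), ‖Complex.exp (c * Complex.I * ζ)‖ = Real.exp (-c * ζ.im) := fun c ζ => by
      rw [Complex.norm_exp]
      congr 1
      simp
    by_cases htr : ‖t‖ = r
    · have hch : ∀ ζ, (annulus r).chart t ζ = t * Complex.exp (Complex.I * ζ) := fun ζ => by
        simp [annulus, htr]
      obtain ⟨θ₀, rfl⟩ := exists_cpt htr
      have hce : ∀ θ : ℝ, (annulus r).chart (cpt r θ₀) θ = cpt r (θ₀ + θ) := fun θ => by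
        rw [hch, cpt, cpt, mul_assoc, ← Complex.exp_add]
        congr 2
        push_cast
        ring
      simp only [hce]
      set R : ℂ → ℂ := fun w => S w + (herg b w⁻¹ - bdMean a + S' (r / w)) with hR
      have hRd : ∀ w : ℂ, 1 < ‖w‖ → ‖w‖ < r * min s s' → DifferentiableAt ℂ R w := fun w hw1 hw2 => by
        have hm1 : r * min s s' ≤ r * s := mul_le_mul_of_nonneg_left (min_le_left _ _) hr0.le
        have hm2 : r * min s s' ≤ r * s' := mul_le_mul_of_nonneg_left (min_le_right _ _) hr0.le
        exact (hSd w (by linarith) (by linarith)).add (((hhb w hw1).sub_const _).add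
          (hSc w (by linarith) (by linarith)))
      have hRr : ∀ w : ℂ, ‖w‖ = r → (R w).re = 0 := fun w hw => by
        have hw0 : w ≠ 0 := norm_pos_iff.1 (by rw [hw]; exact hr0)
        have h3 := hS1' (r / w) (by rw [hdiv w hw0, hw, div_self hr0.ne'])
        rw [div_div_cancel_left' hrc, hbm] at h3
        simp only [hR]
        rw [Complex.add_re, hSr w hw, h3, add_zero]
      have hcont : Continuous fun ζ : ℂ => ‖cpt r θ₀ * Complex.exp (Complex.I * ζ)‖ := by fun_prop
      have hopen : IsOpen {ζ : ℂ | 1 < ‖cpt r θ₀ * Complex.exp (Complex.I * ζ)‖ ∧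
          ‖cpt r θ₀ * Complex.exp (Complex.I * ζ)‖ < r * min s s'} :=
        (isOpen_lt continuous_const hcont).inter (isOpen_lt hcont continuous_const)
      obtain ⟨δ, hδ, hδs⟩ := Metric.isOpen_iff.1 hopen 0 (by
        have : 1 < min s s' := lt_min hs1 hs1'
        simp only [Set.mem_ofPred_eq, mul_zero, Complex.exp_zero, mul_one, norm_cpt hr0.le]
        exact ⟨hr, by nlinarith⟩)
      refine ⟨hout.translate θ₀, fun ζ => R ((annulus r).chart (cpt r θ₀) ζ), δ, hδ, ?_, ?_, ?_⟩
      · intro ζ hζ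
        have h3 := hδs hζ
        simp only [hch]
        refine (DifferentiableAt.comp ζ (g := R) (hRd _ h3.1 h3.2) ?_).differentiableWithinAt
        fun_prop
      · intro x _
        refine hRr _ ?_
        rw [hce, norm_cpt hr0.le]
      · intro ζ him hζ
        have h3 := hδs (mem_ball_zero_iff.2 hζ)
        have e1 : (annulus r).chart (cpt r θ₀) ζ / r = Complex.exp (Complex.I * ζ) * ept θ₀ := by
          rw [hch, cpt, ept]
          field_simp
        have e2 := hergExt_rotate hout θ₀ (Complex.exp (Complex.I * ζ))
        rw [← e1] at e2
        rw [← e2]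
        simp only [hF, hR]
        rw [hEb _ (by rw [hch]; exact h3.1)]
        ring
    · have ht1 : ‖t‖ = 1 := ht.resolve_right htr
      have hch : ∀ ζ, (annulus r).chart t ζ = t * Complex.exp (-(Complex.I * ζ)) := fun ζ => by
        simp [annulus, htr]
      obtain ⟨θ₀, rfl⟩ := exists_cpt ht1
      have hce : ∀ θ : ℝ, (annulus r).chart (cpt 1 θ₀) θ = cpt 1 (-(-θ₀ + θ)) := fun θ => by
        rw [hch, cpt, cpt, mul_assoc, ← Complex.exp_add]
        congr 2
        push_cast
        ring
      simp only [hce]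
      set R : ℂ → ℂ := fun w => (herg a (w / r) - bdMean a + S w) + S' (r / w) with hR
      have hRd : ∀ w : ℂ, max s⁻¹ s'⁻¹ < ‖w‖ → ‖w‖ < r → DifferentiableAt ℂ R w := fun w hw1 hw2 => by
        rw [max_lt_iff] at hw1
        exact (((hha w hw2).sub_const _).add (hSd w (by linarith) (by nlinarith))).add
          (hSc w (by linarith) (by nlinarith))
      have hRr : ∀ w : ℂ, ‖w‖ = 1 → (R w).re = 0 := fun w hw => by
        have hw0 : w ≠ 0 := norm_pos_iff.1 (by rw [hw]; exact one_pos)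
        simp only [hR]
        rw [Complex.add_re, hS1 w hw, hSr' (r / w) (by rw [hdiv w hw0, hw, div_one]), add_zero]
      have hcont : Continuous fun ζ : ℂ => ‖cpt 1 θ₀ * Complex.exp (-(Complex.I * ζ))‖ := by fun_prop
      have hopen : IsOpen {ζ : ℂ | max s⁻¹ s'⁻¹ < ‖cpt 1 θ₀ * Complex.exp (-(Complex.I * ζ))‖ ∧
          ‖cpt 1 θ₀ * Complex.exp (-(Complex.I * ζ))‖ < r} :=
        (isOpen_lt continuous_const hcont).inter (isOpen_lt hcont continuous_const)
      obtain ⟨δ, hδ, hδs⟩ := Metric.isOpen_iff.1 hopen 0 (by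
        have : max s⁻¹ s'⁻¹ < 1 := max_lt hsi hsi'
        simp only [Set.mem_ofPred_eq, mul_zero, neg_zero, Complex.exp_zero, mul_one,
          norm_cpt zero_le_one]
        exact ⟨this, hr⟩)
      refine ⟨hbd.translate (-θ₀), fun ζ => R ((annulus r).chart (cpt 1 θ₀) ζ), δ, hδ, ?_, ?_, ?_⟩
      · intro ζ hζ
        have h3 := hδs hζ
        simp only [hch]
        refine (DifferentiableAt.comp ζ (g := R) (hRd _ h3.1 h3.2) ?_).differentiableWithinAt
        fun_prop
      · intro x _
        refine hRr _ ?_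
        rw [hce, norm_cpt zero_le_one]
      · intro ζ him hζ
        have h3 := hδs (mem_ball_zero_iff.2 hζ)
        have e1 : ((annulus r).chart (cpt 1 θ₀) ζ)⁻¹ = Complex.exp (Complex.I * ζ) * ept (-θ₀) := by
          rw [hch, cpt, ept, mul_inv, mul_inv, ← Complex.exp_neg, ← Complex.exp_neg]
          push_cast
          simp only [inv_one, one_mul, neg_neg, neg_mul]
          ring
        have e2 := hergExt_rotate hbd (-θ₀) (Complex.exp (Complex.I * ζ))
        rw [← e1] at e2
        rw [← e2]
        simp only [hF, hR]
        rw [hEa _ (by rw [hch]; exact h3.2)]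
        ring

end LegAnnuli

namespace LegAnnuli

/-! ### Boundary estimates at the corners -/

/-- If a holomorphic function on a half square has boundary chords close to a fixed line, then its
boundary difference quotient is square integrable, with a scale invariant bound. -/
lemma integral_slope_sq_le {f : ℂ → ℂ} {d M : ℝ} (hd : 0 < d) {T : ℂ} (hT : T ≠ 0)
    (hf : DifferentiableOn ℂ f (Set.Icc (-d) d ×ℂ Set.Icc 0 d)) (hf0 : f 0 = 0)
    (hM : ∀ ζ ∈ Set.Icc (-d) d ×ℂ Set.Icc 0 d, ‖f ζ‖ ≤ M)
    (hch : ∀ x ∈ Set.Icc (-d) d, ∃ c : ℝ, ‖f x - c * T‖ ≤ 1 / 2 * ‖f x‖) :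
    ∃ g : ℝ → ℝ, ContinuousOn g (Set.Icc (-d) d) ∧ (∀ x, x ≠ 0 → g x = ‖f x‖ / |x|) ∧
      ∫ x in (-d)..d, g x ^ 2 ≤ 8 * M ^ 2 / d := by
  classical
  set K : Set ℂ := Set.Icc (-d) d ×ℂ Set.Icc 0 d with hK
  have h0K : (0 : ℂ) ∈ K := ⟨⟨by simp [hd.le], by simp [hd.le]⟩, ⟨le_rfl, hd.le⟩⟩
  have hM0 : 0 ≤ M := (norm_nonneg _).trans (hM 0 h0K)
  -- The difference quotient at the boundary point `0`, completed by the one-sided derivative, is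
  -- continuous on the closed rectangle and holomorphic inside.
  set G : ℂ → ℂ := Function.update (fun ζ => f ζ / ζ) 0 (derivWithin f K 0) with hG
  have hGne : ∀ ζ, ζ ≠ 0 → G ζ = f ζ / ζ := fun ζ hζ => by
    simp only [hG]; rw [Function.update_of_ne hζ]
  have hGc : ContinuousOn G K := by
    rw [hG, continuousOn_update_iff]
    refine ⟨?_, fun _ => ?_⟩
    · exact (hf.continuousOn.mono Set.sdiff_subset).div continuousOn_id fun ζ hζ => hζ.2
    · have h1 := hasDerivWithinAt_iff_tendsto_slope.1 (hf 0 h0K).hasDerivWithinAt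
      refine h1.congr fun ζ => ?_
      rw [slope_def_field, hf0, sub_zero, sub_zero]
  have hGd : DifferentiableOn ℂ G (Set.Ioo (-d) d ×ℂ Set.Ioo 0 d) := by
    have hs : Set.Ioo (-d) d ×ℂ Set.Ioo 0 d ⊆ K := fun ζ hζ =>
      ⟨Set.Ioo_subset_Icc_self hζ.1, Set.Ioo_subset_Icc_self hζ.2⟩
    have hne : ∀ ζ ∈ Set.Ioo (-d) d ×ℂ Set.Ioo 0 d, ζ ≠ 0 := by
      rintro ζ hζ rfl
      exact lt_irrefl _ hζ.2.1
    exact ((hf.mono hs).div differentiableOn_id hne).congr fun ζ hζ => hGne ζ (hne ζ hζ)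
  have hGb : ∀ ζ ∈ K, d ≤ ‖ζ‖ → ‖G ζ ^ 2‖ ≤ M ^ 2 / d ^ 2 := fun ζ hζ hdζ => by
    have hζ0 : ζ ≠ 0 := norm_pos_iff.1 (hd.trans_le hdζ)
    rw [hGne ζ hζ0, norm_pow, norm_div, div_pow]
    have := hM ζ hζ
    gcongr
  -- Cauchy's theorem for `G ^ 2` bounds the integral over the bottom side by the other three sides,
  -- where `‖ζ‖ ≥ d` and the quotient is at most `M / d`.
  have key := Complex.integral_boundary_rect_eq_zero_of_continuousOn_of_differentiableOn
    (fun ζ => G ζ ^ 2) (-d : ℝ) (d + d * Complex.I) (by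
      simp only [Complex.ofReal_re, Complex.ofReal_im, Complex.add_re, Complex.add_im,
        Complex.re_ofReal_mul, Complex.im_ofReal_mul, Complex.I_re, Complex.I_im, mul_zero, mul_one,
        add_zero, zero_add]
      rw [Set.uIcc_of_le (by linarith), Set.uIcc_of_le hd.le]
      exact hGc.pow 2) (by
      simp only [Complex.ofReal_re, Complex.ofReal_im, Complex.add_re, Complex.add_im,
        Complex.re_ofReal_mul, Complex.im_ofReal_mul, Complex.I_re, Complex.I_im, mul_zero, mul_one,
        add_zero, zero_add]
      rw [min_eq_left (by linarith), max_eq_right (by linarith), min_eq_left hd.le,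
        max_eq_right hd.le]
      exact hGd.pow 2)
  simp only [Complex.ofReal_re, Complex.ofReal_im, Complex.add_re, Complex.add_im,
        Complex.re_ofReal_mul, Complex.im_ofReal_mul, Complex.I_re, Complex.I_im, mul_zero, mul_one,
        add_zero, zero_add, Complex.ofReal_zero, zero_mul, smul_eq_mul] at key
  have hb1 : ‖∫ x in (-d)..d, G (x + d * Complex.I) ^ 2‖ ≤ M ^ 2 / d ^ 2 * (2 * d) := by
    have : ∀ x ∈ Set.uIoc (-d) d, ‖G (x + d * Complex.I) ^ 2‖ ≤ M ^ 2 / d ^ 2 := fun x hx => by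
      rw [Set.uIoc_of_le (by linarith)] at hx
      refine hGb _ ⟨by simpa using ⟨hx.1.le, hx.2⟩, by simp [hd.le]⟩ ?_
      have := Complex.abs_im_le_norm (x + d * Complex.I)
      simp only [Complex.add_im, Complex.ofReal_im, Complex.im_ofReal_mul, Complex.I_im, mul_one,
        zero_add] at this
      rwa [abs_of_pos hd] at this
    refine (intervalIntegral.norm_integral_le_of_norm_le_const this).trans (le_of_eq ?_)
    rw [sub_neg_eq_add, abs_of_pos (by linarith), two_mul]
  have hb2 : ∀ c : ℝ, |c| = d → ‖∫ y in (0 : ℝ)..d, G (c + y * Complex.I) ^ 2‖ ≤ M ^ 2 / d ^ 2 * d := by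
    intro c hc
    have : ∀ y ∈ Set.uIoc 0 d, ‖G (c + y * Complex.I) ^ 2‖ ≤ M ^ 2 / d ^ 2 := fun y hy => by
      rw [Set.uIoc_of_le hd.le] at hy
      have hcI : c ∈ Set.Icc (-d) d := abs_le.1 hc.le
      refine hGb _ ⟨by simpa using hcI, by simpa using ⟨hy.1.le, hy.2⟩⟩ ?_
      have := Complex.abs_re_le_norm (c + y * Complex.I)
      simp only [Complex.add_re, Complex.ofReal_re, Complex.re_ofReal_mul, Complex.I_re, mul_zero,
        add_zero] at this
      rwa [hc] at this
    refine (intervalIntegral.norm_integral_le_of_norm_le_const this).trans (le_of_eq ?_)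
    rw [sub_zero, abs_of_pos hd]
  have hb3 := hb2 d (abs_of_pos hd)
  have hb4 := hb2 (-d) (by rw [abs_neg, abs_of_pos hd])
  have hbot : ‖∫ x in (-d)..d, G x ^ 2‖ ≤ 4 * M ^ 2 / d := by
    have e : ∫ x in (-d)..d, G x ^ 2 = (∫ x in (-d)..d, G (x + d * Complex.I) ^ 2) -
        Complex.I * (∫ y in (0 : ℝ)..d, G (d + y * Complex.I) ^ 2) +
        Complex.I * ∫ y in (0 : ℝ)..d, G (((-d : ℝ) : ℂ) + y * Complex.I) ^ 2 := by
      linear_combination key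
    rw [e]
    refine (norm_add_le _ _).trans ((add_le_add_left (norm_sub_le _ _) _).trans ?_)
    rw [norm_mul, norm_mul, Complex.norm_I, one_mul, one_mul]
    have : M ^ 2 / d ^ 2 * (2 * d) + M ^ 2 / d ^ 2 * d + M ^ 2 / d ^ 2 * d = 4 * M ^ 2 / d := by
      field_simp; ring
    linarith
  have hmap : Set.MapsTo (fun x : ℝ => (x : ℂ)) (Set.Icc (-d) d) K := fun x hx =>
    ⟨by simpa using hx, by simp [hd.le]⟩
  have hGr : ContinuousOn (fun x : ℝ => G x) (Set.Icc (-d) d) :=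
    hGc.comp Complex.continuous_ofReal.continuousOn hmap
  have hgne : ∀ x : ℝ, x ≠ 0 → ‖G x‖ = ‖f x‖ / |x| := fun x hx => by
    rw [hGne x (by exact_mod_cast hx), norm_div, Complex.norm_real, Real.norm_eq_abs]
  refine ⟨fun x => ‖G x‖, hGr.norm, hgne, ?_⟩
  have hT2 : 0 < ‖T‖ ^ 2 := by have := norm_pos_iff.2 hT; positivity
  -- On the bottom side the chord direction is close to `±T`, so after multiplication by the square
  -- of the conjugate of `T` the real part of `G ^ 2` controls its modulus: an imaginary part of at
  -- most half the modulus leaves a factor `1 - 2 * (1 / 2) ^ 2 = 1 / 2`.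
  have hpt : ∀ x ∈ Set.Icc (-d) d, x ≠ 0 →
      ‖T‖ ^ 2 * (1 / 2) * ‖G x‖ ^ 2 ≤ ((starRingEnd ℂ) T ^ 2 * G x ^ 2).re := by
    intro x hx hx0
    obtain ⟨c, hc⟩ := hch x hx
    have hGx := hGne x (by exact_mod_cast hx0)
    set e := G x - (c / x : ℝ) * T with he
    have hxc : (x : ℂ) ≠ 0 := by exact_mod_cast hx0
    have hce : ‖e‖ ≤ 1 / 2 * ‖G x‖ := by
      have h1 : e = (f x - c * T) / x := by
        rw [he, hGx]; push_cast; field_simp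
      rw [h1, hGx, norm_div, norm_div, ← mul_div_assoc]
      gcongr
    have hw : (starRingEnd ℂ) T * G x = (c / x * ‖T‖ ^ 2 : ℝ) + (starRingEnd ℂ) T * e := by
      have h2 : (starRingEnd ℂ) T * T = (‖T‖ ^ 2 : ℝ) := by
        rw [mul_comm, Complex.mul_conj, Complex.normSq_eq_norm_sq]
      have h3 : G x = (c / x : ℝ) * T + e := by rw [he]; ring
      conv_lhs => rw [h3]
      rw [mul_add, mul_left_comm, h2]
      push_cast
      ring
    have him : |((starRingEnd ℂ) T * G x).im| ≤ ‖T‖ * (1 / 2 * ‖G x‖) := by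
      rw [hw, Complex.add_im, Complex.ofReal_im, zero_add]
      refine (Complex.abs_im_le_norm _).trans ?_
      rw [norm_mul, Complex.norm_conj]
      gcongr
    have hn : ((starRingEnd ℂ) T * G x).re ^ 2 + ((starRingEnd ℂ) T * G x).im ^ 2 =
        ‖T‖ ^ 2 * ‖G x‖ ^ 2 := by
      rw [← mul_pow, ← Complex.norm_conj T, ← norm_mul, ← Complex.normSq_eq_norm_sq,
        Complex.normSq_apply]
      ring
    rw [← mul_pow, sq ((starRingEnd ℂ) T * G x), Complex.mul_re]
    have h4 : ((starRingEnd ℂ) T * G x).im ^ 2 ≤ (‖T‖ * (1 / 2 * ‖G x‖)) ^ 2 := by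
      rw [← sq_abs]
      gcongr
    nlinarith
  have hGi : IntervalIntegrable (fun x : ℝ => (starRingEnd ℂ) T ^ 2 * G x ^ 2) volume (-d) d := by
    refine ContinuousOn.intervalIntegrable ?_
    rw [Set.uIcc_of_le (by linarith)]
    exact continuousOn_const.mul (hGr.pow 2)
  have hni : IntervalIntegrable (fun x : ℝ => ‖T‖ ^ 2 * (1 / 2) * ‖G x‖ ^ 2) volume (-d) d := by
    refine ContinuousOn.intervalIntegrable ?_
    rw [Set.uIcc_of_le (by linarith)]
    exact continuousOn_const.mul (hGr.norm.pow 2)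
  have hre := Complex.reCLM.intervalIntegral_comp_comm hGi
  simp only [Complex.reCLM_apply] at hre
  have hle : ∫ x in (-d)..d, ‖T‖ ^ 2 * (1 / 2) * ‖G x‖ ^ 2 ≤
      ∫ x in (-d)..d, ((starRingEnd ℂ) T ^ 2 * G x ^ 2).re := by
    have hne : ∀ᵐ x : ℝ, x ∉ ({0} : Set ℝ) := (Set.countable_singleton 0).ae_notMem volume
    refine intervalIntegral.integral_mono_ae_restrict (by linarith) hni
      (⟨hGi.1.re, hGi.2.re⟩) ?_
    filter_upwards [ae_restrict_of_ae hne, ae_restrict_mem measurableSet_Icc] with x hx hx'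
    exact hpt x hx' hx
  rw [hre, intervalIntegral.integral_const_mul, intervalIntegral.integral_const_mul] at hle
  have h5 : ((starRingEnd ℂ) T ^ 2 * ∫ x in (-d)..d, G x ^ 2).re ≤ ‖T‖ ^ 2 * (4 * M ^ 2 / d) := by
    refine (Complex.re_le_norm _).trans ?_
    rw [norm_mul, norm_pow, Complex.norm_conj]
    gcongr
  have h6 : ‖T‖ ^ 2 * (1 / 2 * ∫ x in (-d)..d, ‖G x‖ ^ 2) ≤ ‖T‖ ^ 2 * (4 * M ^ 2 / d) := by
    linarith
  have h7 := le_of_mul_le_mul_left h6 hT2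
  have h8 : 8 * M ^ 2 / d = 2 * (4 * M ^ 2 / d) := by ring
  rw [h8]
  linarith

/-- The height is Lipschitz in the projection, so its difference quotient inherits the square
integrability of that of `f`. The bound does not involve `d`, which is what gives a uniform constant
as the square shrinks towards a corner. -/
lemma dini_of_chord {f : ℂ → ℂ} {a : ℝ → ℝ} {d M C : ℝ} (hd : 0 < d) (hC : 0 ≤ C) {T : ℂ} (hT : T ≠ 0)
    (hf : DifferentiableOn ℂ f (Set.Icc (-d) d ×ℂ Set.Icc 0 d)) (hf0 : f 0 = 0)
    (hM : ∀ ζ ∈ Set.Icc (-d) d ×ℂ Set.Icc 0 d, ‖f ζ‖ ≤ M)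
    (hch : ∀ x ∈ Set.Icc (-d) d, ∃ c : ℝ, ‖f x - c * T‖ ≤ 1 / 2 * ‖f x‖)
    (ha : AEStronglyMeasurable a) (hle : ∀ x ∈ Set.Icc (-d) d, |a x - a 0| ≤ C * ‖f x‖) :
    IntervalIntegrable (fun x => |a x - a 0| / |x|) volume (-d) d ∧
      ∫ x in (-d)..d, |a x - a 0| / |x| ≤ C * (1 + 4 * M ^ 2) := by
  obtain ⟨g, hgc, hg, hgi⟩ := integral_slope_sq_le hd hT hf hf0 hM hch
  have hgc' : ContinuousOn g (Set.uIcc (-d) d) := by rwa [Set.uIcc_of_le (by linarith)]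
  have hgint := hgc'.intervalIntegrable (μ := volume)
  have hg2 : IntervalIntegrable (fun x => g x ^ 2) volume (-d) d := (hgc'.pow 2).intervalIntegrable
  have hpt : ∀ x ∈ Set.Icc (-d) d, |a x - a 0| / |x| ≤ |C * g x| := fun x hx => by
    rcases eq_or_ne x 0 with rfl | h
    · rw [sub_self, abs_zero, zero_div]
      exact abs_nonneg _
    · refine le_trans ?_ (le_abs_self _)
      rw [hg x h, ← mul_div_assoc]
      have := hle x hx
      gcongr
  have hint : IntervalIntegrable (fun x => |a x - a 0| / |x|) volume (-d) d := by
    refine (hgint.const_mul C).mono_fun ?_ ?_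
    · refine AEStronglyMeasurable.restrict (AEMeasurable.aestronglyMeasurable ?_)
      exact ((ha.aemeasurable.sub_const _).norm.div measurable_id.norm.aemeasurable)
    · rw [Set.uIoc_of_le (by linarith)]
      filter_upwards [ae_restrict_mem measurableSet_Ioc] with x hx
      rw [Real.norm_eq_abs, Real.norm_eq_abs, abs_of_nonneg (by positivity)]
      exact hpt x ⟨hx.1.le, hx.2⟩
  refine ⟨hint, ?_⟩
  have hi3 : IntervalIntegrable (fun x => C * (1 / (2 * d) + d / 2 * g x ^ 2)) volume (-d) d :=
    ((intervalIntegrable_const).add (hg2.const_mul _)).const_mul _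
  have hmono : ∫ x in (-d)..d, |a x - a 0| / |x| ≤
      ∫ x in (-d)..d, C * (1 / (2 * d) + d / 2 * g x ^ 2) := by
    refine intervalIntegral.integral_mono_on (by linarith) hint hi3 fun x hx => ?_
    refine (hpt x hx).trans ?_
    rw [abs_mul, abs_of_nonneg hC]
    refine mul_le_mul_of_nonneg_left ?_ hC
    -- The inequality between arithmetic and geometric mean, weighted so that both resulting
    -- integrals are independent of the scale `d`.
    have h1 : 0 ≤ (1 - d * |g x|) ^ 2 / (2 * d) := by positivity
    have h2 : (1 - d * |g x|) ^ 2 / (2 * d) = 1 / (2 * d) + d / 2 * |g x| ^ 2 - |g x| := by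
      field_simp; ring
    rw [← sq_abs]
    linarith
  refine hmono.trans ?_
  rw [intervalIntegral.integral_const_mul, intervalIntegral.integral_add intervalIntegrable_const
    (hg2.const_mul _), intervalIntegral.integral_const, intervalIntegral.integral_const_mul,
    smul_eq_mul]
  refine mul_le_mul_of_nonneg_left ?_ hC
  have h3 : (d - -d) * (1 / (2 * d)) = 1 := by field_simp; ring
  have h4 : d / 2 * (8 * M ^ 2 / d) = 4 * M ^ 2 := by field_simp; ring
  have h5 := mul_le_mul_of_nonneg_left hgi (show 0 ≤ d / 2 by linarith)
  linarith

namespace HolCurve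

variable {Λ : LegendrianKnot} {r : ℝ} {C : HolCurve Λ (annulus r)}

lemma continuous_chart (r : ℝ) (t : ℂ) : Continuous ((annulus r).chart t) := by
  obtain ⟨σ, -, h⟩ := annulus_chart r t
  rw [show (annulus r).chart t = fun ζ => t * Complex.exp (σ * Complex.I * ζ) from funext h]
  fun_prop

lemma differentiable_chart (r : ℝ) (t : ℂ) : Differentiable ℂ ((annulus r).chart t) := by
  obtain ⟨σ, -, h⟩ := annulus_chart r t
  rw [show (annulus r).chart t = fun ζ => t * Complex.exp (σ * Complex.I * ζ) from funext h]
  fun_prop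

lemma chart_zero (r : ℝ) (t : ℂ) : (annulus r).chart t 0 = t := by
  obtain ⟨σ, -, h⟩ := annulus_chart r t
  rw [h]; simp

lemma bdry_ne_zero (hr : 1 < r) {t : ℂ} (ht : t ∈ (annulus r).bdry) : t ≠ 0 := by
  rintro rfl
  rcases ht with h | h <;> rw [norm_zero] at h <;> linarith

lemma norm_chart (hr : 1 < r) {t : ℂ} (ht : t ∈ (annulus r).bdry) :
    (‖t‖ = r ∧ ∀ ζ, ‖(annulus r).chart t ζ‖ = r * Real.exp (-ζ.im)) ∨
    (‖t‖ = 1 ∧ ∀ ζ, ‖(annulus r).chart t ζ‖ = Real.exp ζ.im) := by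
  by_cases h : ‖t‖ = r
  · left
    refine ⟨h, fun ζ => ?_⟩
    simp [annulus, h, Complex.norm_exp]
  · right
    have h1 : ‖t‖ = 1 := ht.resolve_right h
    refine ⟨h1, fun ζ => ?_⟩
    have hne : (1 : ℝ) ≠ r := hr.ne
    simp [annulus, h1, hne, Complex.norm_exp]

lemma chart_ofReal_mem_bdry (hr : 1 < r) {t : ℂ} (ht : t ∈ (annulus r).bdry) (x : ℝ) :
    (annulus r).chart t x ∈ (annulus r).bdry := by
  rw [bdry_iff]
  rcases norm_chart hr ht with ⟨-, h⟩ | ⟨-, h⟩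
  · right; rw [h]; simp
  · left; rw [h]; simp

/-- The radius is kept below `log r`, so that the opposite boundary circle is not reached, below
`1`, so that the chart is injective, and small enough to avoid all other punctures. -/
lemma chart_mem_dom (hr : 1 < r) {t : ℂ} (ht : t ∈ (annulus r).bdry) :
    ∃ δ > 0, δ ≤ 1 ∧ (∀ ζ : ℂ, 0 ≤ ζ.im → ‖ζ‖ < δ → ζ ≠ 0 ∨ t ∉ C.P → (annulus r).chart t ζ ∈ C.dom) ∧
      ∀ ζ : ℂ, 0 < ζ.im → ‖ζ‖ < δ →
        1 < ‖(annulus r).chart t ζ‖ ∧ ‖(annulus r).chart t ζ‖ < r := by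
  have hL : 0 < Real.log r := Real.log_pos hr
  have hr0 : 0 < r := by linarith
  have hfin : IsClosed ((C.P : Set ℂ) \ {t}) := (C.P.finite_toSet.subset Set.sdiff_subset).isClosed
  have hev : ∀ᶠ ζ in 𝓝 (0 : ℂ), (annulus r).chart t ζ ∈ ((C.P : Set ℂ) \ {t})ᶜ :=
    (continuous_chart r t).continuousAt.eventually (hfin.isOpen_compl.mem_nhds (by
      rw [chart_zero]; simp))
  obtain ⟨δ, hδ, hball⟩ := Metric.eventually_nhds_iff.1 hev
  have hmin : ∀ ζ : ℂ, ‖ζ‖ < min δ (min (Real.log r) 1) → ζ.im < Real.log r := fun ζ hζ =>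
    ((le_abs_self _).trans (Complex.abs_im_le_norm ζ)).trans_lt
      (hζ.trans_le ((min_le_right _ _).trans (min_le_left _ _)))
  refine ⟨min δ (min (Real.log r) 1), by positivity, (min_le_right _ _).trans (min_le_right _ _),
    fun ζ him hζ hne => ⟨?_, ?_⟩, fun ζ him hζ => ?_⟩
  · have hi := hmin ζ hζ
    show 1 ≤ ‖(annulus r).chart t ζ‖ ∧ ‖(annulus r).chart t ζ‖ ≤ r
    rcases norm_chart hr ht with ⟨-, h⟩ | ⟨-, h⟩
    · rw [h]
      refine ⟨?_, ?_⟩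
      · have : Real.exp (-Real.log r) ≤ Real.exp (-ζ.im) := Real.exp_le_exp.2 (by linarith)
        rw [Real.exp_neg, Real.exp_log hr0] at this
        calc (1 : ℝ) = r * r⁻¹ := by field_simp
          _ ≤ _ := by gcongr
      · have : Real.exp (-ζ.im) ≤ 1 := Real.exp_le_one_iff.2 (by linarith)
        nlinarith
    · rw [h]
      refine ⟨Real.one_le_exp him, ?_⟩
      rw [← Real.le_log_iff_exp_le hr0]
      exact hi.le
  · intro hP
    have h1 := hball (y := ζ) (by rw [dist_zero_right]; exact hζ.trans_le (min_le_left _ _))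
    have h2 : (annulus r).chart t ζ = t := by
      by_contra h3
      exact h1 ⟨hP, h3⟩
    have h3 : ζ = 0 := by
      refine annulus_chart_injective (bdry_ne_zero hr ht) ?_ (h2.trans (chart_zero r t).symm)
      rw [sub_zero]
      have := hζ.trans_le ((min_le_right _ _).trans (min_le_right _ _))
      linarith [Real.pi_gt_three]
    rcases hne with h | h
    · exact h h3
    · exact h (by rw [← h2]; exact hP)
  · have hi := hmin ζ hζ
    rcases norm_chart hr ht with ⟨-, h⟩ | ⟨-, h⟩
    · rw [h]
      refine ⟨?_, ?_⟩
      · have : Real.exp (-Real.log r) < Real.exp (-ζ.im) := Real.exp_lt_exp.2 (by linarith)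
        rw [Real.exp_neg, Real.exp_log hr0] at this
        calc (1 : ℝ) = r * r⁻¹ := by field_simp
          _ < _ := by gcongr
      · have : Real.exp (-ζ.im) < 1 := by
          rw [← Real.exp_zero]; exact Real.exp_lt_exp.2 (by linarith)
        nlinarith
    · rw [h]
      refine ⟨?_, ?_⟩
      · rw [← Real.exp_zero]; exact Real.exp_lt_exp.2 him
      · rw [← Real.lt_log_iff_exp_lt hr0]
        exact hi

/-- The boundary height satisfies the Dini type bound at every corner. -/
lemma diniCorner (hr : 1 < r) {t Γ : ℂ} (ht : t ∈ C.P) {l m : ℝ} (hc : C.HasCorner t Γ l m)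
    {a : ℝ → ℝ} (ham : AEStronglyMeasurable a)
    (ha : ∀ᶠ θ in 𝓝[≠] (0 : ℝ), a θ = C.h ((annulus r).chart t θ)) : DiniCorner a l m := by
  obtain ⟨hl, hm, hu, htl, htr⟩ := hc
  have htb := C.punctures_mem t ht
  have hal : Tendsto a (𝓝[<] 0) (𝓝 l) := htl.congr' (by
    filter_upwards [ha.filter_mono (nhdsWithin_mono _ fun x (hx : x < 0) => hx.ne)] with x hx
    exact hx.symm)
  have har : Tendsto a (𝓝[>] 0) (𝓝 m) := htr.congr' (by
    filter_upwards [ha.filter_mono (nhdsWithin_mono _ fun x (hx : 0 < x) => hx.ne')] with x hx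
    exact hx.symm)
  refine ⟨hal, har, ?_⟩
  obtain ⟨δ, hδ, hδ1, hdom, -⟩ := chart_mem_dom (C := C) hr htb
  set f : ℂ → ℂ := fun ζ => C.u ((annulus r).chart t ζ) with hf
  set S : Set ℂ := {ζ | 0 ≤ ζ.im ∧ ζ ≠ 0 ∧ ‖ζ‖ < δ} with hS
  have hfd : DifferentiableOn ℂ f S := by
    refine (C.holomorphic.differentiableOn (by simp)).comp (differentiable_chart r t).differentiableOn
      fun ζ hζ => hdom ζ hζ.1 hζ.2.2 (Or.inl hζ.2.1)
  have hft : Tendsto f (𝓝[S] 0) (𝓝 Γ) := by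
    refine hu.comp (tendsto_nhdsWithin_iff.2 ⟨?_, ?_⟩)
    · have := (continuous_chart r t).tendsto 0
      rw [chart_zero] at this
      exact this.mono_left nhdsWithin_le_nhds
    · filter_upwards [self_mem_nhdsWithin] with ζ hζ
      exact hdom ζ hζ.1 hζ.2.2 (Or.inl hζ.2.1)
  -- Chord estimates on one branch at the corner; the filter `F` is one of the two one-sided
  -- filters, so the two branches may have different constants and tangents.
  have key : ∀ (F : Filter ℝ) (c : ℝ), F ≤ 𝓝 0 → Λ.Mem Γ c → Tendsto a F (𝓝 c) →
      (∀ᶠ φ in F, φ ≠ 0 ∧ a φ = C.h ((annulus r).chart t φ)) →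
      ∃ K s₀ η, 0 ≤ K ∧ 0 < η ∧ (∀ p ζ p' ζ', Λ.Mem p ζ → Λ.Mem p' ζ' →
        ‖p - Γ‖ < η → |ζ - c| < η → ‖p' - Γ‖ < η → |ζ' - c| < η →
        |ζ - ζ'| ≤ K * ‖p - p'‖ ∧ ∃ c : ℝ, ‖(p - p') - c * Λ.tangent s₀‖ ≤ 1 / 2 * ‖p - p'‖) ∧
      ∀ᶠ x in F, x ≠ 0 ∧ a x = C.h ((annulus r).chart t x) ∧ |a x - c| < η := by
    intro F c hF hmem hat haF
    obtain ⟨s₀, hp, hz⟩ := Λ.mem_iff.1 hmem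
    obtain ⟨K, hK, hKc⟩ := Λ.chord s₀
    obtain ⟨η, hη, hη'⟩ := hKc (1 / 2) (by norm_num)
    rw [hp, hz] at hη'
    refine ⟨K, s₀, η, hK, hη, hη', ?_⟩
    filter_upwards [haF, Metric.tendsto_nhds.1 hat η hη] with x h1 h2
    exact ⟨h1.1, h1.2, h2⟩
  obtain ⟨K₁, s₁, η₁, hK₁, hη₁, hch₁, hev₁⟩ := key (𝓝[<] 0) l nhdsWithin_le_nhds hl hal (by
    filter_upwards [ha.filter_mono (nhdsWithin_mono _ fun x (hx : x < 0) => hx.ne),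
      self_mem_nhdsWithin] with x h1 h2
    exact ⟨ne_of_lt h2, h1⟩)
  obtain ⟨K₂, s₂, η₂, hK₂, hη₂, hch₂, hev₂⟩ := key (𝓝[>] 0) m nhdsWithin_le_nhds hm har (by
    filter_upwards [ha.filter_mono (nhdsWithin_mono _ fun x (hx : 0 < x) => hx.ne'),
      self_mem_nhdsWithin] with x h1 h2
    exact ⟨ne_of_gt h2, h1⟩)
  have hfe : ∀ᶠ ζ in 𝓝[S] 0, ‖f ζ - Γ‖ < min (min η₁ η₂) 1 := by
    have := Metric.tendsto_nhds.1 hft (min (min η₁ η₂) 1) (by positivity)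
    simpa [dist_eq_norm] using this
  rw [eventually_nhdsWithin_iff, Metric.eventually_nhds_iff] at hfe hev₁ hev₂
  obtain ⟨ε₀, hε₀, hfe⟩ := hfe
  obtain ⟨ε₁, hε₁, hev₁⟩ := hev₁
  obtain ⟨ε₂, hε₂, hev₂⟩ := hev₂
  set ε := min (min δ ε₀) (min ε₁ ε₂) with hε
  have hε' : 0 < ε := by positivity
  have hεδ : ε ≤ δ := (min_le_left _ _).trans (min_le_left _ _)
  have hεε₀ : ε ≤ ε₀ := (min_le_left _ _).trans (min_le_right _ _)
  have hεε₁ : ε ≤ ε₁ := (min_le_right _ _).trans (min_le_left _ _)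
  have hεε₂ : ε ≤ ε₂ := (min_le_right _ _).trans (min_le_right _ _)
  have hfb : ∀ ζ : ℂ, 0 ≤ ζ.im → ζ ≠ 0 → ‖ζ‖ < ε → ‖f ζ - Γ‖ < min (min η₁ η₂) 1 := fun ζ h1 h2 h3 =>
    hfe (by rw [dist_zero_right]; exact h3.trans_le hεε₀) ⟨h1, h2, h3.trans_le hεδ⟩
  refine ⟨max K₁ K₂ * (1 + 4 * 2 ^ 2), ?_⟩
  filter_upwards [self_mem_nhdsWithin, nhdsWithin_le_nhds (Metric.ball_mem_nhds (0 : ℝ) (show 0 < ε / 2 by positivity))] with φ hφ0 hφ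
  have hφ0' : φ ≠ 0 := hφ0
  have hφp : 0 < |φ| := abs_pos.2 hφ0'
  rw [mem_ball_zero_iff, Real.norm_eq_abs] at hφ
  set d := |φ| / 2 with hd
  have hd0 : 0 < d := by positivity
  -- points of the translated square stay in the punctured half disk
  have hsq : ∀ ζ ∈ Set.Icc (-d) d ×ℂ Set.Icc 0 d, 0 ≤ (φ + ζ : ℂ).im ∧ (φ + ζ : ℂ) ≠ 0 ∧
      ‖(φ + ζ : ℂ)‖ < ε := by
    intro ζ hζ
    have h1 : |ζ.re| ≤ d := abs_le.2 hζ.1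
    have h2 : |ζ.im| ≤ d := abs_le.2 ⟨by linarith [hζ.2.1], hζ.2.2⟩
    refine ⟨by simpa using hζ.2.1, fun h => ?_, ?_⟩
    · have h3 := congrArg Complex.re h
      simp only [Complex.add_re, Complex.ofReal_re, Complex.zero_re] at h3
      have h4 : |φ| = |ζ.re| := by rw [eq_neg_of_add_eq_zero_left h3, abs_neg]
      linarith
    · have h3 := norm_add_le (φ : ℂ) ζ
      rw [Complex.norm_real, Real.norm_eq_abs] at h3
      have h4 := Complex.norm_le_abs_re_add_abs_im ζ
      linarith
  -- The interval around `φ` lies on one side of the corner, so a single branch supplies both the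
  -- Lipschitz constant and the chord direction.
  have hdata : ∃ K ≥ 0, K ≤ max K₁ K₂ ∧ ∃ s : ℝ, ∀ x ∈ Set.Icc (-d) d,
      a (φ + x) = C.h ((annulus r).chart t (φ + x : ℝ)) ∧ a φ = C.h ((annulus r).chart t φ) ∧
      |a (φ + x) - a φ| ≤ K * ‖f (φ + x : ℝ) - f φ‖ ∧
      ∃ c : ℝ, ‖(f (φ + x : ℝ) - f φ) - c * Λ.tangent s‖ ≤ 1 / 2 * ‖f (φ + x : ℝ) - f φ‖ := by
    have hsmall : ∀ x ∈ Set.Icc (-d) d, |φ + x| < ε := fun x hx => by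
      have := abs_add_le φ x
      have := abs_le.2 hx
      linarith
    have hmem : ∀ x : ℝ, x ≠ 0 → |x| < ε → a x = C.h ((annulus r).chart t x) →
        Λ.Mem (f x) (a x) ∧ ‖f x - Γ‖ < min (min η₁ η₂) 1 := fun x h0 hx hax => by
      have hx' : ‖(x : ℂ)‖ < ε := by rwa [Complex.norm_real, Real.norm_eq_abs]
      have hxd := hdom x (by simp) (hx'.trans_le hεδ) (Or.inl (by exact_mod_cast h0))
      refine ⟨?_, hfb x (by simp) (by exact_mod_cast h0) hx'⟩
      rw [hax]
      exact C.lift_mem _ ⟨chart_ofReal_mem_bdry hr htb x, hxd.2⟩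
    have h00 : (0 : ℝ) ∈ Set.Icc (-d) d := ⟨by linarith, hd0.le⟩
    rcases hφ0'.lt_or_gt with hn | hp
    · have hneg : ∀ x ∈ Set.Icc (-d) d, φ + x < 0 := fun x hx => by
        rw [abs_of_neg hn] at hd
        linarith [hx.2]
      have hev : ∀ x ∈ Set.Icc (-d) d, (φ + x) ≠ 0 ∧ a (φ + x) = C.h ((annulus r).chart t (φ + x : ℝ)) ∧
          |a (φ + x) - l| < η₁ := fun x hx => hev₁ (by
        rw [dist_zero_right, Real.norm_eq_abs]; exact (hsmall x hx).trans_le hεε₁) (hneg x hx)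
      refine ⟨K₁, hK₁, le_max_left _ _, s₁, fun x hx => ?_⟩
      have h1 := hev x hx
      have h2 := hev 0 h00
      rw [add_zero] at h2
      have h3 := hmem _ h1.1 (hsmall x hx) h1.2.1
      have h4 := hmem φ h2.1 (by have := hsmall 0 h00; rwa [add_zero] at this) h2.2.1
      have hle : min (min η₁ η₂) 1 ≤ η₁ := (min_le_left _ _).trans (min_le_left _ _)
      exact ⟨h1.2.1, h2.2.1, hch₁ _ _ _ _ h3.1 h4.1 (h3.2.trans_le hle) h1.2.2 (h4.2.trans_le hle) h2.2.2⟩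
    · have hpos : ∀ x ∈ Set.Icc (-d) d, 0 < φ + x := fun x hx => by
        rw [abs_of_pos hp] at hd
        linarith [hx.1]
      have hev : ∀ x ∈ Set.Icc (-d) d, (φ + x) ≠ 0 ∧ a (φ + x) = C.h ((annulus r).chart t (φ + x : ℝ)) ∧
          |a (φ + x) - m| < η₂ := fun x hx => hev₂ (by
        rw [dist_zero_right, Real.norm_eq_abs]; exact (hsmall x hx).trans_le hεε₂) (hpos x hx)
      refine ⟨K₂, hK₂, le_max_right _ _, s₂, fun x hx => ?_⟩
      have h1 := hev x hx
      have h2 := hev 0 h00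
      rw [add_zero] at h2
      have h3 := hmem _ h1.1 (hsmall x hx) h1.2.1
      have h4 := hmem φ h2.1 (by have := hsmall 0 h00; rwa [add_zero] at this) h2.2.1
      have hle : min (min η₁ η₂) 1 ≤ η₂ := (min_le_left _ _).trans (min_le_right _ _)
      exact ⟨h1.2.1, h2.2.1, hch₂ _ _ _ _ h3.1 h4.1 (h3.2.trans_le hle) h1.2.2 (h4.2.trans_le hle) h2.2.2⟩
  obtain ⟨K, hK, hKle, s, hdat⟩ := hdata
  have hφe : ‖(φ : ℂ)‖ < ε := by rw [Complex.norm_real, Real.norm_eq_abs]; linarith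
  -- The base point is moved to the regular boundary point `φ`. Both values of `f` are within `1` of
  -- `Γ`, hence `M = 2` at every scale.
  have hres := dini_of_chord (f := fun ζ => f (φ + ζ) - f φ) (a := fun x => a (φ + x)) (M := 2) hd0 hK
    (Λ.tangent_ne_zero s) (by
      have h1 : DifferentiableOn ℂ (fun ζ : ℂ => f (φ + ζ)) (Set.Icc (-d) d ×ℂ Set.Icc 0 d) := by
        refine hfd.comp (by fun_prop) fun ζ hζ => ?_
        have := hsq ζ hζ
        exact ⟨this.1, this.2.1, this.2.2.trans_le hεδ⟩
      exact h1.sub_const _) (by simp) (by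
      intro ζ hζ
      have h1 := hsq ζ hζ
      have h2 := hfb _ h1.1 h1.2.1 h1.2.2
      have h3 := hfb φ (by simp) (by exact_mod_cast hφ0') hφe
      have h4 := norm_sub_le (f (φ + ζ) - Γ) (f φ - Γ)
      rw [sub_sub_sub_cancel_right] at h4
      have h5 : min (min η₁ η₂) 1 ≤ 1 := min_le_right _ _
      linarith) (by
      intro x hx
      have := (hdat x hx).2.2.2
      simpa using this)
    (ham.comp_measurePreserving (measurePreserving_add_left volume φ)) (by
      intro x hx
      have := (hdat x hx).2.2.1
      simpa using this)
  simp only [add_zero] at hres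
  refine ⟨hres.1, hres.2.trans ?_⟩
  gcongr

end HolCurve

end LegAnnuli

namespace LegAnnuli

/-! ### Construction of lifts -/

lemma CornerAsymp.congr {S : Set ℂ} {f g : ℂ → ℂ} {l r : ℝ} (hf : CornerAsymp S f l r)
    (h : ∀ᶠ ζ in 𝓝[S] 0, f ζ = g ζ) : CornerAsymp S g l r := by
  intro ε hε
  obtain ⟨C, hC⟩ := hf ε hε
  refine ⟨C, ?_⟩
  filter_upwards [hC, h] with ζ h1 h2
  rwa [← h2]

/-- The half-plane coordinate of the point `(s, τ)` of the strip. -/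
noncomputable def halfPt (s τ : ℝ) : ℂ := -Complex.exp (-(Real.pi * (s + τ * Complex.I)))

/-- Polar form: modulus `exp (-π s)` and argument `π * (1 - τ)`. The side `τ = 0` is the negative
half-axis, that is, the arriving arc. -/
lemma halfPt_eq (s τ : ℝ) : halfPt s τ =
    (Real.exp (-(Real.pi * s)) : ℝ) * (Complex.cos ((Real.pi * (1 - τ) : ℝ)) +
      Complex.sin ((Real.pi * (1 - τ) : ℝ)) * Complex.I) := by
  rw [halfPt, ← Complex.exp_mul_I, Complex.ofReal_exp, ← Complex.exp_add, ← neg_one_mul,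
    ← Complex.exp_pi_mul_I, ← Complex.exp_add]
  congr 1
  push_cast
  ring

lemma halfPt_ne_zero (s τ : ℝ) : halfPt s τ ≠ 0 := neg_ne_zero.2 (Complex.exp_ne_zero _)

lemma norm_halfPt (s τ : ℝ) : ‖halfPt s τ‖ = Real.exp (-(Real.pi * s)) := by
  rw [halfPt, norm_neg, Complex.norm_exp]
  simp

lemma arg_halfPt {s τ : ℝ} (hτ : τ ∈ Set.Icc (0 : ℝ) 1) : (halfPt s τ).arg = Real.pi * (1 - τ) := by
  have hpi := Real.pi_pos
  rw [halfPt_eq, Complex.arg_mul_cos_add_sin_mul_I (Real.exp_pos _)]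
  constructor <;> nlinarith [hτ.1, hτ.2]

lemma halfPt_im_nonneg {s τ : ℝ} (hτ : τ ∈ Set.Icc (0 : ℝ) 1) : 0 ≤ (halfPt s τ).im := by
  rw [← Complex.arg_nonneg_iff, arg_halfPt hτ]
  have := Real.pi_pos
  nlinarith [hτ.2]

lemma eventually_halfPt {p : ℂ → Prop} (h : ∀ᶠ ζ in 𝓝[{ζ : ℂ | 0 ≤ ζ.im ∧ ζ ≠ 0}] 0, p ζ) :
    ∀ᶠ s : ℝ in atTop, ∀ τ ∈ Set.Icc (0 : ℝ) 1, p (halfPt s τ) := by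
  rw [eventually_nhdsWithin_iff, Metric.eventually_nhds_iff] at h
  obtain ⟨δ, hδ, h⟩ := h
  have : Tendsto (fun s : ℝ => Real.exp (-(Real.pi * s))) atTop (𝓝 0) :=
    Real.tendsto_exp_neg_atTop_nhds_zero.comp (tendsto_id.const_mul_atTop Real.pi_pos)
  filter_upwards [this.eventually_lt_const hδ] with s hs τ hτ
  exact h (by rw [dist_zero_right, norm_halfPt]; exact hs) ⟨halfPt_im_nonneg hτ, halfPt_ne_zero s τ⟩

namespace HolCurve

variable {Λ : LegendrianKnot} {r : ℝ} {C : HolCurve Λ (annulus r)}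

lemma uniqueDiffOn_dom (hr : 1 < r) : UniqueDiffOn ℝ C.dom := by
  have h1 : UniqueDiffOn ℝ (annulus r).carrier := by
    intro t ht
    have ht1 : 1 ≤ ‖t‖ ∧ ‖t‖ ≤ r := ht
    have ht0 : 0 < ‖t‖ := by linarith [ht1.1]
    -- The annulus is not convex, but the disk of radius `(r - 1) / 2` centred on the middle circle
    -- in the direction of `t` lies in it and contains `t`.
    set c : ℂ := (((1 + r) / 2 / ‖t‖ : ℝ) : ℂ) * t with hc
    have hcn : ‖c‖ = (1 + r) / 2 := by
      rw [hc, norm_mul, Complex.norm_real, Real.norm_eq_abs, abs_of_pos (by positivity)]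
      field_simp
    have hε : 0 < (r - 1) / 2 := by linarith
    refine (uniqueDiffWithinAt_convex (convex_closedBall c ((r - 1) / 2)) ?_ (subset_closure ?_)).mono ?_
    · rw [interior_closedBall _ hε.ne']
      exact ⟨c, Metric.mem_ball_self hε⟩
    · rw [mem_closedBall_iff_norm]
      have e : t - c = ((1 - (1 + r) / 2 / ‖t‖ : ℝ) : ℂ) * t := by rw [hc]; push_cast; ring
      have e2 : (1 - (1 + r) / 2 / ‖t‖) * ‖t‖ = ‖t‖ - (1 + r) / 2 := by field_simp
      rw [e, norm_mul, Complex.norm_real, Real.norm_eq_abs, ← abs_of_pos ht0, ← abs_mul, abs_of_pos ht0,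
        e2, abs_le]
      constructor <;> linarith [ht1.1, ht1.2]
    · intro w hw
      rw [mem_closedBall_iff_norm] at hw
      have h2 := norm_sub_norm_le c w
      have h3 := norm_sub_norm_le w c
      rw [norm_sub_rev] at h2
      show 1 ≤ ‖w‖ ∧ ‖w‖ ≤ r
      constructor <;> linarith
  exact h1.inter C.P.finite_toSet.isClosed.isOpen_compl

/-- The boundary height is smooth along the boundary arcs. -/
lemma contDiffOn_height (hr : 1 < r) {t : ℂ} (ht : t ∈ (annulus r).bdry) (htP : t ∉ C.P) :
    ∃ η > 0, ContDiffOn ℝ ∞ (fun θ : ℝ => C.h ((annulus r).chart t θ)) (Metric.ball 0 η) := by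
  obtain ⟨δ, hδ, -, hdom, -⟩ := chart_mem_dom (C := C) hr ht
  have htd : t ∈ (annulus r).bdry \ (C.P : Set ℂ) := ⟨ht, htP⟩
  obtain ⟨Φ, ε, hε, hΦ, -, hg⟩ := Λ.exists_local_graph (C.lift_mem t htd)
  have hd : ∀ θ : ℝ, |θ| < δ → (annulus r).chart t θ ∈ C.dom := fun θ hθ =>
    hdom θ (by simp) (by rwa [Complex.norm_real, Real.norm_eq_abs]) (Or.inr htP)
  have h0 : (annulus r).chart t ((0 : ℝ) : ℂ) = t := by rw [Complex.ofReal_zero, chart_zero]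
  have hch : ContDiff ℝ ∞ fun θ : ℝ => (annulus r).chart t θ := by
    have := (differentiable_chart r t).contDiff (n := ∞)
    exact (this.restrict_scalars ℝ).comp Complex.ofRealCLM.contDiff
  have hus : ContDiffOn ℝ ∞ (fun θ : ℝ => C.u ((annulus r).chart t θ)) (Metric.ball 0 δ) :=
    (C.holomorphic.restrict_scalars ℝ).comp hch.contDiffOn fun θ hθ => hd θ (by simpa using hθ)
  have hu : ContinuousAt (fun θ : ℝ => C.u ((annulus r).chart t θ)) 0 :=
    hus.continuousOn.continuousAt (Metric.ball_mem_nhds 0 hδ)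
  have hh : ContinuousAt (fun θ : ℝ => C.h ((annulus r).chart t θ)) 0 := by
    have h1 : ContinuousOn (fun θ : ℝ => C.h ((annulus r).chart t θ)) (Metric.ball 0 δ) :=
      C.lift_continuous.comp hch.continuous.continuousOn fun θ hθ =>
        ⟨chart_ofReal_mem_bdry hr ht θ, (hd θ (by simpa using hθ)).2⟩
    exact h1.continuousAt (Metric.ball_mem_nhds 0 hδ)
  have h1 := Metric.continuousAt_iff.1 hu ε hε
  have h2 := Metric.continuousAt_iff.1 hh ε hε
  simp only [h0] at h1 h2
  obtain ⟨η₁, hη₁, h1⟩ := h1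
  obtain ⟨η₂, hη₂, h2⟩ := h2
  refine ⟨min δ (min η₁ η₂), by positivity, ?_⟩
  have hsub : Metric.ball (0 : ℝ) (min δ (min η₁ η₂)) ⊆ Metric.ball 0 δ :=
    Metric.ball_subset_ball (min_le_left _ _)
  refine ContDiffOn.congr (f := fun θ : ℝ => Φ (C.u ((annulus r).chart t θ))) ?_ fun θ hθ => ?_
  · refine hΦ.comp (hus.mono hsub) fun θ hθ => ?_
    exact h1 ((Metric.mem_ball.1 hθ).trans_le ((min_le_right _ _).trans (min_le_left _ _)))
  · refine hg _ _ (C.lift_mem _ ⟨chart_ofReal_mem_bdry hr ht θ, (hd θ ?_).2⟩) ?_ ?_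
    · simpa using (Metric.mem_ball.1 (hsub hθ))
    · rw [← dist_eq_norm]
      exact h1 ((Metric.mem_ball.1 hθ).trans_le ((min_le_right _ _).trans (min_le_left _ _)))
    · rw [← Real.dist_eq]
      exact h2 ((Metric.mem_ball.1 hθ).trans_le ((min_le_right _ _).trans (min_le_right _ _)))

/-- A function which is smooth up to the boundary in a boundary chart is smooth within the
domain. -/
lemma contDiffWithinAt_of_chart (hr : 1 < r) {t : ℂ} (ht : t ∈ (annulus r).bdry) {F : ℂ → ℂ} {δ : ℝ}
    (hδ : 0 < δ)
    (hF : ContDiffOn ℂ ∞ (fun ζ => F ((annulus r).chart t ζ)) {ζ | 0 ≤ ζ.im ∧ ‖ζ‖ < δ}) :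
    ContDiffWithinAt ℂ ∞ F C.dom t := by
  have ht0 := bdry_ne_zero hr ht
  obtain ⟨σ, hσ, hch⟩ := annulus_chart r t
  have hσ0 : (σ : ℂ) * Complex.I ≠ 0 := by
    refine mul_ne_zero ?_ Complex.I_ne_zero
    rcases hσ with rfl | rfl <;> norm_num
  -- The inverse of the boundary chart near `t`; it maps points of the domain to the closed upper
  -- half-plane.
  set κ : ℂ → ℂ := fun w => Complex.log (w / t) / (σ * Complex.I) with hκ
  have hκt : κ t = 0 := by simp [hκ, div_self ht0]
  have hκc : ContDiffAt ℂ ∞ κ t := by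
    refine ContDiffAt.div_const ?_ _
    have hsl : t / t ∈ Complex.slitPlane := by simp [div_self ht0]
    exact ContDiffAt.comp t (f := fun w : ℂ => w / t) (Complex.contDiffAt_log hsl) (contDiffAt_id.div_const t)
  have hinv : ∀ w, w ≠ 0 → (annulus r).chart t (κ w) = w := fun w hw => by
    rw [hch]
    simp only [hκ]
    rw [mul_div_cancel₀ _ hσ0, Complex.exp_log (div_ne_zero hw ht0), mul_div_cancel₀ _ ht0]
  have hne : ∀ w ∈ C.dom, w ≠ 0 := by
    rintro w hw rfl
    have : (1 : ℝ) ≤ ‖(0 : ℂ)‖ := hw.1.1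
    rw [norm_zero] at this
    linarith
  have him : ∀ w ∈ C.dom, 0 ≤ (κ w).im := fun w hw => by
    have h1 : 1 ≤ ‖w‖ ∧ ‖w‖ ≤ r := hw.1
    have h2 := hinv w (hne w hw)
    rcases norm_chart hr ht with ⟨-, h⟩ | ⟨-, h⟩
    · have h3 := h (κ w)
      rw [h2] at h3
      by_contra! hlt
      have : 1 < Real.exp (-(κ w).im) := Real.one_lt_exp_iff.2 (by linarith)
      nlinarith
    · have h3 := h (κ w)
      rw [h2] at h3
      rw [← Real.one_le_exp_iff]
      linarith
  have hsm : ∀ᶠ w in 𝓝[C.dom] t, ‖κ w‖ < δ := by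
    have := hκc.continuousAt.norm
    rw [ContinuousAt, hκt, norm_zero] at this
    exact nhdsWithin_le_nhds (this.eventually_lt_const hδ)
  have hmem : ∀ᶠ w in 𝓝[C.dom] t, κ w ∈ {ζ : ℂ | 0 ≤ ζ.im ∧ ‖ζ‖ < δ} := by
    filter_upwards [hsm, self_mem_nhdsWithin] with w h1 h2
    exact ⟨him w h2, h1⟩
  have h0 : κ t ∈ {ζ : ℂ | 0 ≤ ζ.im ∧ ‖ζ‖ < δ} := by
    rw [hκt]; exact ⟨le_rfl, by simpa using hδ⟩
  have hcomp : ContDiffWithinAt ℂ ∞ (fun w => F ((annulus r).chart t (κ w))) C.dom t :=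
    (hF _ h0).comp_of_preimage_mem_nhdsWithin t hκc.contDiffWithinAt hmem
  refine hcomp.congr (fun w hw => ?_) ?_
  · rw [hinv w (hne w hw)]
  · rw [hinv t ht0]

end HolCurve

namespace HolAnnulus

variable {Λ : LegendrianKnot}

/-- A holomorphic function on the annulus whose real part restricts to the height on the boundary,
with the asymptotics at the punctures prescribed by the corners. -/
theorem exists_height_extension {A : HolAnnulus Λ} (hA : A.flux = 0) :
    ∃ F : ℂ → ℂ, ContDiffOn ℂ ∞ F A.curve.dom ∧
      (∀ t ∈ (annulus A.r).bdry \ (A.curve.P : Set ℂ), (F t).re = A.curve.h t) ∧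
      ∀ t ∈ A.curve.P, ∀ Γ l m, A.curve.HasCorner t Γ l m →
        CornerAsymp {ζ | 0 ≤ ζ.im ∧ ζ ≠ 0} (fun ζ => F ((annulus A.r).chart t ζ)) l m := by
  classical
  have hr := A.one_lt_r
  have hr0 : 0 < A.r := by linarith
  set C := A.curve with hC
  -- The values of `h` at the punctures are arbitrary, whereas the boundary data must be bounded
  -- everywhere; they are reset on this null set.
  set h₀ : ℂ → ℝ := fun w => if w ∈ C.P then 0 else C.h w with hh₀
  have hh : ∀ w, w ∉ C.P → h₀ w = C.h w := fun w hw => if_neg hw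
  obtain ⟨Z, hZ0, hZ⟩ := Λ.exists_bound
  have hae : ∀ R : ℝ, (R = 1 ∨ R = A.r) → ∀ᵐ θ, h₀ (cpt R θ) = C.h (cpt R θ) := fun R hR => by
    filter_upwards [HolCurve.ae_mem_arcs (C := C) (R := R) (by rcases hR with h | h <;> linarith)]
      with θ hθ
    exact hh _ hθ
  have hbd : ∀ R : ℝ, (R = 1 ∨ R = A.r) → BdData fun θ => h₀ (cpt R θ) := fun R hR => by
    refine ⟨fun θ => by simp only [cpt_periodic R θ], ?_, Z, fun θ => ?_⟩
    · exact (HolCurve.aestronglyMeasurable_height (C := C) hr hR).congr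
        ((hae R hR).mono fun _ h => h.symm)
    · by_cases hP : cpt R θ ∈ C.P
      · simp only [hh₀, if_pos hP, abs_zero]; exact hZ0
      · rw [hh _ hP]
        exact (hZ _ _ (HolCurve.mem_height (C := C) hr hR hP)).1
  have hmean : ∀ R : ℝ, (R = 1 ∨ R = A.r) → bdMean (fun θ => h₀ (cpt R θ)) =
      (2 * Real.pi)⁻¹ * C.total R := fun R hR => by
    rw [bdMean, HolCurve.total_eq (C := C) R (-Real.pi),
      show -Real.pi + 2 * Real.pi = Real.pi by ring]
    congr 1
    refine intervalIntegral.integral_congr_ae ?_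
    filter_upwards [hae R hR] with θ hθ _
    exact hθ
  have htot : C.total 1 = C.total A.r := by
    have hl := (Real.log_pos hr).ne'
    have h1 := hA
    rw [flux, div_eq_zero_iff] at h1
    exact sub_eq_zero.1 (h1.resolve_right hl)
  obtain ⟨F, hFi, hFb⟩ := exists_annulus_extension hr (h := h₀) (hbd 1 (Or.inl rfl))
    (hbd A.r (Or.inr rfl)) (by rw [hmean 1 (Or.inl rfl), hmean A.r (Or.inr rfl), htot])
  have hexp : ∀ ζ : ℂ, 0 ≤ ζ.im → ‖Complex.exp (Complex.I * ζ)‖ ≤ 1 := fun ζ hζ => by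
    rw [Complex.norm_exp]
    simpa using hζ
  have hexp' : ∀ ζ : ℂ, 0 < ζ.im → ‖Complex.exp (Complex.I * ζ)‖ < 1 := fun ζ hζ => by
    rw [Complex.norm_exp]
    simpa using hζ
  have hcexp : ContDiff ℂ ∞ fun ζ : ℂ => Complex.exp (Complex.I * ζ) :=
    (contDiff_const.mul contDiff_id).cexp
  have hbdry : ∀ t ∈ (annulus A.r).bdry, t ∉ C.P →
      ContDiffWithinAt ℂ ∞ F C.dom t ∧ (F t).re = C.h t := by
    intro t ht htP
    obtain ⟨hbt, R, δ, hδ, hRd, hRr, hFR⟩ := hFb t ht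
    obtain ⟨η, hη, hs⟩ := HolCurve.contDiffOn_height (C := C) hr ht htP
    obtain ⟨δ', hδ', -, hdom, -⟩ := HolCurve.chart_mem_dom (C := C) hr ht
    set a : ℝ → ℝ := fun θ => h₀ ((annulus A.r).chart t θ) with ha
    have hη' : 0 < min η δ' := by positivity
    have hsa : ContDiffOn ℝ ∞ a (Metric.ball 0 (min η δ')) := by
      refine (hs.mono (Metric.ball_subset_ball (min_le_left _ _))).congr fun θ hθ => ?_
      refine hh _ (hdom θ (by simp) ?_ (Or.inr htP)).2
      rw [Complex.norm_real]
      simpa using (mem_ball_zero_iff.1 hθ).trans_le (min_le_right _ _)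
    obtain ⟨N, hN, hNs, hNr⟩ := hergExt_smooth_at hbt hη' hsa
    rw [ept_zero] at hN
    have hN' : ∀ᶠ ζ in 𝓝 (0 : ℂ), Complex.exp (Complex.I * ζ) ∈ N := by
      refine hcexp.continuous.continuousAt.eventually_mem ?_
      simpa using hN
    obtain ⟨δ₂, hδ₂, hN2⟩ := Metric.eventually_nhds_iff.1 hN'
    have hF0 : F t = hergExt a 1 + R 0 := by
      have := hFR 0 le_rfl (by simpa using hδ)
      rwa [HolCurve.chart_zero, mul_zero, Complex.exp_zero] at this
    refine ⟨HolCurve.contDiffWithinAt_of_chart hr ht (δ := min δ δ₂) (by positivity) ?_, ?_⟩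
    · refine ContDiffOn.congr (f := fun ζ => hergExt a (Complex.exp (Complex.I * ζ)) + R ζ) ?_
        fun ζ hζ => hFR ζ hζ.1 (hζ.2.trans_le (min_le_left _ _))
      refine ContDiffOn.add ?_ ?_
      · refine hNs.comp hcexp.contDiffOn fun ζ hζ => ⟨?_, ?_⟩
        · exact hN2 (by rw [dist_zero_right]; exact hζ.2.trans_le (min_le_right _ _))
        · rw [mem_closedBall_zero_iff]; exact hexp ζ hζ.1
      · refine (hRd.contDiffOn Metric.isOpen_ball).mono fun ζ hζ => ?_
        rw [mem_ball_zero_iff]; exact hζ.2.trans_le (min_le_left _ _)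
    · have h1 := hNr 0 (by rw [ept_zero]; exact mem_of_mem_nhds hN)
      have h2 := hRr 0 (by simpa using hδ)
      rw [Complex.ofReal_zero] at h2
      rw [ept_zero] at h1
      rw [hF0, Complex.add_re, h1, h2, add_zero]
      simp only [ha, Complex.ofReal_zero, HolCurve.chart_zero]
      exact hh t htP
  have hFs : ContDiffOn ℂ ∞ F C.dom := by
    intro w hw
    have h1 : 1 ≤ ‖w‖ ∧ ‖w‖ ≤ A.r := hw.1
    by_cases hb : w ∈ (annulus A.r).bdry
    · exact (hbdry w hb hw.2).1
    · rw [HolCurve.bdry_iff, not_or] at hb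
      have hw1 : 1 < ‖w‖ := lt_of_le_of_ne h1.1 (Ne.symm hb.1)
      have hw2 : ‖w‖ < A.r := lt_of_le_of_ne h1.2 hb.2
      have hopen : IsOpen {w : ℂ | 1 < ‖w‖ ∧ ‖w‖ < A.r} :=
        (isOpen_lt continuous_const continuous_norm).inter
          (isOpen_lt continuous_norm continuous_const)
      have hd : DifferentiableOn ℂ F {w : ℂ | 1 < ‖w‖ ∧ ‖w‖ < A.r} := fun x hx =>
        (hFi x hx.1 hx.2).differentiableWithinAt
      exact ((hd.contDiffOn hopen).contDiffAt (hopen.mem_nhds ⟨hw1, hw2⟩)).contDiffWithinAt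
  refine ⟨F, hFs, fun t ht => (hbdry t ht.1 ht.2).2, fun t ht Γ l m hcor => ?_⟩
  have htb := C.punctures_mem t ht
  obtain ⟨hbt, R, δ, hδ, hRd, hRr, hFR⟩ := hFb t htb
  obtain ⟨δ', hδ', -, hdom, -⟩ := HolCurve.chart_mem_dom (C := C) hr htb
  set a : ℝ → ℝ := fun θ => h₀ ((annulus A.r).chart t θ) with ha
  have hdini : DiniCorner a l m := by
    refine HolCurve.diniCorner hr ht hcor hbt.meas ?_
    filter_upwards [self_mem_nhdsWithin,
      nhdsWithin_le_nhds (Metric.ball_mem_nhds (0 : ℝ) hδ')] with θ h1 h2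
    refine hh _ (hdom θ (by simp) ?_ (Or.inl ?_)).2
    · rw [Complex.norm_real]; simpa using h2
    · exact_mod_cast h1
  have hR0 : (R 0).re = 0 := by
    have h2 := hRr 0 (by simpa using hδ)
    rwa [Complex.ofReal_zero] at h2
  have hRc : Tendsto R (𝓝[{ζ | 0 < ζ.im}] 0) (𝓝 (R 0)) :=
    (hRd.continuousOn.continuousAt (Metric.ball_mem_nhds 0 hδ)).tendsto.mono_left nhdsWithin_le_nhds
  -- The Herglotz asymptotics hold in the open half-plane. The regular term `R` has real part zero
  -- at the corner and does not disturb them, and continuity of `F` carries them to the boundary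
  -- rays.
  refine CornerAsymp.closure (((cornerAsymp_herg hbt hdini).add hRc hR0).congr ?_) ?_
  · filter_upwards [self_mem_nhdsWithin,
      nhdsWithin_le_nhds (Metric.ball_mem_nhds (0 : ℂ) hδ)] with ζ h1 h2
    have h1' : 0 < ζ.im := h1
    rw [mem_ball_zero_iff] at h2
    rw [hFR ζ h1'.le h2, hergExt_eq hbt (hexp' ζ h1')]
  · filter_upwards [self_mem_nhdsWithin,
      nhdsWithin_le_nhds (Metric.ball_mem_nhds (0 : ℂ) hδ')] with ζ h1 h2
    rw [mem_ball_zero_iff] at h2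
    have hζd := hdom ζ h1.1 h2 (Or.inl h1.2)
    refine (hFs.continuousOn _ hζd).tendsto.comp (tendsto_nhdsWithin_iff.2 ⟨?_, ?_⟩)
    · exact ((HolCurve.continuous_chart A.r t).tendsto ζ).mono_left nhdsWithin_le_nhds
    · filter_upwards [self_mem_nhdsWithin, nhdsWithin_le_nhds
        ((isOpen_lt continuous_norm continuous_const).mem_nhds h2)] with ξ h3 h4
      have h3' : 0 < ξ.im := h3
      refine hdom ξ h3'.le h4 (Or.inl ?_)
      rintro rfl
      simp at h3'

end HolAnnulus

end LegAnnuli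

/-! ### Existence of lifts for vanishing flux -/

namespace LegAnnuli.HolAnnulus

variable {Λ : LegendrianKnot}

/-- An annulus with vanishing flux has a lift. -/
theorem exists_isLift {A : HolAnnulus Λ} (hA : A.flux = 0) : ∃ U : ℂ → R4, A.IsLift U := by
  have hr := A.one_lt_r
  obtain ⟨F, hFs, hFb, hFc⟩ := exists_height_extension hA
  set C := A.curve with hC
  -- The symplectization coordinate solves `Im F = y ^ 2 / 2 - r`, the relation forced by the
  -- `J`-equation.
  set U : ℂ → R4 := fun w => ((C.u w).im ^ 2 / 2 - (F w).im, (C.u w).re, (C.u w).im, (F w).re) with hU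
  have hproj : ∀ w, projXY (U w) = C.u w := fun w => rfl
  have hz : ∀ w, (coords (U w)).z = (F w).re := fun w => rfl
  have hrr : ∀ w, (coords (U w)).r = (C.u w).im ^ 2 / 2 - (F w).im := fun w => rfl
  have huR := C.holomorphic.restrict_scalars ℝ
  have hFR := hFs.restrict_scalars ℝ
  have hstrip : ∀ t s τ, stripEnd (annulus A.r) t s τ = (annulus A.r).chart t (halfPt s τ) :=
    fun _ _ _ => rfl
  -- asymptotics at a corner
  have hcorner : ∀ t ∈ C.P, ∀ Γ l m, C.HasCorner t Γ l m →
      TendstoUniformlyOn (fun s τ => projXY (U (stripEnd (annulus A.r) t s τ))) (fun _ => Γ)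
        atTop (Set.Icc 0 1) ∧
      TendstoUniformlyOn (fun s τ => (coords (U (stripEnd (annulus A.r) t s τ))).z)
        (fun τ => l + (m - l) * τ) atTop (Set.Icc 0 1) ∧
      ∀ ε > 0, ∃ K : ℝ, ∀ᶠ s in atTop, ∀ τ ∈ Set.Icc (0 : ℝ) 1,
        |(coords (U (stripEnd (annulus A.r) t s τ))).r - (m - l) * s| ≤ K + ε * s := by
    intro t ht Γ l m hcor
    have hca := hFc t ht Γ l m hcor
    obtain ⟨δ, hδ, -, hdom, -⟩ := HolCurve.chart_mem_dom (C := C) hr (C.punctures_mem t ht)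
    have hu : Tendsto (fun ζ => C.u ((annulus A.r).chart t ζ))
        (𝓝[{ζ : ℂ | 0 ≤ ζ.im ∧ ζ ≠ 0}] 0) (𝓝 Γ) := by
      refine hcor.2.2.1.comp (tendsto_nhdsWithin_iff.2 ⟨?_, ?_⟩)
      · have := (HolCurve.continuous_chart A.r t).tendsto 0
        rw [HolCurve.chart_zero] at this
        exact this.mono_left nhdsWithin_le_nhds
      · filter_upwards [self_mem_nhdsWithin, nhdsWithin_le_nhds (Metric.ball_mem_nhds (0 : ℂ) hδ)]
          with ζ h1 h2
        exact hdom ζ h1.1 (by simpa using h2) (Or.inl h1.2)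
    have hpi := Real.pi_pos
    refine ⟨?_, ?_, fun ε hε => ?_⟩
    · rw [Metric.tendstoUniformlyOn_iff]
      intro ε hε
      filter_upwards [eventually_halfPt (Metric.tendsto_nhds.1 hu ε hε)] with s hs τ hτ
      rw [dist_comm, hproj, hstrip]
      exact hs τ hτ
    · rw [Metric.tendstoUniformlyOn_iff]
      intro ε hε
      obtain ⟨K, hK⟩ := hca (ε / 2) (by linarith)
      filter_upwards [eventually_halfPt hK] with s hs τ hτ
      have h1 := (hs τ hτ).1
      rw [arg_halfPt hτ, mul_div_cancel_left₀ _ hpi.ne'] at h1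
      rw [dist_comm, hz, hstrip, Real.dist_eq]
      have e : l + (m - l) * τ = m - (m - l) * (1 - τ) := by ring
      rw [e]
      linarith
    -- Since `log ‖ζ‖ = -π s` on the strip end, an error `ε / π` in the logarithm becomes `ε` in
    -- `s`. The term `y ^ 2 / 2` is bounded near the corner and goes into `K`.
    · obtain ⟨K, hK⟩ := hca (ε / Real.pi) (by positivity)
      refine ⟨K + (‖Γ‖ + 1) ^ 2 / 2, ?_⟩
      have hub : ∀ᶠ ζ in 𝓝[{ζ : ℂ | 0 ≤ ζ.im ∧ ζ ≠ 0}] 0,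
          ‖C.u ((annulus A.r).chart t ζ)‖ < ‖Γ‖ + 1 := hu.norm.eventually_lt_const (by linarith)
      filter_upwards [eventually_halfPt hK, eventually_halfPt hub] with s hs hs' τ hτ
      have h1 := (hs τ hτ).2
      have h2 := hs' τ hτ
      rw [norm_halfPt, Real.log_exp] at h1
      rw [hrr, hstrip]
      have h3 := Complex.abs_im_le_norm (C.u ((annulus A.r).chart t (halfPt s τ)))
      have h4 : (C.u ((annulus A.r).chart t (halfPt s τ))).im ^ 2 ≤ (‖Γ‖ + 1) ^ 2 := by
        rw [← sq_abs]
        gcongr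
        linarith
      have h5 := sq_nonneg (C.u ((annulus A.r).chart t (halfPt s τ))).im
      have e1 : (m - l) / Real.pi * -(Real.pi * s) = -((m - l) * s) := by field_simp
      have e2 : ε / Real.pi * -(Real.pi * s) = -(ε * s) := by field_simp
      rw [e1, e2] at h1
      rw [abs_le] at h1 ⊢
      constructor <;> linarith [h1.1, h1.2]
  refine ⟨U, ?_, ?_, ?_, ?_, ?_, fun w _ => hproj w⟩
  · have him := Complex.imCLM.contDiff (n := ∞)
    have hre := Complex.reCLM.contDiff (n := ∞)
    have h1 := him.comp_contDiffOn huR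
    have h2 := hre.comp_contDiffOn huR
    have h3 := him.comp_contDiffOn hFR
    have h4 := hre.comp_contDiffOn hFR
    exact (((h1.pow 2).div_const 2).sub h3).prodMk (h2.prodMk (h1.prodMk h4))
  · intro z hz v
    have hud := HolCurve.uniqueDiffOn_dom (C := C) hr z hz
    have hu : HasFDerivWithinAt C.u _ C.dom z :=
      ((C.holomorphic.differentiableOn (by simp)) z hz).hasDerivWithinAt.hasFDerivWithinAt.restrictScalars ℝ
    have hF : HasFDerivWithinAt F _ C.dom z :=
      ((hFs.differentiableOn (by simp)) z hz).hasDerivWithinAt.hasFDerivWithinAt.restrictScalars ℝ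
    have h1 : HasFDerivWithinAt (fun w => (C.u w).im) _ C.dom z :=
      Complex.imCLM.hasFDerivAt.comp_hasFDerivWithinAt z hu
    have h2 : HasFDerivWithinAt (fun w => (C.u w).re) _ C.dom z :=
      Complex.reCLM.hasFDerivAt.comp_hasFDerivWithinAt z hu
    have h3 : HasFDerivWithinAt (fun w => (F w).im) _ C.dom z :=
      Complex.imCLM.hasFDerivAt.comp_hasFDerivWithinAt z hF
    have h4 : HasFDerivWithinAt (fun w => (F w).re) _ C.dom z :=
      Complex.reCLM.hasFDerivAt.comp_hasFDerivWithinAt z hF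
    have h5 : HasFDerivWithinAt (fun w => (C.u w).im ^ 2 / 2) _ C.dom z :=
      (h1.pow 2).mul_const (2 : ℝ)⁻¹
    have h6 := (h5.sub h3).prodMk (h2.prodMk (h1.prodMk h4))
    rw [show fderivWithin ℝ U C.dom z = _ from h6.fderivWithin hud]
    simp only [almostJ, coords, hU]
    refine Prod.ext ?_ (Prod.ext ?_ (Prod.ext ?_ ?_)) <;> simp <;> ring
  · intro z hz'
    rw [hproj, hz, hFb z hz']
    exact C.lift_mem z hz'
  · obtain ⟨Γ, a, b, hcor, hab⟩ := A.isPos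
    obtain ⟨h1, h2, h3⟩ := hcorner A.pos A.pos_mem Γ a b hcor
    refine ⟨Γ, a, b, hcor.1, hcor.2.1, hab, h1, h2, fun M => ?_⟩
    -- An error of half the slope still leaves linear growth of the symplectization coordinate.
    obtain ⟨K, hK⟩ := h3 ((b - a) / 2) (by linarith)
    have ht : Tendsto (fun s : ℝ => (b - a) / 2 * s) atTop atTop :=
      tendsto_id.const_mul_atTop (by linarith)
    filter_upwards [hK, ht.eventually_ge_atTop (M + K)] with s hs hs' τ hτ
    have := (abs_le.1 (hs τ hτ)).1
    linarith
  · intro t ht hne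
    obtain ⟨Γ, a, b, hcor, hab⟩ := A.isNeg t ht hne
    obtain ⟨h1, h2, h3⟩ := hcorner t ht Γ a b hcor
    -- At a negative corner the arriving height is the larger one, so the Reeb chord runs from `b`
    -- to `a` and the slope in `s` is negative.
    refine ⟨Γ, b, a, hcor.2.1, hcor.1, hab, h1, ?_, fun M => ?_⟩
    · have e : (fun τ => b + (a - b) * (1 - τ)) = fun τ => a + (b - a) * τ := by funext τ; ring
      rw [e]
      exact h2
    · obtain ⟨K, hK⟩ := h3 ((a - b) / 2) (by linarith)
      have ht : Tendsto (fun s : ℝ => (a - b) / 2 * s) atTop atTop :=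
        tendsto_id.const_mul_atTop (by linarith)
      filter_upwards [hK, ht.eventually_ge_atTop (K - M)] with s hs hs' τ hτ
      have := (abs_le.1 (hs τ hτ)).2
      linarith

theorem exists_isLift_iff (hΛ : Λ.GeneralPosition) (A : HolAnnulus Λ) :
    (∃ U : ℂ → R4, A.IsLift U) ↔ A.flux = 0 :=
  ⟨fun ⟨_, hU⟩ => flux_eq_zero_of_isLift hΛ hU, exists_isLift⟩

end LegAnnuli.HolAnnulus

namespace LegAnnuli

/-! ### Smooth dependence of integrals on parameters -/

section ParametricIntegral

variable {E F : Type} [NormedAddCommGroup E] [NormedSpace ℝ E]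
  [NormedAddCommGroup F] [NormedSpace ℝ F] {U : Set E} {V K : Set ℝ}

/-- `f` is smooth on `U × V`, and its parameter derivatives are locally bounded near `U × K`. -/
structure ParamSmooth (U : Set E) (V K : Set ℝ) (f : E → ℝ → F) : Prop where
  smooth : ContDiffOn ℝ ∞ (fun q : E × ℝ => f q.1 q.2) (U ×ˢ V)
  bounded : ∀ p ∈ U, ∀ θ ∈ K \ V, ∀ k : ℕ, ∃ C : ℝ, ∀ᶠ q : E × ℝ in 𝓝 (p, θ), q.2 ∈ V →
    ‖iteratedFDeriv ℝ k (fun x => f x q.2) q.1‖ ≤ C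

namespace ParamSmooth

variable {f : E → ℝ → F}

lemma contDiffAt (h : ParamSmooth U V K f) (hU : IsOpen U) (hV : IsOpen V) {p : E} {θ : ℝ}
    (hp : p ∈ U) (hθ : θ ∈ V) : ContDiffAt ℝ ∞ (fun q : E × ℝ => f q.1 q.2) (p, θ) :=
  h.smooth.contDiffAt ((hU.prod hV).mem_nhds ⟨hp, hθ⟩)

lemma contDiffAt_left (h : ParamSmooth U V K f) (hU : IsOpen U) (hV : IsOpen V) {p : E} {θ : ℝ}
    (hp : p ∈ U) (hθ : θ ∈ V) : ContDiffAt ℝ ∞ (fun x => f x θ) p :=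
  ContDiffAt.comp (g := fun q : E × ℝ => f q.1 q.2) (f := fun x => (x, θ)) p
    (h.contDiffAt hU hV hp hθ) (contDiffAt_id.prodMk contDiffAt_const)

lemma fderiv_eq (h : ParamSmooth U V K f) (hU : IsOpen U) (hV : IsOpen V) {p : E} {θ : ℝ}
    (hp : p ∈ U) (hθ : θ ∈ V) : fderiv ℝ (fun x => f x θ) p =
      (fderiv ℝ (fun q : E × ℝ => f q.1 q.2) (p, θ)).comp (ContinuousLinearMap.inl ℝ E ℝ) := by
  have h1 : HasFDerivAt (fun x : E => (x, θ)) (ContinuousLinearMap.inl ℝ E ℝ) p :=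
    hasFDerivAt_prodMk_left p θ
  exact (HasFDerivAt.comp (g := fun q : E × ℝ => f q.1 q.2) p
    ((h.contDiffAt hU hV hp hθ).differentiableAt (by simp)).hasFDerivAt h1).fderiv

lemma smooth_fderiv (h : ParamSmooth U V K f) (hU : IsOpen U) (hV : IsOpen V) :
    ContDiffOn ℝ ∞ (fun q : E × ℝ => fderiv ℝ (fun x => f x q.2) q.1) (U ×ˢ V) := by
  have h1 : ContDiffOn ℝ ∞ (fderiv ℝ (fun q : E × ℝ => f q.1 q.2)) (U ×ˢ V) :=
    h.smooth.fderiv_of_isOpen (hU.prod hV) (by simp)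
  refine ContDiffOn.congr (f := fun q : E × ℝ => (fderiv ℝ (fun q : E × ℝ => f q.1 q.2) q).comp
    (ContinuousLinearMap.inl ℝ E ℝ)) (h1.clm_comp contDiffOn_const) ?_
  exact fun q hq => h.fderiv_eq hU hV hq.1 hq.2

/-- The class is closed under differentiation in the parameter, which lets smoothness of the
integral be proved by induction. -/
lemma deriv (h : ParamSmooth U V K f) (hU : IsOpen U) (hV : IsOpen V) :
    ParamSmooth U V K fun p θ => fderiv ℝ (fun x => f x θ) p where
  smooth := h.smooth_fderiv hU hV
  bounded p hp θ hθ k := by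
    obtain ⟨C, hC⟩ := h.bounded p hp θ hθ (k + 1)
    refine ⟨C, hC.mono fun q hq hqV => ?_⟩
    rw [norm_iteratedFDeriv_fderiv]
    exact hq hqV

lemma bounded_zero_one (h : ParamSmooth U V K f) (hU : IsOpen U) (hV : IsOpen V) {p : E} {θ : ℝ}
    (hp : p ∈ U) (hθ : θ ∈ K) : ∃ C : ℝ, ∀ᶠ q : E × ℝ in 𝓝 (p, θ), q.2 ∈ V →
      ‖f q.1 q.2‖ ≤ C := by
  by_cases hθV : θ ∈ V
  · refine ⟨‖f p θ‖ + 1, ?_⟩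
    have := (h.contDiffAt hU hV hp hθV).continuousAt.norm
    filter_upwards [this.eventually_lt_const (lt_add_one _)] with q hq _ using hq.le
  · obtain ⟨C, hC⟩ := h.bounded p hp θ ⟨hθ, hθV⟩ 0
    refine ⟨C, hC.mono fun q hq hqV => ?_⟩
    simpa using hq hqV

/-- The local bounds, at regular and exceptional angles alike, combine by compactness of `K` into
one constant valid for all parameters near `p`. It dominates the integrand. -/
lemma exists_uniform_bound (h : ParamSmooth U V K f) (hU : IsOpen U) (hV : IsOpen V)
    (hK : IsCompact K) {p : E} (hp : p ∈ U) :
    ∃ C : ℝ, ∀ᶠ x in 𝓝 p, ∀ θ ∈ K, θ ∈ V → ‖f x θ‖ ≤ C := by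
  refine hK.induction_on (p := fun S => ∃ C : ℝ, ∀ᶠ x in 𝓝 p, ∀ θ ∈ S, θ ∈ V → ‖f x θ‖ ≤ C)
    ⟨0, by simp⟩ ?_ ?_ ?_
  · rintro s t hst ⟨C, hC⟩
    exact ⟨C, hC.mono fun x hx θ hθ => hx θ (hst hθ)⟩
  · rintro s t ⟨C, hC⟩ ⟨C', hC'⟩
    refine ⟨max C C', ?_⟩
    filter_upwards [hC, hC'] with x hx hx' θ hθ hθV
    rcases hθ with hθ | hθ
    · exact (hx θ hθ hθV).trans (le_max_left _ _)
    · exact (hx' θ hθ hθV).trans (le_max_right _ _)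
  · intro θ hθ
    obtain ⟨C, hC⟩ := h.bounded_zero_one hU hV hp hθ
    rw [nhds_prod_eq, eventually_prod_iff] at hC
    obtain ⟨P, hP, Q, hQ, hPQ⟩ := hC
    exact ⟨{θ | Q θ}, mem_nhdsWithin_of_mem_nhds hQ, C,
      hP.mono fun x hx θ hθ hθV => hPQ hx hθ hθV⟩

lemma aestronglyMeasurable (h : ParamSmooth U V K f) (hV : IsOpen V) {μ : Measure ℝ}
    (hμ : ∀ᵐ θ ∂μ, θ ∈ V ∩ K) {p : E} (hp : p ∈ U) : AEStronglyMeasurable (f p) μ := by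
  have h1 : ContinuousOn (f p) V :=
    ContinuousOn.comp (g := fun q : E × ℝ => f q.1 q.2) (f := fun θ => (p, θ))
      h.smooth.continuousOn (by fun_prop) fun θ hθ => ⟨hp, hθ⟩
  have h2 := h1.aestronglyMeasurable (μ := μ) hV.measurableSet
  rwa [Measure.restrict_eq_self_of_ae_mem (hμ.mono fun θ hθ => hθ.1)] at h2

lemma hasFDerivAt_integral [CompleteSpace F] (h : ParamSmooth U V K f) (hU : IsOpen U) (hV : IsOpen V)
    (hK : IsCompact K) {μ : Measure ℝ} [IsFiniteMeasure μ] (hμ : ∀ᵐ θ ∂μ, θ ∈ V ∩ K) {p : E}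
    (hp : p ∈ U) : HasFDerivAt (fun x => ∫ θ, f x θ ∂μ)
      (∫ θ, fderiv ℝ (fun x => f x θ) p ∂μ) p := by
  obtain ⟨C, hC⟩ := h.exists_uniform_bound hU hV hK hp
  obtain ⟨C', hC'⟩ := (h.deriv hU hV).exists_uniform_bound hU hV hK hp
  refine hasFDerivAt_integral_of_dominated_of_fderiv_le (bound := fun _ => C')
    (F' := fun x θ => fderiv ℝ (fun x => f x θ) x) (inter_mem (hU.mem_nhds hp) hC')
    ?_ ?_ ((h.deriv hU hV).aestronglyMeasurable hV hμ hp) ?_ (integrable_const _) ?_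
  · exact (hU.eventually_mem hp).mono fun x hx => h.aestronglyMeasurable hV hμ hx
  · exact Integrable.of_bound (h.aestronglyMeasurable hV hμ hp) C
      (hμ.mono fun θ hθ => hC.self_of_nhds θ hθ.2 hθ.1)
  · exact hμ.mono fun θ hθ x hx => hx.2 θ hθ.2 hθ.1
  · exact hμ.mono fun θ hθ x hx =>
      ((h.contDiffAt_left hU hV hx.1 hθ.1).differentiableAt (by simp)).hasFDerivAt

end ParamSmooth

/-- Differentiation under the integral sign, repeated. The target space varies with the induction,
since the derivative takes values in a space of linear maps. -/
lemma ParamSmooth.contDiffOn_nat_integral (hU : IsOpen U) (hV : IsOpen V)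
    (hK : IsCompact K) {μ : Measure ℝ} [IsFiniteMeasure μ] (hμ : ∀ᵐ θ ∂μ, θ ∈ V ∩ K) (n : ℕ) :
    ∀ {F : Type} [NormedAddCommGroup F] [NormedSpace ℝ F] [CompleteSpace F] {f : E → ℝ → F},
      ParamSmooth U V K f → ContDiffOn ℝ n (fun p => ∫ θ, f p θ ∂μ) U := by
  induction n with
  | zero =>
    intro F _ _ _ f h
    exact contDiffOn_zero.2 fun p hp =>
      (h.hasFDerivAt_integral hU hV hK hμ hp).continuousAt.continuousWithinAt
  | succ n ih =>
    intro F _ _ _ f h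
    push_cast
    rw [contDiffOn_succ_iff_fderiv_of_isOpen hU]
    refine ⟨fun p hp => (h.hasFDerivAt_integral hU hV hK hμ
      hp).differentiableAt.differentiableWithinAt, by simp, ?_⟩
    exact (ih (h.deriv hU hV)).congr fun p hp => (h.hasFDerivAt_integral hU hV hK hμ hp).fderiv

theorem ParamSmooth.contDiffOn_integral [CompleteSpace F] {f : E → ℝ → F}
    (h : ParamSmooth U V K f) (hU : IsOpen U) (hV : IsOpen V)
    (hK : IsCompact K) {μ : Measure ℝ} [IsFiniteMeasure μ] (hμ : ∀ᵐ θ ∂μ, θ ∈ V ∩ K) :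
    ContDiffOn ℝ ∞ (fun p => ∫ θ, f p θ ∂μ) U :=
  contDiffOn_infty.2 fun n => ParamSmooth.contDiffOn_nat_integral hU hV hK hμ n h

end ParametricIntegral

end LegAnnuli

/-! ### Smoothness of lifts and bounds for their derivatives -/

namespace LegAnnuli

variable {E : Type} [NormedAddCommGroup E] [NormedSpace ℝ E]

/-- A continuous lift of a smooth map to the projection of the knot is smooth. -/
lemma LegendrianKnot.contDiffAt_lift (Λ : LegendrianKnot) {w : E → ℂ} {h : E → ℝ} {x : E}
    (hw : ContDiffAt ℝ ∞ w x) (hh : ContinuousAt h x) (hm : ∀ᶠ y in 𝓝 x, Λ.Mem (w y) (h y)) :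
    ContDiffAt ℝ ∞ h x := by
  obtain ⟨Φ, δ, hδ, hΦ, -, hg⟩ := Λ.exists_local_graph hm.self_of_nhds
  have h1 : ContDiffAt ℝ ∞ (Φ ∘ w) x :=
    (hΦ.contDiffAt (Metric.ball_mem_nhds _ hδ)).comp x hw
  refine h1.congr_of_eventuallyEq ?_
  filter_upwards [hm, hw.continuousAt (Metric.ball_mem_nhds _ hδ),
    hh (Metric.ball_mem_nhds _ hδ)] with y h1 h2 h3
  exact hg _ _ h1 (by simpa [dist_eq_norm] using h2) (by simpa [Real.dist_eq] using h3)

/-- Near a double point of the projection, the height along a preconnected set stays close to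
its value at one point. -/
lemma LegendrianKnot.exists_height_close (Λ : LegendrianKnot) {Γ : ℂ} {b : ℝ} (hb : Λ.Mem Γ b) {ε : ℝ}
    (hε : 0 < ε) : ∃ δ > 0, ∃ η > 0, ∀ {X : Type} [TopologicalSpace X] {Q : Set X} {w : X → ℂ}
      {h : X → ℝ}, IsPreconnected Q → ContinuousOn h Q → (∀ q ∈ Q, Λ.Mem (w q) (h q)) →
      (∀ q ∈ Q, ‖w q - Γ‖ < δ) → ∀ q₀ ∈ Q, |h q₀ - b| < η → ∀ q ∈ Q, |h q - b| < ε := by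
  obtain ⟨η, hη, hgap⟩ := Λ.exists_gap
  obtain ⟨δ, hδ, hgap⟩ := hgap (min ε η) (by positivity)
  refine ⟨δ, hδ, η, hη, fun {X _ Q w h} hQ hc hm hw q₀ hq₀ h0 q hq => ?_⟩
  have g := fun q hq => hgap _ _ _ _ (hm q hq) hb (hw q hq)
  rcases g q hq with h1 | h1
  · exact h1.trans_le (min_le_left _ _)
  -- Leaving the branch would make the distance to `b` take the value `η`, which lies in the gap
  -- between the branches.
  · obtain ⟨x, hx, hxη⟩ := hQ.intermediate_value hq₀ hq
      (f := fun q => |h q - b|) (by fun_prop) ⟨h0.le, h1.le⟩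
    have hxη : |h x - b| = η := hxη
    rcases g x hx with h2 | h2
    · exact absurd h2 (by rw [hxη]; exact not_lt.2 (min_le_right _ _))
    · exact absurd h2 (by rw [hxη]; exact lt_irrefl _)

/-- Bounds for the derivatives of a composition. -/
lemma exists_comp_bound {Φ : ℂ → ℝ} {Γ : ℂ} {δ : ℝ} (hδ : 0 < δ)
    (hΦ : ContDiffOn ℝ ∞ Φ (Metric.ball Γ δ)) (k : ℕ) (C : ℕ → ℝ) : ∃ B : ℝ, ∃ ρ > 0,
      ∀ {w : E → ℂ} {s : Set E} {p : E}, IsOpen s → ContDiffOn ℝ ∞ w s →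
        Set.MapsTo w s (Metric.ball Γ ρ) → p ∈ s → (∀ i ≤ k, ‖iteratedFDeriv ℝ i w p‖ ≤ C i) →
        ‖iteratedFDeriv ℝ k (Φ ∘ w) p‖ ≤ B := by
  have hat : ContDiffAt ℝ ∞ Φ Γ := hΦ.contDiffAt (Metric.ball_mem_nhds _ hδ)
  have h1 : ∀ i ∈ Finset.range (k + 1), ∀ᶠ y in 𝓝 Γ,
      ‖iteratedFDeriv ℝ i Φ y‖ ≤ ‖iteratedFDeriv ℝ i Φ Γ‖ + 1 := fun i _ =>
    ((hat.continuousAt_iteratedFDeriv (k := i) (by exact_mod_cast le_top)).norm.eventually_lt_const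
      (lt_add_one _)).mono fun y hy => hy.le
  rw [← eventually_all_finset] at h1
  obtain ⟨ρ, hρ, h1⟩ := Metric.eventually_nhds_iff_ball.1 h1
  have hle : ∀ (f : ℕ → ℝ), (∀ i, 0 ≤ f i) → ∀ i ≤ k, f i ≤ ∑ j ∈ Finset.range (k + 1), f j :=
    fun f hf i hi => Finset.single_le_sum (fun j _ => hf j) (Finset.mem_range.2 (by omega))
  set B := ∑ i ∈ Finset.range (k + 1), (‖iteratedFDeriv ℝ i Φ Γ‖ + 1)
  -- At least one, so that its powers dominate the bounds for the inner derivatives of all positive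
  -- orders.
  set D := 1 + ∑ i ∈ Finset.range (k + 1), |C i|
  have hD : 1 ≤ D := le_add_of_nonneg_right (Finset.sum_nonneg fun i _ => abs_nonneg _)
  refine ⟨k.factorial * B * D ^ k, min δ ρ, by positivity, fun {w s p} hs hw hst hp hC => ?_⟩
  have hmem := hst hp
  rw [← iteratedFDerivWithin_of_isOpen k hs hp]
  refine norm_iteratedFDerivWithin_comp_le (N := ∞) (t := Metric.ball Γ (min δ ρ))
    (hΦ.mono (Metric.ball_subset_ball (min_le_left _ _))) hw (by exact_mod_cast le_top)
    Metric.isOpen_ball.uniqueDiffOn hs.uniqueDiffOn hst hp (fun i hi => ?_) fun i hi hik => ?_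
  · rw [iteratedFDerivWithin_of_isOpen i Metric.isOpen_ball hmem]
    refine (h1 _ (Metric.ball_subset_ball (min_le_right _ _) hmem) i
      (Finset.mem_range.2 (by omega))).trans ?_
    exact hle (fun i => ‖iteratedFDeriv ℝ i Φ Γ‖ + 1) (fun i => by positivity) i hi
  · rw [iteratedFDerivWithin_of_isOpen i hs hp]
    calc _ ≤ C i := hC i hik
      _ ≤ |C i| := le_abs_self _
      _ ≤ D := (hle (fun i => |C i|) (fun i => abs_nonneg _) i hik).trans (by simp [D])
      _ ≤ D ^ i := le_self_pow₀ hD (by omega)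

end LegAnnuli

/-! ### Parameter derivatives of the height near a corner -/

namespace LegAnnuli

namespace ParamSmooth

variable {E : Type} [NormedAddCommGroup E] [NormedSpace ℝ E] {U : Set E} {V K : Set ℝ}

lemma eventually_ball {X : Type} [PseudoMetricSpace X] {p : X} {θ : ℝ} {P : X × ℝ → Prop} :
    (∀ᶠ q in 𝓝 (p, θ), P q) ↔ ∃ ρ > 0, ∀ x ∈ Metric.ball p ρ, ∀ y ∈ Metric.ball θ ρ, P (x, y) := by
  rw [Metric.eventually_nhds_iff_ball]
  refine exists_congr fun ρ => and_congr_right fun _ => ?_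
  rw [← ball_prod_same]
  exact ⟨fun h x hx y hy => h _ ⟨hx, hy⟩, fun h q hq => h _ hq.1 _ hq.2⟩

lemma eventually_mem_left {X : Type} [TopologicalSpace X] {U : Set X} (hU : IsOpen U) {p : X}
    (hp : p ∈ U) (θ : ℝ) : ∀ᶠ q : X × ℝ in 𝓝 (p, θ), q.1 ∈ U :=
  continuous_fst.continuousAt.eventually_mem (hU.mem_nhds hp)

/-- Convergence at an exceptional point, uniformly in the parameter. -/
lemma eventually_near {W : E → ℝ → ℂ} (h : ParamSmooth U V K W) (hU : IsOpen U) (hV : IsOpen V)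
    {p : E} {θ : ℝ} (hp : p ∈ U) (hθ : θ ∈ K \ V) {Γ : ℂ} (hΓ : Tendsto (W p) (𝓝[V] θ) (𝓝 Γ))
    {ε : ℝ} (hε : 0 < ε) : ∀ᶠ q : E × ℝ in 𝓝 (p, θ), q.2 ∈ V → ‖W q.1 q.2 - Γ‖ < ε := by
  obtain ⟨C, hC⟩ := (h.deriv hU hV).bounded p hp θ hθ 0
  obtain ⟨ρ, hρ, hC⟩ := eventually_ball.1 (hC.and (eventually_mem_left hU hp θ))
  have h1 : ∀ᶠ y in 𝓝 θ, y ∈ V → ‖W p y - Γ‖ < ε / 2 := by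
    have := Metric.tendsto_nhds.1 hΓ (ε / 2) (by positivity)
    rw [eventually_nhdsWithin_iff] at this
    simpa only [dist_eq_norm] using this
  obtain ⟨ρ', hρ', h1⟩ := Metric.eventually_nhds_iff_ball.1 h1
  refine eventually_ball.2 ⟨min (min ρ ρ') (ε / (2 * (|C| + 1))), by positivity,
    fun x hx y hy hyV => ?_⟩
  rw [Metric.mem_ball, lt_min_iff, lt_min_iff] at hx hy
  have hyρ : y ∈ Metric.ball θ ρ := hy.1.1
  -- The bound on the first parameter derivative makes the convergence at the corner uniform in the
  -- parameter, although the maps are not defined at the corner itself.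
  have h2 : ‖W x y - W p y‖ ≤ C * ‖x - p‖ := by
    refine (convex_ball p ρ).norm_image_sub_le_of_norm_fderiv_le (𝕜 := ℝ) (f := fun x => W x y)
      (fun z hz => ?_) (fun z hz => ?_) (Metric.mem_ball_self hρ) hx.1.1
    · exact (h.contDiffAt_left hU hV (hC z hz y hyρ).2 hyV).differentiableAt (by simp)
    · simpa using (hC z hz y hyρ).1 hyV
  have h3 : C * ‖x - p‖ < ε / 2 := by
    have hx2 := hx.2
    rw [dist_eq_norm, lt_div_iff₀ (by positivity)] at hx2
    nlinarith [le_abs_self C, norm_nonneg (x - p), mul_le_mul_of_nonneg_right (le_abs_self C)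
      (norm_nonneg (x - p))]
  have h4 := h1 y hy.1.2 hyV
  calc ‖W x y - Γ‖ = ‖(W x y - W p y) + (W p y - Γ)‖ := by ring_nf
    _ ≤ _ := norm_add_le _ _
    _ < ε := by linarith

/-- Derivative bounds for the height on one side of a corner. -/
lemma exists_height_bound {Λ : LegendrianKnot} {W : E → ℝ → ℂ} {H : E → ℝ → ℝ}
    (h : ParamSmooth U V K W) (hU : IsOpen U) (hV : IsOpen V)
    (hH : ContinuousOn (fun q : E × ℝ => H q.1 q.2) (U ×ˢ V))
    (hm : ∀ p ∈ U, ∀ θ ∈ V, Λ.Mem (W p θ) (H p θ)) {p : E} {θ : ℝ} (hp : p ∈ U) (hθ : θ ∈ K \ V)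
    {Γ : ℂ} {b : ℝ} (hΓ : Tendsto (W p) (𝓝[V] θ) (𝓝 Γ)) (hb : Λ.Mem Γ b) {S : Set ℝ}
    (hSV : S ⊆ V) (hS : ∀ ρ, IsPreconnected (Metric.ball θ ρ ∩ S))
    (hSθ : (𝓝[S] θ).NeBot) (hHb : Tendsto (H p) (𝓝[S] θ) (𝓝 b)) (k : ℕ) :
    ∃ C : ℝ, ∀ᶠ q : E × ℝ in 𝓝 (p, θ), q.2 ∈ S →
      ‖iteratedFDeriv ℝ k (fun x => H x q.2) q.1‖ ≤ C := by
  obtain ⟨Φ, δ, hδ, hΦ, -, hg⟩ := Λ.exists_local_graph hb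
  choose! C hC using h.bounded p hp θ hθ
  obtain ⟨B, ρ₁, hρ₁, hB⟩ := exists_comp_bound (E := E) hδ hΦ k C
  obtain ⟨δ₂, hδ₂, η, hη, hclose⟩ := Λ.exists_height_close hb hδ
  have hC' : ∀ᶠ q : E × ℝ in 𝓝 (p, θ), ∀ i ∈ Finset.range (k + 1), q.2 ∈ V →
      ‖iteratedFDeriv ℝ i (fun x => W x q.2) q.1‖ ≤ C i := by
    rw [eventually_all_finset]
    exact fun i _ => hC i
  obtain ⟨ρ, hρ, hall⟩ := eventually_ball.1 (((hC'.and
    (h.eventually_near hU hV hp hθ hΓ (lt_min hδ (lt_min hρ₁ hδ₂)))).and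
    (eventually_mem_left hU hp θ)))
  -- The parameter ball times one side of the corner is connected, so a height close to `b` at one
  -- point keeps all of them on that branch, where the height is the smooth function `Φ` of the
  -- projection.
  have hpre : IsPreconnected (Metric.ball p ρ ×ˢ (Metric.ball θ ρ ∩ S)) :=
    (convex_ball p ρ).isPreconnected.prod (hS ρ)
  have hsub : Metric.ball p ρ ×ˢ (Metric.ball θ ρ ∩ S) ⊆ U ×ˢ V := fun q hq =>
    ⟨(hall q.1 hq.1 q.2 hq.2.1).2, hSV hq.2.2⟩
  have hnear : ∀ x ∈ Metric.ball p ρ, ∀ y ∈ Metric.ball θ ρ ∩ S,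
      ‖W x y - Γ‖ < δ ∧ ‖W x y - Γ‖ < ρ₁ ∧ ‖W x y - Γ‖ < δ₂ := fun x hx y hy => by
    have := (hall x hx y hy.1).1.2 (hSV hy.2)
    rwa [lt_min_iff, lt_min_iff] at this
  obtain ⟨y₀, hy₀, hy₀S⟩ : ∃ y ∈ Metric.ball θ ρ ∩ S, |H p y - b| < η := by
    have h1 : ∀ᶠ y in 𝓝[S] θ, |H p y - b| < η := by
      simpa only [Real.dist_eq] using Metric.tendsto_nhds.1 hHb η hη
    have h2 : ∀ᶠ y in 𝓝[S] θ, y ∈ Metric.ball θ ρ ∩ S :=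
      inter_mem (mem_nhdsWithin_of_mem_nhds (Metric.ball_mem_nhds θ hρ)) self_mem_nhdsWithin
    obtain ⟨y, hy⟩ := (h2.and h1).exists
    exact ⟨y, hy⟩
  have hcl := hclose (w := fun q : E × ℝ => W q.1 q.2) hpre (hH.mono hsub)
    (fun q hq => hm _ (hsub hq).1 _ (hsub hq).2) (fun q hq => (hnear _ hq.1 _ hq.2).2.2)
    (p, y₀) ⟨Metric.mem_ball_self hρ, hy₀⟩ hy₀S
  refine ⟨B, eventually_ball.2 ⟨ρ, hρ, fun x hx y hy hyS => ?_⟩⟩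
  have heq : ∀ z ∈ Metric.ball p ρ, H z y = (Φ ∘ fun x => W x y) z := fun z hz =>
    hg _ _ (hm z (hall z hz y hy).2 y (hSV hyS)) (hnear z hz y ⟨hy, hyS⟩).1
      (hcl (z, y) ⟨hz, hy, hyS⟩)
  have he : (fun x => H x y) =ᶠ[𝓝 x] Φ ∘ fun x => W x y := by
    filter_upwards [Metric.isOpen_ball.mem_nhds hx] with z hz using heq z hz
  show ‖iteratedFDeriv ℝ k (fun x => H x y) x‖ ≤ B
  rw [(Filter.EventuallyEq.iteratedFDeriv ℝ he k).self_of_nhds]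
  refine hB Metric.isOpen_ball (fun z hz => ?_) (fun z hz => ?_) hx fun i hi => ?_
  · exact (h.contDiffAt_left hU hV (hall z hz y hy).2 (hSV hyS)).contDiffWithinAt
  · simpa [dist_eq_norm] using (hnear z hz y ⟨hy, hyS⟩).2.1
  · exact (hall x hx y hy).1.1 i (Finset.mem_range.2 (by omega)) (hSV hyS)

/-- The height of a family of boundary arcs with a corner at `0`. -/
lemma height {Λ : LegendrianKnot} {W : E → ℝ → ℂ} {H : E → ℝ → ℝ} {ε : ℝ} (hε : 0 < ε)
    (hVeq : V = {θ | θ ≠ 0 ∧ |θ| < ε}) (hK : K ⊆ Metric.ball 0 ε)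
    (h : ParamSmooth U V K W) (hU : IsOpen U)
    (hH : ContinuousOn (fun q : E × ℝ => H q.1 q.2) (U ×ˢ V))
    (hm : ∀ p ∈ U, ∀ θ ∈ V, Λ.Mem (W p θ) (H p θ))
    (hc : ∀ p ∈ U, ∃ Γ a b, Λ.Mem Γ a ∧ Λ.Mem Γ b ∧ Tendsto (W p) (𝓝[V] 0) (𝓝 Γ) ∧
      Tendsto (H p) (𝓝[<] 0) (𝓝 a) ∧ Tendsto (H p) (𝓝[>] 0) (𝓝 b)) :
    ParamSmooth U V K H := by
  have hV : IsOpen V := by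
    rw [hVeq]
    exact isOpen_ne.inter (isOpen_lt continuous_abs continuous_const)
  refine ⟨fun q hq => ?_, fun p hp θ hθ k => ?_⟩
  · have hq' := (hU.prod hV).mem_nhds hq
    exact (Λ.contDiffAt_lift (h.contDiffAt hU hV hq.1 hq.2) (hH.continuousAt hq')
      (mem_of_superset hq' fun y hy => hm _ hy.1 _ hy.2)).contDiffWithinAt
  · have h0 : θ = 0 := by
      by_contra hne
      refine hθ.2 ?_
      rw [hVeq]
      exact ⟨hne, by simpa using hK hθ.1⟩
    subst h0
    obtain ⟨Γ, a, b, ha, hb, hΓ, hHa, hHb⟩ := hc p hp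
    have hl : Set.Ioo (-ε) 0 ⊆ V := by
      rw [hVeq]
      exact fun x hx => ⟨hx.2.ne, by rw [abs_of_neg hx.2]; linarith [hx.1]⟩
    have hr : Set.Ioo 0 ε ⊆ V := by
      rw [hVeq]
      exact fun x hx => ⟨hx.1.ne', by rw [abs_of_pos hx.1]; exact hx.2⟩
    have el : 𝓝[Set.Ioo (-ε) 0] (0 : ℝ) = 𝓝[<] 0 := nhdsWithin_Ioo_eq_nhdsLT (by linarith)
    have er : 𝓝[Set.Ioo 0 ε] (0 : ℝ) = 𝓝[>] 0 := nhdsWithin_Ioo_eq_nhdsGT hε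
    obtain ⟨C, hC⟩ := h.exists_height_bound hU hV hH hm hp hθ hΓ ha hl
      (fun ρ => ((convex_ball _ _).inter (convex_Ioo _ _)).isPreconnected)
      (by rw [el]; infer_instance) (by rwa [el]) k
    obtain ⟨C', hC'⟩ := h.exists_height_bound hU hV hH hm hp hθ hΓ hb hr
      (fun ρ => ((convex_ball _ _).inter (convex_Ioo _ _)).isPreconnected)
      (by rw [er]; infer_instance) (by rwa [er]) k
    refine ⟨max C C', ?_⟩
    filter_upwards [hC, hC'] with q h1 h2 hq
    rw [hVeq] at hq
    rcases lt_or_gt_of_ne hq.1 with h0 | h0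
    · refine (h1 ⟨?_, h0⟩).trans (le_max_left _ _)
      have := hq.2
      rw [abs_of_neg h0] at this
      linarith
    · exact (h2 ⟨h0, by simpa [abs_of_pos h0] using hq.2⟩).trans (le_max_right _ _)

/-- Multiplication by a smooth function independent of the parameter. -/
lemma smul {H : E → ℝ → ℝ} (h : ParamSmooth U V K H) (hU : IsOpen U) (hV : IsOpen V) {χ : ℝ → ℝ}
    (hχ : ContDiff ℝ ∞ χ) {B : ℝ} (hB : ∀ θ, |χ θ| ≤ B) :
    ParamSmooth U V K fun p θ => χ θ * H p θ where
  smooth := (hχ.comp contDiff_snd).contDiffOn.mul h.smooth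
  bounded p hp θ hθ k := by
    obtain ⟨C, hC⟩ := h.bounded p hp θ hθ k
    refine ⟨B * C, ?_⟩
    filter_upwards [hC, eventually_mem_left hU hp θ] with q hq hqU hqV
    have := iteratedFDeriv_const_smul_apply (a := χ q.2) (i := k)
      ((h.contDiffAt_left hU hV hqU hqV).of_le (by exact_mod_cast le_top))
    show ‖iteratedFDeriv ℝ k (χ q.2 • fun x => H x q.2) q.1‖ ≤ _
    rw [this, norm_smul]
    exact mul_le_mul (hB _) (hq hqV) (norm_nonneg _) ((abs_nonneg _).trans (hB 0))

end ParamSmooth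

end LegAnnuli

/-! ### Boundary circles in smooth families of annuli -/

namespace LegAnnuli

variable {E : Type} [NormedAddCommGroup E] [NormedSpace ℝ E] {Λ : LegendrianKnot}

/-- A smooth family of annuli together with one of its two boundary circles, of radius `R p`. -/
structure CircleFamily (F : E → HolAnnulus Λ) (R : E → ℝ) {m : ℕ} (t : Fin m → E → ℂ) : Prop where
  smooth_r : ContDiff ℝ ∞ fun p => (F p).r
  radius : (∀ p, R p = 1) ∨ ∀ p, R p = (F p).r
  smooth_u : ContDiffOn ℝ ∞ (fun q : E × ℂ => (F q.1).curve.u q.2) {q | q.2 ∈ (F q.1).curve.dom}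
  smooth_t : ∀ j, ContDiff ℝ ∞ (t j)
  injective : ∀ p, Function.Injective fun j => t j p
  punctures : ∀ p, ((F p).curve.P : Set ℂ) = Set.range fun j => t j p
  bounded : ∀ (j : Fin m) (p₀ : E) (k : ℕ), ∃ δ > 0, ∃ C : ℝ,
    ∀ p ∈ Metric.ball p₀ δ, ∀ ζ : ℂ, 0 ≤ ζ.im → ζ ≠ 0 → ‖ζ‖ < δ →
      ‖iteratedFDeriv ℝ k
        (fun q => (F q).curve.u ((annulus (F q).r).chart (t j q) ζ)) p‖ ≤ C

namespace CircleFamily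

variable {F : E → HolAnnulus Λ} {R : E → ℝ} {m : ℕ} {t : Fin m → E → ℂ}

lemma radius_eq (h : CircleFamily F R t) (p : E) : R p = 1 ∨ R p = (F p).r :=
  h.radius.imp (fun h => h p) fun h => h p

lemma radius_pos (h : CircleFamily F R t) (p : E) : 0 < R p := by
  rcases h.radius_eq p with h1 | h1 <;> linarith [(F p).one_lt_r]

lemma smooth_R (h : CircleFamily F R t) : ContDiff ℝ ∞ R := by
  rcases h.radius with h1 | h1
  · rw [funext h1]
    exact contDiff_const
  · rw [funext h1]
    exact h.smooth_r

lemma mem_P (h : CircleFamily F R t) {p : E} {z : ℂ} : z ∈ (F p).curve.P ↔ ∃ j, t j p = z := by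
  rw [← Finset.mem_coe, h.punctures p]
  rfl

lemma mem_arcs (h : CircleFamily F R t) {p : E} {θ : ℝ} :
    θ ∈ (F p).curve.arcs (R p) ↔ ∀ j, t j p ≠ cpt (R p) θ := by
  show cpt (R p) θ ∉ (F p).curve.P ↔ _
  rw [h.mem_P]
  push Not
  rfl

lemma norm_t (h : CircleFamily F R t) (j : Fin m) (p : E) : ‖t j p‖ = 1 ∨ ‖t j p‖ = (F p).r :=
  (F p).curve.punctures_mem _ (h.mem_P.2 ⟨j, rfl⟩)

/-- A puncture stays on the same boundary component. -/
lemma norm_eq_or_ne (h : CircleFamily F R t) (j : Fin m) :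
    (∀ p, ‖t j p‖ = R p) ∨ ∀ p, ‖t j p‖ ≠ R p := by
  have hcl : IsClosed {p | ‖t j p‖ = R p} :=
    isClosed_eq (h.smooth_t j).continuous.norm h.smooth_R.continuous
  have hop : IsOpen {p | ‖t j p‖ = R p} := by
    -- The radius of the other boundary circle is `1 + r - R`. Lying on this circle is thus the
    -- complement of lying on the other, and both conditions are closed.
    have h2 : {p | ‖t j p‖ = R p} = {p | ‖t j p‖ = 1 + (F p).r - R p}ᶜ := by
      ext p
      show ‖t j p‖ = R p ↔ ¬ ‖t j p‖ = 1 + (F p).r - R p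
      have := (F p).one_lt_r
      rcases h.norm_t j p with h1 | h1 <;> rcases h.radius_eq p with h3 | h3 <;> rw [h1, h3]
      · exact ⟨fun _ => by linarith, fun _ => rfl⟩
      · exact ⟨fun _ => by linarith, fun h => absurd (by ring) h⟩
      · exact ⟨fun _ => by linarith, fun h => absurd (by ring) h⟩
      · exact ⟨fun _ => by linarith, fun _ => rfl⟩
    rw [h2]
    exact (isClosed_eq (h.smooth_t j).continuous.norm ((continuous_const.add
      h.smooth_r.continuous).sub h.smooth_R.continuous)).isOpen_compl
  rcases isClopen_iff.1 ⟨hcl, hop⟩ with h1 | h1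
  · exact Or.inr fun p hp => (Set.eq_empty_iff_forall_notMem.1 h1 p) hp
  · exact Or.inl fun p => (Set.eq_univ_iff_forall.1 h1 p)

/-- The parameters of the boundary points which are not punctures. -/
def arcSet (F : E → HolAnnulus Λ) (R : E → ℝ) : Set (E × ℝ) :=
  {q | q.2 ∈ (F q.1).curve.arcs (R q.1)}

lemma contDiff_circle (h : CircleFamily F R t) :
    ContDiff ℝ ∞ fun q : E × ℝ => cpt (R q.1) q.2 :=
  ContDiff.comp (g := fun q : ℝ × ℝ => cpt q.1 q.2) contDiff_cpt
    ((h.smooth_R.comp contDiff_fst).prodMk contDiff_snd)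

lemma isOpen_arcSet (h : CircleFamily F R t) : IsOpen (arcSet F R) := by
  have h1 : arcSet F R = ⋂ j, {q : E × ℝ | t j q.1 ≠ cpt (R q.1) q.2} := by
    ext q
    simp only [Set.mem_iInter]
    exact h.mem_arcs
  rw [h1]
  exact isOpen_iInter_of_finite fun j => isOpen_ne_fun
    ((h.smooth_t j).continuous.comp continuous_fst) h.contDiff_circle.continuous

/-- The boundary values of the family on the circle. -/
noncomputable def trace (F : E → HolAnnulus Λ) (R : E → ℝ) (p : E) (θ : ℝ) : ℂ := (F p).curve.u (cpt (R p) θ)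

/-- The height of the family on the circle. -/
noncomputable def hgt (F : E → HolAnnulus Λ) (R : E → ℝ) (p : E) (θ : ℝ) : ℝ := (F p).curve.h (cpt (R p) θ)

lemma contDiffOn_trace (h : CircleFamily F R t) :
    ContDiffOn ℝ ∞ (fun q : E × ℝ => trace F R q.1 q.2) (arcSet F R) :=
  ContDiffOn.comp (g := fun q : E × ℂ => (F q.1).curve.u q.2)
    (f := fun q : E × ℝ => (q.1, cpt (R q.1) q.2)) h.smooth_u
    (contDiff_fst.prodMk h.contDiff_circle).contDiffOn
    fun q hq => HolCurve.cpt_mem_dom (F q.1).one_lt_r (h.radius_eq q.1) hq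

lemma mem_hgt (h : CircleFamily F R t) {q : E × ℝ} (hq : q ∈ arcSet F R) :
    Λ.Mem (trace F R q.1 q.2) (hgt F R q.1 q.2) :=
  HolCurve.mem_height (F q.1).one_lt_r (h.radius_eq q.1) hq

/-- The traces converge uniformly on a small closed arc by compactness, so stability of lifts makes
the heights converge uniformly there. Continuity of the limiting height then gives joint continuity.
-/
lemma continuousOn_hgt (h : CircleFamily F R t) [ProperSpace E] (hΛ : Λ.GeneralPosition) :
    ContinuousOn (fun q : E × ℝ => hgt F R q.1 q.2) (arcSet F R) := by
  rintro ⟨p₀, θ₀⟩ hq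
  refine ContinuousAt.continuousWithinAt ?_
  obtain ⟨ρ, hρ, hsub⟩ := Metric.nhds_basis_closedBall.mem_iff.1 (h.isOpen_arcSet.mem_nhds hq)
  rw [← closedBall_prod_same] at hsub
  have harc : ∀ p ∈ Metric.closedBall p₀ ρ, Metric.closedBall θ₀ ρ ⊆ (F p).curve.arcs (R p) :=
    fun p hp θ hθ => hsub (show (p, θ) ∈ _ from ⟨hp, hθ⟩)
  have hp₀ : p₀ ∈ Metric.closedBall p₀ ρ := Metric.mem_closedBall_self hρ.le
  have hnear : ∀ᶠ p in 𝓝 p₀, p ∈ Metric.closedBall p₀ ρ := Metric.closedBall_mem_nhds _ hρ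
  have huc : UniformContinuousOn (fun q : E × ℝ => trace F R q.1 q.2)
      (Metric.closedBall p₀ ρ ×ˢ Metric.closedBall θ₀ ρ) :=
    ((isCompact_closedBall p₀ ρ).prod (isCompact_closedBall θ₀ ρ)).uniformContinuousOn_of_continuous
      (h.contDiffOn_trace.continuousOn.mono hsub)
  have hlift := LegendrianKnot.lift_tendsto hΛ (l := 𝓝 p₀) (I := Metric.closedBall θ₀ ρ)
    (v := trace F R p₀) (h := hgt F R p₀) (w := trace F R) (k := hgt F R)
    (convex_closedBall _ _).isPreconnected
    ((HolCurve.continuousOn_trace (F p₀).one_lt_r (h.radius_eq p₀)).mono (harc p₀ hp₀)) ?_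
    ((HolCurve.continuousOn_height (F p₀).one_lt_r (h.radius_eq p₀)).mono (harc p₀ hp₀))
    (fun θ hθ => HolCurve.mem_height (F p₀).one_lt_r (h.radius_eq p₀) (harc p₀ hp₀ hθ)) ?_ ?_
  · have hc : ContinuousAt (hgt F R p₀) θ₀ :=
      (HolCurve.continuousOn_height (F p₀).one_lt_r (h.radius_eq p₀)).continuousAt
        (((F p₀).curve.isOpen_arcs _).mem_nhds hq)
    refine Metric.tendsto_nhds.2 fun ε hε => ?_
    have h1 := hlift (ε / 2) (by positivity)
    have h2 := Metric.tendsto_nhds.1 hc (ε / 2) (by positivity)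
    have h3 : ∀ᶠ θ in 𝓝 θ₀, θ ∈ Metric.closedBall θ₀ ρ := Metric.closedBall_mem_nhds _ hρ
    rw [nhds_prod_eq]
    filter_upwards [h1.prod_mk (h2.and h3)] with q hq
    have h4 := hq.1 q.2 hq.2.2
    have h5 := hq.2.1
    rw [Real.dist_eq] at h5 ⊢
    calc _ ≤ |hgt F R q.1 q.2 - hgt F R p₀ q.2| + |hgt F R p₀ q.2 - hgt F R p₀ θ₀| :=
          abs_sub_le _ _ _
      _ < ε := by linarith
  · rintro ⟨c, hc⟩
    refine HolCurve.not_const_arc (C := (F p₀).curve) (F p₀).one_lt_r (h.radius_eq p₀)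
      (a := θ₀ - ρ) (b := θ₀ + ρ) (by linarith) ?_ ⟨c, ?_⟩
    · rw [← Real.ball_eq_Ioo]
      exact Metric.ball_subset_closedBall.trans (harc p₀ hp₀)
    · rw [← Real.ball_eq_Ioo]
      exact fun x hx => hc x (Metric.ball_subset_closedBall hx)
  · filter_upwards [hnear] with p hp
    exact ⟨(HolCurve.continuousOn_height (F p).one_lt_r (h.radius_eq p)).mono (harc p hp),
      fun θ hθ => HolCurve.mem_height (F p).one_lt_r (h.radius_eq p) (harc p hp hθ)⟩
  · intro δ hδ
    obtain ⟨η, hη, huc⟩ := Metric.uniformContinuousOn_iff.1 huc δ hδ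
    filter_upwards [hnear, Metric.ball_mem_nhds p₀ hη] with p hp hpη θ hθ
    have := huc (p, θ) ⟨hp, hθ⟩ (p₀, θ) ⟨hp₀, hθ⟩ (by
      rw [Prod.dist_eq, dist_self]
      exact max_lt hpη hη)
    rwa [dist_eq_norm] at this

lemma contDiffAt_hgt (h : CircleFamily F R t) [ProperSpace E] (hΛ : Λ.GeneralPosition) {q : E × ℝ}
    (hq : q ∈ arcSet F R) : ContDiffAt ℝ ∞ (fun q : E × ℝ => hgt F R q.1 q.2) q := by
  have hn := h.isOpen_arcSet.mem_nhds hq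
  exact Λ.contDiffAt_lift (h.contDiffOn_trace.contDiffAt hn)
    ((h.continuousOn_hgt hΛ).continuousAt hn) (mem_of_superset hn fun q hq => h.mem_hgt hq)

/-- The boundary chart at a puncture on the circle, in the angular coordinate. -/
lemma exists_chart_eq (h : CircleFamily F R t) {j : Fin m} (hj : ∀ p, ‖t j p‖ = R p) :
    ∃ σ : ℝ, (σ = 1 ∨ σ = -1) ∧ ∀ p (φ θ : ℝ), cpt (R p) φ = t j p →
      cpt (R p) (φ + θ) = (annulus (F p).r).chart (t j p) ((σ * θ : ℝ) : ℂ) := by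
  rcases h.radius with h1 | h1
  · refine ⟨-1, Or.inr rfl, fun p φ θ hφ => ?_⟩
    have hne : ‖t j p‖ ≠ (F p).r := by rw [hj, h1]; exact (F p).one_lt_r.ne
    show _ = if ‖t j p‖ = (F p).r then _ else _
    rw [if_neg hne, cpt_add, hφ, mul_comm]
    push_cast
    congr 2
    ring
  · refine ⟨1, Or.inl rfl, fun p φ θ hφ => ?_⟩
    show _ = if ‖t j p‖ = (F p).r then _ else _
    rw [if_pos (by rw [hj, h1]), cpt_add, hφ, mul_comm]
    push_cast
    congr 2
    ring

/-- At a puncture on the circle, the trace converges to the corner and the height has one-sided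
limits. -/
lemma exists_corner (h : CircleFamily F R t) {j : Fin m} (hj : ∀ p, ‖t j p‖ = R p) {p : E} {φ : ℝ}
    (hφ : cpt (R p) φ = t j p) {V : Set ℝ} (hV : ∀ θ ∈ V, φ + θ ∈ (F p).curve.arcs (R p)) :
    ∃ Γ a b, Λ.Mem Γ a ∧ Λ.Mem Γ b ∧ Tendsto (fun θ => trace F R p (φ + θ)) (𝓝[V] 0) (𝓝 Γ) ∧
      Tendsto (fun θ => hgt F R p (φ + θ)) (𝓝[<] 0) (𝓝 a) ∧
      Tendsto (fun θ => hgt F R p (φ + θ)) (𝓝[>] 0) (𝓝 b) := by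
  have hcorner : ∃ Γ a b, (F p).curve.HasCorner (t j p) Γ a b := by
    have htP : t j p ∈ (F p).curve.P := h.mem_P.2 ⟨j, rfl⟩
    by_cases hpos : t j p = (F p).pos
    · obtain ⟨Γ, a, b, hc, -⟩ := (F p).isPos
      exact ⟨Γ, a, b, by rwa [hpos]⟩
    · obtain ⟨Γ, a, b, hc, -⟩ := (F p).isNeg _ htP hpos
      exact ⟨Γ, a, b, hc⟩
  obtain ⟨Γ, a, b, ha, hb, hu, hl, hr⟩ := hcorner
  have hu' : Tendsto (fun θ => trace F R p (φ + θ)) (𝓝[V] 0) (𝓝 Γ) := by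
    refine hu.comp (tendsto_nhdsWithin_iff.2 ⟨?_, ?_⟩)
    · have hc : Continuous fun θ : ℝ => cpt (R p) (φ + θ) := (continuous_cpt _).comp (by fun_prop)
      have := hc.tendsto 0
      rw [add_zero, hφ] at this
      exact this.mono_left nhdsWithin_le_nhds
    · filter_upwards [self_mem_nhdsWithin] with θ hθ
      exact HolCurve.cpt_mem_dom (F p).one_lt_r (h.radius_eq p) (hV θ hθ)
  obtain ⟨σ, hσ, hch⟩ := h.exists_chart_eq hj
  have hH : ∀ θ, hgt F R p (φ + θ) = (F p).curve.h ((annulus (F p).r).chart (t j p) (σ * θ : ℝ)) :=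
    fun θ => by rw [hgt, hch p φ θ hφ]
  rcases hσ with rfl | rfl
  · refine ⟨Γ, a, b, ha, hb, hu', ?_, ?_⟩
    · simpa only [hH, one_mul] using hl
    · simpa only [hH, one_mul] using hr
  -- On the inner circle the chart runs against the angle, which exchanges the two one-sided limits.
  · refine ⟨Γ, b, a, hb, ha, hu', ?_, ?_⟩
    · have hn : Tendsto (fun θ : ℝ => -θ) (𝓝[<] 0) (𝓝[>] 0) := by
        simpa using tendsto_neg_nhdsLT (a := (0 : ℝ))
      simpa only [hH, neg_one_mul, Function.comp_def] using hr.comp hn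
    · have hn : Tendsto (fun θ : ℝ => -θ) (𝓝[>] 0) (𝓝[<] 0) := by
        simpa using tendsto_neg_nhdsGT (a := (0 : ℝ))
      simpa only [hH, neg_one_mul, Function.comp_def] using hl.comp hn

/-- The height near a moving puncture on the circle, in the coordinate centred at the puncture. -/
lemma paramSmooth_hgt (h : CircleFamily F R t) [ProperSpace E] (hΛ : Λ.GeneralPosition) {j : Fin m}
    (hj : ∀ p, ‖t j p‖ = R p) {U : Set E} (hU : IsOpen U) {φ : E → ℝ} (hφ : ContDiffOn ℝ ∞ φ U)
    (hφt : ∀ p ∈ U, cpt (R p) (φ p) = t j p) {ε : ℝ} (hε : 0 < ε) {K : Set ℝ}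
    (hK : K ⊆ Metric.ball 0 ε)
    (harc : ∀ p ∈ U, ∀ θ, θ ≠ 0 → |θ| < ε → φ p + θ ∈ (F p).curve.arcs (R p)) :
    ParamSmooth U {θ | θ ≠ 0 ∧ |θ| < ε} K fun p θ => hgt F R p (φ p + θ) := by
  set V : Set ℝ := {θ | θ ≠ 0 ∧ |θ| < ε} with hV
  have hshift : ContDiffOn ℝ ∞ (fun q : E × ℝ => (q.1, φ q.1 + q.2)) (U ×ˢ V) :=
    contDiffOn_fst.prodMk ((hφ.comp contDiffOn_fst fun q hq => hq.1).add contDiffOn_snd)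
  have hmaps : Set.MapsTo (fun q : E × ℝ => (q.1, φ q.1 + q.2)) (U ×ˢ V) (arcSet F R) :=
    fun q hq => harc q.1 hq.1 q.2 hq.2.1 hq.2.2
  obtain ⟨σ, hσ, hch⟩ := h.exists_chart_eq hj
  have hσ1 : |σ| = 1 := by rcases hσ with rfl | rfl <;> simp
  have hW : ParamSmooth U V K fun p θ => trace F R p (φ p + θ) := by
    refine ⟨ContDiffOn.comp (g := fun q : E × ℝ => trace F R q.1 q.2) h.contDiffOn_trace hshift
      hmaps, fun p hp θ hθ k => ?_⟩
    have h0 : θ = 0 := by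
      by_contra hne
      exact hθ.2 ⟨hne, by simpa using hK hθ.1⟩
    subst h0
    obtain ⟨δ, hδ, C, hC⟩ := h.bounded j p k
    obtain ⟨ρ, hρ, hρU⟩ := Metric.isOpen_iff.1 hU p hp
    refine ⟨C, ParamSmooth.eventually_ball.2 ⟨min δ ρ, by positivity, fun x hx θ hθ hθV => ?_⟩⟩
    have hxU : x ∈ U := hρU (Metric.ball_subset_ball (min_le_right _ _) hx)
    have heq : (fun x => trace F R x (φ x + θ)) =ᶠ[𝓝 x] fun q =>
        (F q).curve.u ((annulus (F q).r).chart (t j q) ((σ * θ : ℝ) : ℂ)) := by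
      filter_upwards [hU.mem_nhds hxU] with y hy
      rw [trace, hch y (φ y) θ (hφt y hy)]
    show ‖iteratedFDeriv ℝ k (fun x => trace F R x (φ x + θ)) x‖ ≤ C
    rw [(Filter.EventuallyEq.iteratedFDeriv ℝ heq k).self_of_nhds]
    refine hC x (Metric.ball_subset_ball (min_le_left _ _) hx) _ (by simp) ?_ ?_
    · rw [Complex.ofReal_ne_zero]
      refine mul_ne_zero (fun h0 => ?_) hθV.1
      rw [h0, abs_zero] at hσ1
      exact zero_ne_one hσ1
    · rw [Complex.norm_real, Real.norm_eq_abs, abs_mul, hσ1, one_mul]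
      simpa using Metric.ball_subset_ball (min_le_left _ _) hθ
  refine ParamSmooth.height (Λ := Λ) hε hV hK hW hU ?_ (fun p hp θ hθ => ?_) fun p hp => ?_
  · exact ContinuousOn.comp (g := fun q : E × ℝ => hgt F R q.1 q.2) (h.continuousOn_hgt hΛ)
      hshift.continuousOn hmaps
  · exact h.mem_hgt (hmaps (show (p, θ) ∈ U ×ˢ V from ⟨hp, hθ⟩))
  · exact h.exists_corner hj (hφt p hp) fun θ hθ => harc p hp θ hθ.1 hθ.2

end CircleFamily

end LegAnnuli

/-! ### Smooth angles of moving punctures -/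

namespace LegAnnuli

/-- A smooth local angle of a nowhere zero complex-valued function. -/
lemma contDiffAt_arg {E : Type} [NormedAddCommGroup E] [NormedSpace ℝ E] {g : E → ℂ} {p : E}
    (hg : ContDiffAt ℝ ∞ g p) (hs : g p ∈ Complex.slitPlane) :
    ContDiffAt ℝ ∞ (fun q => (g q).arg) p := by
  have h1 : ContDiffAt ℝ ∞ Complex.log (g p) :=
    ((Complex.contDiffAt_log (n := ∞) hs).restrict_scalars ℝ)
  have h2 : ContDiffAt ℝ ∞ (fun q => (Complex.log (g q)).im) p :=
    ContDiffAt.comp (g := fun w : ℂ => w.im) p Complex.imCLM.contDiff.contDiffAt (h1.comp p hg)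
  simpa only [Complex.log_im] using h2

namespace CircleFamily

variable {E : Type} [NormedAddCommGroup E] [NormedSpace ℝ E] {Λ : LegendrianKnot}
  {F : E → HolAnnulus Λ} {R : E → ℝ} {m : ℕ} {t : Fin m → E → ℂ}

/-- Separated angles of the punctures on the circle, for parameters in `U`, relative to the
base angle `a`. -/
structure Angles (F : E → HolAnnulus Λ) (R : E → ℝ) (t : Fin m → E → ℂ) (U : Set E) (a ε : ℝ)
    (J : Finset (Fin m)) (φ : Fin m → E → ℝ) : Prop where
  isOpen : IsOpen U
  pos : 0 < ε
  norm_eq : ∀ j ∈ J, ∀ p, ‖t j p‖ = R p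
  smooth : ∀ j ∈ J, ContDiffOn ℝ ∞ (φ j) U
  eq : ∀ j ∈ J, ∀ p ∈ U, cpt (R p) (φ j p) = t j p
  left : ∀ j ∈ J, ∀ p ∈ U, a + 5 * ε < φ j p
  right : ∀ j ∈ J, ∀ p ∈ U, φ j p < a + 2 * Real.pi - 5 * ε
  separated : ∀ i ∈ J, ∀ j ∈ J, i ≠ j → ∀ p ∈ U, 5 * ε < |φ i p - φ j p|
  mem_arcs : ∀ p ∈ U, ∀ θ, a - ε < θ → θ < a + 2 * Real.pi + ε → (∀ j ∈ J, θ ≠ φ j p) →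
    θ ∈ (F p).curve.arcs (R p)

/-- At `p₀` the punctures on the circle have distinct angles in an open period starting at a regular
angle `a`. By continuity these spread to nearby parameters with a common separation. -/
lemma exists_angles (h : CircleFamily F R t) (p₀ : E) :
    ∃ U a ε J φ, p₀ ∈ U ∧ Angles F R t U a ε J φ := by
  classical
  obtain ⟨a, ha⟩ : ((F p₀).curve.arcs (R p₀)).Nonempty := by
    have h1 := (HolCurve.arcs_compl_countable (C := (F p₀).curve) (h.radius_pos p₀)).dense_compl ℝ
    rw [compl_compl] at h1
    exact h1.nonempty
  set J : Finset (Fin m) := Finset.univ.filter fun j => ∀ p, ‖t j p‖ = R p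
  have hJ : ∀ j, j ∈ J ↔ ∀ p, ‖t j p‖ = R p := fun j => by simp [J]
  have hang : ∀ j, j ∈ J → ∃ φ₀ : ℝ, a < φ₀ ∧ φ₀ < a + 2 * Real.pi ∧ cpt (R p₀) φ₀ = t j p₀ := by
    intro j hj
    obtain ⟨ψ, hψ⟩ := exists_cpt ((hJ j).1 hj p₀)
    have hmem := toIocMod_mem_Ioc Real.two_pi_pos a ψ
    have heq : cpt (R p₀) (toIocMod Real.two_pi_pos a ψ) = t j p₀ := by
      rw [toIocMod, (cpt_periodic (R p₀)).sub_zsmul_eq, hψ]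
    refine ⟨_, hmem.1, lt_of_le_of_ne hmem.2 fun hne => ?_, heq⟩
    rw [hne, cpt_periodic (R p₀)] at heq
    exact h.mem_arcs.1 ha j heq.symm
  choose! φ₀ hl hr heq using hang
  -- Separation by `6 * ε` at `p₀` leaves `5 * ε` nearby, since each angle moves by less than `ε /
  -- 2`.
  have hsmall : ∀ x : ℝ, 0 < x → ∀ᶠ ε in 𝓝[>] (0 : ℝ), 6 * ε < x := fun x hx => by
    have : Tendsto (fun ε : ℝ => 6 * ε) (𝓝[>] 0) (𝓝 0) := by
      have h1 : Continuous fun ε : ℝ => 6 * ε := by fun_prop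
      simpa using (h1.tendsto 0).mono_left nhdsWithin_le_nhds
    exact this.eventually_lt_const hx
  obtain ⟨ε, hε, hε1, hε2⟩ : ∃ ε : ℝ, 0 < ε ∧ (∀ j, j ∈ J → 6 * ε < φ₀ j - a ∧
      6 * ε < a + 2 * Real.pi - φ₀ j) ∧ ∀ i j, i ∈ J → j ∈ J → i ≠ j →
        6 * ε < |φ₀ i - φ₀ j| := by
    have h1 : ∀ᶠ ε in 𝓝[>] (0 : ℝ), ∀ j, j ∈ J → 6 * ε < φ₀ j - a ∧
        6 * ε < a + 2 * Real.pi - φ₀ j := by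
      refine eventually_all.2 fun j => ?_
      by_cases hj : j ∈ J
      · filter_upwards [hsmall _ (sub_pos.2 (hl j hj)), hsmall _ (sub_pos.2 (hr j hj))]
          with ε h1 h2 _ using ⟨h1, h2⟩
      · exact Eventually.of_forall fun _ hj' => absurd hj' hj
    have h2 : ∀ᶠ ε in 𝓝[>] (0 : ℝ), ∀ i j, i ∈ J → j ∈ J → i ≠ j → 6 * ε < |φ₀ i - φ₀ j| := by
      refine eventually_all.2 fun i => eventually_all.2 fun j => ?_
      by_cases hij : i ∈ J ∧ j ∈ J ∧ i ≠ j
      · have hne : φ₀ i ≠ φ₀ j := fun he => hij.2.2 (h.injective p₀ (by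
          show t i p₀ = t j p₀
          rw [← heq i hij.1, ← heq j hij.2.1, he]))
        filter_upwards [hsmall _ (abs_pos.2 (sub_ne_zero.2 hne))] with ε h1 _ _ _ using h1
      · exact Eventually.of_forall fun _ h1 h2 h3 => absurd ⟨h1, h2, h3⟩ hij
    obtain ⟨ε, ⟨h1, h2⟩, h3⟩ := ((h1.and h2).and self_mem_nhdsWithin).exists
    exact ⟨ε, h3, h1, h2⟩
  -- Rotating the puncture to the positive real axis at `p₀` makes the principal argument smooth
  -- near `p₀`.
  let g : Fin m → E → ℂ := fun j p => t j p * Complex.exp (-(φ₀ j * Complex.I))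
  have hg : ∀ j, ContDiff ℝ ∞ (g j) := fun j => (h.smooth_t j).mul contDiff_const
  have hg₀ : ∀ j ∈ J, g j p₀ = R p₀ := fun j hj => by
    show t j p₀ * _ = _
    rw [← heq j hj, cpt, mul_assoc, ← Complex.exp_add, add_neg_cancel, Complex.exp_zero, mul_one]
  have hs₀ : ∀ j ∈ J, g j p₀ ∈ Complex.slitPlane := fun j hj => by
    rw [hg₀ j hj, Complex.ofReal_mem_slitPlane]
    exact h.radius_pos p₀
  have hev : ∀ᶠ p in 𝓝 p₀, ∀ j, j ∈ J → g j p ∈ Complex.slitPlane ∧ |(g j p).arg| < ε / 2 := by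
    refine eventually_all.2 fun j => ?_
    by_cases hj : j ∈ J
    · have h1 := (hg j).continuous.continuousAt.eventually_mem
        (Complex.isOpen_slitPlane.mem_nhds (hs₀ j hj))
      have h2 : ContinuousAt (fun p => |(g j p).arg|) p₀ :=
        (contDiffAt_arg (hg j).contDiffAt (hs₀ j hj)).continuousAt.abs
      have h3 : |(g j p₀).arg| < ε / 2 := by
        rw [hg₀ j hj, Complex.arg_ofReal_of_nonneg (h.radius_pos p₀).le, abs_zero]
        positivity
      filter_upwards [h1, h2.eventually_lt_const h3] with p h1 h2 _ using ⟨h1, h2⟩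
    · exact Eventually.of_forall fun _ hj' => absurd hj' hj
  obtain ⟨U, hU, hUo, hp₀⟩ := eventually_nhds_iff.1 hev
  have hφeq : ∀ j ∈ J, ∀ p, cpt (R p) (φ₀ j + (g j p).arg) = t j p := fun j hj p => by
    have hn : ‖g j p‖ = R p := by
      rw [norm_mul, ← neg_mul, ← Complex.ofReal_neg, Complex.norm_exp_ofReal_mul_I, mul_one,
        (hJ j).1 hj p]
    have h1 := Complex.norm_mul_exp_arg_mul_I (g j p)
    rw [hn] at h1
    rw [add_comm, cpt_add, cpt, h1]
    show Complex.exp _ * (t j p * Complex.exp _) = _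
    rw [mul_left_comm, ← Complex.exp_add, add_neg_cancel, Complex.exp_zero, mul_one]
  have hbd : ∀ j ∈ J, ∀ p ∈ U, -(ε / 2) < (g j p).arg ∧ (g j p).arg < ε / 2 := fun j hj p hp =>
    abs_lt.1 (hU p hp j hj).2
  have hleft : ∀ j ∈ J, ∀ p ∈ U, a + 5 * ε < φ₀ j + (g j p).arg := fun j hj p hp => by
    linarith [hbd j hj p hp, (hε1 j hj).1]
  have hright : ∀ j ∈ J, ∀ p ∈ U, φ₀ j + (g j p).arg < a + 2 * Real.pi - 5 * ε :=
    fun j hj p hp => by linarith [hbd j hj p hp, (hε1 j hj).2]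
  refine ⟨U, a, ε, J, fun j p => φ₀ j + (g j p).arg, hp₀, hUo, hε, fun j hj => (hJ j).1 hj,
    fun j hj p hp => (contDiffAt_const.add
      (contDiffAt_arg (hg j).contDiffAt (hU p hp j hj).1)).contDiffWithinAt,
    fun j hj p _ => hφeq j hj p, hleft, hright, fun i hi j hj hij p hp => ?_,
    fun p hp θ hθ1 hθ2 hne => ?_⟩
  · have h1 := hε2 i j hi hj hij
    have h2 := hbd i hi p hp
    have h3 := hbd j hj p hp
    rcases abs_cases (φ₀ i - φ₀ j) with h4 | h4
    · rw [lt_abs]; left; linarith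
    · rw [lt_abs]; right; linarith
  · rw [h.mem_arcs]
    intro j hj
    have hjJ : j ∈ J := by
      rw [hJ]
      refine (h.norm_eq_or_ne j).resolve_right fun hn => hn p ?_
      rw [hj, norm_cpt (h.radius_pos p).le]
    rw [← hφeq j hjJ p] at hj
    obtain ⟨k, hk⟩ := (cpt_eq_iff (h.radius_pos p)).1 hj.symm
    have h1 := hleft j hjJ p hp
    have h2 := hright j hjJ p hp
    have hpi := Real.pi_pos
    have hk0 : k = 0 := by
      have e1 : (k : ℝ) < 1 := by
        by_contra hc
        push Not at hc
        nlinarith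
      have e2 : (-1 : ℝ) < k := by
        by_contra hc
        push Not at hc
        nlinarith
      have e1' : k < 1 := by exact_mod_cast e1
      have e2' : -1 < k := by exact_mod_cast e2
      omega
    refine hne j hjJ ?_
    rw [hk, hk0]
    simp

end CircleFamily

end LegAnnuli

/-! ### Smoothness of the total height and of the flux -/

namespace LegAnnuli

namespace CircleFamily

variable {E : Type} [NormedAddCommGroup E] [NormedSpace ℝ E] {Λ : LegendrianKnot}
  {F : E → HolAnnulus Λ} {R : E → ℝ} {m : ℕ} {t : Fin m → E → ℂ} {U : Set E} {a ε : ℝ}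
  {J : Finset (Fin m)} {φ : Fin m → E → ℝ} {χ : ℝ → ℝ}

namespace Angles

/-- The radius `3 * ε` is below the separation `5 * ε`, so the only puncture in this neighbourhood
is its centre. -/
lemma shift_mem_arcs (hA : Angles F R t U a ε J φ) {j : Fin m} (hj : j ∈ J) {p : E} (hp : p ∈ U)
    {θ : ℝ} (hθ : θ ≠ 0) (hθε : |θ| < 3 * ε) : φ j p + θ ∈ (F p).curve.arcs (R p) := by
  have h1 := hA.left j hj p hp
  have h2 := hA.right j hj p hp
  have hε := hA.pos
  obtain ⟨h3, h4⟩ := abs_lt.1 hθε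
  refine hA.mem_arcs p hp _ (by linarith) (by linarith) fun i hi heq => ?_
  by_cases hij : j = i
  · subst hij
    exact hθ (by linarith)
  · have h5 := hA.separated j hj i hi hij p hp
    rw [show φ j p - φ i p = -θ by linarith, abs_neg] at h5
    linarith

/-- The contribution of a neighbourhood of a puncture to the total height. -/
lemma contDiffOn_corner_integral [ProperSpace E] (hΛ : Λ.GeneralPosition)
    (h : CircleFamily F R t) (hA : Angles F R t U a ε J φ) (hχ : ContDiff ℝ ∞ χ)
    (hχ1 : ∀ θ, |χ θ| ≤ 1) {j : Fin m} (hj : j ∈ J) :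
    ContDiffOn ℝ ∞ (fun p => ∫ θ in Set.Icc (-(2 * ε)) (2 * ε), χ θ * hgt F R p (φ j p + θ)) U := by
  have hε := hA.pos
  have hV : IsOpen {θ : ℝ | θ ≠ 0 ∧ |θ| < 3 * ε} :=
    isOpen_ne.inter (isOpen_lt continuous_abs continuous_const)
  have hK : Set.Icc (-(2 * ε)) (2 * ε) ⊆ Metric.ball 0 (3 * ε) := fun θ hθ => by
    rw [Metric.mem_ball, dist_zero_right, Real.norm_eq_abs, abs_lt]
    exact ⟨by linarith [hθ.1], by linarith [hθ.2]⟩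
  have hP := (h.paramSmooth_hgt hΛ (hA.norm_eq j hj) hA.isOpen (hA.smooth j hj) (hA.eq j hj)
    (by positivity) hK fun p hp θ h1 h2 => hA.shift_mem_arcs hj hp h1 h2).smul hA.isOpen hV hχ hχ1
  refine hP.contDiffOn_integral hA.isOpen hV isCompact_Icc ?_
  have h0 : ∀ᵐ θ ∂(volume.restrict (Set.Icc (-(2 * ε)) (2 * ε))), θ ≠ 0 :=
    ae_restrict_of_ae (Measure.ae_ne volume 0)
  filter_upwards [h0, ae_restrict_mem measurableSet_Icc] with θ h1 h2
  exact ⟨⟨h1, by simpa using hK h2⟩, h2⟩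

/-- The contribution of the complement of the punctures to the total height. -/
lemma contDiffOn_regular_integral [ProperSpace E] (hΛ : Λ.GeneralPosition)
    (h : CircleFamily F R t) (hA : Angles F R t U a ε J φ) (hχ : ContDiff ℝ ∞ χ)
    (hin : ∀ θ, |θ| ≤ ε → χ θ = 1) (hout : ∀ θ, 2 * ε ≤ |θ| → χ θ = 0) :
    ContDiffOn ℝ ∞ (fun p => ∫ θ in Set.Ioc a (a + 2 * Real.pi),
      (1 - ∑ j ∈ J, χ (θ - φ j p)) * hgt F R p θ) U := by
  have hε := hA.pos
  have hsub : Set.Icc a (a + 2 * Real.pi) ⊆ Set.Ioo (a - ε) (a + 2 * Real.pi + ε) :=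
    fun θ hθ => ⟨by linarith [hθ.1], by linarith [hθ.2]⟩
  have hP : ParamSmooth U (Set.Ioo (a - ε) (a + 2 * Real.pi + ε)) (Set.Icc a (a + 2 * Real.pi))
      fun p θ => (1 - ∑ j ∈ J, χ (θ - φ j p)) * hgt F R p θ := by
    refine ⟨?_, fun p _ θ hθ => absurd (hsub hθ.1) hθ.2⟩
    rintro ⟨p, θ⟩ ⟨hp, hθ⟩
    refine ContDiffAt.contDiffWithinAt ?_
    have hφ : ∀ j ∈ J, ContDiffAt ℝ ∞ (fun q : E × ℝ => q.2 - φ j q.1) (p, θ) := fun j hj =>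
      contDiffAt_snd.sub (ContDiffAt.comp (g := φ j) (p, θ)
        ((hA.smooth j hj).contDiffAt (hA.isOpen.mem_nhds hp)) contDiffAt_fst)
    by_cases hne : ∀ j ∈ J, θ ≠ φ j p
    · refine ContDiffAt.mul (contDiffAt_const.sub (ContDiffAt.sum fun j hj =>
        ContDiffAt.comp (g := χ) (p, θ) hχ.contDiffAt (hφ j hj))) ?_
      exact h.contDiffAt_hgt hΛ (q := (p, θ)) (hA.mem_arcs p hp θ hθ.1 hθ.2 hne)
    · push Not at hne
      obtain ⟨j, hj, hθj⟩ := hne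
      -- Near a puncture its own cut-off is `1` and the others vanish, so the integrand is
      -- identically zero and the height there is irrelevant.
      refine (contDiffAt_const (c := (0 : ℝ))).congr_of_eventuallyEq ?_
      have h1 : ∀ᶠ q : E × ℝ in 𝓝 (p, θ), |q.2 - φ j q.1| < ε :=
        (hφ j hj).continuousAt.abs.eventually_lt_const (by simpa [hθj] using hε)
      filter_upwards [h1, ParamSmooth.eventually_mem_left hA.isOpen hp θ] with q hq hqU
      rw [Finset.sum_eq_single_of_mem j hj, hin _ hq.le, sub_self, zero_mul]
      intro i hi hij
      refine hout _ ?_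
      have h2 := hA.separated i hi j hj hij q.1 hqU
      have h3 := abs_sub_le (φ i q.1) q.2 (φ j q.1)
      rw [abs_sub_comm (φ i q.1) q.2] at h3
      linarith
  refine hP.contDiffOn_integral hA.isOpen isOpen_Ioo isCompact_Icc ?_
  filter_upwards [ae_restrict_mem measurableSet_Ioc] with θ hθ
  exact ⟨hsub (Set.Ioc_subset_Icc_self hθ), Set.Ioc_subset_Icc_self hθ⟩

/-- A partition of unity moving with the punctures. Each corner term is written in the coordinate
centred at its puncture, where singular angles do not depend on the parameter; its cut-off is
supported inside the chosen period. -/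
lemma total_eq_sum (h : CircleFamily F R t) (hA : Angles F R t U a ε J φ) (hχ : Continuous χ)
    (hχ1 : ∀ θ, |χ θ| ≤ 1) (hout : ∀ θ, 2 * ε ≤ |θ| → χ θ = 0) {p : E} (hp : p ∈ U) :
    (F p).curve.total (R p) =
      (∑ j ∈ J, ∫ θ in Set.Icc (-(2 * ε)) (2 * ε), χ θ * hgt F R p (φ j p + θ)) +
        ∫ θ in Set.Ioc a (a + 2 * Real.pi), (1 - ∑ j ∈ J, χ (θ - φ j p)) * hgt F R p θ := by
  have hε := hA.pos
  have hpi := Real.pi_pos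
  have hint : IntegrableOn (hgt F R p) (Set.Ioc a (a + 2 * Real.pi)) :=
    (intervalIntegrable_iff_integrableOn_Ioc_of_le (by linarith)).1
      (HolCurve.intervalIntegrable_height (C := (F p).curve) (F p).one_lt_r (h.radius_eq p) _ _)
  have hint' : ∀ j, IntegrableOn (fun θ => χ (θ - φ j p) * hgt F R p θ)
      (Set.Ioc a (a + 2 * Real.pi)) := fun j =>
    hint.bdd_mul (c := 1) (hχ.comp (continuous_sub_right _)).aestronglyMeasurable
      (Eventually.of_forall fun θ => hχ1 _)
  have hj : ∀ j ∈ J, ∫ θ in Set.Icc (-(2 * ε)) (2 * ε), χ θ * hgt F R p (φ j p + θ) =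
      ∫ θ in Set.Ioc a (a + 2 * Real.pi), χ (θ - φ j p) * hgt F R p θ := by
    intro j hj
    rw [setIntegral_eq_integral_of_forall_compl_eq_zero, setIntegral_eq_integral_of_forall_compl_eq_zero,
      ← integral_add_left_eq_self (fun θ => χ (θ - φ j p) * hgt F R p θ) (φ j p)]
    · simp only [add_sub_cancel_left]
    · intro θ hθ
      rw [hout, zero_mul]
      have h1 := hA.left j hj p hp
      have h2 := hA.right j hj p hp
      by_contra hc
      push Not at hc
      obtain ⟨h3, h4⟩ := abs_lt.1 hc
      exact hθ ⟨by linarith, by linarith⟩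
    · intro θ hθ
      rw [hout, zero_mul]
      by_contra hc
      push Not at hc
      obtain ⟨h3, h4⟩ := abs_lt.1 hc
      exact hθ ⟨h3.le, h4.le⟩
  have hs : IntegrableOn (fun θ => ∑ j ∈ J, χ (θ - φ j p) * hgt F R p θ)
      (Set.Ioc a (a + 2 * Real.pi)) := integrable_finsetSum _ fun j _ => hint' j
  rw [Finset.sum_congr rfl hj, ← integral_finsetSum _ fun j _ => hint' j]
  have h3 : ∀ θ, (1 - ∑ j ∈ J, χ (θ - φ j p)) * hgt F R p θ =
      hgt F R p θ - ∑ j ∈ J, χ (θ - φ j p) * hgt F R p θ := fun θ => by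
    rw [sub_mul, one_mul, Finset.sum_mul]
  simp only [h3]
  rw [integral_sub hint hs, add_sub_cancel, HolCurve.total_eq (R p) a,
    intervalIntegral.integral_of_le (by linarith)]
  rfl

end Angles

/-- The total height along a boundary circle is smooth along smooth families. -/
theorem contDiff_total [ProperSpace E] (hΛ : Λ.GeneralPosition) (h : CircleFamily F R t) :
    ContDiff ℝ ∞ fun p => (F p).curve.total (R p) := by
  refine contDiff_iff_contDiffAt.2 fun p₀ => ?_
  obtain ⟨U, a, ε, J, φ, hp₀, hA⟩ := h.exists_angles p₀
  have hε := hA.pos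
  let χ : ContDiffBump (0 : ℝ) := ⟨ε, 2 * ε, hε, by linarith⟩
  have hχ : ContDiff ℝ ∞ χ := χ.contDiff
  have hχ1 : ∀ θ, |χ θ| ≤ 1 := fun θ => by
    rw [abs_of_nonneg χ.nonneg]
    exact χ.le_one
  have hin : ∀ θ, |θ| ≤ ε → χ θ = 1 := fun θ hθ =>
    χ.one_of_mem_closedBall (by simpa using hθ)
  have hout : ∀ θ, 2 * ε ≤ |θ| → χ θ = 0 := fun θ hθ =>
    χ.zero_of_le_dist (by simpa using hθ)
  have hs := (ContDiffOn.sum fun j hj =>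
    hA.contDiffOn_corner_integral hΛ h hχ hχ1 hj).add
      (hA.contDiffOn_regular_integral hΛ h hχ hin hout)
  refine (hs.contDiffAt (hA.isOpen.mem_nhds hp₀)).congr_of_eventuallyEq ?_
  filter_upwards [hA.isOpen.mem_nhds hp₀] with p hp
  exact hA.total_eq_sum h hχ.continuous hχ1 hout hp

end CircleFamily

/-- Both totals are smooth along the family, and `log r` is smooth and positive. -/
theorem isSmooth_fluxModuli {Λ : LegendrianKnot} (hΛ : Λ.GeneralPosition) :
    Moduli.IsSmooth (fluxModuli hΛ) := by
  rintro n F ⟨hr, hu, m, t, ht, hinj, hP, -, hb⟩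
  have h1 : CircleFamily F (fun _ => 1) t := ⟨hr, Or.inl fun _ => rfl, hu, ht, hinj, hP, hb⟩
  have h2 : CircleFamily F (fun p => (F p).r) t := ⟨hr, Or.inr fun _ => rfl, hu, ht, hinj, hP, hb⟩
  have hlog : ContDiff ℝ ∞ fun p => Real.log (F p).r :=
    hr.log fun p => (zero_lt_one.trans (F p).one_lt_r).ne'
  exact ((h1.contDiff_total hΛ).sub (h2.contDiff_total hΛ)).div hlog fun p =>
    (Real.log_pos (F p).one_lt_r).ne'

end LegAnnuli

/-! ### The proposition -/

theorem proposition1p2 (Λ : LegAnnuli.LegendrianKnot) (hΛ : Λ.GeneralPosition) :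
    ∃ Ω : LegAnnuli.Moduli Λ → ℝ,
      LegAnnuli.Moduli.IsSmooth Ω ∧
      (∀ A : LegAnnuli.HolAnnulus Λ,
        (∃ U : ℂ → LegAnnuli.R4, A.IsLift U) ↔ Ω (LegAnnuli.Moduli.mk A) = 0) ∧
      ∃ Ωbar : LegAnnuli.ModuliBar Λ → EReal,
        Continuous Ωbar ∧
        (∀ (A : LegAnnuli.HolAnnulus Λ) (hA : A.IsDimOne),
          Ωbar (LegAnnuli.ModuliBar.mk (.interior A hA)) =
            ((Ω (LegAnnuli.Moduli.mk A) : ℝ) : EReal)) ∧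
        (∀ d : LegAnnuli.NonSplit Λ,
          (d.outerZ < d.innerZ → Ωbar (LegAnnuli.ModuliBar.mk (.nonSplit d)) = ⊤) ∧
          (d.innerZ < d.outerZ → Ωbar (LegAnnuli.ModuliBar.mk (.nonSplit d)) = ⊥)) ∧
        (∀ d : LegAnnuli.Split Λ,
          Ωbar (LegAnnuli.ModuliBar.mk (.split d)) =
            ((Ω (LegAnnuli.Moduli.mk d.ann) : ℝ) : EReal)) := by
  -- On interior and split points `fluxPre` is the flux of the annulus or of the annular part by
  -- definition, so these two clauses hold by `rfl`.
  refine ⟨LegAnnuli.fluxModuli hΛ, ?_, ?_, LegAnnuli.fluxBar hΛ, LegAnnuli.continuous_fluxBar hΛ,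
    fun A hA => rfl, fun d => ⟨fun h => ?_, fun h => ?_⟩, fun d => rfl⟩
  · exact LegAnnuli.isSmooth_fluxModuli hΛ
  · exact fun A => LegAnnuli.HolAnnulus.exists_isLift_iff hΛ A
  · exact if_pos h
  · exact if_neg (not_lt.2 h.le)
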